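/- **Theorem 1.2 (inviscid case).** Consider on $\mathbb R^3$ the inviscid incompressible Hall-MHD system without resistivity $$\partial_t u+u\cdot\nabla u+\nabla p=(\nabla\times B)\times B,\qquad \operatorname{div}u=0,\qquad \partial_t B-\nabla\times(u\times B)+\nabla\times((\nabla\times B)\times B)=0,$$ with divergence free initial data $(u,B)|_{t=0}=(u_0,B_0)$. Notation. In cylindrical coordinates $(r,\theta,z)$ put $\Pi=b_\theta/r$ and $\Omega=\omega_\theta/r$, where $b_\theta$ and $\omega_\theta$ are the $\theta$-components of $B$ and of $\omega=\nabla\times u$ (on the axis $r=0$ the quotients are the limits $\partial_r b_\theta$, $\partial_r\omega_\theta$); $\Pi_0,\Omega_0$ are their initial values, and $\|f\|_{L^1\cap L^\infty}=\|f\|_{L^1(\mathbb R^3)}+\|f\|_{L^\infty(\mathbb R^3)}$. *Admissible data* are divergence free fields $u_0=u_{0r}(r,z)e_r+u_{0z}(r,z)e_z$ and $B_0=b_{0\theta}(r,z)e_\theta$ in $C_c^\infty(\mathbb R^3)$ with $\Omega_0,\Pi_0\in L^1\cap L^\infty$. A *smooth solution on $[0,T)$* is a solution $(u,B)\in C([0,T);H^m(\mathbb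 R^3))$, for a fixed $m>7/2$, which is $C^\infty$ on $[0,T)\times\mathbb R^3$. 1. For no real $m>7/2$ is the system globally well-posed in $H^m(\mathbb R^3)$: it is not true that all divergence free $(u_0,B_0)\in H^m$ have one and only one solution $(u,B)\in C([0,\infty);H^m)$. 2. There is a positive function $\tilde C_*$ of $\|\Omega_0\|_{L^1\cap L^\infty}+\|\Pi_0\|_{L^1\cap L^\infty}$ alone such that there are admissible data with $$y_0:=\partial_z\Pi_0(0,0)=\partial^2_{rz}b_{0\theta}(0,0)\ \ge\ 4\,\tilde C_*^{1/2},\qquad J_0:=\Pi_0(0,0)>0,\tag{$*$}$$ and such that for all admissible data with $(*)$ and all $m>7/2$ the following holds. (a) Every smooth solution breaks down in finite time, before $4/y_0$: if it exists on $[0,T)$, then $T\le 2/y_0$. It keeps the form $u=u_re_r+u_ze_z$, $B=b_\theta e_\theta$, and for $0\le t<T$ $$\sup_{z\in\mathbb R}|\partial_z\Pi(t,0,z)|\ \ge\ \frac{y_0}{2-ty_0},\qquad \sup_{z\in\mathbb R}\bigl|\bigl(\partial_t\Omega+(u_r\partial_r+u_z\partial_z)\Omega\bigr)(t,0,z)\bigr|\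 \ge\ \frac{2J_0y_0}{2-ty_0}.$$ (b) Let $Q(t)$ be one of the two suprema in (a). Suppose that a smooth solution exists on some $[0,T)$, $T>0$, and that whenever a smooth solution on some $[0,T)$ has $\limsup_{t\to T}Q(t)<\infty$, there is a smooth solution on a longer interval $[0,T')$, $T'>T$ (that is, the solution survives as long as $Q$ is bounded). Then there are $t_\sharp\in(0,2/y_0]$ and a smooth solution on $[0,t_\sharp)$ with $\limsup_{t\to t_\sharp}Q(t)=\infty$. -/

import Mathlib

open MeasureTheory Filter Topology Set
open scoped ContDiff FourierTransform ENNReal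

noncomputable section

namespace HallMHD

/-- Three-dimensional Euclidean space with Cartesian coordinates `x 0, x 1, x 2`. -/
abbrev E3 := EuclideanSpace ℝ (Fin 3)

/-! ### Vector calculus -/

/-- The partial derivative `∂ᵢ vⱼ (x)` of a vector field. -/
def pd (i j : Fin 3) (v : E3 → E3) (x : E3) : ℝ :=
  (fderiv ℝ v x (EuclideanSpace.single i 1)) j

/-- The divergence `div v`. -/
def divergence (v : E3 → E3) (x : E3) : ℝ := ∑ i, pd i i v x

/-- The curl `∇ × v`. -/
def curl (v : E3 → E3) (x : E3) : E3 :=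
  !₂[pd 1 2 v x - pd 2 1 v x, pd 2 0 v x - pd 0 2 v x, pd 0 1 v x - pd 1 0 v x]

/-- The vector product `a × b`. -/
def cross (a b : E3) : E3 := WithLp.toLp 2 (crossProduct (WithLp.ofLp a) (WithLp.ofLp b))

/-! ### Sobolev spaces -/

/-- A real vector field regarded as a complex one. -/
def complexify (f : E3 → E3) (x : E3) : EuclideanSpace ℂ (Fin 3) :=
  WithLp.toLp 2 (fun i => ((f x i : ℝ) : ℂ))

open Classical in
/-- The norm of `H^s(ℝ³)`, `s ≥ 0`: the `L²` norm of `(1 + |ξ|²)^{s/2} f̂(ξ)`, where `f̂` is the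
`L²` Fourier transform of `f`. It is `∞` if `f` is not in `L²`. (Mathlib's Fourier transform has the
kernel `exp (-2πi x·ξ)`; other normalizations give equivalent norms.) -/
def sobolevNorm (s : ℝ) (f : E3 → E3) : ℝ≥0∞ :=
  if h : MemLp (complexify f) 2 volume then
    eLpNorm (fun ξ : E3 => ((1 + ‖ξ‖ ^ 2) ^ (s / 2) : ℝ) •
      (𝓕 (h.toLp (complexify f)) : Lp (EuclideanSpace ℂ (Fin 3)) 2 (volume : Measure E3)) ξ)
      2 volume
  else ⊤

/-- `t ↦ v t` belongs to `C(I; H^s(ℝ³))`. -/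
def ContinuousInSobolev (s : ℝ) (I : Set ℝ) (v : ℝ → E3 → E3) : Prop :=
  (∀ t ∈ I, sobolevNorm s (v t) < ⊤) ∧
    ∀ t₀ ∈ I, Tendsto (fun t => sobolevNorm s (v t - v t₀)) (𝓝[I] t₀) (𝓝 0)

/-! ### The inviscid Hall-MHD system without resistivity -/

/-- `(u, B)` is a solution in `C(I; H^m(ℝ³))` of the Cauchy problem for
`∂ₜu + u·∇u + ∇p = (∇×B)×B`, `div u = 0`, `∂ₜB - ∇×(u×B) + ∇×((∇×B)×B) = 0` on the time interval
`I` (which is `[0,T)` or `[0,∞)`). It is used for `m > 7/2` only. Then `H^m ⊆ C²`, and, by the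
equations, `∂ₜu` and `∂ₜB` are in `C(I; H^{m-2})`, hence continuous in `(t, x)`: with the continuous
representatives, solutions are classical, as is recorded here. Values at times outside `I` are
irrelevant. -/
structure IsSolution (m : ℝ) (I : Set ℝ) (u₀ B₀ : E3 → E3) (u B : ℝ → E3 → E3) : Prop where
  sobolev_u : ContinuousInSobolev m I u
  sobolev_B : ContinuousInSobolev m I B
  c1_u : ContDiffOn ℝ 1 (fun q : ℝ × E3 => u q.1 q.2) (I ×ˢ univ)
  c1_B : ContDiffOn ℝ 1 (fun q : ℝ × E3 => B q.1 q.2) (I ×ˢ univ)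
  c2_u : ∀ t ∈ I, ContDiff ℝ 2 (u t)
  c2_B : ∀ t ∈ I, ContDiff ℝ 2 (B t)
  momentum : ∀ t ∈ I, ∃ p : E3 → ℝ, ContDiff ℝ 1 p ∧ ∀ x,
    derivWithin (fun s => u s x) I t + fderiv ℝ (u t) x (u t x) + gradient p x
      = cross (curl (B t) x) (B t x)
  div_u : ∀ t ∈ I, ∀ x, divergence (u t) x = 0
  induction : ∀ t ∈ I, ∀ x,
    derivWithin (fun s => B s x) I t - curl (fun y => cross (u t y) (B t y)) x
      + curl (fun y => cross (curl (B t) y) (B t y)) x = 0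
  init_u : u 0 = u₀
  init_B : B 0 = B₀

/-- `(u, B)` is a solution on `[0,T)` in `H^m` which is `C^∞` on `[0,T) × ℝ³`. -/
structure IsSmoothSolution (m T : ℝ) (u₀ B₀ : E3 → E3) (u B : ℝ → E3 → E3) : Prop where
  solution : IsSolution m (Ico 0 T) u₀ B₀ u B
  smooth_u : ContDiffOn ℝ ∞ (fun q : ℝ × E3 => u q.1 q.2) (Ico 0 T ×ˢ univ)
  smooth_B : ContDiffOn ℝ ∞ (fun q : ℝ × E3 => B q.1 q.2) (Ico 0 T ×ˢ univ)

/-- A divergence free vector field in `H^m(ℝ³)`, `m > 7/2`, given by its `C²` representative. -/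
structure IsSobolevDatum (m : ℝ) (v : E3 → E3) : Prop where
  c2 : ContDiff ℝ 2 v
  finite : sobolevNorm m v < ⊤
  div_free : ∀ x, divergence v x = 0

/-- Global well-posedness in `H^m(ℝ³)`, reduced to its weakest part: all divergence free data in
`H^m` have a solution in `C([0,∞); H^m)`, and only one. -/
def GloballyWellPosed (m : ℝ) : Prop :=
  ∀ u₀ B₀ : E3 → E3, IsSobolevDatum m u₀ → IsSobolevDatum m B₀ →
    (∃ u B, IsSolution m (Ici 0) u₀ B₀ u B) ∧
    ∀ u B u' B', IsSolution m (Ici 0) u₀ B₀ u B → IsSolution m (Ici 0) u₀ B₀ u' B' →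
      ∀ t ∈ Ici (0 : ℝ), u t = u' t ∧ B t = B' t

/-! ### Axisymmetric fields in cylindrical coordinates -/

/-- The distance `r = √(x₁² + x₂²)` to the axis. -/
def rad (x : E3) : ℝ := Real.sqrt (x 0 ^ 2 + x 1 ^ 2)

/-- The unit vector `e_r` (and `0` on the axis). -/
def eR (x : E3) : E3 := !₂[x 0 / rad x, x 1 / rad x, 0]

/-- The unit vector `e_θ` (and `0` on the axis). -/
def eTheta (x : E3) : E3 := !₂[-(x 1) / rad x, x 0 / rad x, 0]

/-- The unit vector `e_z`. -/
def eZ : E3 := !₂[0, 0, 1]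

/-- `v = v_r(r,z) e_r + v_z(r,z) e_z`: axisymmetric without swirl. -/
def IsAxisymmetricNoSwirl (v : E3 → E3) : Prop :=
  ∃ vr vz : ℝ → ℝ → ℝ, ∀ x, v x = vr (rad x) (x 2) • eR x + vz (rad x) (x 2) • eZ

/-- `v = v_θ(r,z) e_θ`: axisymmetric and purely azimuthal. -/
def IsAxisymmetricSwirl (v : E3 → E3) : Prop :=
  ∃ vθ : ℝ → ℝ → ℝ, ∀ x, v x = vθ (rad x) (x 2) • eTheta x

/-- The point with cylindrical coordinates `θ = 0` and `(r, z)`. There `e_r`, `e_θ`, `e_z` are the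
three vectors of the standard basis. -/
def meridian (r z : ℝ) : E3 := !₂[r, 0, z]

/-- `v_r(r,z)` for an axisymmetric field. -/
def compR (v : E3 → E3) (r z : ℝ) : ℝ := v (meridian r z) 0

/-- `v_θ(r,z)` for an axisymmetric field (extended to `r < 0` as an odd function of `r`). -/
def compTheta (v : E3 → E3) (r z : ℝ) : ℝ := v (meridian r z) 1

/-- `v_z(r,z)` for an axisymmetric field. -/
def compZ (v : E3 → E3) (r z : ℝ) : ℝ := v (meridian r z) 2

/-- `v_θ(r,z) / r`, and on the axis its limit `∂_r v_θ(0,z)`. -/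
def angularQuotient (v : E3 → E3) (r z : ℝ) : ℝ :=
  if r = 0 then deriv (fun ρ => compTheta v ρ z) 0 else compTheta v r z / r

/-- `Π = b_θ / r`. -/
def PiOf (B : E3 → E3) : ℝ → ℝ → ℝ := angularQuotient B

/-- `Ω = ω_θ / r`, where `ω = curl u`. -/
def OmegaOf (u : E3 → E3) : ℝ → ℝ → ℝ := angularQuotient (curl u)

/-- A function of `(r,z)` as a function on `ℝ³`. -/
def lift (g : ℝ → ℝ → ℝ) (x : E3) : ℝ := g (rad x) (x 2)

/-- `g` belongs to `L¹(ℝ³) ∩ L^∞(ℝ³)`. -/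
def MemL1Linfty (g : ℝ → ℝ → ℝ) : Prop :=
  MemLp (lift g) 1 volume ∧ MemLp (lift g) ⊤ volume

/-- `‖g‖_{L¹ ∩ L^∞} = ‖g‖_{L¹(ℝ³)} + ‖g‖_{L^∞(ℝ³)}`. -/
def normL1Linfty (g : ℝ → ℝ → ℝ) : ℝ :=
  (eLpNorm (lift g) 1 volume).toReal + (eLpNorm (lift g) ⊤ volume).toReal

/-- The initial data considered: smooth, compactly supported, divergence free,
`u₀ = u₀ᵣ e_r + u₀_z e_z`, `B₀ = b₀_θ e_θ`, and `Ω₀, Π₀ ∈ L¹ ∩ L^∞`. -/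
structure IsAxisymmetricDatum (u₀ B₀ : E3 → E3) : Prop where
  smooth_u : ContDiff ℝ ∞ u₀
  smooth_B : ContDiff ℝ ∞ B₀
  compact_u : HasCompactSupport u₀
  compact_B : HasCompactSupport B₀
  div_u : ∀ x, divergence u₀ x = 0
  div_B : ∀ x, divergence B₀ x = 0
  form_u : IsAxisymmetricNoSwirl u₀
  form_B : IsAxisymmetricSwirl B₀
  omega : MemL1Linfty (OmegaOf u₀)
  pi : MemL1Linfty (PiOf B₀)

/-- `‖Ω₀‖_{L¹ ∩ L^∞} + ‖Π₀‖_{L¹ ∩ L^∞}`. -/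
def dataNorm (u₀ B₀ : E3 → E3) : ℝ := normL1Linfty (OmegaOf u₀) + normL1Linfty (PiOf B₀)

/-- `∂_zΠ(0,z)`. -/
def dzPiAxis (B : E3 → E3) (z : ℝ) : ℝ := deriv (fun ζ => PiOf B 0 ζ) z

/-- `(∂ₜΩ + (u_r∂_r + u_z∂_z)Ω)(t,r,z)` for `t ≥ 0` (one-sided time derivative at `t = 0`). -/
def materialOmega (u : ℝ → E3 → E3) (t r z : ℝ) : ℝ :=
  derivWithin (fun s => OmegaOf (u s) r z) (Ici 0) t
    + compR (u t) r z * deriv (fun ρ => OmegaOf (u t) ρ z) r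
    + compZ (u t) r z * deriv (fun ζ => OmegaOf (u t) r ζ) z

/-- `sup_z |∂_zΠ(t,0,z)|`, possibly infinite. -/
def supDzPi (B : ℝ → E3 → E3) (t : ℝ) : ℝ≥0∞ := ⨆ z : ℝ, ‖dzPiAxis (B t) z‖ₑ

/-- `sup_z |(∂ₜΩ + (u_r∂_r + u_z∂_z)Ω)(t,0,z)|`, possibly infinite. -/
def supMaterialOmega (u : ℝ → E3 → E3) (t : ℝ) : ℝ≥0∞ := ⨆ z : ℝ, ‖materialOmega u t 0 z‖ₑ

/-- Every smooth solution on some `[0,T)` for which `Q` stays bounded as `t → T` can be continued: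
there is a smooth solution on a longer time interval. -/
def ContinuesWhileBounded (m : ℝ) (u₀ B₀ : E3 → E3)
    (Q : (ℝ → E3 → E3) → (ℝ → E3 → E3) → ℝ → ℝ≥0∞) : Prop :=
  ∀ T > 0, ∀ u B, IsSmoothSolution m T u₀ B₀ u B → limsup (Q u B) (𝓝[<] T) < ⊤ →
    ∃ T' > T, ∃ u' B', IsSmoothSolution m T' u₀ B₀ u' B'

end HallMHD

end

/-!
Axisymmetric solutions `u = u_r e_r + u_z e_z`, `B = b_θ e_θ` of the Hall-MHD system steepen on the
axis of symmetry: there `Π = b_θ/r` solves a Burgers equation, whose nonlinearity stems from the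
Hall term, driven by a velocity whose gradient is bounded in terms of the data.

*Symmetry.* For `m > 7/2` the fields and their first two space derivatives are bounded and square
integrable, locally uniformly in time (`IsSolution.regSol`); this is all that is used of the `H^m`
regularity. In this class solutions are determined by their data (`RegSol.unique`): in the `L²`
estimate for the difference of two solutions the derivatives produced by the Hall term cancel, by
`integral_inner_cross_curl`, and the pressure drops out although nothing is known of its growth
(`integral_inner_gradient_eq_zero`). Fields of the form above are precisely those for which `u` is
even and `B` is odd under the reflections in planes through the axis, and the system is invariant
under these reflections. Hence uniqueness preserves the form of the solution (`RegSol.symm`).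

*A priori bound.* For such solutions `∂ₜΠ + u·∇Π = ∂_z(Π²)`, while the sum `ω + B` satisfies
`∂ₜ(ω + B) = ∇ × (u × (ω + B))`, so that `Ω + Π` is merely transported by `u`. Both equations are
instances of `SwirlTransport`, and both preserve `Lⁿ` bounds for even `n`
(`SwirlTransport.lintegral_quotPow_le`; only the inequality is needed, and the singularity of the
quotient at the axis is handled by replacing `1/r²` with `1/(r² + ε²)`). So `Ω` is bounded in
`L² ∩ L⁴` in terms of `‖Ω₀‖ + ‖Π₀‖` alone. On the axis `∂_z u_z` is the integral of `Ω` against a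
kernel of size `|x - y|⁻²`, which is in `L^(4/3)` near `y` and in `L²` away from `y`
(`exists_abs_pdv_axis_le`). This bounds `|∂_z u_z|` on the axis by a function `K` of the norm of the
data (`exists_axial_strain_bound`).

*Steepening.* On the axis `u_r = 0`, so `g(t,z) = Π(t,0,z)` and `w(t,z) = u_z(t,0,z)` satisfy
`∂ₜg + (w - 2g) ∂_zg = 0` (`RegSol.axisFlow`). If `y₀ = ∂_zg(0,0) ≥ 2K`, the distance between the
characteristics starting from `0` and from a small `b > 0` is at most `b (1 - t y₀/2)`, while they
carry constant and different values of `g`, and so never meet. Hence the solution ends before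
`2/y₀`, and on the characteristic through the origin `∂_zg ≥ y₀/(2 - t y₀)` and `g = J₀`
(`AxisFlow.steepening`). Since `∂ₜΩ + u·∇Ω = -∂_z(Π²)`, the material derivative of `Ω` grows
alongside (`IsSmoothSolution.materialOmega_eq`).

The threshold is `C̃ = exp K`, for which `4 C̃^(1/2) ≥ 2K + 4`. It is reached by data equal to
`Π₀ = 2 + sin (N z)` near the origin, whose norm stays bounded while `∂_zΠ₀(0,0) = N` is arbitrary.
For the continuation statement, smooth solutions on different intervals are glued by uniqueness to
a solution with the largest existence time (`exists_maximal_smoothSolution`).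
-/

open MeasureTheory Filter Topology Set
open scoped ContDiff FourierTransform ENNReal

noncomputable section

namespace HallMHD

/-! ### Sobolev embedding -/

/-- The partial derivative `∂ᵢ v` of a vector field, as a vector field. -/
def pdv (i : Fin 3) (v : E3 → E3) (x : E3) : E3 := fderiv ℝ v x (EuclideanSpace.single i 1)

/-- `complexify`, pointwise and as a real linear map. -/
def complexL : E3 →L[ℝ] EuclideanSpace ℂ (Fin 3) :=
  LinearMap.toContinuousLinearMap
    { toFun := fun v => WithLp.toLp 2 (fun i => ((v i : ℝ) : ℂ))
      map_add' := by intro a b; ext i; simp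
      map_smul' := by intro a b; ext i; simp }

theorem complexify_eq (f : E3 → E3) : complexify f = fun x => complexL (f x) := rfl

theorem norm_complexL (v : E3) : ‖complexL v‖ = ‖v‖ := by
  simp [EuclideanSpace.norm_eq, complexL]

theorem enorm_complexify (f : E3 → E3) (x : E3) : ‖complexify f x‖ₑ = ‖f x‖ₑ := by
  rw [complexify_eq, ← ofReal_norm, norm_complexL, ofReal_norm]

theorem eLpNorm_complexify (f : E3 → E3) (p : ℝ≥0∞) :
    eLpNorm (complexify f) p volume = eLpNorm f p volume :=
  eLpNorm_congr_enorm_ae (ae_of_all _ fun x => enorm_complexify f x)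

theorem sobolevNorm_eq {s : ℝ} {f : E3 → E3} (h : MemLp (complexify f) 2 volume) :
    sobolevNorm s f = eLpNorm (fun ξ : E3 => ((1 + ‖ξ‖ ^ 2) ^ (s / 2) : ℝ) •
      (𝓕 (h.toLp (complexify f)) : Lp (EuclideanSpace ℂ (Fin 3)) 2 (volume : Measure E3)) ξ)
      2 volume := by
  rw [sobolevNorm, dif_pos h]

theorem memLp_of_sobolevNorm {s : ℝ} {f : E3 → E3} (h : sobolevNorm s f < ⊤) :
    MemLp (complexify f) 2 volume := by
  by_contra h'
  rw [sobolevNorm, dif_neg h'] at h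
  exact lt_irrefl _ h

theorem one_le_weight (ξ : E3) {s : ℝ} (hs : 0 ≤ s) : 1 ≤ (1 + ‖ξ‖ ^ 2) ^ (s / 2) :=
  Real.one_le_rpow (by nlinarith [sq_nonneg ‖ξ‖]) (by positivity)

/-- Plancherel: the `L²` norm is at most the `H^s` norm. -/
theorem eLpNorm_le_sobolevNorm {s : ℝ} (hs : 0 ≤ s) (f : E3 → E3) :
    eLpNorm f 2 volume ≤ sobolevNorm s f := by
  by_cases h : MemLp (complexify f) 2 volume
  · rw [sobolevNorm_eq h, ← eLpNorm_complexify]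
    have h1 : eLpNorm (complexify f) 2 volume =
        eLpNorm (𝓕 (h.toLp (complexify f)) : Lp (EuclideanSpace ℂ (Fin 3)) 2
          (volume : Measure E3)) 2 volume := by
      have := Lp.norm_fourier_eq (h.toLp (complexify f))
      rw [Lp.norm_def, Lp.norm_def, ENNReal.toReal_eq_toReal_iff' (Lp.eLpNorm_ne_top _)
        (Lp.eLpNorm_ne_top _)] at this
      rw [this]
      exact eLpNorm_congr_ae h.coeFn_toLp.symm
    rw [h1]
    refine eLpNorm_mono fun ξ => ?_
    rw [norm_smul, Real.norm_of_nonneg (by positivity)]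
    exact le_mul_of_one_le_left (norm_nonneg _) (one_le_weight ξ hs)
  · rw [sobolevNorm, dif_neg h]; exact le_top

open SchwartzMap LineDeriv in
/-- The weak derivative of an `L²` function given by a multiplier of its Fourier transform is
the classical one, for `C¹` functions. -/
theorem pdv_ae_eq {f : E3 → E3} (hf : ContDiff ℝ 1 f) (h : MemLp (complexify f) 2 volume)
    (i : Fin 3)
    (hg : MemLp (fun ξ : E3 => (2 * Real.pi * Complex.I * (ξ i : ℂ)) •
      (𝓕 (h.toLp (complexify f)) : Lp (EuclideanSpace ℂ (Fin 3)) 2 (volume : Measure E3)) ξ)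
      2 volume) :
    complexify (pdv i f) =ᵐ[volume] (𝓕⁻ (hg.toLp _) :
      Lp (EuclideanSpace ℂ (Fin 3)) 2 (volume : Measure E3)) := by
  set F := h.toLp (complexify f) with hF
  set G := hg.toLp _ with hG
  set e : E3 := EuclideanSpace.single i 1 with he
  -- the identity of tempered distributions, which holds after a Fourier transform by definition
  have hdist : ∂_{e} (F : 𝓢'(E3, EuclideanSpace ℂ (Fin 3))) =
      ((𝓕⁻ G : Lp (EuclideanSpace ℂ (Fin 3)) 2 (volume : Measure E3)) :
        𝓢'(E3, EuclideanSpace ℂ (Fin 3))) := by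
    rw [← Lp.fourierInv_toTemperedDistribution_eq]
    apply_fun 𝓕 using (FourierTransform.fourierEquiv ℂ
      𝓢'(E3, EuclideanSpace ℂ (Fin 3))).injective
    rw [FourierTransform.fourier_fourierInv_eq, TemperedDistribution.fourier_lineDerivOp_eq,
      Lp.fourier_toTemperedDistribution_eq]
    ext1 φ
    have hT : (fun x : E3 => inner ℝ x e).HasTemperateGrowth := by fun_prop
    have hT' : (fun x : E3 => (((inner ℝ x e : ℝ)) : ℂ)).HasTemperateGrowth := by fun_prop
    rw [smul_apply, TemperedDistribution.smulLeftCLM_apply_apply, Lp.toTemperedDistribution_apply,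
      Lp.toTemperedDistribution_apply, ← integral_smul]
    refine integral_congr_ae ?_
    filter_upwards [hg.coeFn_toLp] with ξ hξ
    rw [hG, hξ, SchwartzMap.smulLeftCLM_apply_apply hT']
    have : inner ℝ ξ e = ξ i := by
      rw [he, EuclideanSpace.inner_single_right]; simp
    simp only [this, smul_smul]
    simp only [smul_eq_mul]
    ring_nf
  refine ae_eq_of_integral_contDiff_smul_eq ?_ ((Lp.memLp _).locallyIntegrable (by norm_num)) ?_
  · refine Continuous.locallyIntegrable ?_
    have : Continuous (pdv i f) := by
      have := hf.continuous_fderiv (by norm_num)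
      unfold pdv; fun_prop
    exact complexL.continuous.comp this
  intro g hg1 hg2
  have hc : HasCompactSupport (Complex.ofRealCLM ∘ g) := hg2.comp_left rfl
  have hs : ContDiff ℝ ∞ (Complex.ofRealCLM ∘ g) := by fun_prop
  -- evaluated at a test function, it turns into the classical integration by parts for `f`
  have key := congrArg (fun T : 𝓢'(E3, EuclideanSpace ℂ (Fin 3)) =>
    T (hc.toSchwartzMap hs)) hdist
  simp only [TemperedDistribution.lineDerivOp_apply_apply, Lp.toTemperedDistribution_apply] at key
  have h2 : ∫ x, g x • (𝓕⁻ G : Lp (EuclideanSpace ℂ (Fin 3)) 2 (volume : Measure E3)) x =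
      ∫ x, (hc.toSchwartzMap hs) x •
        (𝓕⁻ G : Lp (EuclideanSpace ℂ (Fin 3)) 2 (volume : Measure E3)) x := by
    refine integral_congr_ae (ae_of_all _ fun x => ?_)
    simp
  rw [h2, ← key]
  have hfd : Differentiable ℝ (complexify f) := by
    rw [complexify_eq]; exact complexL.differentiable.comp (hf.differentiable (by norm_num))
  have hfc : Continuous (complexify f) := hfd.continuous
  have hder : ∀ x, fderiv ℝ (complexify f) x e = complexify (pdv i f) x := by
    intro x
    rw [complexify_eq]
    rw [show (fun x => complexL (f x)) = complexL ∘ f from rfl,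
      fderiv_comp _ complexL.differentiableAt (hf.differentiable (by norm_num) x)]
    simp [pdv, complexify_eq, he]
  have hgd : Differentiable ℝ g := hg1.differentiable (by norm_num)
  have hgc : Continuous (fderiv ℝ g) := hg1.continuous_fderiv (by norm_num)
  have hpc : Continuous fun x => fderiv ℝ (complexify f) x e := by
    simp_rw [hder]
    have := hf.continuous_fderiv (by norm_num)
    rw [complexify_eq]; unfold pdv; fun_prop
  have hgs : HasCompactSupport fun x => fderiv ℝ g x e := hg2.fderiv_apply (𝕜 := ℝ) e
  have hibp := integral_smul_fderiv_eq_neg_fderiv_smul_of_integrable (μ := (volume : Measure E3))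
    (f := g) (g := complexify f) (v := e)
    ((hgc.clm_apply continuous_const).smul hfc |>.integrable_of_hasCompactSupport
      (hgs.smul_right))
    ((hg1.continuous.smul hpc).integrable_of_hasCompactSupport hg2.smul_right)
    ((hg1.continuous.smul hfc).integrable_of_hasCompactSupport hg2.smul_right)
    (fun x _ => hgd x) (fun x _ => hfd x)
  simp_rw [hder] at hibp
  rw [hibp, ← integral_neg]
  refine integral_congr_ae ?_
  filter_upwards [h.coeFn_toLp] with x hx
  rw [hF, hx]
  have : (-∂_{e} (hc.toSchwartzMap hs)) x = -((fderiv ℝ g x e : ℝ) : ℂ) := by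
    have h3 : (∂_{e} (hc.toSchwartzMap hs)) x = fderiv ℝ (Complex.ofRealCLM ∘ g) x e := by
      rw [SchwartzMap.lineDerivOp_apply_eq_fderiv]; rfl
    rw [neg_apply, h3, fderiv_comp _ Complex.ofRealCLM.differentiableAt (hgd x)]
    simp
  rw [this, neg_smul]
  congr 1

theorem abs_coord_le_weight (ξ : E3) (i : Fin 3) : |ξ i| ≤ (1 + ‖ξ‖ ^ 2) ^ (1 / 2 : ℝ) := by
  rw [← Real.sqrt_eq_rpow]
  refine Real.le_sqrt_of_sq_le ?_
  have h := EuclideanSpace.norm_sq_eq ξ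
  have : ‖ξ i‖ ^ 2 ≤ ‖ξ‖ ^ 2 := by
    rw [h]; exact Finset.single_le_sum (f := fun i => ‖ξ i‖ ^ 2) (fun _ _ => by positivity)
      (Finset.mem_univ i)
  rw [Real.norm_eq_abs] at this
  linarith

/-- A partial derivative maps `H^s` to `H^{s-1}`. -/
theorem sobolevNorm_pdv_le {s : ℝ} (hs : 1 ≤ s) {f : E3 → E3} (hf : ContDiff ℝ 1 f) (i : Fin 3) :
    sobolevNorm (s - 1) (pdv i f) ≤ ENNReal.ofReal (2 * Real.pi) * sobolevNorm s f := by
  by_cases hfin : sobolevNorm s f < ⊤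
  swap
  · rw [not_lt, top_le_iff] at hfin
    rw [hfin, ENNReal.mul_top (by simp [Real.pi_pos])]; exact le_top
  have h := memLp_of_sobolevNorm hfin
  have heq := sobolevNorm_eq (s := s) h
  set W := (𝓕 (h.toLp (complexify f)) : Lp (EuclideanSpace ℂ (Fin 3)) 2 (volume : Measure E3))
    with hW
  have hWm : AEStronglyMeasurable W volume := Lp.aestronglyMeasurable _
  have hnorm : ∀ (r : ℝ) (ξ : E3), ‖((1 + ‖ξ‖ ^ 2) ^ (r / 2) : ℝ) •
      ((2 * Real.pi * Complex.I * (ξ i : ℂ)) • W ξ)‖ ≤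
      2 * Real.pi * ‖((1 + ‖ξ‖ ^ 2) ^ ((r + 1) / 2) : ℝ) • W ξ‖ := by
    intro r ξ
    rw [norm_smul, norm_smul, norm_smul, Real.norm_of_nonneg (by positivity),
      Real.norm_of_nonneg (by positivity)]
    have h1 : ‖(2 * Real.pi * Complex.I * (ξ i : ℂ))‖ = 2 * Real.pi * |ξ i| := by
      simp [abs_of_pos Real.pi_pos]
    rw [h1, show (r + 1) / 2 = r / 2 + 1 / 2 by ring, Real.rpow_add (by positivity)]
    have := abs_coord_le_weight ξ i
    calc (1 + ‖ξ‖ ^ 2) ^ (r / 2) * (2 * Real.pi * |ξ i| * ‖W ξ‖)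
        ≤ (1 + ‖ξ‖ ^ 2) ^ (r / 2) * (2 * Real.pi * (1 + ‖ξ‖ ^ 2) ^ (1 / 2 : ℝ) * ‖W ξ‖) := by
          gcongr
      _ = _ := by ring
  have hgm : AEStronglyMeasurable (fun ξ : E3 => (2 * Real.pi * Complex.I * (ξ i : ℂ)) • W ξ)
      volume := by
    exact AEStronglyMeasurable.smul (𝕜 := ℂ) (Continuous.aestronglyMeasurable (by fun_prop)) hWm
  have hg : MemLp (fun ξ : E3 => (2 * Real.pi * Complex.I * (ξ i : ℂ)) • W ξ) 2 volume := by
    refine ⟨hgm, ?_⟩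
    calc eLpNorm (fun ξ : E3 => (2 * Real.pi * Complex.I * (ξ i : ℂ)) • W ξ) 2 volume
        ≤ ENNReal.ofReal (2 * Real.pi) *
          eLpNorm (fun ξ : E3 => ((1 + ‖ξ‖ ^ 2) ^ (s / 2) : ℝ) • W ξ) 2 volume := by
          refine eLpNorm_le_mul_eLpNorm_of_ae_le_mul (ae_of_all _ fun ξ => ?_) 2
          have h1 := hnorm 0 ξ
          simp only [zero_div, Real.rpow_zero, one_smul, zero_add] at h1
          refine h1.trans ?_
          gcongr
          rw [norm_smul, norm_smul, Real.norm_of_nonneg (by positivity),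
            Real.norm_of_nonneg (by positivity)]
          gcongr
          nlinarith [sq_nonneg ‖ξ‖]
      _ < ⊤ := by rw [← heq]; exact ENNReal.mul_lt_top ENNReal.ofReal_lt_top hfin
  have hae := pdv_ae_eq hf h i hg
  have hmem : MemLp (complexify (pdv i f)) 2 volume := (memLp_congr_ae hae).2 (Lp.memLp _)
  have htoLp : hmem.toLp _ = 𝓕⁻ (hg.toLp _) := by
    refine Lp.ext ?_
    exact hmem.coeFn_toLp.trans hae
  rw [sobolevNorm_eq hmem, htoLp, FourierTransform.fourier_fourierInv_eq, heq]
  refine eLpNorm_le_mul_eLpNorm_of_ae_le_mul ?_ 2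
  filter_upwards [hg.coeFn_toLp] with ξ hξ
  rw [hξ]
  have := hnorm (s - 1) ξ
  rwa [sub_add_cancel] at this

open SchwartzMap in
/-- Sobolev embedding: continuous functions in `H^s(ℝ³)`, `s > 3/2`, are bounded. -/
theorem exists_enorm_le_sobolevNorm {s : ℝ} (hs : 3 / 2 < s) :
    ∃ C : ℝ≥0∞, C ≠ ⊤ ∧ C ≠ 0 ∧ ∀ f : E3 → E3, Continuous f → ∀ x,
      ‖f x‖ₑ ≤ C * sobolevNorm s f := by
  have hw : MemLp (fun x : E3 ↦ (1 + ‖x‖ ^ 2) ^ (-s / 2)) 2 := by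
    constructor
    · refine Continuous.aestronglyMeasurable ?_
      refine Continuous.rpow_const (by fun_prop) fun x => Or.inl (by positivity)
    · rw [eLpNorm_lt_top_iff_lintegral_rpow_enorm_lt_top (by norm_num) (by norm_num)]
      suffices h : ∫⁻ a : E3, ENNReal.ofReal ‖(1 + ‖a‖ ^ 2) ^ (-s)‖ < ⊤ from by
        norm_cast
        simp_rw [ofReal_norm] at h
        simp_rw [← enorm_pow]
        convert h
        rw [← Real.rpow_mul_natCast (by positivity)]
        simp
      have h3 : (Module.finrank ℝ E3 : ℝ) < 2 * s := by
        rw [finrank_euclideanSpace_fin]; push_cast; linarith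
      apply ((integrable_rpow_neg_one_add_norm_sq h3).congr _).lintegral_lt_top
      filter_upwards with x
      rw [Real.norm_eq_abs, abs_eq_self.mpr (by positivity)]
      congr
      ring
  refine ⟨eLpNorm (fun x : E3 ↦ (1 + ‖x‖ ^ 2) ^ (-s / 2)) 2 volume + 1,
    ENNReal.add_ne_top.2 ⟨hw.2.ne, by simp⟩, by simp, fun f hfc x => ?_⟩
  set C := eLpNorm (fun x : E3 ↦ (1 + ‖x‖ ^ 2) ^ (-s / 2)) 2 volume with hC
  by_cases hfin : sobolevNorm s f < ⊤
  swap
  · rw [not_lt, top_le_iff] at hfin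
    rw [hfin, ENNReal.mul_top (by simp)]; exact le_top
  have h := memLp_of_sobolevNorm hfin
  have heq := sobolevNorm_eq (s := s) h
  set F := h.toLp (complexify f) with hF
  set W := (𝓕 F : Lp (EuclideanSpace ℂ (Fin 3)) 2 (volume : Measure E3)) with hW
  have hWm : AEStronglyMeasurable W volume := Lp.aestronglyMeasurable _
  have hwt : AEStronglyMeasurable (fun ξ : E3 => ((1 + ‖ξ‖ ^ 2) ^ (s / 2) : ℝ) • W ξ) volume := by
    have hwc : Continuous fun ξ : E3 => ((1 + ‖ξ‖ ^ 2) ^ (s / 2) : ℝ) :=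
      Continuous.rpow_const (by fun_prop) fun x => Or.inl (by positivity)
    exact AEStronglyMeasurable.smul (𝕜 := ℝ) hwc.aestronglyMeasurable hWm
  -- the Fourier transform `W` is integrable: Cauchy–Schwarz with the weight in `L²`
  have hW1 : eLpNorm W 1 volume ≤ C * sobolevNorm s f := by
    rw [heq]
    have := eLpNorm_smul_le_mul_eLpNorm (p := 2) (q := 2) (r := 1) hwt hw.1
    refine le_trans (le_of_eq ?_) this
    congr 1
    funext ξ
    simp only [Pi.smul_apply', smul_smul]
    rw [← Real.rpow_add (by positivity), show -s / 2 + s / 2 = 0 by ring, Real.rpow_zero, one_smul]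
  have hWi : Integrable W volume :=
    memLp_one_iff_integrable.1 ⟨hWm, hW1.trans_lt (ENNReal.mul_lt_top hw.2 hfin)⟩
  have hWc : Continuous (𝓕⁻ (W : E3 → EuclideanSpace ℂ (Fin 3))) := by
    rw [Real.fourierInv_eq_fourier_comp_neg]
    exact VectorFourier.fourierIntegral_continuous Real.continuous_fourierChar
      (by exact continuous_inner) (hWi.comp_neg)
  -- the Fourier transform of `L²` is inverted by the integral, as both agree as distributions
  have hae : complexify f =ᵐ[volume] 𝓕⁻ (W : E3 → EuclideanSpace ℂ (Fin 3)) := by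
    refine ae_eq_of_integral_contDiff_smul_eq (h.locallyIntegrable (by norm_num))
      hWc.locallyIntegrable ?_
    intro g hg1 hg2
    have hc : HasCompactSupport (Complex.ofRealCLM ∘ g) := hg2.comp_left rfl
    have hsm : ContDiff ℝ ∞ (Complex.ofRealCLM ∘ g) := by fun_prop
    set φ := hc.toSchwartzMap hsm with hφ
    have hφx : ∀ x, φ x = (g x : ℂ) := fun x => rfl
    have e1 : 𝓕⁻ (W : 𝓢'(E3, EuclideanSpace ℂ (Fin 3))) = (F : 𝓢'(E3, EuclideanSpace ℂ (Fin 3))) := by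
      rw [Lp.fourierInv_toTemperedDistribution_eq, hW, FourierTransform.fourierInv_fourier_eq]
    have e2 := congrArg (fun T : 𝓢'(E3, EuclideanSpace ℂ (Fin 3)) => T φ) e1
    simp only [TemperedDistribution.fourierInv_apply, Lp.toTemperedDistribution_apply] at e2
    have e3 : ∫ x, g x • complexify f x = ∫ x, φ x • F x := by
      refine integral_congr_ae ?_
      filter_upwards [h.coeFn_toLp] with x hx
      rw [hF, hx, hφx]; rfl
    rw [e3, ← e2]
    have hflip : (-innerₗ E3).flip = -innerₗ E3 := by
      ext x y; simp [real_inner_comm]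
    have e4 := VectorFourier.integral_fourierIntegral_smul_eq_flip (μ := (volume : Measure E3))
      (ν := (volume : Measure E3)) (L := -innerₗ E3) (f := φ) (g := W)
      Real.continuous_fourierChar (by simpa using! continuous_inner.neg) φ.integrable hWi
    rw [hflip] at e4
    rw [SchwartzMap.fourierInv_coe]
    refine Eq.trans e4 ?_
    refine integral_congr_ae (ae_of_all _ fun x => ?_)
    simp only [hφx]
    rfl
  have hle : ∀ x, ‖complexify f x‖ₑ ≤ eLpNorm W 1 volume := by
    intro x
    have : complexify f = 𝓕⁻ (W : E3 → EuclideanSpace ℂ (Fin 3)) :=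
      Continuous.ae_eq_iff_eq volume (complexL.continuous.comp hfc) hWc |>.1 hae
    rw [this, eLpNorm_one_eq_lintegral_enorm]
    refine (enorm_integral_le_lintegral_enorm _).trans (le_of_eq ?_)
    refine lintegral_congr fun v => ?_
    rw [← ofReal_norm, Circle.norm_smul, ofReal_norm]
  rw [← enorm_complexify]
  calc _ ≤ _ := hle x
    _ ≤ C * sobolevNorm s f := hW1
    _ ≤ _ := by gcongr; exact le_self_add

/-! ### Partial derivatives of scalar functions and the divergence theorem -/

/-- The partial derivative `∂ᵢ f` of a scalar function. -/
def sd (i : Fin 3) (f : E3 → ℝ) (x : E3) : ℝ := fderiv ℝ f x (EuclideanSpace.single i 1)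

section sd
variable {f g : E3 → ℝ} {x : E3} {i : Fin 3}

theorem sd_add (hf : DifferentiableAt ℝ f x) (hg : DifferentiableAt ℝ g x) :
    sd i (fun y => f y + g y) x = sd i f x + sd i g x := by
  simp [sd, fderiv_fun_add hf hg]

theorem sd_sub (hf : DifferentiableAt ℝ f x) (hg : DifferentiableAt ℝ g x) :
    sd i (fun y => f y - g y) x = sd i f x - sd i g x := by
  simp [sd, fderiv_fun_sub hf hg]

theorem sd_mul (hf : DifferentiableAt ℝ f x) (hg : DifferentiableAt ℝ g x) :
    sd i (fun y => f y * g y) x = f x * sd i g x + sd i f x * g x := by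
  simp [sd, fderiv_fun_mul hf hg, mul_comm]

theorem sd_neg : sd i (fun y => - f y) x = - sd i f x := by
  simp [sd]

theorem sd_const (c : ℝ) : sd i (fun _ => c) x = 0 := by simp [sd]

theorem sd_pow (n : ℕ) (hf : DifferentiableAt ℝ f x) :
    sd i (fun y => f y ^ n) x = n * f x ^ (n - 1) * sd i f x := by
  simp [sd, fderiv_fun_pow n hf]

theorem sd_coord (j : Fin 3) : sd i (fun y : E3 => y j) x = if i = j then 1 else 0 := by
  have : (fun y : E3 => y j) = EuclideanSpace.proj (𝕜 := ℝ) j := by ext y; simp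
  rw [sd, this, ContinuousLinearMap.fderiv]
  simp [eq_comm]

end sd

theorem differentiableAt_coord {v : E3 → E3} {x : E3} (h : DifferentiableAt ℝ v x) (j : Fin 3) :
    DifferentiableAt ℝ (fun y => v y j) x := by fun_prop

theorem pdv_apply {v : E3 → E3} {x : E3} (h : DifferentiableAt ℝ v x) (i j : Fin 3) :
    pdv i v x j = sd i (fun y => v y j) x := by
  have key := (((EuclideanSpace.proj j : E3 →L[ℝ] ℝ).hasFDerivAt (x := v x)).comp x
    h.hasFDerivAt).fderiv
  rw [sd, show (fun y => v y j) = (EuclideanSpace.proj j : E3 →L[ℝ] ℝ) ∘ v from rfl, key]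
  rfl

theorem pd_eq_sd {v : E3 → E3} {x : E3} (h : DifferentiableAt ℝ v x) (i j : Fin 3) :
    pd i j v x = sd i (fun y => v y j) x := pdv_apply h i j

theorem pd_eq_pdv (v : E3 → E3) (x : E3) (i j : Fin 3) : pd i j v x = pdv i v x j := rfl

theorem curl_zero_apply (v : E3 → E3) (x : E3) : curl v x 0 = pd 1 2 v x - pd 2 1 v x := rfl
theorem curl_one_apply (v : E3 → E3) (x : E3) : curl v x 1 = pd 2 0 v x - pd 0 2 v x := rfl
theorem curl_two_apply (v : E3 → E3) (x : E3) : curl v x 2 = pd 0 1 v x - pd 1 0 v x := rfl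

theorem cross_zero_apply (a b : E3) : cross a b 0 = a 1 * b 2 - a 2 * b 1 := by
  simp [cross, cross_apply]
theorem cross_one_apply (a b : E3) : cross a b 1 = a 2 * b 0 - a 0 * b 2 := by
  simp [cross, cross_apply]
theorem cross_two_apply (a b : E3) : cross a b 2 = a 0 * b 1 - a 1 * b 0 := by
  simp [cross, cross_apply]

theorem contDiff_pdv {v : E3 → E3} {n m : ℕ∞} (h : ContDiff ℝ m v) (hmn : n + 1 ≤ m) (i : Fin 3) :
    ContDiff ℝ n (pdv i v) := by
  have h1 : ContDiff ℝ n (fderiv ℝ v) := h.fderiv_right (by exact_mod_cast hmn)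
  exact h1.clm_apply contDiff_const

theorem contDiff_sd {f : E3 → ℝ} {n m : ℕ∞} (h : ContDiff ℝ m f) (hmn : n + 1 ≤ m) (i : Fin 3) :
    ContDiff ℝ n (sd i f) := by
  have h1 : ContDiff ℝ n (fderiv ℝ f) := h.fderiv_right (by exact_mod_cast hmn)
  exact h1.clm_apply contDiff_const

theorem sd_comm {f : E3 → ℝ} (h : ContDiff ℝ 2 f) (i k : Fin 3) (x : E3) :
    sd i (sd k f) x = sd k (sd i f) x := by
  have hs := (h.contDiffAt (x := x)).isSymmSndFDerivAt (by simp)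
  have hd : DifferentiableAt ℝ (fderiv ℝ f) x :=
    (h.fderiv_right (m := 1) (by norm_num)).differentiable (by norm_num) x
  have key : ∀ i k : Fin 3, sd i (sd k f) x =
      fderiv ℝ (fderiv ℝ f) x (EuclideanSpace.single i 1) (EuclideanSpace.single k 1) := by
    intro i k
    have : sd k f = fun y => fderiv ℝ f y (EuclideanSpace.single k 1) := rfl
    rw [sd, this, fderiv_clm_apply hd (differentiableAt_const _)]
    simp
  rw [key, key, hs.eq]

theorem fderiv_eq_sum_pdv (v : E3 → E3) (x w : E3) :
    fderiv ℝ v x w = ∑ i, w i • pdv i v x := by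
  conv_lhs => rw [← (EuclideanSpace.basisFun (Fin 3) ℝ).sum_repr w]
  simp [pdv, map_sum]

theorem integral_sd_eq_zero {f : E3 → ℝ} (i : Fin 3) (hd : Differentiable ℝ f)
    (hf : Integrable f) (hf' : Integrable (sd i f)) : ∫ x, sd i f x = 0 := by
  have := integral_mul_fderiv_eq_neg_fderiv_mul_of_integrable (μ := (volume : Measure E3))
    (f := f) (g := fun _ => (1 : ℝ)) (v := EuclideanSpace.single i 1)
    (by simp only [mul_one]; exact hf') (by simp) (by simpa using hf) (fun x _ => hd x)
    (fun x _ => differentiableAt_const _)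
  simp only [mul_one, fderiv_fun_const, Pi.zero_apply, zero_apply, mul_zero,
    integral_zero] at this
  have h2 : ∫ x, (fderiv ℝ f x) (EuclideanSpace.single i 1) = 0 := by linarith
  exact h2

/-- The divergence theorem on `ℝ³` for integrable fields with integrable divergence. -/
theorem integral_sum_sd_eq_zero {f : Fin 3 → E3 → ℝ} (hd : ∀ i, Differentiable ℝ (f i))
    (hf : ∀ i, Integrable (f i)) (hf' : ∀ i, Integrable (sd i (f i))) :
    ∫ x, ∑ i, sd i (f i) x = 0 := by
  rw [integral_finsetSum _ fun i _ => hf' i]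
  exact Finset.sum_eq_zero fun i _ => integral_sd_eq_zero i (hd i) (hf i) (hf' i)

theorem pdv_add {u v : E3 → E3} {x : E3} (i : Fin 3) (hu : DifferentiableAt ℝ u x)
    (hv : DifferentiableAt ℝ v x) : pdv i (fun y => u y + v y) x = pdv i u x + pdv i v x := by
  simp [pdv, fderiv_fun_add hu hv]

theorem pdv_sub {u v : E3 → E3} {x : E3} (i : Fin 3) (hu : DifferentiableAt ℝ u x)
    (hv : DifferentiableAt ℝ v x) : pdv i (fun y => u y - v y) x = pdv i u x - pdv i v x := by
  simp [pdv, fderiv_fun_sub hu hv]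

/-! ### Time-dependent fields with uniform bounds -/

/-- A time-dependent field on `[0,T] × ℝ³` that is jointly continuous, bounded, bounded in `L²`
uniformly in time, and continuous in time with values in `L²`. -/
structure Nice (T : ℝ) (g : ℝ → E3 → E3) : Prop where
  cont : ContinuousOn (fun q : ℝ × E3 => g q.1 q.2) (Icc 0 T ×ˢ univ)
  bdd : ∃ M : ℝ, ∀ t ∈ Icc 0 T, ∀ x, ‖g t x‖ ≤ M
  l2 : ∃ M : ℝ≥0∞, M ≠ ⊤ ∧ ∀ t ∈ Icc 0 T, eLpNorm (g t) 2 volume ≤ M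
  l2cont : ∀ t₀ ∈ Icc 0 T,
    Tendsto (fun t => eLpNorm (g t - g t₀) 2 volume) (𝓝[Icc 0 T] t₀) (𝓝 0)

namespace Nice
variable {T : ℝ} {g h : ℝ → E3 → E3}

theorem continuous (hg : Nice T g) {t : ℝ} (ht : t ∈ Icc 0 T) : Continuous (g t) := by
  have h1 := hg.cont.comp_continuous (f := fun x : E3 => (t, x)) (by fun_prop)
    (fun x => ⟨ht, mem_univ _⟩)
  exact h1

theorem memLp (hg : Nice T g) {t : ℝ} (ht : t ∈ Icc 0 T) : MemLp (g t) 2 volume := by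
  obtain ⟨M, hM, hb⟩ := hg.l2
  exact ⟨(hg.continuous ht).aestronglyMeasurable, (hb t ht).trans_lt hM.lt_top⟩

theorem add (hg : Nice T g) (hh : Nice T h) : Nice T (fun t x => g t x + h t x) := by
  refine ⟨hg.cont.add hh.cont, ?_, ?_, ?_⟩
  · obtain ⟨M, hM⟩ := hg.bdd
    obtain ⟨N, hN⟩ := hh.bdd
    exact ⟨M + N, fun t ht x => (norm_add_le _ _).trans (add_le_add (hM t ht x) (hN t ht x))⟩
  · obtain ⟨M, hM, hM'⟩ := hg.l2
    obtain ⟨N, hN, hN'⟩ := hh.l2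
    exact ⟨M + N, ENNReal.add_ne_top.2 ⟨hM, hN⟩, fun t ht =>
      (eLpNorm_add_le (hg.memLp ht).1 (hh.memLp ht).1 (by norm_num)).trans
        (add_le_add (hM' t ht) (hN' t ht))⟩
  · intro t₀ ht₀
    have := (hg.l2cont t₀ ht₀).add (hh.l2cont t₀ ht₀)
    rw [add_zero] at this
    refine tendsto_of_tendsto_of_tendsto_of_le_of_le' tendsto_const_nhds this
      (Eventually.of_forall fun _ => zero_le) ?_
    filter_upwards [self_mem_nhdsWithin] with t ht
    have e : (fun x => g t x + h t x) - (fun x => g t₀ x + h t₀ x) =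
        (g t - g t₀) + (h t - h t₀) := by
      funext x; simp only [Pi.sub_apply, Pi.add_apply]; abel
    rw [e]
    exact eLpNorm_add_le ((hg.memLp ht).sub (hg.memLp ht₀)).1
      ((hh.memLp ht).sub (hh.memLp ht₀)).1 (by norm_num)

/-- Post-composition with a linear map and pre-composition with a measure preserving
homeomorphism of space. -/
theorem clm_comp (hg : Nice T g) (L : E3 →L[ℝ] E3) (S : E3 ≃ₗᵢ[ℝ] E3) :
    Nice T (fun t x => L (g t (S x))) := by
  have hmp : MeasurePreserving S volume volume := S.measurePreserving
  have key : ∀ f : E3 → E3, MemLp f 2 volume →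
      eLpNorm (fun x => L (f (S x))) 2 volume ≤ ENNReal.ofReal ‖L‖ * eLpNorm f 2 volume := by
    intro f hf
    calc eLpNorm (fun x => L (f (S x))) 2 volume
        ≤ ENNReal.ofReal ‖L‖ * eLpNorm (f ∘ S) 2 volume :=
          eLpNorm_le_mul_eLpNorm_of_ae_le_mul (ae_of_all _ fun x => L.le_opNorm _) 2
      _ = _ := by rw [eLpNorm_comp_measurePreserving hf.1 hmp]
  refine ⟨?_, ?_, ?_, ?_⟩
  · refine L.continuous.comp_continuousOn (hg.cont.comp (f := fun q : ℝ × E3 => (q.1, S q.2)) ?_ ?_)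
    · fun_prop
    · intro q hq; exact ⟨hq.1, mem_univ _⟩
  · obtain ⟨M, hM⟩ := hg.bdd
    refine ⟨‖L‖ * M, fun t ht x => (L.le_opNorm _).trans ?_⟩
    gcongr; exact hM t ht _
  · obtain ⟨M, hM, hM'⟩ := hg.l2
    exact ⟨ENNReal.ofReal ‖L‖ * M, ENNReal.mul_ne_top ENNReal.ofReal_ne_top hM,
      fun t ht => (key _ (hg.memLp ht)).trans (by gcongr; exact hM' t ht)⟩
  · intro t₀ ht₀
    have := ENNReal.Tendsto.const_mul (a := ENNReal.ofReal ‖L‖) (hg.l2cont t₀ ht₀)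
      (Or.inr ENNReal.ofReal_ne_top)
    rw [mul_zero] at this
    refine tendsto_of_tendsto_of_tendsto_of_le_of_le' tendsto_const_nhds this
      (Eventually.of_forall fun _ => zero_le) ?_
    filter_upwards [self_mem_nhdsWithin] with t ht
    refine le_trans (le_of_eq ?_) (key _ ((hg.memLp ht).sub (hg.memLp ht₀)))
    congr 1
    funext x; simp

theorem clm (hg : Nice T g) (L : E3 →L[ℝ] E3) : Nice T (fun t x => L (g t x)) :=
  hg.clm_comp L (LinearIsometryEquiv.refl ℝ E3)

theorem neg (hg : Nice T g) : Nice T (fun t x => - g t x) := by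
  simpa using hg.clm (-ContinuousLinearMap.id ℝ E3)

theorem sub (hg : Nice T g) (hh : Nice T h) : Nice T (fun t x => g t x - h t x) := by
  simpa [sub_eq_add_neg] using hg.add hh.neg

theorem congr (hg : Nice T g) (e : ∀ t ∈ Icc 0 T, ∀ x, h t x = g t x) : Nice T h := by
  have e' : ∀ t ∈ Icc 0 T, h t = g t := fun t ht => funext (e t ht)
  refine ⟨hg.cont.congr fun q hq => e q.1 hq.1 q.2, ?_, ?_, ?_⟩
  · obtain ⟨M, hM⟩ := hg.bdd
    exact ⟨M, fun t ht x => by rw [e t ht]; exact hM t ht x⟩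
  · obtain ⟨M, hM, hM'⟩ := hg.l2
    exact ⟨M, hM, fun t ht => by rw [e' t ht]; exact hM' t ht⟩
  · intro t₀ ht₀
    refine (hg.l2cont t₀ ht₀).congr' ?_
    filter_upwards [self_mem_nhdsWithin] with t ht
    rw [e' t ht, e' t₀ ht₀]

end Nice

/-- A time-dependent field which, with its space derivatives up to order two, is `Nice`. -/
structure Nice2 (T : ℝ) (g : ℝ → E3 → E3) : Prop where
  c2 : ∀ t ∈ Icc 0 T, ContDiff ℝ 2 (g t)
  zero : Nice T g
  one : ∀ i, Nice T (fun t => pdv i (g t))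
  two : ∀ i k, Nice T (fun t => pdv i (pdv k (g t)))

theorem ContinuousInSobolev.pdv {s : ℝ} (hs : 1 ≤ s) {I : Set ℝ} {v : ℝ → E3 → E3}
    (h : ContinuousInSobolev s I v) (hc : ∀ t ∈ I, ContDiff ℝ 1 (v t)) (i : Fin 3) :
    ContinuousInSobolev (s - 1) I (fun t => HallMHD.pdv i (v t)) := by
  refine ⟨fun t ht => (sobolevNorm_pdv_le hs (hc t ht) i).trans_lt
    (ENNReal.mul_lt_top ENNReal.ofReal_lt_top (h.1 t ht)), fun t₀ ht₀ => ?_⟩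
  have := ENNReal.Tendsto.const_mul (a := ENNReal.ofReal (2 * Real.pi)) (h.2 t₀ ht₀)
      (Or.inr ENNReal.ofReal_ne_top)
  rw [mul_zero] at this
  refine tendsto_of_tendsto_of_tendsto_of_le_of_le' tendsto_const_nhds this
    (Eventually.of_forall fun _ => zero_le) ?_
  filter_upwards [self_mem_nhdsWithin] with t ht
  have e : HallMHD.pdv i (v t) - HallMHD.pdv i (v t₀) = HallMHD.pdv i (v t - v t₀) := by
    funext x
    exact (pdv_sub i ((hc t ht).differentiable (by norm_num) x)
      ((hc t₀ ht₀).differentiable (by norm_num) x)).symm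
  rw [e]
  exact sobolevNorm_pdv_le hs ((hc t ht).sub (hc t₀ ht₀)) i

/-- A path in `H^s`, `s > 3/2`, of continuous functions is bounded and jointly continuous, since
the Sobolev norm dominates the supremum. -/
theorem ContinuousInSobolev.nice {s : ℝ} (hs : 3 / 2 < s) {I : Set ℝ} {v : ℝ → E3 → E3}
    (h : ContinuousInSobolev s I v) (hc : ∀ t ∈ I, Continuous (v t)) {T : ℝ} (hT : Icc 0 T ⊆ I) :
    Nice T v := by
  obtain ⟨C, hC, -, hsup⟩ := exists_enorm_le_sobolevNorm hs
  -- a family continuous in `H^s` is locally bounded, hence bounded on the compact interval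
  have hloc : ∀ t₀ ∈ Icc 0 T, ∀ᶠ t in 𝓝[Icc 0 T] t₀, sobolevNorm s (v t - v t₀) ≤ 1 := by
    intro t₀ ht₀
    exact ((h.2 t₀ (hT ht₀)).mono_left (nhdsWithin_mono _ hT)).eventually
      (Iic_mem_nhds (by norm_num))
  have hbdd : ∃ M : ℝ≥0∞, M ≠ ⊤ ∧ ∀ t ∈ Icc 0 T,
      (∀ x, ‖v t x‖ₑ ≤ M) ∧ eLpNorm (v t) 2 volume ≤ M := by
    refine isCompact_Icc.induction_on (p := fun S => ∃ M : ℝ≥0∞, M ≠ ⊤ ∧ ∀ t ∈ S,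
      (∀ x, ‖v t x‖ₑ ≤ M) ∧ eLpNorm (v t) 2 volume ≤ M) ⟨0, by simp⟩ ?_ ?_ ?_
    · rintro S S' hSS ⟨M, hM, h'⟩
      exact ⟨M, hM, fun t ht => h' t (hSS ht)⟩
    · rintro S S' ⟨M, hM, h1⟩ ⟨M', hM', h2⟩
      refine ⟨max M M', by simp [hM, hM'], fun t ht => ?_⟩
      rcases ht with ht | ht
      · exact ⟨fun x => ((h1 t ht).1 x).trans (le_max_left _ _),
          ((h1 t ht).2).trans (le_max_left _ _)⟩
      · exact ⟨fun x => ((h2 t ht).1 x).trans (le_max_right _ _),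
          ((h2 t ht).2).trans (le_max_right _ _)⟩
    · intro t₀ ht₀
      refine ⟨{t | t ∈ Icc 0 T ∧ sobolevNorm s (v t - v t₀) ≤ 1},
        (Filter.inter_mem self_mem_nhdsWithin (hloc t₀ ht₀)),
        C * sobolevNorm s (v t₀) + C * 1 + (sobolevNorm s (v t₀) + 1), ?_, ?_⟩
      · have := (h.1 t₀ (hT ht₀)).ne
        simp [ENNReal.mul_ne_top, hC, this]
      · rintro t ⟨htI, ht⟩
        have e : v t = v t₀ + (v t - v t₀) := by simp
        constructor
        · intro x
          have h1 := hsup (v t₀) (hc t₀ (hT ht₀)) x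
          have h2 := hsup (v t - v t₀) ((hc t (hT htI)).sub (hc t₀ (hT ht₀))) x
          calc ‖v t x‖ₑ = ‖v t₀ x + (v t - v t₀) x‖ₑ := by simp
            _ ≤ ‖v t₀ x‖ₑ + ‖(v t - v t₀) x‖ₑ := enorm_add_le _ _
            _ ≤ C * sobolevNorm s (v t₀) + C * 1 := by
                refine add_le_add h1 (h2.trans ?_); gcongr
            _ ≤ _ := le_self_add
        · calc eLpNorm (v t) 2 volume = eLpNorm (v t₀ + (v t - v t₀)) 2 volume := by rw [← e]
            _ ≤ eLpNorm (v t₀) 2 volume + eLpNorm (v t - v t₀) 2 volume :=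
                eLpNorm_add_le (hc t₀ (hT ht₀)).aestronglyMeasurable
                  ((hc t (hT htI)).sub (hc t₀ (hT ht₀))).aestronglyMeasurable (by norm_num)
            _ ≤ sobolevNorm s (v t₀) + 1 := add_le_add (eLpNorm_le_sobolevNorm (by linarith) _)
                ((eLpNorm_le_sobolevNorm (by linarith) _).trans ht)
            _ ≤ _ := le_add_self
  obtain ⟨M, hM, hMb⟩ := hbdd
  refine ⟨?_, ⟨M.toReal, fun t ht x => ?_⟩, ⟨M, hM, fun t ht => (hMb t ht).2⟩, ?_⟩
  · rintro ⟨t₀, x₀⟩ ⟨ht₀, -⟩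
    rw [ContinuousWithinAt, tendsto_iff_edist_tendsto_0]
    have h1 : Tendsto (fun q : ℝ × E3 => C * sobolevNorm s (v q.1 - v t₀))
        (𝓝[Icc 0 T ×ˢ univ] (t₀, x₀)) (𝓝 0) := by
      have := ENNReal.Tendsto.const_mul (a := C)
        ((h.2 t₀ (hT ht₀)).mono_left (nhdsWithin_mono _ hT)) (Or.inr hC)
      rw [mul_zero] at this
      refine this.comp ?_
      rw [nhdsWithin_prod_eq]; exact tendsto_fst
    have h2 : Tendsto (fun q : ℝ × E3 => edist (v t₀ q.2) (v t₀ x₀))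
        (𝓝[Icc 0 T ×ˢ univ] (t₀, x₀)) (𝓝 0) := by
      rw [← tendsto_iff_edist_tendsto_0]
      refine ((hc t₀ (hT ht₀)).tendsto x₀).comp ?_
      rw [nhdsWithin_prod_eq, nhdsWithin_univ]; exact tendsto_snd
    have h3 := h1.add h2
    rw [add_zero] at h3
    refine tendsto_of_tendsto_of_tendsto_of_le_of_le' tendsto_const_nhds h3
      (Eventually.of_forall fun _ => zero_le) ?_
    filter_upwards [self_mem_nhdsWithin] with q hq
    refine (edist_triangle _ (v t₀ q.2) _).trans (add_le_add ?_ le_rfl)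
    rw [edist_eq_enorm_sub]
    exact hsup (v q.1 - v t₀) ((hc q.1 (hT hq.1)).sub (hc t₀ (hT ht₀))) q.2
  · have := (hMb t ht).1 x
    rw [← ENNReal.ofReal_le_ofReal_iff (by positivity), ENNReal.ofReal_toReal hM, ofReal_norm]
    exact this
  · intro t₀ ht₀
    refine tendsto_of_tendsto_of_tendsto_of_le_of_le tendsto_const_nhds
      ((h.2 t₀ (hT ht₀)).mono_left (nhdsWithin_mono _ hT))
      (fun _ => zero_le) (fun t => eLpNorm_le_sobolevNorm (by linarith) _)

/-- Sobolev regularity above `7/2` gives control of two space derivatives. -/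
theorem ContinuousInSobolev.nice2 {m : ℝ} (hm : 7 / 2 < m) {I : Set ℝ} {v : ℝ → E3 → E3}
    (h : ContinuousInSobolev m I v) (hc : ∀ t ∈ I, ContDiff ℝ 2 (v t)) {T : ℝ} (hT : Icc 0 T ⊆ I) :
    Nice2 T v := by
  have hc1 : ∀ t ∈ I, ContDiff ℝ 1 (v t) := fun t ht => (hc t ht).of_le (by norm_num)
  have hc1' : ∀ i, ∀ t ∈ I, ContDiff ℝ 1 (HallMHD.pdv i (v t)) := fun i t ht =>
    contDiff_pdv (n := 1) (m := 2) (hc t ht) (by norm_num) i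
  have h1 := fun i => h.pdv (by linarith) hc1 i
  have h2 := fun i k => (h1 k).pdv (by linarith) (hc1' k) i
  refine ⟨fun t ht => hc t (hT ht), h.nice (by linarith) (fun t ht => (hc1 t ht).continuous) hT,
    fun i => (h1 i).nice (by linarith) (fun t ht => (hc1' i t ht).continuous) hT,
    fun i k => (h2 i k).nice (by linarith) (fun t ht => ?_) hT⟩
  exact (contDiff_pdv (n := 0) (m := 1) (hc1' k t ht) (by norm_num) i).continuous

/-! ### Square integrable fields -/

section BL2
variable {F : Type*} [NormedAddCommGroup F]

/-- Bounded continuous square integrable functions on `ℝ³`. -/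
structure BL2 (f : E3 → F) : Prop where
  cont : Continuous f
  bdd : ∃ M : ℝ, ∀ x, ‖f x‖ ≤ M
  memLp : MemLp f 2 volume

/-- Time-dependent fields on `[0,T] × ℝ³`, jointly continuous, and bounded and bounded in `L²`
uniformly in time. -/
structure BddL2 (T : ℝ) (g : ℝ → E3 → F) : Prop where
  cont : ContinuousOn (fun q : ℝ × E3 => g q.1 q.2) (Icc 0 T ×ˢ univ)
  bdd : ∃ M : ℝ, ∀ t ∈ Icc 0 T, ∀ x, ‖g t x‖ ≤ M
  l2 : ∃ M : ℝ≥0∞, M ≠ ⊤ ∧ ∀ t ∈ Icc 0 T, eLpNorm (g t) 2 volume ≤ M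

theorem Nice.bddL2 {T : ℝ} {g : ℝ → E3 → E3} (h : Nice T g) : BddL2 T g := ⟨h.cont, h.bdd, h.l2⟩

namespace BL2

theorem add {f g : E3 → F} (hf : BL2 f) (hg : BL2 g) : BL2 (fun x => f x + g x) := by
  obtain ⟨M, hM⟩ := hf.bdd
  obtain ⟨N, hN⟩ := hg.bdd
  exact ⟨hf.cont.add hg.cont, ⟨M + N, fun x => (norm_add_le _ _).trans (add_le_add (hM x) (hN x))⟩,
    hf.memLp.add hg.memLp⟩

theorem neg {f : E3 → F} (hf : BL2 f) : BL2 (fun x => - f x) := by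
  obtain ⟨M, hM⟩ := hf.bdd
  exact ⟨hf.cont.neg, ⟨M, fun x => by rw [norm_neg]; exact hM x⟩, hf.memLp.neg⟩

theorem sub {f g : E3 → F} (hf : BL2 f) (hg : BL2 g) : BL2 (fun x => f x - g x) := by
  simpa [sub_eq_add_neg] using hf.add hg.neg

theorem mul_bdd {f g : E3 → ℝ} (hf : Continuous f) (hfb : ∃ M : ℝ, ∀ x, ‖f x‖ ≤ M) (hg : BL2 g) :
    BL2 (fun x => f x * g x) := by
  obtain ⟨M, hM⟩ := hfb
  obtain ⟨N, hN⟩ := hg.bdd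
  have hc := hf.mul hg.cont
  refine ⟨hc, ⟨M * N, fun x => ?_⟩, ?_⟩
  · rw [norm_mul]
    exact mul_le_mul (hM x) (hN x) (norm_nonneg _) ((norm_nonneg _).trans (hM x))
  · refine MemLp.of_le_mul (c := M) hg.memLp hc.aestronglyMeasurable (ae_of_all _ fun x => ?_)
    rw [norm_mul]; exact mul_le_mul_of_nonneg_right (hM x) (norm_nonneg _)

theorem mul {f g : E3 → ℝ} (hf : BL2 f) (hg : BL2 g) : BL2 (fun x => f x * g x) :=
  mul_bdd hf.cont hf.bdd hg

theorem integrable_mul {f g : E3 → ℝ} (hf : BL2 f) (hg : BL2 g) :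
    Integrable (fun x => f x * g x) := hf.memLp.integrable_mul hg.memLp

theorem coord {v : E3 → E3} (hv : BL2 v) (j : Fin 3) : BL2 (fun x => v x j) := by
  obtain ⟨M, hM⟩ := hv.bdd
  have hc : Continuous fun x => v x j := by have := hv.cont; fun_prop
  refine ⟨hc, ⟨M, fun x => (PiLp.norm_apply_le (v x) j).trans (hM x)⟩, ?_⟩
  exact hv.memLp.of_le hc.aestronglyMeasurable (ae_of_all _ fun x => PiLp.norm_apply_le (v x) j)

theorem congr {f g : E3 → F} (hf : BL2 f) (h : ∀ x, g x = f x) : BL2 g := by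
  rwa [show g = f from funext h]

end BL2

namespace BddL2
variable {T : ℝ}

theorem at_time {g : ℝ → E3 → F} (hg : BddL2 T g) {t : ℝ} (ht : t ∈ Icc 0 T) : BL2 (g t) := by
  have hc : Continuous (g t) := hg.cont.comp_continuous (f := fun x : E3 => (t, x)) (by fun_prop)
    (fun x => ⟨ht, mem_univ _⟩)
  obtain ⟨M, hM⟩ := hg.bdd
  obtain ⟨N, hN, hN'⟩ := hg.l2
  exact ⟨hc, ⟨M, hM t ht⟩, hc.aestronglyMeasurable, (hN' t ht).trans_lt hN.lt_top⟩

theorem add {f g : ℝ → E3 → F} (hf : BddL2 T f) (hg : BddL2 T g) :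
    BddL2 T (fun t x => f t x + g t x) := by
  obtain ⟨M, hM⟩ := hf.bdd
  obtain ⟨N, hN⟩ := hg.bdd
  obtain ⟨A, hA, hA'⟩ := hf.l2
  obtain ⟨B, hB, hB'⟩ := hg.l2
  exact ⟨hf.cont.add hg.cont,
    ⟨M + N, fun t ht x => (norm_add_le _ _).trans (add_le_add (hM t ht x) (hN t ht x))⟩,
    A + B, ENNReal.add_ne_top.2 ⟨hA, hB⟩, fun t ht =>
      (eLpNorm_add_le (hf.at_time ht).memLp.1 (hg.at_time ht).memLp.1 (by norm_num)).trans
        (add_le_add (hA' t ht) (hB' t ht))⟩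

theorem neg {f : ℝ → E3 → F} (hf : BddL2 T f) : BddL2 T (fun t x => - f t x) := by
  obtain ⟨M, hM⟩ := hf.bdd
  obtain ⟨A, hA, hA'⟩ := hf.l2
  refine ⟨hf.cont.neg, ⟨M, fun t ht x => by rw [norm_neg]; exact hM t ht x⟩, A, hA, fun t ht => ?_⟩
  rw [show (fun x => - f t x) = - f t from rfl, eLpNorm_neg]
  exact hA' t ht

theorem sub {f g : ℝ → E3 → F} (hf : BddL2 T f) (hg : BddL2 T g) :
    BddL2 T (fun t x => f t x - g t x) := by
  simpa [sub_eq_add_neg] using hf.add hg.neg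

theorem mul {f g : ℝ → E3 → ℝ} (hf : BddL2 T f) (hg : BddL2 T g) :
    BddL2 T (fun t x => f t x * g t x) := by
  obtain ⟨M, hM⟩ := hf.bdd
  obtain ⟨N, hN⟩ := hg.bdd
  obtain ⟨B, hB, hB'⟩ := hg.l2
  refine ⟨hf.cont.mul hg.cont, ⟨M * N, fun t ht x => ?_⟩, ENNReal.ofReal M * B,
    ENNReal.mul_ne_top ENNReal.ofReal_ne_top hB, fun t ht => ?_⟩
  · rw [norm_mul]
    exact mul_le_mul (hM t ht x) (hN t ht x) (norm_nonneg _) ((norm_nonneg _).trans (hM t ht x))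
  · refine (eLpNorm_le_mul_eLpNorm_of_ae_le_mul (g := g t) (c := M) (ae_of_all _ fun x => ?_) 2).trans
      (by gcongr; exact hB' t ht)
    rw [norm_mul]; exact mul_le_mul_of_nonneg_right (hM t ht x) (norm_nonneg _)

theorem congr {f g : ℝ → E3 → F} (hf : BddL2 T f) (h : ∀ t ∈ Icc 0 T, ∀ x, g t x = f t x) :
    BddL2 T g := by
  obtain ⟨M, hM⟩ := hf.bdd
  obtain ⟨A, hA, hA'⟩ := hf.l2
  refine ⟨hf.cont.congr fun q hq => h q.1 hq.1 q.2, ⟨M, fun t ht x => ?_⟩, A, hA, fun t ht => ?_⟩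
  · rw [h t ht]; exact hM t ht x
  · rw [show g t = f t from funext (h t ht)]; exact hA' t ht

theorem coord {v : ℝ → E3 → E3} (hv : BddL2 T v) (j : Fin 3) : BddL2 T (fun t x => v t x j) := by
  obtain ⟨M, hM⟩ := hv.bdd
  obtain ⟨A, hA, hA'⟩ := hv.l2
  refine ⟨?_, ⟨M, fun t ht x => (PiLp.norm_apply_le (v t x) j).trans (hM t ht x)⟩, A, hA,
    fun t ht => ?_⟩
  · exact (EuclideanSpace.proj j : E3 →L[ℝ] ℝ).continuous.comp_continuousOn hv.cont
  · exact (eLpNorm_mono fun x => PiLp.norm_apply_le (v t x) j).trans (hA' t ht)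

theorem of_coord {v : ℝ → E3 → E3} (hv : ∀ j, BddL2 T (fun t x => v t x j)) : BddL2 T v := by
  have h1 : ∀ j : Fin 3, BddL2 T (fun t x => (v t x j) • (EuclideanSpace.single j 1 : E3)) := by
    intro j
    obtain ⟨M, hM⟩ := (hv j).bdd
    obtain ⟨A, hA, hA'⟩ := (hv j).l2
    have hn : ∀ t x, ‖(v t x j) • (EuclideanSpace.single j 1 : E3)‖ = ‖v t x j‖ := by
      intro t x; rw [norm_smul]; simp
    refine ⟨(hv j).cont.smul continuousOn_const, ⟨M, fun t ht x => ?_⟩, A, hA, fun t ht => ?_⟩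
    · rw [hn]; exact hM t ht x
    · rw [eLpNorm_congr_norm_ae (ae_of_all _ (hn t))]; exact hA' t ht
  refine (((h1 0).add (h1 1)).add (h1 2)).congr fun t _ x => ?_
  ext j
  fin_cases j <;> simp

end BddL2

end BL2

theorem integral_inner_le {f g : E3 → E3} (hf : MemLp f 2 volume) (hg : MemLp g 2 volume) :
    |∫ x, inner ℝ (f x) (g x)| ≤
      (eLpNorm f 2 volume).toReal * (eLpNorm g 2 volume).toReal := by
  have h1 : inner ℝ (hf.toLp f) (hg.toLp g) = ∫ x, inner ℝ (f x) (g x) := by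
    rw [L2.inner_def]
    refine integral_congr_ae ?_
    filter_upwards [hf.coeFn_toLp, hg.coeFn_toLp] with x h1 h2
    rw [h1, h2]
  rw [← h1, ← Lp.norm_toLp f hf, ← Lp.norm_toLp g hg]
  exact abs_real_inner_le_norm _ _

theorem integral_norm_sq {f : E3 → E3} (hf : MemLp f 2 volume) :
    ∫ x, ‖f x‖ ^ 2 = (eLpNorm f 2 volume).toReal ^ 2 := by
  rw [← Lp.norm_toLp f hf, ← real_inner_self_eq_norm_sq, L2.inner_def]
  refine integral_congr_ae ?_
  filter_upwards [hf.coeFn_toLp] with x h1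
  rw [h1, real_inner_self_eq_norm_sq]

theorem integrable_inner {f g : E3 → E3} (hf : MemLp f 2 volume) (hg : MemLp g 2 volume) :
    Integrable (fun x => inner ℝ (f x) (g x)) := by
  have := L2.integrable_inner (𝕜 := ℝ) (hf.toLp f) (hg.toLp g)
  refine this.congr ?_
  filter_upwards [hf.coeFn_toLp, hg.coeFn_toLp] with x h1 h2
  rw [h1, h2]

section Fubini
variable {T s t : ℝ}

theorem aestronglyMeasurable_prod {F : Type*} [NormedAddCommGroup F] {f : ℝ → E3 → F}
    (hf : ContinuousOn (fun q : ℝ × E3 => f q.1 q.2) (Icc s t ×ˢ univ)) :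
    AEStronglyMeasurable (fun q : ℝ × E3 => f q.1 q.2)
      ((volume.restrict (Ioc s t)).prod (volume : Measure E3)) := by
  have h2 : (volume.restrict (Ioc s t)).prod (volume : Measure E3) =
      (volume : Measure (ℝ × E3)).restrict (Ioc s t ×ˢ univ) := by
    rw [Measure.volume_eq_prod, ← Measure.prod_restrict, Measure.restrict_univ]
  rw [h2]
  exact (hf.mono (prod_mono_left Ioc_subset_Icc_self)).aestronglyMeasurable
    (measurableSet_Ioc.prod MeasurableSet.univ)

theorem integrable_prod_of_bound {f : ℝ → E3 → ℝ}
    (hf : ContinuousOn (fun q : ℝ × E3 => f q.1 q.2) (Icc s t ×ˢ univ)) {C : ℝ≥0∞} (hC : C ≠ ⊤)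
    (hb : ∀ τ ∈ Icc s t, ∫⁻ x, ‖f τ x‖ₑ ≤ C) :
    Integrable (fun q : ℝ × E3 => f q.1 q.2)
      ((volume.restrict (Ioc s t)).prod (volume : Measure E3)) := by
  have hm := aestronglyMeasurable_prod hf
  refine ⟨hm, ?_⟩
  rw [HasFiniteIntegral, lintegral_prod _ hm.enorm]
  calc ∫⁻ τ in Ioc s t, ∫⁻ x, ‖f τ x‖ₑ ≤ ∫⁻ τ in Ioc s t, C :=
        setLIntegral_mono measurable_const fun τ hτ => hb τ (Ioc_subset_Icc_self hτ)
    _ < ⊤ := by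
        rw [setLIntegral_const]
        exact ENNReal.mul_lt_top hC.lt_top measure_Ioc_lt_top

/-- Fubini's theorem for space-time integrals of functions with uniformly bounded `L¹` norms. -/
theorem integral_intervalIntegral_swap (hst : s ≤ t) {f : ℝ → E3 → ℝ}
    (hf : ContinuousOn (fun q : ℝ × E3 => f q.1 q.2) (Icc s t ×ˢ univ)) {C : ℝ≥0∞} (hC : C ≠ ⊤)
    (hb : ∀ τ ∈ Icc s t, ∫⁻ x, ‖f τ x‖ₑ ≤ C) :
    Integrable (fun x => ∫ τ in s..t, f τ x) ∧
    IntervalIntegrable (fun τ => ∫ x, f τ x) volume s t ∧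
    ∫ x, ∫ τ in s..t, f τ x = ∫ τ in s..t, ∫ x, f τ x := by
  have hi := integrable_prod_of_bound hf hC hb
  simp_rw [intervalIntegral.integral_of_le hst]
  refine ⟨hi.integral_prod_right, ?_, ?_⟩
  · rw [intervalIntegrable_iff_integrableOn_Ioc_of_le hst]
    exact hi.integral_prod_left
  · exact (integral_integral_swap hi).symm

end Fubini

/-- Minkowski's inequality, in qualitative form: time integrals of families bounded in `L²` are
in `L²`. -/
theorem memLp_intervalIntegral {s t : ℝ} (hst : s ≤ t) {f : ℝ → E3 → ℝ}
    (hf : ContinuousOn (fun q : ℝ × E3 => f q.1 q.2) (Icc s t ×ˢ univ)) {C : ℝ≥0∞} (hC : C ≠ ⊤)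
    (hb : ∀ τ ∈ Icc s t, eLpNorm (f τ) 2 volume ≤ C) :
    MemLp (fun x => ∫ τ in s..t, f τ x) 2 volume := by
  have hm := aestronglyMeasurable_prod hf
  have hc : ∀ x, ContinuousOn (fun τ => f τ x) (Icc s t) := fun x =>
    hf.comp (f := fun τ : ℝ => (τ, x)) (by fun_prop) (fun τ hτ => ⟨hτ, mem_univ _⟩)
  have hm2 : AEStronglyMeasurable (fun x => ∫ τ in s..t, f τ x) volume := by
    simp_rw [intervalIntegral.integral_of_le hst]
    exact hm.prod_swap.integral_prod_right'
  have hsq : ∀ τ ∈ Icc s t, ∫⁻ x, ‖(f τ x) ^ 2‖ₑ ≤ C ^ 2 := by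
    intro τ hτ
    have h1 := hb τ hτ
    have h2 : ∫⁻ x, ‖(f τ x) ^ 2‖ₑ = eLpNorm (f τ) 2 volume ^ 2 := by
      rw [eLpNorm_eq_lintegral_rpow_enorm_toReal (by norm_num) (by norm_num)]
      simp only [ENNReal.toReal_ofNat, ENNReal.rpow_ofNat, one_div, enorm_pow]
      rw [← ENNReal.rpow_natCast, ← ENNReal.rpow_mul]; norm_num
    rw [h2]; gcongr
  have hi := integral_intervalIntegral_swap hst (f := fun τ x => (f τ x) ^ 2) (hf.pow 2)
    (C := C ^ 2) (by simp [hC]) hsq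
  rw [memLp_two_iff_integrable_sq_norm hm2]
  refine (hi.1.const_mul (t - s)).mono' (by exact (hm2.norm.pow 2)) (ae_of_all _ fun x => ?_)
  rw [Real.norm_of_nonneg (by positivity), Real.norm_eq_abs, sq_abs]
  have hii : IntervalIntegrable (fun τ => f τ x) volume s t :=
    (by rw [← uIcc_of_le hst] at hc; exact (hc x).intervalIntegrable)
  have hii2 : IntervalIntegrable (fun τ => (f τ x) ^ 2) volume s t :=
    (by rw [← uIcc_of_le hst] at hc; exact ((hc x).pow 2).intervalIntegrable)
  set A := ∫ τ in s..t, f τ x with hA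
  -- expand the square of `(t - s) f - A`
  have h0 : 0 ≤ ∫ τ in s..t, ((t - s) * f τ x - A) ^ 2 :=
    intervalIntegral.integral_nonneg hst fun τ _ => sq_nonneg _
  have h1 : ∫ τ in s..t, ((t - s) * f τ x - A) ^ 2 =
      (t - s) ^ 2 * (∫ τ in s..t, (f τ x) ^ 2) - (t - s) * A ^ 2 := by
    have : ∀ τ, ((t - s) * f τ x - A) ^ 2 =
        (t - s) ^ 2 * (f τ x) ^ 2 - 2 * (t - s) * A * f τ x + A ^ 2 := fun τ => by ring
    simp_rw [this]
    rw [intervalIntegral.integral_add ((hii2.const_mul _).sub (hii.const_mul _)) (by simp),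
      intervalIntegral.integral_sub (hii2.const_mul _) (hii.const_mul _),
      intervalIntegral.integral_const_mul, intervalIntegral.integral_const_mul, ← hA,
      intervalIntegral.integral_const, smul_eq_mul]
    ring
  rcases hst.eq_or_lt with h | h
  · simp [hA, h]
  · have h2 : 0 ≤ (t - s) * ((t - s) * (∫ τ in s..t, (f τ x) ^ 2) - A ^ 2) := by
      rw [h1] at h0; linarith
    have := nonneg_of_mul_nonneg_right h2 (by linarith)
    linarith

/-! ### Gradients and divergence free fields -/

/-- The fundamental theorem of calculus for one-sided derivatives on an interval. -/
theorem intervalIntegral_deriv_eq_sub {F : Type*} [NormedAddCommGroup F] [NormedSpace ℝ F]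
    [CompleteSpace F] {T : ℝ} {f f' : ℝ → F}
    (hf : ∀ t ∈ Icc 0 T, HasDerivWithinAt f (f' t) (Icc 0 T) t) (hf' : ContinuousOn f' (Icc 0 T))
    {s t : ℝ} (hs : 0 ≤ s) (hst : s ≤ t) (ht : t ≤ T) : ∫ τ in s..t, f' τ = f t - f s := by
  have hsub : Icc s t ⊆ Icc 0 T := Icc_subset_Icc hs ht
  refine intervalIntegral.integral_eq_sub_of_hasDeriv_right_of_le hst
    (fun τ hτ => (hf τ (hsub hτ)).continuousWithinAt.mono hsub) (fun τ hτ => ?_) ?_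
  · have : Icc 0 T ∈ 𝓝 τ := Icc_mem_nhds (by linarith [hτ.1]) (by linarith [hτ.2])
    exact ((hf τ (hsub (Ioo_subset_Icc_self hτ))).hasDerivAt this).hasDerivWithinAt
  · refine ContinuousOn.intervalIntegrable ?_
    rw [uIcc_of_le hst]; exact hf'.mono hsub

/-- Fields having a potential are closed under integration in time. -/
theorem exists_potential_intervalIntegral {h : ℝ → E3 → E3} {s t : ℝ} (hst : s ≤ t)
    (hc : ContinuousOn (fun q : ℝ × E3 => h q.1 q.2) (Icc s t ×ˢ univ))
    (hp : ∀ τ ∈ Icc s t, ∃ q : E3 → ℝ, ContDiff ℝ 1 q ∧ ∀ x, gradient q x = h τ x) :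
    ∃ Q : E3 → ℝ, ∀ x, HasFDerivAt Q (innerSL ℝ (∫ τ in s..t, h τ x)) x := by
  classical
  choose! q hq1 hq2 using hp
  -- normalize the potentials at the origin
  set P : ℝ → E3 → ℝ := fun τ x => q τ x - q τ 0 with hP
  have hPd : ∀ τ ∈ Icc s t, ∀ x, HasFDerivAt (P τ) (innerSL ℝ (h τ x)) x := by
    intro τ hτ x
    have h1 : DifferentiableAt ℝ (q τ) x := (hq1 τ hτ).differentiable (by norm_num) x
    have h2 := h1.hasGradientAt.hasFDerivAt
    rw [hq2 τ hτ x] at h2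
    exact h2.sub_const _
  have hPint : ∀ τ ∈ Icc s t, ∀ x, P τ x = ∫ l in (0:ℝ)..1, inner ℝ (h τ (l • x)) x := by
    intro τ hτ x
    have h1 : ∀ l ∈ Icc (0:ℝ) 1, HasDerivWithinAt (fun l : ℝ => P τ (l • x))
        (inner ℝ (h τ (l • x)) x) (Icc 0 1) l := by
      intro l _
      have h2 : HasDerivAt (fun l : ℝ => l • x) x l := by
        simpa using (hasDerivAt_id l).smul_const x
      exact ((hPd τ hτ (l • x)).comp_hasDerivAt l h2).hasDerivWithinAt
    have h3 : ContinuousOn (fun l : ℝ => inner ℝ (h τ (l • x)) x) (Icc 0 1) := by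
      refine ContinuousOn.inner ?_ continuousOn_const
      exact hc.comp (f := fun l : ℝ => (τ, l • x)) (by fun_prop) (fun l _ => ⟨hτ, mem_univ _⟩)
    have := intervalIntegral_deriv_eq_sub h1 h3 le_rfl zero_le_one le_rfl
    rw [this]; simp [hP]
  have hPc : ∀ x, ContinuousOn (fun τ => P τ x) (Icc s t) := by
    intro x
    have h1 : ContinuousOn (fun τ => ∫ l in (0:ℝ)..1, inner ℝ (h τ (l • x)) x) (Icc s t) := by
      rw [continuousOn_iff_continuous_domRestrict]
      refine intervalIntegral.continuous_parametric_intervalIntegral_of_continuous'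
        (f := fun (τ : Icc s t) (l : ℝ) => inner ℝ (h τ (l • x)) x) ?_ 0 1
      refine Continuous.inner ?_ continuous_const
      exact hc.comp_continuous (f := fun p : Icc s t × ℝ => ((p.1 : ℝ), p.2 • x)) (by fun_prop)
        (fun p => ⟨p.1.2, mem_univ _⟩)
    exact h1.congr fun τ hτ => hPint τ hτ x
  have hhc : ∀ x, ContinuousOn (fun τ => h τ x) (Icc s t) := fun x =>
    hc.comp (f := fun τ : ℝ => (τ, x)) (by fun_prop) (fun τ hτ => ⟨hτ, mem_univ _⟩)
  refine ⟨fun x => ∫ τ in s..t, P τ x, fun x => ?_⟩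
  obtain ⟨M, hM⟩ := (isCompact_Icc.prod (isCompact_closedBall x 1)).exists_bound_of_continuousOn
    (hc.mono (prod_mono_right (subset_univ (Metric.closedBall x 1))))
  have hIoc : Set.uIoc s t = Ioc s t := uIoc_of_le hst
  have hmeas : ∀ {F : Type} [NormedAddCommGroup F] (f : ℝ → F), ContinuousOn f (Icc s t) →
      AEStronglyMeasurable f (volume.restrict (Set.uIoc s t)) := by
    intro F _ f hf
    rw [hIoc]
    exact (hf.mono Ioc_subset_Icc_self).aestronglyMeasurable measurableSet_Ioc
  have key := intervalIntegral.hasFDerivAt_integral_of_dominated_of_fderiv_le (𝕜 := ℝ)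
    (μ := volume) (a := s) (b := t) (F := fun x τ => P τ x)
    (F' := fun x τ => innerSL ℝ (h τ x)) (x₀ := x) (s := Metric.ball x 1) (bound := fun _ => M)
    (Metric.ball_mem_nhds x one_pos)
    (Eventually.of_forall fun y => hmeas _ (hPc y))
    (ContinuousOn.intervalIntegrable (by rw [uIcc_of_le hst]; exact hPc x))
    (hmeas _ ((innerSL ℝ).continuous.comp_continuousOn (hhc x)))
    (ae_of_all _ fun τ hτ y hy => ?_) (by simp)
    (ae_of_all _ fun τ hτ y hy => hPd τ (Ioc_subset_Icc_self (hIoc ▸ hτ)) y)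
  · have hi : IntervalIntegrable (fun τ => h τ x) volume s t :=
      ContinuousOn.intervalIntegrable (by rw [uIcc_of_le hst]; exact hhc x)
    have := (innerSL ℝ (E := E3)).intervalIntegral_comp_comm hi
    rw [this] at key
    exact key
  · rw [innerSL_apply_norm]
    exact hM (τ, y) ⟨Ioc_subset_Icc_self (hIoc ▸ hτ), Metric.ball_subset_closedBall hy⟩

/-- Translates of an `L²` field converge weakly to zero. -/
theorem tendsto_integral_inner_translate {v H : E3 → E3} (hv : MemLp v 2 volume)
    (hH : MemLp H 2 volume) {e : E3} (he : e ≠ 0) :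
    Tendsto (fun n : ℕ => ∫ x, inner ℝ (v x) (H (x + (n : ℝ) • e))) atTop (𝓝 0) := by
  have htr : ∀ (K : E3 → E3), MemLp K 2 volume → ∀ n : ℕ,
      MemLp (fun x => K (x + (n : ℝ) • e)) 2 volume ∧
      eLpNorm (fun x => K (x + (n : ℝ) • e)) 2 volume = eLpNorm K 2 volume := by
    intro K hK n
    have hmp := measurePreserving_add_right (volume : Measure E3) ((n : ℝ) • e)
    exact ⟨hK.comp_measurePreserving hmp, eLpNorm_comp_measurePreserving hK.1 hmp⟩
  rw [Metric.tendsto_atTop]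
  intro ε hε
  set A := (eLpNorm H 2 volume).toReal with hA
  have hA0 : 0 ≤ A := ENNReal.toReal_nonneg
  obtain ⟨w, hwc, hw1, hwcont, hwm⟩ := hv.exists_hasCompactSupport_eLpNorm_sub_le (by norm_num)
    (ε := ENNReal.ofReal (ε / (4 * (A + 1)))) (by simp; positivity)
  set D := (eLpNorm w 2 volume).toReal with hD
  have hD0 : 0 ≤ D := ENNReal.toReal_nonneg
  obtain ⟨z, hzc, hz1, hzcont, hzm⟩ := hH.exists_hasCompactSupport_eLpNorm_sub_le (by norm_num)
    (ε := ENNReal.ofReal (ε / (4 * (D + 1)))) (by simp; positivity)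
  obtain ⟨R, hR⟩ := hwc.isCompact.isBounded.subset_closedBall 0
  obtain ⟨R', hR'⟩ := hzc.isCompact.isBounded.subset_closedBall 0
  obtain ⟨N, hN⟩ := exists_nat_gt ((R + R') / ‖e‖)
  refine ⟨N, fun n hn => ?_⟩
  rw [dist_zero_right, Real.norm_eq_abs]
  have hen : 0 < ‖e‖ := norm_pos_iff.2 he
  -- the compactly supported approximations have disjoint supports after a large translation
  have hzero : ∀ x, inner ℝ (w x) (z (x + (n : ℝ) • e)) = 0 := by
    intro x
    by_contra hne
    have h1 : w x ≠ 0 := fun h => hne (by rw [h, inner_zero_left])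
    have h2 : z (x + (n : ℝ) • e) ≠ 0 := fun h => hne (by rw [h, inner_zero_right])
    have h3 := hR (subset_tsupport w h1)
    have h4 := hR' (subset_tsupport z h2)
    rw [mem_closedBall_zero_iff] at h3 h4
    have h5 : ‖(n : ℝ) • e‖ ≤ R + R' := by
      calc ‖(n : ℝ) • e‖ = ‖(x + (n : ℝ) • e) - x‖ := by simp
        _ ≤ _ := (norm_sub_le _ _).trans (by linarith)
    rw [norm_smul, Real.norm_of_nonneg (by positivity)] at h5
    have h6 : (R + R') / ‖e‖ < n := hN.trans_le (by exact_mod_cast hn)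
    rw [div_lt_iff₀ hen] at h6
    linarith
  have hsplit : ∀ x, inner ℝ (v x) (H (x + (n : ℝ) • e)) =
      inner ℝ ((v - w) x) (H (x + (n : ℝ) • e)) +
        inner ℝ (w x) ((fun y => (H - z) (y + (n : ℝ) • e)) x) := by
    intro x
    have := hzero x
    simp only [Pi.sub_apply, inner_sub_left, inner_sub_right, this]
    ring
  simp_rw [hsplit]
  rw [integral_add (integrable_inner (hv.sub hwm) (htr H hH n).1)
    (integrable_inner hwm (htr _ (hH.sub hzm) n).1)]
  have b1 := integral_inner_le (hv.sub hwm) (htr H hH n).1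
  have b2 := integral_inner_le hwm (htr _ (hH.sub hzm) n).1
  rw [(htr H hH n).2, ← hA] at b1
  rw [(htr _ (hH.sub hzm) n).2, ← hD] at b2
  have c1 : (eLpNorm (v - w) 2 volume).toReal ≤ ε / (4 * (A + 1)) :=
    ENNReal.toReal_le_of_le_ofReal (by positivity) hw1
  have c2 : (eLpNorm (H - z) 2 volume).toReal ≤ ε / (4 * (D + 1)) :=
    ENNReal.toReal_le_of_le_ofReal (by positivity) hz1
  have d1 : ε / (4 * (A + 1)) * A ≤ ε / 4 := by
    rw [div_mul_eq_mul_div, div_le_div_iff₀ (by positivity) (by norm_num)]; nlinarith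
  have d2 : D * (ε / (4 * (D + 1))) ≤ ε / 4 := by
    rw [mul_div_assoc', div_le_div_iff₀ (by positivity) (by norm_num)]; nlinarith
  calc _ ≤ _ := abs_add_le _ _
    _ ≤ ε / 4 + ε / 4 := add_le_add (b1.trans ((mul_le_mul_of_nonneg_right c1 hA0).trans d1))
        (b2.trans ((mul_le_mul_of_nonneg_left c2 hD0).trans d2))
    _ < ε := by linarith

theorem inner_eq_sum (a b : E3) : inner ℝ a b = ∑ i, a i * b i := by
  simp [PiLp.inner_apply, mul_comm]

/-- Square integrable divergence free fields are orthogonal to square integrable gradients,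
whatever the growth of the potential: since the differences `Q(x + h) - Q(x)` are square
integrable, `∫ v · H(x + h)` does not depend on `h`, and it tends to zero as `h → ∞`. -/
theorem integral_inner_gradient_eq_zero {v H : E3 → E3} {Q : E3 → ℝ} (hvd : ContDiff ℝ 1 v)
    (hv : MemLp v 2 volume) (hv' : ∀ i, MemLp (pdv i v) 2 volume) (hdiv : ∀ x, divergence v x = 0)
    (hHc : Continuous H) (hH : MemLp H 2 volume)
    (hQ : ∀ x, HasFDerivAt Q (innerSL ℝ (H x)) x) :
    ∫ x, inner ℝ (v x) (H x) = 0 := by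
  have hvd' : Differentiable ℝ v := hvd.differentiable (by norm_num)
  have htr : ∀ h : E3, MemLp (fun x => H (x + h)) 2 volume := fun h =>
    hH.comp_measurePreserving (measurePreserving_add_right (volume : Measure E3) h)
  have hQc : Continuous Q := continuous_iff_continuousAt.2 fun x => (hQ x).continuousAt
  -- differences of `Q` are averages of translates of `H`, and so are in `L²`
  have hDQ : ∀ h : E3, MemLp (fun x => Q (x + h) - Q x) 2 volume := by
    intro h
    have h1 : ∀ x, Q (x + h) - Q x = ∫ l in (0:ℝ)..1, inner ℝ (H (x + l • h)) h := by
      intro x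
      have h2 : ∀ l ∈ Icc (0:ℝ) 1, HasDerivWithinAt (fun l : ℝ => Q (x + l • h))
          (inner ℝ (H (x + l • h)) h) (Icc 0 1) l := by
        intro l _
        have h2 : HasDerivAt (fun l : ℝ => x + l • h) h l := by
          simpa using ((hasDerivAt_id l).smul_const h).const_add x
        exact ((hQ (x + l • h)).comp_hasDerivAt l h2).hasDerivWithinAt
      have := intervalIntegral_deriv_eq_sub h2
        (Continuous.continuousOn (by fun_prop)) le_rfl zero_le_one le_rfl
      rw [this]; simp
    simp_rw [h1]
    refine memLp_intervalIntegral zero_le_one (f := fun l x => inner ℝ (H (x + l • h)) h)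
      (Continuous.continuousOn (by fun_prop))
      (C := ENNReal.ofReal ‖h‖ * eLpNorm H 2 volume)
      (ENNReal.mul_ne_top ENNReal.ofReal_ne_top hH.2.ne) fun l _ => ?_
    have hmp := measurePreserving_add_right (volume : Measure E3) (l • h)
    rw [← eLpNorm_comp_measurePreserving hH.1 hmp]
    refine eLpNorm_le_mul_eLpNorm_of_ae_le_mul (ae_of_all _ fun x => ?_) 2
    rw [mul_comm]
    exact norm_inner_le_norm _ _
  -- `H(x + h) - H(x)` is the gradient of an `L²` function, and is orthogonal to `v` by parts
  have hinv : ∀ h : E3, ∫ x, inner ℝ (v x) (H (x + h)) = ∫ x, inner ℝ (v x) (H x) := by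
    intro h
    have hQd : ∀ x, HasFDerivAt (fun x => Q (x + h) - Q x)
        (innerSL ℝ (H (x + h)) - innerSL ℝ (H x)) x := by
      intro x
      have h1 : HasFDerivAt (fun x => Q (x + h)) (innerSL ℝ (H (x + h))) x := by
        have := HasFDerivAt.comp (g := Q) x (hQ (id x + h)) ((hasFDerivAt_id x).add_const h)
        rwa [ContinuousLinearMap.comp_id] at this
      exact h1.sub (hQ x)
    have hQd' : Differentiable ℝ (fun x => Q (x + h) - Q x) := fun x => (hQd x).differentiableAt
    have hsdQ : ∀ i x, sd i (fun x => Q (x + h) - Q x) x = H (x + h) i - H x i := by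
      intro i x
      rw [sd, (hQd x).fderiv]
      simp [EuclideanSpace.inner_single_right]
    have hsd : ∀ i x, sd i (fun x => v x i * (Q (x + h) - Q x)) x =
        v x i * (H (x + h) i - H x i) + pdv i v x i * (Q (x + h) - Q x) := by
      intro i x
      rw [sd_mul (differentiableAt_coord (hvd' x) i) (hQd' x), hsdQ, pdv_apply (hvd' x)]
    have hcoord : ∀ {f : E3 → E3}, MemLp f 2 volume → ∀ i, MemLp (fun x => f x i) 2 volume := by
      intro f hf i
      exact hf.of_le ((EuclideanSpace.proj i : E3 →L[ℝ] ℝ).continuous.comp_aestronglyMeasurable hf.1)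
        (ae_of_all _ fun x => PiLp.norm_apply_le (f x) i)
    have key := integral_sum_sd_eq_zero (f := fun i x => v x i * (Q (x + h) - Q x))
      (fun i => by have := hvd'; fun_prop)
      (fun i => (hcoord hv i).integrable_mul (hDQ h))
      (fun i => by
        simp_rw [funext (hsd i)]
        exact ((hcoord hv i).integrable_mul ((hcoord (htr h) i).sub (hcoord hH i))).add
          ((hcoord (hv' i) i).integrable_mul (hDQ h)))
    have hpt : ∀ x, ∑ i, sd i (fun x => v x i * (Q (x + h) - Q x)) x =
        inner ℝ (v x) (H (x + h)) - inner ℝ (v x) (H x) := by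
      intro x
      have hd := hdiv x
      simp only [divergence, pd_eq_pdv] at hd
      simp_rw [hsd, Finset.sum_add_distrib, ← Finset.sum_mul, hd, inner_eq_sum]
      simp [Fin.sum_univ_three]
      ring
    simp_rw [hpt] at key
    rw [integral_sub (integrable_inner hv (htr h)) (integrable_inner hv hH)] at key
    linarith
  have hlim := tendsto_integral_inner_translate hv hH
    (e := EuclideanSpace.single 0 1) (by simp)
  simp_rw [hinv] at hlim
  exact tendsto_nhds_unique tendsto_const_nhds hlim

/-! ### Fields with bounded square integrable first derivatives -/

section BL1

/-- Integrable functions; products of two `BL2` functions are of this kind. -/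
def BL1 (f : E3 → ℝ) : Prop := Integrable f

theorem BL1.add {f g : E3 → ℝ} (hf : BL1 f) (hg : BL1 g) : BL1 (fun x => f x + g x) :=
  Integrable.add hf hg
theorem BL1.sub {f g : E3 → ℝ} (hf : BL1 f) (hg : BL1 g) : BL1 (fun x => f x - g x) :=
  Integrable.sub hf hg
theorem BL1.mul {f g : E3 → ℝ} (hf : BL2 f) (hg : BL2 g) : BL1 (fun x => f x * g x) :=
  hf.integrable_mul hg

end BL1

/-- Differentiable fields on `ℝ³` which, with their partial derivatives, are bounded, continuous
and square integrable. -/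
structure W1 (a : E3 → E3) : Prop where
  diff : Differentiable ℝ a
  zero : BL2 a
  one : ∀ i, BL2 (pdv i a)

/-- Time-dependent fields in `W1` with bounds uniform in time. -/
structure BddW1 (T : ℝ) (a : ℝ → E3 → E3) : Prop where
  diff : ∀ t ∈ Icc 0 T, Differentiable ℝ (a t)
  zero : BddL2 T a
  one : ∀ i, BddL2 T (fun t => pdv i (a t))

theorem cross_sub_right (a b c : E3) : cross a (b - c) = cross a b - cross a c := by
  ext j; fin_cases j <;> simp [cross_zero_apply, cross_one_apply, cross_two_apply] <;> ring

theorem differentiable_of_coord {a : E3 → E3} {x : E3}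
    (h : ∀ j, DifferentiableAt ℝ (fun y => a y j) x) : DifferentiableAt ℝ a x :=
  differentiableAt_euclidean.2 h

theorem differentiableAt_cross {a b : E3 → E3} {x : E3} (ha : DifferentiableAt ℝ a x)
    (hb : DifferentiableAt ℝ b x) : DifferentiableAt ℝ (fun y => cross (a y) (b y)) x := by
  refine differentiable_of_coord fun j => ?_
  fin_cases j <;> simp only [cross_zero_apply, cross_one_apply, cross_two_apply, Fin.zero_eta,
    Fin.mk_one, Fin.reduceFinMk] <;> fun_prop

theorem pdv_cross {a b : E3 → E3} {x : E3} (ha : DifferentiableAt ℝ a x)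
    (hb : DifferentiableAt ℝ b x) (i : Fin 3) :
    pdv i (fun y => cross (a y) (b y)) x = cross (pdv i a x) (b x) + cross (a x) (pdv i b x) := by
  ext j
  rw [pdv_apply (differentiableAt_cross ha hb)]
  fin_cases j <;> simp only [cross_zero_apply, cross_one_apply, cross_two_apply, Fin.zero_eta,
    Fin.mk_one, Fin.reduceFinMk, PiLp.add_apply, pdv_apply ha, pdv_apply hb] <;>
    simp (disch := fun_prop) only [sd_sub, sd_mul] <;> ring

theorem differentiable_curl {a : E3 → E3} (ha : ContDiff ℝ 2 a) : Differentiable ℝ (curl a) := by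
  intro x
  refine differentiable_of_coord fun j => ?_
  have h : ∀ i, Differentiable ℝ (pdv i a) := fun i =>
    (contDiff_pdv (n := 1) (m := 2) ha (by norm_num) i).differentiable (by norm_num)
  have h0 := h 0
  have h1 := h 1
  have h2 := h 2
  fin_cases j <;> simp only [curl_zero_apply, curl_one_apply, curl_two_apply, Fin.zero_eta,
    Fin.mk_one, Fin.reduceFinMk, pd_eq_pdv] <;> fun_prop

theorem pdv_curl {a : E3 → E3} (ha : ContDiff ℝ 2 a) (i : Fin 3) (x : E3) :
    pdv i (curl a) x = !₂[pdv i (pdv 1 a) x 2 - pdv i (pdv 2 a) x 1,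
      pdv i (pdv 2 a) x 0 - pdv i (pdv 0 a) x 2, pdv i (pdv 0 a) x 1 - pdv i (pdv 1 a) x 0] := by
  have h : ∀ i, Differentiable ℝ (pdv i a) := fun i =>
    (contDiff_pdv (n := 1) (m := 2) ha (by norm_num) i).differentiable (by norm_num)
  have h0 := h 0
  have h1 := h 1
  have h2 := h 2
  ext j
  rw [pdv_apply (differentiable_curl ha x)]
  fin_cases j <;> simp only [curl_zero_apply, curl_one_apply, curl_two_apply, Fin.zero_eta,
    Fin.mk_one, Fin.reduceFinMk, pd_eq_pdv, pdv_apply (h _ x)] <;>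
    simp (disch := fun_prop) [sd_sub]

theorem curl_sub {a b : E3 → E3} {x : E3} (ha : DifferentiableAt ℝ a x)
    (hb : DifferentiableAt ℝ b x) : curl (fun y => a y - b y) x = curl a x - curl b x := by
  ext j
  fin_cases j <;> simp [curl_zero_apply, curl_one_apply, curl_two_apply, pd_eq_pdv,
    pdv_sub _ ha hb] <;> ring

theorem curl_add {a b : E3 → E3} {x : E3} (ha : DifferentiableAt ℝ a x)
    (hb : DifferentiableAt ℝ b x) : curl (fun y => a y + b y) x = curl a x + curl b x := by
  ext j
  fin_cases j <;> simp [curl_zero_apply, curl_one_apply, curl_two_apply, pd_eq_pdv,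
    pdv_add _ ha hb] <;> ring

namespace BddL2
variable {T : ℝ}

theorem cross {a b : ℝ → E3 → E3} (ha : BddL2 T a) (hb : BddL2 T b) :
    BddL2 T (fun t x => HallMHD.cross (a t x) (b t x)) := by
  refine of_coord fun j => ?_
  fin_cases j
  · exact (((ha.coord 1).mul (hb.coord 2)).sub ((ha.coord 2).mul (hb.coord 1))).congr
      fun t _ x => cross_zero_apply _ _
  · exact (((ha.coord 2).mul (hb.coord 0)).sub ((ha.coord 0).mul (hb.coord 2))).congr
      fun t _ x => cross_one_apply _ _
  · exact (((ha.coord 0).mul (hb.coord 1)).sub ((ha.coord 1).mul (hb.coord 0))).congr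
      fun t _ x => cross_two_apply _ _

/-- The `L¹` norms of products of two families bounded in `L²` are bounded. -/
theorem lintegral_mul {f g : ℝ → E3 → ℝ} (hf : BddL2 T f) (hg : BddL2 T g) :
    ∃ C : ℝ≥0∞, C ≠ ⊤ ∧ ∀ t ∈ Icc 0 T, ∫⁻ x, ‖f t x * g t x‖ₑ ≤ C := by
  obtain ⟨A, hA, hA'⟩ := hf.l2
  obtain ⟨B, hB, hB'⟩ := hg.l2
  refine ⟨A * B, ENNReal.mul_ne_top hA hB, fun t ht => ?_⟩
  have h := eLpNorm_smul_le_mul_eLpNorm (p := 2) (q := 2) (r := 1) (hg.at_time ht).memLp.1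
    (hf.at_time ht).memLp.1
  rw [eLpNorm_one_eq_lintegral_enorm] at h
  exact h.trans (mul_le_mul' (hA' t ht) (hB' t ht))

theorem lintegral_inner {f g : ℝ → E3 → E3} (hf : BddL2 T f) (hg : BddL2 T g) :
    ∃ C : ℝ≥0∞, C ≠ ⊤ ∧ ∀ t ∈ Icc 0 T, ∫⁻ x, ‖inner ℝ (f t x) (g t x)‖ₑ ≤ C := by
  obtain ⟨A, hA, hA'⟩ := hf.l2
  obtain ⟨B, hB, hB'⟩ := hg.l2
  refine ⟨A * B, ENNReal.mul_ne_top hA hB, fun t ht => ?_⟩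
  have h := eLpNorm_smul_le_mul_eLpNorm (p := 2) (q := 2) (r := 1) (hg.at_time ht).memLp.norm.1
    (hf.at_time ht).memLp.norm.1
  rw [eLpNorm_one_eq_lintegral_enorm, eLpNorm_norm, eLpNorm_norm] at h
  refine le_trans (lintegral_mono fun x => ?_) (h.trans (mul_le_mul' (hA' t ht) (hB' t ht)))
  simp only [Pi.smul_apply', smul_eq_mul]
  rw [← ofReal_norm, ← ofReal_norm]
  apply ENNReal.ofReal_le_ofReal
  rw [norm_mul, norm_norm, norm_norm]
  exact norm_inner_le_norm _ _

theorem const {F : Type*} [NormedAddCommGroup F] {f : E3 → F} (hf : BL2 f) :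
    BddL2 T (fun _ => f) := by
  obtain ⟨M, hM⟩ := hf.bdd
  exact ⟨(hf.cont.comp continuous_snd).continuousOn, ⟨M, fun _ _ => hM⟩,
    eLpNorm f 2 volume, hf.memLp.2.ne, fun _ _ => le_rfl⟩

end BddL2

namespace BddW1
variable {T : ℝ} {a b : ℝ → E3 → E3}

theorem at_time (ha : BddW1 T a) {t : ℝ} (ht : t ∈ Icc 0 T) : W1 (a t) :=
  ⟨ha.diff t ht, ha.zero.at_time ht, fun i => (ha.one i).at_time ht⟩

theorem sub (ha : BddW1 T a) (hb : BddW1 T b) : BddW1 T (fun t x => a t x - b t x) :=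
  ⟨fun t ht => (ha.diff t ht).sub (hb.diff t ht), ha.zero.sub hb.zero, fun i =>
    ((ha.one i).sub (hb.one i)).congr fun t ht x => pdv_sub i (ha.diff t ht x) (hb.diff t ht x)⟩

theorem add (ha : BddW1 T a) (hb : BddW1 T b) : BddW1 T (fun t x => a t x + b t x) :=
  ⟨fun t ht => (ha.diff t ht).add (hb.diff t ht), ha.zero.add hb.zero, fun i =>
    ((ha.one i).add (hb.one i)).congr fun t ht x => pdv_add i (ha.diff t ht x) (hb.diff t ht x)⟩

theorem cross (ha : BddW1 T a) (hb : BddW1 T b) :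
    BddW1 T (fun t x => HallMHD.cross (a t x) (b t x)) :=
  ⟨fun t ht x => differentiableAt_cross (ha.diff t ht x) (hb.diff t ht x), ha.zero.cross hb.zero,
    fun i => (((ha.one i).cross hb.zero).add (ha.zero.cross (hb.one i))).congr
      fun t ht x => pdv_cross (ha.diff t ht x) (hb.diff t ht x) i⟩

theorem curl (ha : BddW1 T a) : BddL2 T (fun t => HallMHD.curl (a t)) := by
  have h : ∀ i j, BddL2 T (fun t x => pdv i (a t) x j) := fun i j => (ha.one i).coord j
  refine BddL2.of_coord fun j => ?_
  fin_cases j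
  · exact ((h 1 2).sub (h 2 1)).congr fun _ _ _ => rfl
  · exact ((h 2 0).sub (h 0 2)).congr fun _ _ _ => rfl
  · exact ((h 0 1).sub (h 1 0)).congr fun _ _ _ => rfl

end BddW1

namespace Nice2
variable {T : ℝ} {v : ℝ → E3 → E3}

theorem bddW1 (h : Nice2 T v) : BddW1 T v :=
  ⟨fun t ht => (h.c2 t ht).differentiable (by norm_num), h.zero.bddL2, fun i => (h.one i).bddL2⟩

theorem bddW1_curl (h : Nice2 T v) : BddW1 T (fun t => curl (v t)) := by
  refine ⟨fun t ht => differentiable_curl (h.c2 t ht), h.bddW1.curl, fun i => ?_⟩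
  have h2 : ∀ k j, BddL2 T (fun t x => pdv i (pdv k (v t)) x j) := fun k j =>
    (h.two i k).bddL2.coord j
  refine BddL2.of_coord fun j => ?_
  fin_cases j
  · exact ((h2 1 2).sub (h2 2 1)).congr fun t ht x => by rw [pdv_curl (h.c2 t ht)]; rfl
  · exact ((h2 2 0).sub (h2 0 2)).congr fun t ht x => by rw [pdv_curl (h.c2 t ht)]; rfl
  · exact ((h2 0 1).sub (h2 1 0)).congr fun t ht x => by rw [pdv_curl (h.c2 t ht)]; rfl

end Nice2

/-! ### Integration by parts for vector fields -/

section IBP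
variable {a b : E3 → E3}

/-- The curl is symmetric. -/
theorem integral_inner_curl (ha : W1 a) (hb : W1 b) :
    ∫ x, inner ℝ (b x) (curl a x) = ∫ x, inner ℝ (a x) (curl b x) := by
  have had := ha.diff
  have hbd := hb.diff
  have hcd : ∀ x, DifferentiableAt ℝ (fun y => cross (a y) (b y)) x := fun x =>
    differentiableAt_cross (had x) (hbd x)
  have hcr : ∀ {f g : E3 → E3}, BL2 f → BL2 g → ∀ j, Integrable (fun x => cross (f x) (g x) j) := by
    intro f g hf hg j
    fin_cases j <;> simp only [cross_zero_apply, cross_one_apply, cross_two_apply, Fin.zero_eta,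
      Fin.mk_one, Fin.reduceFinMk] <;>
      exact ((hf.coord _).integrable_mul (hg.coord _)).sub ((hf.coord _).integrable_mul (hg.coord _))
  have hsd : ∀ i x, sd i (fun y => cross (a y) (b y) i) x =
      cross (pdv i a x) (b x) i + cross (a x) (pdv i b x) i := fun i x => by
    rw [← pdv_apply (hcd x), pdv_cross (had x) (hbd x)]; rfl
  have key := integral_sum_sd_eq_zero (f := fun i x => cross (a x) (b x) i)
    (fun i x => differentiableAt_coord (hcd x) i) (fun i => hcr ha.zero hb.zero i)
    (fun i => by
      simp_rw [funext (hsd i)]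
      exact (hcr (ha.one i) hb.zero i).add (hcr ha.zero (hb.one i) i))
  have hin : ∀ {f g : E3 → E3}, W1 f → W1 g → Integrable (fun x => inner ℝ (f x) (curl g x)) := by
    intro f g hf hg
    simp only [inner_eq_sum, Fin.sum_univ_three, curl_zero_apply, curl_one_apply, curl_two_apply,
      pd_eq_pdv]
    have := fun i j => (hg.one i).coord j
    exact ((BL1.mul (hf.zero.coord _) ((this _ _).sub (this _ _))).add
      (BL1.mul (hf.zero.coord _) ((this _ _).sub (this _ _)))).add
      (BL1.mul (hf.zero.coord _) ((this _ _).sub (this _ _)))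
  have hpt : ∀ x, ∑ i, sd i (fun y => cross (a y) (b y) i) x =
      inner ℝ (b x) (curl a x) - inner ℝ (a x) (curl b x) := by
    intro x
    simp_rw [hsd]
    simp only [inner_eq_sum, Fin.sum_univ_three, curl_zero_apply, curl_one_apply, curl_two_apply,
      pd_eq_pdv, cross_zero_apply, cross_one_apply, cross_two_apply]
    ring
  simp_rw [hpt] at key
  rw [integral_sub (hin hb ha) (hin ha hb)] at key
  linarith

/-- For divergence free fields the quadratic form `b ↦ ∫ curl b · (a × b)` does not contain
derivatives of `b`. -/
theorem integral_inner_cross_curl (ha : W1 a) (hb : W1 b) (hda : ∀ x, divergence a x = 0)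
    (hdb : ∀ x, divergence b x = 0) :
    ∫ x, inner ℝ (cross (a x) (b x)) (curl b x) =
      ∫ x, inner ℝ (b x) (fderiv ℝ a x (b x)) := by
  have had := ha.diff
  have hbd := hb.diff
  have A0 := fun j => ha.zero.coord j
  have B0 := fun j => hb.zero.coord j
  have A1 := fun i j => (ha.one i).coord j
  have B1 := fun i j => (hb.one i).coord j
  -- `(a × b) · curl b - b · (b·∇)a` is half the divergence of `|b|² a - 2 (a·b) b`
  set f : Fin 3 → E3 → ℝ := fun l y => a y l * (b y 0 * b y 0 + b y 1 * b y 1 + b y 2 * b y 2)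
    - (b y l + b y l) * (a y 0 * b y 0 + a y 1 * b y 1 + a y 2 * b y 2) with hf
  have hsd : ∀ l x, sd l (f l) x =
      pdv l a x l * (b x 0 * b x 0 + b x 1 * b x 1 + b x 2 * b x 2)
      + a x l * ((pdv l b x 0 * b x 0 + pdv l b x 1 * b x 1 + pdv l b x 2 * b x 2)
        + (pdv l b x 0 * b x 0 + pdv l b x 1 * b x 1 + pdv l b x 2 * b x 2))
      - ((pdv l b x l + pdv l b x l) * (a x 0 * b x 0 + a x 1 * b x 1 + a x 2 * b x 2)
        + (b x l + b x l) * ((pdv l a x 0 * b x 0 + pdv l a x 1 * b x 1 + pdv l a x 2 * b x 2)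
          + (a x 0 * pdv l b x 0 + a x 1 * pdv l b x 1 + a x 2 * pdv l b x 2))) := by
    intro l x
    simp only [hf, pdv_apply (had x), pdv_apply (hbd x)]
    simp (disch := fun_prop) only [sd_sub, sd_mul, sd_add]
    ring
  have key := integral_sum_sd_eq_zero (f := f) (fun i => by simp only [hf]; fun_prop)
    (fun l => by
      simp only [hf]
      change BL1 _
      repeat' with_reducible first
        | apply A0 | apply B0 | apply A1 | apply B1 | apply BL1.sub | apply BL1.add
        | apply BL1.mul | apply BL2.sub | apply BL2.add | apply BL2.mul)
    (fun l => by
      simp_rw [funext (hsd l)]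
      change BL1 _
      repeat' with_reducible first
        | apply A0 | apply B0 | apply A1 | apply B1 | apply BL1.sub | apply BL1.add
        | apply BL1.mul | apply BL2.sub | apply BL2.add | apply BL2.mul)
  have i1 : Integrable fun x => inner ℝ (cross (a x) (b x)) (curl b x) := by
    simp only [inner_eq_sum, Fin.sum_univ_three, curl_zero_apply, curl_one_apply, curl_two_apply,
      pd_eq_pdv, cross_zero_apply, cross_one_apply, cross_two_apply]
    change BL1 _
    repeat' with_reducible first
        | apply A0 | apply B0 | apply A1 | apply B1 | apply BL1.sub | apply BL1.add
        | apply BL1.mul | apply BL2.sub | apply BL2.add | apply BL2.mul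
  have i2 : Integrable fun x => inner ℝ (b x) (fderiv ℝ a x (b x)) := by
    simp only [inner_eq_sum, Fin.sum_univ_three, fderiv_eq_sum_pdv, PiLp.add_apply,
      PiLp.smul_apply, smul_eq_mul]
    change BL1 _
    repeat' with_reducible first
        | apply A0 | apply B0 | apply A1 | apply B1 | apply BL1.sub | apply BL1.add
        | apply BL1.mul | apply BL2.sub | apply BL2.add | apply BL2.mul
  have hpt : ∀ x, ∑ l, sd l (f l) x =
      2 * (inner ℝ (cross (a x) (b x)) (curl b x) - inner ℝ (b x) (fderiv ℝ a x (b x))) := by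
    intro x
    have d1 := hda x
    have d2 := hdb x
    simp only [divergence, pd_eq_pdv, Fin.sum_univ_three] at d1 d2
    simp_rw [hsd]
    simp only [inner_eq_sum, Fin.sum_univ_three, curl_zero_apply, curl_one_apply, curl_two_apply,
      pd_eq_pdv, cross_zero_apply, cross_one_apply, cross_two_apply, fderiv_eq_sum_pdv,
      PiLp.add_apply, PiLp.smul_apply, smul_eq_mul]
    linear_combination (b x 0 * b x 0 + b x 1 * b x 1 + b x 2 * b x 2) * d1
      - 2 * (a x 0 * b x 0 + a x 1 * b x 1 + a x 2 * b x 2) * d2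
  simp_rw [hpt] at key
  rw [integral_const_mul, integral_sub i1 i2] at key
  linarith

/-- Transport by a divergence free field does not change the `L²` norm. -/
theorem integral_inner_transport (ha : W1 a) (hb : W1 b) (hda : ∀ x, divergence a x = 0) :
    ∫ x, inner ℝ (b x) (fderiv ℝ b x (a x)) = 0 := by
  have had := ha.diff
  have hbd := hb.diff
  have A0 := fun j => ha.zero.coord j
  have B0 := fun j => hb.zero.coord j
  have A1 := fun i j => (ha.one i).coord j
  have B1 := fun i j => (hb.one i).coord j
  set f : Fin 3 → E3 → ℝ := fun l y => a y l * (b y 0 * b y 0 + b y 1 * b y 1 + b y 2 * b y 2)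
    with hf
  have hsd : ∀ l x, sd l (f l) x =
      pdv l a x l * (b x 0 * b x 0 + b x 1 * b x 1 + b x 2 * b x 2)
      + a x l * ((pdv l b x 0 * b x 0 + pdv l b x 1 * b x 1 + pdv l b x 2 * b x 2)
        + (pdv l b x 0 * b x 0 + pdv l b x 1 * b x 1 + pdv l b x 2 * b x 2)) := by
    intro l x
    simp only [hf, pdv_apply (had x), pdv_apply (hbd x)]
    simp (disch := fun_prop) only [sd_mul, sd_add]
    ring
  have key := integral_sum_sd_eq_zero (f := f) (fun i => by simp only [hf]; fun_prop)
    (fun l => by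
      simp only [hf]
      change BL1 _
      repeat' with_reducible first
        | apply A0 | apply B0 | apply A1 | apply B1 | apply BL1.sub | apply BL1.add
        | apply BL1.mul | apply BL2.sub | apply BL2.add | apply BL2.mul)
    (fun l => by
      simp_rw [funext (hsd l)]
      change BL1 _
      repeat' with_reducible first
        | apply A0 | apply B0 | apply A1 | apply B1 | apply BL1.sub | apply BL1.add
        | apply BL1.mul | apply BL2.sub | apply BL2.add | apply BL2.mul)
  have hpt : ∀ x, ∑ l, sd l (f l) x = 2 * inner ℝ (b x) (fderiv ℝ b x (a x)) := by
    intro x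
    have d1 := hda x
    simp only [divergence, pd_eq_pdv, Fin.sum_univ_three] at d1
    simp_rw [hsd]
    simp only [inner_eq_sum, Fin.sum_univ_three, fderiv_eq_sum_pdv,
      PiLp.add_apply, PiLp.smul_apply, smul_eq_mul]
    linear_combination (b x 0 * b x 0 + b x 1 * b x 1 + b x 2 * b x 2) * d1
  simp_rw [hpt] at key
  rw [integral_const_mul] at key
  linarith

end IBP

/-! ### Persistence of the divergence constraint -/

theorem BL2.of_hasCompactSupport {F : Type*} [NormedAddCommGroup F] {f : E3 → F}
    (hf : Continuous f) (hc : HasCompactSupport f) : BL2 f := by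
  obtain ⟨M, hM⟩ := hf.bounded_above_of_compact_support hc
  exact ⟨hf, ⟨M, hM⟩, hf.memLp_of_hasCompactSupport hc⟩

/-- Space-time integrals of `w · N` with `w` independent of time. -/
theorem integral_inner_intervalIntegral {T s t : ℝ} {N : ℝ → E3 → E3} {w : E3 → E3}
    (hN : BddL2 T N) (hw : BL2 w) (hs : 0 ≤ s) (hst : s ≤ t) (ht : t ≤ T) :
    MemLp (fun x => ∫ τ in s..t, N τ x) 2 volume ∧
    IntervalIntegrable (fun τ => ∫ x, inner ℝ (w x) (N τ x)) volume s t ∧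
    ∫ x, inner ℝ (w x) (∫ τ in s..t, N τ x) = ∫ τ in s..t, ∫ x, inner ℝ (w x) (N τ x) := by
  have hsub : Icc s t ⊆ Icc 0 T := Icc_subset_Icc hs ht
  have hcN : ContinuousOn (fun q : ℝ × E3 => N q.1 q.2) (Icc s t ×ˢ univ) :=
    hN.cont.mono (prod_mono_left hsub)
  have hNx : ∀ x, IntervalIntegrable (fun τ => N τ x) volume s t := fun x =>
    ContinuousOn.intervalIntegrable (by
      rw [uIcc_of_le hst]
      exact hcN.comp (f := fun τ : ℝ => (τ, x)) (by fun_prop) (fun τ hτ => ⟨hτ, mem_univ _⟩))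
  obtain ⟨C, hC, hb⟩ := (BddL2.const (T := T) hw).lintegral_inner hN
  have h := integral_intervalIntegral_swap hst (f := fun τ x => inner ℝ (w x) (N τ x))
    ((hw.cont.comp continuous_snd).continuousOn.inner hcN) hC (fun τ hτ => hb τ (hsub hτ))
  have hin : ∀ x, inner ℝ (w x) (∫ τ in s..t, N τ x) = ∫ τ in s..t, inner ℝ (w x) (N τ x) := by
    intro x
    exact ((innerSL ℝ (w x)).intervalIntegral_comp_comm (hNx x)).symm
  refine ⟨?_, h.2.1, ?_⟩
  · have hco : ∀ j, MemLp (fun x => (∫ τ in s..t, N τ x) j) 2 volume := by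
      intro j
      obtain ⟨M, hM, hM'⟩ := (hN.coord j).l2
      have := memLp_intervalIntegral hst (f := fun τ x => N τ x j)
        ((hN.coord j).cont.mono (prod_mono_left hsub)) hM (fun τ hτ => hM' τ (hsub hτ))
      have e : ∀ x, (∫ τ in s..t, N τ x) j = ∫ τ in s..t, N τ x j := fun x =>
        ((EuclideanSpace.proj j : E3 →L[ℝ] ℝ).intervalIntegral_comp_comm (hNx x)).symm
      simp_rw [e]; exact this
    exact MemLp.of_eval_piLp hco
  · simp_rw [hin]; exact h.2.2

theorem intervalIntegral_eq_sub_of_bddL2 {T s t : ℝ} {B Bt : ℝ → E3 → E3}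
    (hc : ContinuousOn (fun q : ℝ × E3 => Bt q.1 q.2) (Icc 0 T ×ˢ univ))
    (hd : ∀ t ∈ Icc 0 T, ∀ x, HasDerivWithinAt (fun s => B s x) (Bt t x) (Icc 0 T) t)
    (hs : 0 ≤ s) (hst : s ≤ t) (ht : t ≤ T) (x : E3) :
    ∫ τ in s..t, Bt τ x = B t x - B s x :=
  intervalIntegral_deriv_eq_sub (fun t ht => hd t ht x)
    (hc.comp (f := fun τ : ℝ => (τ, x)) (by fun_prop) (fun τ hτ => ⟨hτ, mem_univ _⟩)) hs hst ht

/-- If `∂ₜB` is a curl then `div B` does not depend on time. -/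
theorem divergence_eq_zero_of_curl {T : ℝ} {B Bt E : ℝ → E3 → E3}
    (hB : ∀ t ∈ Icc 0 T, ContDiff ℝ 1 (B t)) (hB2 : ∀ t ∈ Icc 0 T, BL2 (B t)) (hBt : BddL2 T Bt)
    (hd : ∀ t ∈ Icc 0 T, ∀ x, HasDerivWithinAt (fun s => B s x) (Bt t x) (Icc 0 T) t)
    (hE : BddW1 T E) (hcurl : ∀ t ∈ Icc 0 T, ∀ x, Bt t x = curl (E t) x)
    (h0 : ∀ x, divergence (B 0) x = 0) {t : ℝ} (ht : t ∈ Icc 0 T) (x : E3) :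
    divergence (B t) x = 0 := by
  have hT0 : (0 : ℝ) ∈ Icc 0 T := ⟨le_rfl, ht.1.trans ht.2⟩
  have hdivc : ∀ t ∈ Icc 0 T, Continuous (divergence (B t)) := by
    intro t ht
    have := fun i => (contDiff_pdv (n := 0) (m := 1) (hB t ht) (by norm_num) i).continuous
    have h0 := this 0
    have h1 := this 1
    have h2 := this 2
    have e : divergence (B t) = fun x => pdv 0 (B t) x 0 + pdv 1 (B t) x 1 + pdv 2 (B t) x 2 := by
      funext x; simp [divergence, Fin.sum_univ_three, pd_eq_pdv]
    rw [e]; fun_prop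
  -- test against gradients of test functions
  have key : ∀ φ : E3 → ℝ, ContDiff ℝ ∞ φ → HasCompactSupport φ →
      ∫ x, φ x • divergence (B t) x = 0 := by
    intro φ hφ hφc
    have hs1 : ∀ i, ContDiff ℝ ∞ (sd i φ) := fun i =>
      contDiff_sd (n := ⊤) (m := ⊤) hφ (by simp) i
    have hs1c : ∀ i, HasCompactSupport (sd i φ) := fun i => hφc.fderiv_apply (𝕜 := ℝ) _
    have hs2 : ∀ i k, BL2 (sd i (sd k φ)) := fun i k =>
      BL2.of_hasCompactSupport (contDiff_sd (n := 0) (m := ⊤) (hs1 k) (by simp) i).continuous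
        ((hs1c k).fderiv_apply (𝕜 := ℝ) _)
    have hs1' : ∀ i, BL2 (sd i φ) := fun i => BL2.of_hasCompactSupport (hs1 i).continuous (hs1c i)
    set G : E3 → E3 := fun x => !₂[sd 0 φ x, sd 1 φ x, sd 2 φ x] with hG
    have hGj : ∀ j x, G x j = sd j φ x := by intro j x; fin_cases j <;> rfl
    have hGs : ContDiff ℝ ∞ G := contDiff_euclidean.2 fun j => by simp_rw [hGj]; exact hs1 j
    have hGd : Differentiable ℝ G := hGs.differentiable (by simp)
    have hGp : ∀ i j x, pdv i G x j = sd i (sd j φ) x := by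
      intro i j x
      rw [pdv_apply (hGd x)]; simp_rw [hGj]
    have hof : ∀ {f : E3 → E3}, (∀ j, BL2 (fun x => f x j)) → BL2 f := fun {f} h =>
      (BddL2.of_coord (T := 0) (v := fun _ => f) fun j => BddL2.const (h j)).at_time
        (t := 0) (by simp)
    have hGW : W1 G := ⟨hGd, hof fun j => (hs1' j).congr (hGj j), fun i => hof fun j =>
      (hs2 i j).congr (hGp i j)⟩
    have hcG : ∀ x, curl G x = 0 := by
      intro x
      have hc := sd_comm (f := φ) (by exact_mod_cast contDiff_infty.1 hφ 2)
      ext j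
      fin_cases j <;> simp [curl_zero_apply, curl_one_apply, curl_two_apply, pd_eq_pdv, hGp,
        hc 1 2, hc 2 0, hc 0 1]
    -- gradients are orthogonal to curls, since the curl is symmetric
    have hz : ∀ τ ∈ Icc 0 T, ∫ x, inner ℝ (G x) (Bt τ x) = 0 := by
      intro τ hτ
      simp_rw [hcurl τ hτ]
      rw [integral_inner_curl (hE.at_time hτ) hGW]
      simp [hcG]
    have hconst : ∫ x, inner ℝ (G x) (B t x) = ∫ x, inner ℝ (G x) (B 0 x) := by
      have h := (integral_inner_intervalIntegral hBt hGW.zero le_rfl ht.1 ht.2).2.2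
      simp_rw [intervalIntegral_eq_sub_of_bddL2 hBt.cont hd le_rfl ht.1 ht.2, inner_sub_right] at h
      rw [integral_sub (integrable_inner hGW.zero.memLp (hB2 t ht).memLp)
        (integrable_inner hGW.zero.memLp (hB2 0 hT0).memLp)] at h
      have h2 : ∫ τ in (0:ℝ)..t, ∫ x, inner ℝ (G x) (Bt τ x) = 0 := by
        rw [intervalIntegral.integral_congr (g := fun _ => (0:ℝ))]
        · simp
        · intro τ hτ
          rw [uIcc_of_le ht.1] at hτ
          exact hz τ ⟨hτ.1, hτ.2.trans ht.2⟩
      linarith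
    have hparts : ∀ τ ∈ Icc 0 T, ∫ x, φ x * divergence (B τ) x = - ∫ x, inner ℝ (G x) (B τ x) := by
      intro τ hτ
      have hBd : Differentiable ℝ (B τ) := (hB τ hτ).differentiable (by norm_num)
      have hφd : Differentiable ℝ φ := hφ.differentiable (by simp)
      have hsd : ∀ i x, sd i (fun x => φ x * B τ x i) x =
          φ x * pdv i (B τ) x i + sd i φ x * B τ x i := by
        intro i x
        rw [sd_mul (hφd x) (differentiableAt_coord (hBd x) i), pdv_apply (hBd x)]
      have hBc := (hB τ hτ).continuous
      have hpc : ∀ i, Continuous (pdv i (B τ)) := fun i =>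
        (contDiff_pdv (n := 0) (m := 1) (hB τ hτ) (by norm_num) i).continuous
      have h := integral_sum_sd_eq_zero (f := fun i x => φ x * B τ x i) (fun i => by fun_prop)
        (fun i => Continuous.integrable_of_hasCompactSupport (by fun_prop) hφc.mul_right)
        (fun i => by
          simp_rw [funext (hsd i)]
          have := (hs1 i).continuous
          have := hpc i
          exact (Continuous.integrable_of_hasCompactSupport (by fun_prop) hφc.mul_right).add
            (Continuous.integrable_of_hasCompactSupport (by fun_prop) (hs1c i).mul_right))
      have hpt : ∀ x, ∑ i, sd i (fun x => φ x * B τ x i) x =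
          φ x * divergence (B τ) x + inner ℝ (G x) (B τ x) := by
        intro x
        simp only [hsd, divergence, pd_eq_pdv, inner_eq_sum, hGj, Fin.sum_univ_three]
        ring
      simp_rw [hpt] at h
      have hi : Integrable fun x => φ x * divergence (B τ) x :=
        (hφ.continuous.mul (hdivc τ hτ)).integrable_of_hasCompactSupport hφc.mul_right
      rw [integral_add hi (integrable_inner hGW.zero.memLp (hB2 τ hτ).memLp)] at h
      linarith
    simp only [smul_eq_mul]
    rw [hparts t ht, hconst, ← hparts 0 hT0]
    simp [h0]
  have hae := ae_eq_zero_of_integral_contDiff_smul_eq_zero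
    (hdivc t ht).locallyIntegrable key
  have := Continuous.ae_eq_iff_eq (volume : Measure E3) (hdivc t ht) continuous_const |>.1 hae
  exact congrFun this x

/-! ### Regular solutions -/

/-- The momentum flux term `(∇×B)×B - u·∇u`. -/
def force (u B : E3 → E3) (x : E3) : E3 := cross (curl B x) (B x) - fderiv ℝ u x (u x)

/-- The electric field `u×B - (∇×B)×B`, up to sign. -/
def emf (u B : E3 → E3) (x : E3) : E3 := cross (u x) (B x) - cross (curl B x) (B x)

/-- Solutions on `[0,T]` with uniform bounds on two space derivatives; `ut` and `Bt` are the time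
derivatives. -/
structure RegSol (T : ℝ) (u B ut Bt : ℝ → E3 → E3) : Prop where
  u2 : Nice2 T u
  B2 : Nice2 T B
  ut_cont : ContinuousOn (fun q : ℝ × E3 => ut q.1 q.2) (Icc 0 T ×ˢ univ)
  du : ∀ t ∈ Icc 0 T, ∀ x, HasDerivWithinAt (fun s => u s x) (ut t x) (Icc 0 T) t
  dB : ∀ t ∈ Icc 0 T, ∀ x, HasDerivWithinAt (fun s => B s x) (Bt t x) (Icc 0 T) t
  momentum : ∀ t ∈ Icc 0 T, ∃ p : E3 → ℝ, ContDiff ℝ 1 p ∧ ∀ x,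
    gradient p x = force (u t) (B t) x - ut t x
  induction : ∀ t ∈ Icc 0 T, ∀ x, Bt t x = curl (emf (u t) (B t)) x
  div_u : ∀ t ∈ Icc 0 T, ∀ x, divergence (u t) x = 0
  div_B : ∀ t ∈ Icc 0 T, ∀ x, divergence (B t) x = 0

theorem BddW1.emf {T : ℝ} {u B : ℝ → E3 → E3} (hu : Nice2 T u) (hB : Nice2 T B) :
    BddW1 T (fun t => emf (u t) (B t)) :=
  (hu.bddW1.cross hB.bddW1).sub (hB.bddW1_curl.cross hB.bddW1)

theorem BddL2.advect {T : ℝ} {a b : ℝ → E3 → E3} (ha : BddW1 T a) (hb : BddL2 T b) :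
    BddL2 T (fun t x => fderiv ℝ (a t) x (b t x)) := by
  refine BddL2.of_coord fun j => ?_
  have A := fun i j => (ha.one i).coord j
  have B := fun j => hb.coord j
  refine ((((B 0).mul (A 0 j)).add ((B 1).mul (A 1 j))).add ((B 2).mul (A 2 j))).congr
    fun t _ x => ?_
  simp [fderiv_eq_sum_pdv, Fin.sum_univ_three]

theorem BddL2.force {T : ℝ} {u B : ℝ → E3 → E3} (hu : Nice2 T u) (hB : Nice2 T B) :
    BddL2 T (fun t => force (u t) (B t)) :=
  (hB.bddW1_curl.zero.cross hB.bddW1.zero).sub (BddL2.advect hu.bddW1 hu.bddW1.zero)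

theorem RegSol.Bt_bddL2 {T : ℝ} {u B ut Bt : ℝ → E3 → E3} (h : RegSol T u B ut Bt) :
    BddL2 T Bt := (BddW1.emf h.u2 h.B2).curl.congr h.induction

/-- Solutions in the sense of `IsSolution` are regular on compact time intervals. -/
theorem IsSolution.regSol {m T₀ T : ℝ} (hm : 7 / 2 < m) (hT : T < T₀)
    {u₀ B₀ : E3 → E3}
    {u B : ℝ → E3 → E3} (h : IsSolution m (Ico 0 T₀) u₀ B₀ u B)
    (h0 : ∀ x, divergence B₀ x = 0) :
    RegSol T u B (fun t x => derivWithin (fun s => u s x) (Ico 0 T₀) t)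
      (fun t x => derivWithin (fun s => B s x) (Ico 0 T₀) t) := by
  have hsub : Icc 0 T ⊆ Ico 0 T₀ := fun t ht => ⟨ht.1, ht.2.trans_lt hT⟩
  have hu2 := h.sobolev_u.nice2 hm h.c2_u hsub
  have hB2 := h.sobolev_B.nice2 hm h.c2_B hsub
  have hI : UniqueDiffOn ℝ (Ico 0 T₀) := uniqueDiffOn_Ico 0 T₀
  have hIu : UniqueDiffOn ℝ (Ico 0 T₀ ×ˢ (univ : Set E3)) := hI.prod uniqueDiffOn_univ
  have hder : ∀ v : ℝ → E3 → E3, ContDiffOn ℝ 1 (fun q : ℝ × E3 => v q.1 q.2) (Ico 0 T₀ ×ˢ univ) →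
      ∀ t ∈ Ico 0 T₀, ∀ x, HasDerivWithinAt (fun s => v s x)
        (fderivWithin ℝ (fun q : ℝ × E3 => v q.1 q.2) (Ico 0 T₀ ×ˢ univ) (t, x) (1, 0))
        (Ico 0 T₀) t := by
    intro v hv t ht x
    have h1 := (hv.differentiableOn (by norm_num) (t, x) ⟨ht, mem_univ _⟩).hasFDerivWithinAt
    have h2 : HasDerivWithinAt (fun s : ℝ => (s, x)) ((1 : ℝ), (0 : E3)) (Ico 0 T₀) t :=
      ((hasDerivAt_id t).prodMk (hasDerivAt_const t x)).hasDerivWithinAt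
    have h3 : MapsTo (fun s : ℝ => (s, x)) (Ico 0 T₀) (Ico 0 T₀ ×ˢ univ) :=
      fun s hs => ⟨hs, mem_univ _⟩
    exact h1.comp_hasDerivWithinAt t h2 h3
  have hcont : ∀ v : ℝ → E3 → E3, ContDiffOn ℝ 1 (fun q : ℝ × E3 => v q.1 q.2) (Ico 0 T₀ ×ˢ univ) →
      ContinuousOn (fun q : ℝ × E3 => derivWithin (fun s => v s q.2) (Ico 0 T₀) q.1)
        (Icc 0 T ×ˢ univ) := by
    intro v hv
    have h1 : ContinuousOn (fun q : ℝ × E3 =>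
        fderivWithin ℝ (fun q : ℝ × E3 => v q.1 q.2) (Ico 0 T₀ ×ˢ univ) q ((1 : ℝ), (0 : E3)))
        (Ico 0 T₀ ×ˢ univ) :=
      (hv.continuousOn_fderivWithin hIu le_rfl).clm_apply continuousOn_const
    refine (h1.congr fun q hq => ?_).mono (prod_mono_left hsub)
    exact (hder v hv q.1 hq.1 q.2).derivWithin (hI q.1 hq.1)
  have hd : ∀ v : ℝ → E3 → E3, ContDiffOn ℝ 1 (fun q : ℝ × E3 => v q.1 q.2) (Ico 0 T₀ ×ˢ univ) →
      ∀ t ∈ Icc 0 T, ∀ x, HasDerivWithinAt (fun s => v s x)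
        (derivWithin (fun s => v s x) (Ico 0 T₀) t) (Icc 0 T) t := fun v hv t ht x =>
    ((hder v hv t (hsub ht) x).differentiableWithinAt.hasDerivWithinAt).mono hsub
  have hind : ∀ t ∈ Icc 0 T, ∀ x, derivWithin (fun s => B s x) (Ico 0 T₀) t =
      curl (emf (u t) (B t)) x := by
    intro t ht x
    have h1 := h.induction t (hsub ht) x
    have h2 : curl (emf (u t) (B t)) x = curl (fun y => cross (u t y) (B t y)) x -
        curl (fun y => cross (curl (B t) y) (B t y)) x :=
      curl_sub ((hu2.bddW1.cross hB2.bddW1).diff t ht x)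
        ((hB2.bddW1_curl.cross hB2.bddW1).diff t ht x)
    rw [h2]
    rw [← sub_eq_zero, ← h1]; abel
  refine ⟨hu2, hB2, hcont u h.c1_u, hd u h.c1_u, hd B h.c1_B, ?_, hind,
    fun t ht => h.div_u t (hsub ht), ?_⟩
  · intro t ht
    obtain ⟨p, hp, hp'⟩ := h.momentum t (hsub ht)
    refine ⟨p, hp, fun x => ?_⟩
    rw [force, ← hp' x]; abel
  · intro t ht x
    refine divergence_eq_zero_of_curl (fun t ht => (hB2.c2 t ht).of_le (by norm_num))
      (fun t ht => hB2.bddW1.zero.at_time ht) ((BddW1.emf hu2 hB2).curl.congr hind) (hd B h.c1_B)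
      (BddW1.emf hu2 hB2) hind ?_ ht x
    rw [h.init_B]; exact h0

/-! ### Uniqueness -/

theorem norm_cross_le (a b : E3) : ‖cross a b‖ ≤ ‖a‖ * ‖b‖ := by
  rw [← sq_le_sq₀ (norm_nonneg _) (by positivity), mul_pow, EuclideanSpace.norm_sq_eq,
    EuclideanSpace.norm_sq_eq, EuclideanSpace.norm_sq_eq]
  simp only [Fin.sum_univ_three, cross_zero_apply, cross_one_apply, cross_two_apply,
    Real.norm_eq_abs, sq_abs]
  nlinarith [sq_nonneg (a 0 * b 0 + a 1 * b 1 + a 2 * b 2)]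

theorem norm_fderiv_apply_le {a : E3 → E3} {M : ℝ} {x : E3} (h : ∀ i, ‖pdv i a x‖ ≤ M) (w : E3) :
    ‖fderiv ℝ a x w‖ ≤ 3 * M * ‖w‖ := by
  rw [fderiv_eq_sum_pdv]
  refine (norm_sum_le _ _).trans ?_
  have : ∀ i ∈ Finset.univ, ‖w i • pdv i a x‖ ≤ ‖w‖ * M := fun i _ => by
    rw [norm_smul]
    exact mul_le_mul (PiLp.norm_apply_le w i) (h i) (norm_nonneg _) (norm_nonneg _)
  refine (Finset.sum_le_sum this).trans (le_of_eq ?_)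
  simp; ring

theorem BddL2.norm_bound {T : ℝ} {F : Type*} [NormedAddCommGroup F] {g : ℝ → E3 → F}
    (h : BddL2 T g) : ∃ M : ℝ, 0 ≤ M ∧ ∀ t ∈ Icc 0 T, ∀ x, ‖g t x‖ ≤ M := by
  obtain ⟨M, hM⟩ := h.bdd
  exact ⟨max M 0, le_max_right _ _, fun t ht x => (hM t ht x).trans (le_max_left _ _)⟩

theorem BddW1.pdv_bound {T : ℝ} {g : ℝ → E3 → E3} (h : BddW1 T g) :
    ∃ M : ℝ, 0 ≤ M ∧ ∀ t ∈ Icc 0 T, ∀ x i, ‖pdv i (g t) x‖ ≤ M := by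
  choose M hM0 hM using fun i => (h.one i).norm_bound
  refine ⟨∑ i, M i, Finset.sum_nonneg fun i _ => hM0 i, fun t ht x i => (hM i t ht x).trans ?_⟩
  exact Finset.single_le_sum (f := M) (fun i _ => hM0 i) (Finset.mem_univ i)

theorem divergence_curl {v : E3 → E3} (hv : ContDiff ℝ 2 v) (x : E3) :
    divergence (curl v) x = 0 := by
  have hd : Differentiable ℝ v := hv.differentiable (by norm_num)
  have hc : ∀ j i k, pdv i (pdv k v) x j = pdv k (pdv i v) x j := by
    intro j i k
    have hk : ∀ k, Differentiable ℝ (pdv k v) := fun k =>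
      (contDiff_pdv (n := 1) (m := 2) hv (by norm_num) k).differentiable (by norm_num)
    have e : ∀ k, (fun y => pdv k v y j) = sd k (fun y => v y j) := fun k =>
      funext fun y => pdv_apply (hd y) k j
    rw [pdv_apply (hk k x), pdv_apply (hk i x), e, e]
    exact sd_comm (contDiff_euclidean.1 hv j) i k x
  simp only [divergence, pd_eq_pdv, Fin.sum_univ_three, pdv_curl hv]
  simp [hc 2 0 1, hc 1 0 2, hc 0 1 2]

/-- The real `L²` norm. -/
def n2 (f : E3 → E3) : ℝ := (eLpNorm f 2 volume).toReal

theorem n2_nonneg (f : E3 → E3) : 0 ≤ n2 f := ENNReal.toReal_nonneg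

theorem n2_add_le {f g : E3 → E3} (hf : MemLp f 2 volume) (hg : MemLp g 2 volume) :
    n2 (f + g) ≤ n2 f + n2 g := by
  rw [n2, n2, n2, ← ENNReal.toReal_add hf.2.ne hg.2.ne]
  exact ENNReal.toReal_mono (ENNReal.add_ne_top.2 ⟨hf.2.ne, hg.2.ne⟩)
    (eLpNorm_add_le hf.1 hg.1 (by norm_num))

theorem n2_sub_comm (f g : E3 → E3) : n2 (f - g) = n2 (g - f) := by
  rw [n2, n2, eLpNorm_sub_comm]

theorem BddL2.n2_bound {T : ℝ} {g : ℝ → E3 → E3} (h : BddL2 T g) :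
    ∃ M : ℝ, 0 ≤ M ∧ ∀ t ∈ Icc 0 T, n2 (g t) ≤ M := by
  obtain ⟨M, hM, hM'⟩ := h.l2
  exact ⟨M.toReal, ENNReal.toReal_nonneg, fun t ht => ENNReal.toReal_mono hM (hM' t ht)⟩

theorem Nice.tendsto_n2 {T : ℝ} {g : ℝ → E3 → E3} (h : Nice T g) {s : ℝ} (hs : s ∈ Icc 0 T) :
    Tendsto (fun t => n2 (g t - g s)) (𝓝[Icc 0 T] s) (𝓝 0) := by
  have := (ENNReal.tendsto_toReal ENNReal.zero_ne_top).comp (h.l2cont s hs)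
  simpa using! this

theorem Nice.continuousOn_n2 {T : ℝ} {g : ℝ → E3 → E3} (h : Nice T g) :
    ContinuousOn (fun t => n2 (g t)) (Icc 0 T) := by
  intro s hs
  rw [ContinuousWithinAt, tendsto_iff_norm_sub_tendsto_zero]
  refine squeeze_zero' (Eventually.of_forall fun _ => norm_nonneg _) ?_ (h.tendsto_n2 hs)
  filter_upwards [self_mem_nhdsWithin] with t ht
  have h1 := n2_add_le (h.memLp hs) ((h.memLp ht).sub (h.memLp hs))
  have h2 := n2_add_le (h.memLp ht) ((h.memLp hs).sub (h.memLp ht))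
  rw [add_sub_cancel] at h1 h2
  rw [n2_sub_comm (g s) (g t)] at h2
  rw [Real.norm_eq_abs, abs_le]
  constructor <;> linarith

/-- The energy inequality for the difference of two solutions, at a fixed time. All terms with
derivatives of `v` and `b` cancel or are divergences. -/
theorem RegSol.energy_ineq {T : ℝ} {u B ut Bt u' B' ut' Bt' : ℝ → E3 → E3}
    (h : RegSol T u B ut Bt) (h' : RegSol T u' B' ut' Bt') :
    ∃ C : ℝ, 0 ≤ C ∧ ∀ t ∈ Icc 0 T,
      (∫ x, inner ℝ ((u t - u' t) x) (force (u t) (B t) x - force (u' t) (B' t) x)) +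
      (∫ x, inner ℝ ((B t - B' t) x) (Bt t x - Bt' t x)) ≤
      C * (n2 (u t - u' t) ^ 2 + n2 (B t - B' t) ^ 2) := by
  obtain ⟨M₁, hM₁, b₁⟩ := h'.u2.bddW1.pdv_bound
  obtain ⟨M₂, hM₂, b₂⟩ := h.B2.bddW1.curl.norm_bound
  have ha' := h.u2.bddW1.sub h.B2.bddW1_curl
  obtain ⟨M₃, hM₃, b₃⟩ := ha'.pdv_bound
  refine ⟨3 * M₁ + M₂ + 3 * M₃, by positivity, fun t ht => ?_⟩
  have hv : W1 (u t - u' t) := (h.u2.bddW1.sub h'.u2.bddW1).at_time ht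
  have hb : W1 (B t - B' t) := (h.B2.bddW1.sub h'.B2.bddW1).at_time ht
  have hu := h.u2.bddW1.at_time ht
  have hu' := h'.u2.bddW1.at_time ht
  have hB := h.B2.bddW1.at_time ht
  have hB' := h'.B2.bddW1.at_time ht
  have hJ := h.B2.bddW1_curl.at_time ht
  have ha : W1 (fun x => u t x - curl (B t) x) := ha'.at_time ht
  set v := u t - u' t with hvdef
  set b := B t - B' t with hbdef
  -- `a` is the velocity of the electrons, which carries the magnetic field in the Hall model
  set a : E3 → E3 := fun x => u t x - curl (B t) x with hadef
  have hdivsub : ∀ {f g : E3 → E3}, Differentiable ℝ f → Differentiable ℝ g →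
      (∀ x, divergence f x = 0) → (∀ x, divergence g x = 0) →
      ∀ x, divergence (fun y => f y - g y) x = 0 := by
    intro f g hf hg hf0 hg0 x
    have h1 := hf0 x
    have h2 := hg0 x
    simp only [divergence, pd_eq_pdv] at h1 h2 ⊢
    simp_rw [pdv_sub _ (hf x) (hg x), PiLp.sub_apply, Finset.sum_sub_distrib]
    rw [h1, h2, sub_zero]
  have hdJ : ∀ x, divergence (curl (B t)) x = 0 := divergence_curl (h.B2.c2 t ht)
  have hda : ∀ x, divergence a x = 0 := hdivsub hu.diff hJ.diff (h.div_u t ht) hdJ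
  have hdb : ∀ x, divergence b x = 0 := hdivsub hB.diff hB'.diff (h.div_B t ht) (h'.div_B t ht)
  -- the magnetic term
  set Y : E3 → E3 := fun x => emf (u t) (B t) x - emf (u' t) (B' t) x with hY
  have hYW : W1 Y := ((BddW1.emf h.u2 h.B2).sub (BddW1.emf h'.u2 h'.B2)).at_time ht
  have hM : ∀ x, Bt t x - Bt' t x = curl Y x := by
    intro x
    rw [h.induction t ht, h'.induction t ht]
    exact (curl_sub (((BddW1.emf h.u2 h.B2).at_time ht).diff x)
      (((BddW1.emf h'.u2 h'.B2).at_time ht).diff x)).symm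
  have hcb : ∀ x, curl b x = curl (B t) x - curl (B' t) x := fun x =>
    curl_sub (hB.diff x) (hB'.diff x)
  -- the last term reappears with the opposite sign in the momentum equation
  have hYeq : ∀ x, inner ℝ (Y x) (curl b x) = inner ℝ (cross (a x) (b x)) (curl b x) +
      inner ℝ (cross (v x) (B' t x)) (curl b x) := by
    intro x
    rw [hcb]
    simp only [hY, hadef, hvdef, hbdef, emf, inner_eq_sum, Fin.sum_univ_three, PiLp.sub_apply,
      Pi.sub_apply, cross_zero_apply, cross_one_apply, cross_two_apply]
    ring
  have hcbL : BL2 (curl b) := by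
    have h1 := (((h.B2.bddW1.sub h'.B2.bddW1).curl).at_time ht)
    exact h1
  have hcrL : ∀ {f g : E3 → E3}, BL2 f → BL2 g → MemLp (fun x => cross (f x) (g x)) 2 volume :=
    fun {f g} hf hg => ((BddL2.const (T := 0) hf).cross (BddL2.const hg)).at_time
      (t := 0) (by simp) |>.memLp
  have e2 : ∫ x, inner ℝ (b x) (Bt t x - Bt' t x) =
      (∫ x, inner ℝ (b x) (fderiv ℝ a x (b x))) +
        ∫ x, inner ℝ (cross (v x) (B' t x)) (curl b x) := by
    simp_rw [hM]
    rw [integral_inner_curl hYW hb, ← integral_inner_cross_curl ha hb hda hdb]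
    simp_rw [hYeq]
    exact integral_add (integrable_inner (hcrL ha.zero hb.zero) hcbL.memLp)
      (integrable_inner (hcrL hv.zero hB'.zero) hcbL.memLp)
  -- the momentum term
  set R : E3 → E3 := fun x => cross (curl (B t) x) (b x) - fderiv ℝ (u' t) x (v x) with hR
  have hvd : ∀ x w, fderiv ℝ v x w = fderiv ℝ (u t) x w - fderiv ℝ (u' t) x w := by
    intro x w
    rw [hvdef, fderiv_sub (hu.diff x) (hu'.diff x)]; rfl
  have hF : ∀ x, inner ℝ (v x) (force (u t) (B t) x - force (u' t) (B' t) x) =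
      (inner ℝ (v x) (R x) - inner ℝ (v x) (fderiv ℝ v x (u t x)))
        - inner ℝ (cross (v x) (B' t x)) (curl b x) := by
    intro x
    have e : fderiv ℝ (u' t) x (u t x) = fderiv ℝ (u' t) x (u' t x) + fderiv ℝ (u' t) x (v x) := by
      rw [← map_add]; congr 1; simp [hvdef]
    rw [hvd, e, hcb]
    simp only [force, hR, hbdef, inner_eq_sum, Fin.sum_univ_three, PiLp.sub_apply, PiLp.add_apply,
      Pi.sub_apply, cross_zero_apply, cross_one_apply, cross_two_apply]
    ring
  have hadv : ∀ {f g : E3 → E3}, W1 f → BL2 g → MemLp (fun x => fderiv ℝ f x (g x)) 2 volume :=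
    fun {f g} hf hg => (BddL2.advect (T := 0) (a := fun _ => f) (b := fun _ => g)
      ⟨fun _ _ => hf.diff, BddL2.const hf.zero, fun i => BddL2.const (hf.one i)⟩
      (BddL2.const hg)).at_time (t := 0) (by simp) |>.memLp
  have hRL : MemLp R 2 volume := (hcrL hJ.zero hb.zero).sub (hadv hu' hv.zero)
  have e1 : ∫ x, inner ℝ (v x) (force (u t) (B t) x - force (u' t) (B' t) x) =
      (∫ x, inner ℝ (v x) (R x)) - ∫ x, inner ℝ (cross (v x) (B' t x)) (curl b x) := by
    simp_rw [hF]
    have hi12 : Integrable (fun x => inner ℝ (v x) (R x) - inner ℝ (v x) (fderiv ℝ v x (u t x))) :=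
      (integrable_inner hv.zero.memLp hRL).sub (integrable_inner hv.zero.memLp (hadv hv hu.zero))
    rw [integral_sub hi12 (integrable_inner (hcrL hv.zero hB'.zero) hcbL.memLp),
      integral_sub (integrable_inner hv.zero.memLp hRL)
      (integrable_inner hv.zero.memLp (hadv hv hu.zero)),
      integral_inner_transport hu hv (h.div_u t ht), sub_zero]
  rw [e1, e2]
  have hsum : ∫ x, (inner ℝ (v x) (R x) + inner ℝ (b x) (fderiv ℝ a x (b x))) ≤
      ∫ x, (3 * M₁ + M₂ + 3 * M₃) * (‖v x‖ ^ 2 + ‖b x‖ ^ 2) := by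
    refine integral_mono ((integrable_inner hv.zero.memLp hRL).add
      (integrable_inner hb.zero.memLp (hadv ha hb.zero)))
      ((hv.zero.memLp.integrable_norm_pow (by norm_num)).add
        (hb.zero.memLp.integrable_norm_pow (by norm_num)) |>.const_mul _) fun x => ?_
    have f1 : inner ℝ (v x) (R x) ≤ ‖v x‖ * (M₂ * ‖b x‖ + 3 * M₁ * ‖v x‖) := by
      refine (real_inner_le_norm _ _).trans (mul_le_mul_of_nonneg_left ?_ (norm_nonneg _))
      refine (norm_sub_le _ _).trans (add_le_add ((norm_cross_le _ _).trans ?_)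
        (norm_fderiv_apply_le (b₁ t ht x) _))
      exact mul_le_mul_of_nonneg_right (b₂ t ht x) (norm_nonneg _)
    have f2 : inner ℝ (b x) (fderiv ℝ a x (b x)) ≤ ‖b x‖ * (3 * M₃ * ‖b x‖) :=
      (real_inner_le_norm _ _).trans
        (mul_le_mul_of_nonneg_left (norm_fderiv_apply_le (b₃ t ht x) _) (norm_nonneg _))
    have f3 : 2 * (‖v x‖ * ‖b x‖) ≤ ‖v x‖ ^ 2 + ‖b x‖ ^ 2 := by
      nlinarith [sq_nonneg (‖v x‖ - ‖b x‖)]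
    have f4 : M₂ * (‖v x‖ * ‖b x‖) ≤ M₂ * (‖v x‖ ^ 2 + ‖b x‖ ^ 2) :=
      mul_le_mul_of_nonneg_left (by nlinarith [sq_nonneg (‖v x‖), sq_nonneg ‖b x‖]) hM₂
    nlinarith [mul_nonneg hM₁ (sq_nonneg ‖b x‖), mul_nonneg hM₃ (sq_nonneg ‖v x‖)]
  rw [integral_add (integrable_inner hv.zero.memLp hRL)
      (integrable_inner hb.zero.memLp (hadv ha hb.zero)), integral_const_mul,
    integral_add (hv.zero.memLp.integrable_norm_pow (by norm_num))
        (hb.zero.memLp.integrable_norm_pow (by norm_num)), integral_norm_sq hv.zero.memLp,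
        integral_norm_sq hb.zero.memLp] at hsum
  simp only [n2]
  linarith

/-- Increments of the squared `L²` norm of a field whose time derivative is `N` up to terms
orthogonal to it. -/
theorem n2_sq_sub {T s t : ℝ} {w N : ℝ → E3 → E3} (hw : BddL2 T w) (hN : BddL2 T N)
    (hs : 0 ≤ s) (hst : s ≤ t) (ht : t ≤ T)
    (hortho : ∀ τ ∈ Icc 0 T, ∫ x, inner ℝ (w τ x) ((∫ τ in s..t, N τ x) - (w t x - w s x)) = 0) :
    IntervalIntegrable (fun τ => ∫ x, inner ℝ (w t x + w s x) (N τ x)) volume s t ∧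
    n2 (w t) ^ 2 - n2 (w s) ^ 2 = ∫ τ in s..t, ∫ x, inner ℝ (w t x + w s x) (N τ x) := by
  have htI : t ∈ Icc 0 T := ⟨hs.trans hst, ht⟩
  have hsI : s ∈ Icc 0 T := ⟨hs, hst.trans ht⟩
  have hwt := (hw.at_time htI).memLp
  have hws := (hw.at_time hsI).memLp
  obtain ⟨hm, hi, he⟩ := integral_inner_intervalIntegral hN
    ((hw.at_time htI).add (hw.at_time hsI)) hs hst ht
  refine ⟨hi, ?_⟩
  have hH : MemLp (fun x => (∫ τ in s..t, N τ x) - (w t x - w s x)) 2 volume :=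
    hm.sub (hwt.sub hws)
  have h1 : ∫ x, inner ℝ (w t x + w s x) ((∫ τ in s..t, N τ x) - (w t x - w s x)) = 0 := by
    simp_rw [inner_add_left]
    rw [integral_add (integrable_inner hwt hH) (integrable_inner hws hH), hortho t htI,
      hortho s hsI, add_zero]
  have hd : MemLp (fun x => w t x - w s x) 2 volume := hwt.sub hws
  have ha : MemLp (fun x => w t x + w s x) 2 volume := hwt.add hws
  simp_rw [inner_sub_right _ (∫ τ in s..t, N τ _)] at h1
  rw [integral_sub (integrable_inner ha hm) (integrable_inner ha hd), he] at h1
  have h2 : ∫ x, inner ℝ (w t x + w s x) (w t x - w s x) = n2 (w t) ^ 2 - n2 (w s) ^ 2 := by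
    rw [n2, n2, ← integral_norm_sq hwt, ← integral_norm_sq hws,
      ← integral_sub (hwt.integrable_norm_pow (by norm_num))
        (hws.integrable_norm_pow (by norm_num))]
    refine integral_congr_ae (ae_of_all _ fun x => ?_)
    simp only [inner_add_left, inner_sub_right, real_inner_self_eq_norm_sq]
    rw [real_inner_comm (w t x) (w s x)]
    ring
  linarith

/-- Solutions are determined by their initial values: Gronwall's inequality for the `L²` norm of the
difference. -/
theorem RegSol.unique {T : ℝ} {u B ut Bt u' B' ut' Bt' : ℝ → E3 → E3}
    (h : RegSol T u B ut Bt) (h' : RegSol T u' B' ut' Bt') (hu0 : u 0 = u' 0) (hB0 : B 0 = B' 0)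
    {t : ℝ} (ht : t ∈ Icc 0 T) : u t = u' t ∧ B t = B' t := by
  obtain ⟨C, hC, hen⟩ := h.energy_ineq h'
  set v : ℝ → E3 → E3 := fun t x => u t x - u' t x with hv
  set b : ℝ → E3 → E3 := fun t x => B t x - B' t x with hb
  set N : ℝ → E3 → E3 := fun t x => force (u t) (B t) x - force (u' t) (B' t) x with hN
  set M : ℝ → E3 → E3 := fun t x => Bt t x - Bt' t x with hM
  have hvN : Nice T v := h.u2.zero.sub h'.u2.zero
  have hbN : Nice T b := h.B2.zero.sub h'.B2.zero
  have hNb : BddL2 T N := (BddL2.force h.u2 h.B2).sub (BddL2.force h'.u2 h'.B2)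
  have hMb : BddL2 T M := h.Bt_bddL2.sub h'.Bt_bddL2
  have hvW : BddW1 T v := h.u2.bddW1.sub h'.u2.bddW1
  obtain ⟨K₁, hK₁, c₁⟩ := hNb.n2_bound
  obtain ⟨K₂, hK₂, c₂⟩ := hMb.n2_bound
  obtain ⟨K₃, hK₃, c₃⟩ := hvN.bddL2.n2_bound
  obtain ⟨K₄, hK₄, c₄⟩ := hbN.bddL2.n2_bound
  -- orthogonality to the pressure gradient
  have hov : ∀ s t, 0 ≤ s → s ≤ t → t ≤ T → ∀ τ ∈ Icc 0 T,
      ∫ x, inner ℝ (v τ x) ((∫ τ in s..t, N τ x) - (v t x - v s x)) = 0 := by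
    intro s t hs hst ht τ hτ
    have hsub : Icc s t ⊆ Icc 0 T := Icc_subset_Icc hs ht
    set G : ℝ → E3 → E3 := fun t x => N t x - (ut t x - ut' t x) with hG
    have hutc : ContinuousOn (fun q : ℝ × E3 => ut q.1 q.2 - ut' q.1 q.2) (Icc 0 T ×ˢ univ) :=
      h.ut_cont.sub h'.ut_cont
    have hGc : ContinuousOn (fun q : ℝ × E3 => G q.1 q.2) (Icc s t ×ˢ univ) :=
      (hNb.cont.sub hutc).mono (prod_mono_left hsub)
    obtain ⟨Q, hQ⟩ := exists_potential_intervalIntegral hst hGc (fun τ hτ => by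
      obtain ⟨p, hp, hp'⟩ := h.momentum τ (hsub hτ)
      obtain ⟨q, hq, hq'⟩ := h'.momentum τ (hsub hτ)
      refine ⟨fun x => p x - q x, hp.sub hq, fun x => ?_⟩
      have hpd := (hp.differentiable (by norm_num) x).hasGradientAt
      have hqd := (hq.differentiable (by norm_num) x).hasGradientAt
      have : HasGradientAt (fun x => p x - q x) (gradient p x - gradient q x) x := by
        rw [hasGradientAt_iff_hasFDerivAt, map_sub]
        exact hpd.hasFDerivAt.sub hqd.hasFDerivAt
      rw [this.gradient, hp', hq']
      simp only [hG, hN]; abel)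
    have hint : ∀ x, ∫ τ in s..t, G τ x = (∫ τ in s..t, N τ x) - (v t x - v s x) := by
      intro x
      have i1 : IntervalIntegrable (fun τ => N τ x) volume s t :=
        ContinuousOn.intervalIntegrable (by
          rw [uIcc_of_le hst]
          exact (hNb.cont.mono (prod_mono_left hsub)).comp (f := fun τ : ℝ => (τ, x)) (by fun_prop)
            (fun τ hτ => ⟨hτ, mem_univ _⟩))
      have i2 : IntervalIntegrable (fun τ => ut τ x - ut' τ x) volume s t :=
        ContinuousOn.intervalIntegrable (by
          rw [uIcc_of_le hst]
          exact (hutc.mono (prod_mono_left hsub)).comp (f := fun τ : ℝ => (τ, x)) (by fun_prop)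
            (fun τ hτ => ⟨hτ, mem_univ _⟩))
      simp only [hG]
      rw [intervalIntegral.integral_sub i1 i2]
      congr 1
      exact intervalIntegral_eq_sub_of_bddL2 (Bt := fun t x => ut t x - ut' t x) hutc
        (fun t ht x => (h.du t ht x).sub (h'.du t ht x)) hs hst ht x
    simp_rw [hint] at hQ
    have hHm : MemLp (fun x => (∫ τ in s..t, N τ x) - (v t x - v s x)) 2 volume :=
      ((integral_inner_intervalIntegral hNb (hvN.bddL2.at_time hτ) hs hst ht).1).sub
        ((hvN.memLp ⟨hs.trans hst, ht⟩).sub (hvN.memLp ⟨hs, hst.trans ht⟩))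
    have hHc : Continuous (fun x => (∫ τ in s..t, N τ x) - (v t x - v s x)) := by
      refine Continuous.sub ?_ ((hvN.continuous ⟨hs.trans hst, ht⟩).sub
        (hvN.continuous ⟨hs, hst.trans ht⟩))
      obtain ⟨K, hK⟩ := hNb.bdd
      refine intervalIntegral.continuous_of_dominated_interval (bound := fun _ => K) ?_ ?_ (by simp) ?_
      · intro x
        have : ContinuousOn (fun τ => N τ x) (Icc s t) :=
          (hNb.cont.mono (prod_mono_left hsub)).comp (f := fun τ : ℝ => (τ, x)) (by fun_prop)
            (fun τ hτ => ⟨hτ, mem_univ _⟩)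
        rw [uIoc_of_le hst]
        exact (this.mono Ioc_subset_Icc_self).aestronglyMeasurable measurableSet_Ioc
      · intro x
        refine ae_of_all _ fun τ hτ => ?_
        rw [uIoc_of_le hst] at hτ
        exact hK τ (hsub (Ioc_subset_Icc_self hτ)) x
      · refine ae_of_all _ fun τ hτ => ?_
        rw [uIoc_of_le hst] at hτ
        exact (hNb.at_time (hsub (Ioc_subset_Icc_self hτ))).cont
    refine integral_inner_gradient_eq_zero (v := v τ) ?_ (hvN.memLp hτ)
      (fun i => ((hvW.one i).at_time hτ).memLp) ?_ hHc hHm hQ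
    · exact ((h.u2.c2 τ hτ).sub (h'.u2.c2 τ hτ)).of_le (by norm_num)
    · intro x
      have d1 := h.div_u τ hτ x
      have d2 := h'.div_u τ hτ x
      simp only [divergence, pd_eq_pdv] at d1 d2 ⊢
      simp only [hv]
      simp_rw [pdv_sub _ (h.u2.bddW1.diff τ hτ x) (h'.u2.bddW1.diff τ hτ x), PiLp.sub_apply,
        Finset.sum_sub_distrib]
      rw [d1, d2, sub_zero]
  have hob : ∀ s t, 0 ≤ s → s ≤ t → t ≤ T → ∀ τ ∈ Icc 0 T,
      ∫ x, inner ℝ (b τ x) ((∫ τ in s..t, M τ x) - (b t x - b s x)) = 0 := by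
    intro s t hs hst ht τ hτ
    have : ∀ x, (∫ τ in s..t, M τ x) - (b t x - b s x) = 0 := by
      intro x
      rw [sub_eq_zero]
      exact intervalIntegral_eq_sub_of_bddL2 hMb.cont
        (fun t ht x => (h.dB t ht x).sub (h'.dB t ht x)) hs hst ht x
    simp [this]
  set e : ℝ → ℝ := fun t => n2 (v t) ^ 2 + n2 (b t) ^ 2 with he
  have hec : ContinuousOn e (Icc 0 T) := (hvN.continuousOn_n2.pow 2).add (hbN.continuousOn_n2.pow 2)
  have hgr := le_gronwallBound_of_liminf_deriv_right_le (f := e) (f' := fun t => 2 * C * e t)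
    (δ := 0) (K := 2 * C) (ε := 0) (a := 0) (b := T) hec ?_ ?_ (fun x _ => by simp)
  · have h0 := hgr t ht
    rw [gronwallBound_ε0_δ0] at h0
    have hv0 : n2 (v t) = 0 := by
      have := sq_nonneg (n2 (b t))
      exact pow_eq_zero_iff (two_ne_zero) |>.1 (le_antisymm (by simp only [he] at h0; linarith)
        (sq_nonneg _))
    have hb0 : n2 (b t) = 0 := by
      have := sq_nonneg (n2 (v t))
      exact pow_eq_zero_iff (two_ne_zero) |>.1 (le_antisymm (by simp only [he] at h0; linarith)
        (sq_nonneg _))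
    have hz : ∀ {w : E3 → E3}, Continuous w → MemLp w 2 volume → n2 w = 0 → ∀ x, w x = 0 := by
      intro w hwc hwm hw0 x
      rw [n2, ENNReal.toReal_eq_zero_iff, or_iff_left hwm.2.ne,
        eLpNorm_eq_zero_iff hwm.1 (by norm_num)] at hw0
      exact congrFun ((Continuous.ae_eq_iff_eq volume hwc continuous_const).1 hw0) x
    constructor
    · funext x
      exact sub_eq_zero.1 (hz (hvN.continuous ht) (hvN.memLp ht) hv0 x)
    · funext x
      exact sub_eq_zero.1 (hz (hbN.continuous ht) (hbN.memLp ht) hb0 x)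
  · intro s hs r hr
    have hsI : s ∈ Icc 0 T := Ico_subset_Icc_self hs
    refine Eventually.frequently ?_
    -- the right difference quotients of `e` at `s` are eventually less than any `r > 2 C e(s)`
    -- choose the size of the time step
    set L := 3 * K₁ + 3 * K₂ + 2 * C * (2 * K₃ + 2 * K₄) + 1 with hL
    have hLpos : 0 < L := by positivity
    set ε := (r - 2 * C * e s) / (2 * L) with hε
    have hεpos : 0 < ε := div_pos (by linarith) (by positivity)
    have hclose : ∀ᶠ τ in 𝓝[Icc 0 T] s, n2 (v τ - v s) < ε ∧ n2 (b τ - b s) < ε :=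
      ((hvN.tendsto_n2 hsI).eventually_lt_const hεpos).and
        ((hbN.tendsto_n2 hsI).eventually_lt_const hεpos)
    obtain ⟨δ, hδ, hball⟩ := Metric.mem_nhdsWithin_iff.1 hclose
    filter_upwards [Ioo_mem_nhdsGT (show s < min (s + δ) T by
      exact lt_min (by linarith) hs.2)] with z hz
    have hsz : s < z := hz.1
    have hzT : z ≤ T := (hz.2.trans_le (min_le_right _ _)).le
    have hzI : z ∈ Icc 0 T := ⟨hs.1.trans hsz.le, hzT⟩
    have hin : ∀ τ ∈ Icc s z, n2 (v τ - v s) < ε ∧ n2 (b τ - b s) < ε := by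
      intro τ hτ
      refine hball ⟨?_, hs.1.trans hτ.1, hτ.2.trans hzT⟩
      rw [Metric.mem_ball, Real.dist_eq, abs_of_nonneg (by linarith [hτ.1])]
      linarith [hτ.2, hz.2.trans_le (min_le_left _ _)]
    obtain ⟨i1, e1⟩ := n2_sq_sub hvN.bddL2 hNb hs.1 hsz.le hzT (hov s z hs.1 hsz.le hzT)
    obtain ⟨i2, e2⟩ := n2_sq_sub hbN.bddL2 hMb hs.1 hsz.le hzT (hob s z hs.1 hsz.le hzT)
    -- `e` is compared with its increments, since the time derivative of `v`, which contains the
    -- pressure gradient, is not known to be in `L²`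
    have hez : e z - e s = ∫ τ in s..z, ((∫ x, inner ℝ (v z x + v s x) (N τ x)) +
        ∫ x, inner ℝ (b z x + b s x) (M τ x)) := by
      rw [intervalIntegral.integral_add i1 i2, ← e1, ← e2]; simp only [he]; ring
    -- replace the endpoint values by the values at time `τ`; the error is of order `ε`
    have hpair : ∀ (w P : ℝ → E3 → E3) (K : ℝ), BddL2 T w → BddL2 T P →
        (∀ t ∈ Icc 0 T, n2 (P t) ≤ K) → 0 ≤ K → (∀ τ ∈ Icc s z, n2 (w τ - w s) < ε) →
        ∀ τ ∈ Icc s z, ∫ x, inner ℝ (w z x + w s x) (P τ x) ≤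
          2 * (∫ x, inner ℝ (w τ x) (P τ x)) + 3 * ε * K := by
      intro w P K hw hP hK hK0 hwε τ hτ
      have hτI : τ ∈ Icc 0 T := ⟨hs.1.trans hτ.1, hτ.2.trans hzT⟩
      have m1 := (hw.at_time hzI).memLp
      have m2 := (hw.at_time hsI).memLp
      have m3 := (hw.at_time hτI).memLp
      have mP := (hP.at_time hτI).memLp
      have hsplit : ∀ x, inner ℝ (w z x + w s x) (P τ x) = 2 * inner ℝ (w τ x) (P τ x) +
          inner ℝ (((w z - w s) + ((w s - w τ) + (w s - w τ))) x) (P τ x) := by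
        intro x
        simp only [Pi.add_apply, Pi.sub_apply, inner_add_left, inner_sub_left]; ring
      have mr : MemLp ((w z - w s) + ((w s - w τ) + (w s - w τ))) 2 volume :=
        (m1.sub m2).add ((m2.sub m3).add (m2.sub m3))
      simp_rw [hsplit]
      rw [integral_add ((integrable_inner m3 mP).const_mul 2) (integrable_inner mr mP),
        integral_const_mul]
      have q1 := (le_abs_self _).trans (integral_inner_le mr mP)
      have q2 : n2 ((w z - w s) + ((w s - w τ) + (w s - w τ))) ≤ 3 * ε := by
        have r1 := n2_add_le (m1.sub m2) ((m2.sub m3).add (m2.sub m3))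
        have r2 := n2_add_le (m2.sub m3) (m2.sub m3)
        have r3 := hwε z ⟨hsz.le, le_rfl⟩
        have r4 := hwε τ hτ
        rw [n2_sub_comm] at r4
        linarith
      have q3 : n2 ((w z - w s) + ((w s - w τ) + (w s - w τ))) * n2 (P τ) ≤ 3 * ε * K :=
        mul_le_mul q2 (hK τ hτI) (n2_nonneg _) (by positivity)
      simp only [n2] at q3
      linarith
    have hptw : ∀ τ ∈ Icc s z, (∫ x, inner ℝ (v z x + v s x) (N τ x)) +
        (∫ x, inner ℝ (b z x + b s x) (M τ x)) ≤ 2 * C * e s + ε * L := by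
      intro τ hτ
      have hτI : τ ∈ Icc 0 T := ⟨hs.1.trans hτ.1, hτ.2.trans hzT⟩
      have p1 := hpair v N K₁ hvN.bddL2 hNb c₁ hK₁ (fun τ hτ => (hin τ hτ).1) τ hτ
      have p2 := hpair b M K₂ hbN.bddL2 hMb c₂ hK₂ (fun τ hτ => (hin τ hτ).2) τ hτ
      have p3 : (∫ x, inner ℝ (v τ x) (N τ x)) + (∫ x, inner ℝ (b τ x) (M τ x)) ≤ C * e τ :=
        hen τ hτI
      have hsq : ∀ (w : ℝ → E3 → E3) (K : ℝ), BddL2 T w → (∀ t ∈ Icc 0 T, n2 (w t) ≤ K) →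
          n2 (w τ - w s) < ε → n2 (w τ) ^ 2 ≤ n2 (w s) ^ 2 + 2 * K * ε := by
        intro w K hw hK hwε
        have m2 := (hw.at_time hsI).memLp
        have m3 := (hw.at_time hτI).memLp
        have r1 := n2_add_le m2 (m3.sub m2)
        rw [add_sub_cancel] at r1
        have r2 := hK τ hτI
        have r3 := hK s hsI
        have r4 := n2_nonneg (w τ)
        have r5 := n2_nonneg (w s)
        nlinarith
      have p4 := hsq v K₃ hvN.bddL2 c₃ (hin τ hτ).1
      have p5 := hsq b K₄ hbN.bddL2 c₄ (hin τ hτ).2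
      have p6 : e τ ≤ e s + (2 * K₃ + 2 * K₄) * ε := by simp only [he]; linarith
      have p7 := mul_le_mul_of_nonneg_left p6 hC
      rw [hL]
      nlinarith
    have hle : e z - e s ≤ (z - s) * (2 * C * e s + ε * L) := by
      rw [hez]
      have := intervalIntegral.integral_mono_on hsz.le (i1.add i2)
        (intervalIntegrable_const (c := 2 * C * e s + ε * L)) hptw
      rwa [intervalIntegral.integral_const, smul_eq_mul] at this
    have hlt : 2 * C * e s + ε * L < r := by
      have : ε * L = (r - 2 * C * e s) / 2 := by rw [hε]; field_simp
      rw [this]; linarith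
    have hzs : 0 < z - s := by linarith
    calc (z - s)⁻¹ * (e z - e s) ≤ (z - s)⁻¹ * ((z - s) * (2 * C * e s + ε * L)) := by gcongr
      _ = 2 * C * e s + ε * L := by field_simp
      _ < r := hlt
  · simp only [he, hv, hb, hu0, hB0]
    simp [n2]

/-! ### Reflections in planes through the axis -/

/-- The reflection in a plane through the axis (when `p² + q² = 1`), as a linear map. -/
def reflL (p q : ℝ) : E3 →ₗ[ℝ] E3 where
  toFun x := !₂[p * x 0 + q * x 1, q * x 0 - p * x 1, x 2]
  map_add' x y := by ext j; fin_cases j <;> simp <;> ring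
  map_smul' c x := by ext j; fin_cases j <;> simp <;> ring

theorem reflL_zero (p q : ℝ) (x : E3) : reflL p q x 0 = p * x 0 + q * x 1 := rfl
theorem reflL_one (p q : ℝ) (x : E3) : reflL p q x 1 = q * x 0 - p * x 1 := rfl
theorem reflL_two (p q : ℝ) (x : E3) : reflL p q x 2 = x 2 := rfl

theorem reflL_reflL {p q : ℝ} (h : p ^ 2 + q ^ 2 = 1) (x : E3) : reflL p q (reflL p q x) = x := by
  ext j
  fin_cases j
  · change p * (p * x 0 + q * x 1) + q * (q * x 0 - p * x 1) = x 0
    linear_combination x 0 * h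
  · change q * (p * x 0 + q * x 1) - p * (q * x 0 - p * x 1) = x 1
    linear_combination x 1 * h
  · rfl

/-- The reflection in a plane through the axis. -/
def refl {p q : ℝ} (h : p ^ 2 + q ^ 2 = 1) : E3 ≃ₗᵢ[ℝ] E3 where
  toLinearEquiv := LinearEquiv.ofInvolutive (reflL p q) (reflL_reflL h)
  norm_map' x := by
    change ‖reflL p q x‖ = ‖x‖
    rw [← sq_eq_sq₀ (norm_nonneg _) (norm_nonneg _), EuclideanSpace.norm_sq_eq,
      EuclideanSpace.norm_sq_eq]
    simp only [Fin.sum_univ_three, Real.norm_eq_abs, sq_abs]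
    rw [reflL_zero, reflL_one, reflL_two]
    linear_combination (x 0 ^ 2 + x 1 ^ 2) * h

section
variable {p q : ℝ} (h : p ^ 2 + q ^ 2 = 1)

theorem refl_zero (x : E3) : refl h x 0 = p * x 0 + q * x 1 := rfl
theorem refl_one (x : E3) : refl h x 1 = q * x 0 - p * x 1 := rfl
theorem refl_two (x : E3) : refl h x 2 = x 2 := rfl
theorem refl_refl (x : E3) : refl h (refl h x) = x := reflL_reflL h x

/-- The reflected vector field. -/
def reflField (v : E3 → E3) (x : E3) : E3 := refl h (v (refl h x))

theorem fderiv_reflField {v : E3 → E3} (hv : Differentiable ℝ v) (x w : E3) :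
    fderiv ℝ (reflField h v) x w = refl h (fderiv ℝ v (refl h x) (refl h w)) := by
  have h1 : HasFDerivAt (reflField h v)
      (((refl h).toContinuousLinearEquiv : E3 →L[ℝ] E3).comp ((fderiv ℝ v (refl h x)).comp
        ((refl h).toContinuousLinearEquiv : E3 →L[ℝ] E3))) x := by
    have := ((hv (refl h x)).hasFDerivAt).comp x
      ((refl h).toContinuousLinearEquiv : E3 →L[ℝ] E3).hasFDerivAt
    exact ((refl h).toContinuousLinearEquiv : E3 →L[ℝ] E3).hasFDerivAt.comp x this
  rw [h1.fderiv]; rfl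

theorem contDiff_reflField {v : E3 → E3} {n : WithTop ℕ∞} (hv : ContDiff ℝ n v) :
    ContDiff ℝ n (reflField h v) :=
  (refl h).contDiff.comp (hv.comp (refl h).contDiff)

theorem pdv_reflField {v : E3 → E3} (hv : Differentiable ℝ v) (i : Fin 3) (x : E3) :
    pdv i (reflField h v) x =
      ∑ k, (refl h (EuclideanSpace.single i 1) k) • reflField h (pdv k v) x := by
  rw [pdv, fderiv_reflField h hv, fderiv_eq_sum_pdv, map_sum]
  exact Finset.sum_congr rfl fun k _ => by rw [map_smul]; rfl

/-- Reflections reverse the orientation, so the curl of a reflected field is the reflected curl with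
the opposite sign. -/
theorem curl_reflField {v : E3 → E3} (hv : Differentiable ℝ v) (x : E3) :
    curl (reflField h v) x = - refl h (curl v (refl h x)) := by
  ext j
  fin_cases j <;>
  simp only [Fin.zero_eta, Fin.mk_one, Fin.reduceFinMk, PiLp.neg_apply, refl_zero, refl_one,
    refl_two, curl_zero_apply, curl_one_apply, curl_two_apply, pd_eq_pdv, pdv_reflField h hv,
    Fin.sum_univ_three, PiLp.add_apply, PiLp.smul_apply, reflField, smul_eq_mul] <;>
  simp
  · ring
  · ring
  · linear_combination (pdv 1 v (refl h x) 0 - pdv 0 v (refl h x) 1) * h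

theorem divergence_reflField {v : E3 → E3} (hv : Differentiable ℝ v) (x : E3) :
    divergence (reflField h v) x = divergence v (refl h x) := by
  simp only [divergence, refl_zero, refl_one,
    refl_two, pd_eq_pdv, pdv_reflField h hv,
    Fin.sum_univ_three, PiLp.add_apply, PiLp.smul_apply, reflField, smul_eq_mul]
  simp
  linear_combination (pdv 0 v (refl h x) 0 + pdv 1 v (refl h x) 1) * h

theorem cross_refl (a b : E3) : cross (refl h a) (refl h b) = - refl h (cross a b) := by
  ext j
  fin_cases j <;>
  simp only [Fin.zero_eta, Fin.mk_one, Fin.reduceFinMk, PiLp.neg_apply, refl_zero, refl_one,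
    refl_two, cross_zero_apply, cross_one_apply, cross_two_apply]
  · ring
  · ring
  · linear_combination (a 1 * b 0 - a 0 * b 1) * h

theorem Nice.reflField {T : ℝ} {g : ℝ → E3 → E3} (hg : Nice T g) :
    Nice T (fun t => reflField h (g t)) :=
  hg.clm_comp ((refl h).toContinuousLinearEquiv : E3 →L[ℝ] E3) (refl h)

theorem Nice.const_smul {T : ℝ} {g : ℝ → E3 → E3} (hg : Nice T g) (c : ℝ) :
    Nice T (fun t x => c • g t x) :=
  hg.clm (c • ContinuousLinearMap.id ℝ E3)

theorem Nice.sum_three {T : ℝ} {g : Fin 3 → ℝ → E3 → E3} (hg : ∀ i, Nice T (g i)) :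
    Nice T (fun t x => ∑ i, g i t x) := by
  simp only [Fin.sum_univ_three]
  exact ((hg 0).add (hg 1)).add (hg 2)

theorem Nice2.reflField {T : ℝ} {v : ℝ → E3 → E3} (hv : Nice2 T v) :
    Nice2 T (fun t => reflField h (v t)) := by
  have hd : ∀ t ∈ Icc 0 T, Differentiable ℝ (v t) := fun t ht =>
    (hv.c2 t ht).differentiable (by norm_num)
  have hd' : ∀ t ∈ Icc 0 T, ∀ k, Differentiable ℝ (pdv k (v t)) := fun t ht k =>
    (contDiff_pdv (n := 1) (m := 2) (hv.c2 t ht) (by norm_num) k).differentiable (by norm_num)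
  refine ⟨fun t ht => contDiff_reflField h (hv.c2 t ht), hv.zero.reflField h, fun i => ?_,
    fun i k => ?_⟩
  · exact (Nice.sum_three fun k => ((hv.one k).reflField h).const_smul _).congr
      fun t ht x => pdv_reflField h (hd t ht) i x
  · refine (Nice.sum_three fun l => (Nice.sum_three fun j =>
      ((hv.two j l).reflField h).const_smul (refl h (EuclideanSpace.single i 1) j)).const_smul
        (refl h (EuclideanSpace.single k 1) l)).congr fun t ht x => ?_
    have e : pdv k (HallMHD.reflField h (v t)) = fun x =>
        ∑ l, (refl h (EuclideanSpace.single k 1) l) • HallMHD.reflField h (pdv l (v t)) x :=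
      funext fun x => pdv_reflField h (hd t ht) k x
    have hdr : ∀ l, Differentiable ℝ (HallMHD.reflField h (pdv l (v t))) := fun l =>
      (refl h).differentiable.comp ((hd' t ht l).comp (refl h).differentiable)
    have hs := HasFDerivAt.fun_sum (u := Finset.univ) fun l _ =>
      ((hdr l x).hasFDerivAt.fun_const_smul (refl h (EuclideanSpace.single k 1) l))
    rw [e, pdv, hs.fderiv, sum_apply]
    refine Finset.sum_congr rfl fun l _ => ?_
    rw [smul_apply, ← pdv_reflField h (hd' t ht l)]
    rfl

theorem Nice2.neg {T : ℝ} {v : ℝ → E3 → E3} (hv : Nice2 T v) : Nice2 T (fun t x => - v t x) := by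
  have e : ∀ (w : E3 → E3) i, pdv i (fun x => - w x) = fun x => - pdv i w x := by
    intro w i; funext x; rw [pdv, fderiv_fun_neg]; rfl
  refine ⟨fun t ht => (hv.c2 t ht).neg, hv.zero.neg, fun i => ?_, fun i k => ?_⟩
  · simp only [e]; exact (hv.one i).neg
  · simp only [e]; exact (hv.two i k).neg

theorem gradient_comp_refl {f : E3 → ℝ} (hf : Differentiable ℝ f) (x : E3) :
    gradient (fun y => f (refl h y)) x = refl h (gradient f (refl h x)) := by
  have h1 := ((hf (refl h x)).hasGradientAt).hasFDerivAt.comp x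
    ((refl h).toContinuousLinearEquiv : E3 →L[ℝ] E3).hasFDerivAt
  refine HasGradientAt.gradient ?_
  rw [hasGradientAt_iff_hasFDerivAt]
  have e : (InnerProductSpace.toDual ℝ E3) (refl h (gradient f (refl h x))) =
      ((InnerProductSpace.toDual ℝ E3) (gradient f (refl h x))).comp
        ((refl h).toContinuousLinearEquiv : E3 →L[ℝ] E3) := by
    ext w
    change inner ℝ (refl h (gradient f (refl h x))) w = inner ℝ (gradient f (refl h x)) (refl h w)
    rw [← (refl h).inner_map_map, refl_refl]
  rw [e]; exact h1

theorem curl_neg (v : E3 → E3) (x : E3) : curl (fun y => - v y) x = - curl v x := by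
  ext j
  fin_cases j <;>
  simp [curl_zero_apply, curl_one_apply, curl_two_apply, pd] <;> ring

theorem divergence_neg (v : E3 → E3) (x : E3) : divergence (fun y => - v y) x = - divergence v x := by
  simp [divergence, pd]

theorem cross_neg_right (a b : E3) : cross a (-b) = - cross a b := by
  ext j
  fin_cases j <;> simp [cross_zero_apply, cross_one_apply, cross_two_apply] <;> ring

/-- The system is invariant under reflections: `u` is reflected as a vector field, `B` as a
pseudovector field. -/
theorem RegSol.reflect {T : ℝ} {u B ut Bt : ℝ → E3 → E3} (hs : RegSol T u B ut Bt) :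
    RegSol T (fun t => reflField h (u t)) (fun t x => - reflField h (B t) x)
      (fun t => reflField h (ut t)) (fun t x => - reflField h (Bt t) x) := by
  have hdu : ∀ t ∈ Icc 0 T, Differentiable ℝ (u t) := hs.u2.bddW1.diff
  have hdB : ∀ t ∈ Icc 0 T, Differentiable ℝ (B t) := hs.B2.bddW1.diff
  have hcB : ∀ t ∈ Icc 0 T, ∀ x, curl (fun x => - reflField h (B t) x) x =
      refl h (curl (B t) (refl h x)) := fun t ht x => by
    rw [curl_neg, curl_reflField h (hdB t ht), neg_neg]
  have hcl : ∀ {f : E3 → E3} {f' : E3} {t : ℝ} {g : ℝ → E3}, HasDerivWithinAt g f' (Icc 0 T) t →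
      HasDerivWithinAt (fun s => refl h (g s)) (refl h f') (Icc 0 T) t := fun {f f' t g} hg =>
    ((refl h).toContinuousLinearEquiv : E3 →L[ℝ] E3).hasFDerivAt.comp_hasDerivWithinAt t hg
  refine ⟨hs.u2.reflField h, (hs.B2.reflField h).neg, ?_, fun t ht x => ?_, fun t ht x => ?_,
    fun t ht => ?_, fun t ht x => ?_, fun t ht x => ?_, fun t ht x => ?_⟩
  · refine (refl h).continuous.comp_continuousOn
      (hs.ut_cont.comp (f := fun q : ℝ × E3 => (q.1, refl h q.2)) ?_ ?_)
    · fun_prop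
    · intro q hq; exact ⟨hq.1, mem_univ _⟩
  · exact hcl (f := u t) (hs.du t ht _)
  · exact (hcl (f := u t) (hs.dB t ht _)).neg
  · obtain ⟨P, hP, hP'⟩ := hs.momentum t ht
    refine ⟨fun x => P (refl h x), hP.comp (refl h).contDiff, fun x => ?_⟩
    rw [gradient_comp_refl h (hP.differentiable (by norm_num)), hP', force, force, hcB t ht,
      fderiv_reflField h (hdu t ht), cross_neg_right]
    simp only [reflField]
    rw [refl_refl, cross_refl, neg_neg, map_sub, map_sub]
  · have e : emf (reflField h (u t)) (fun x => - reflField h (B t) x) =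
        reflField h (emf (u t) (B t)) := by
      funext x
      rw [emf, hcB t ht, cross_neg_right, cross_neg_right]
      simp only [reflField]
      rw [cross_refl, cross_refl, neg_neg, neg_neg, emf, map_sub]
    rw [e, curl_reflField h ((BddW1.emf hs.u2 hs.B2).diff t ht), ← hs.induction t ht]
    rfl
  · rw [divergence_reflField h (hdu t ht)]; exact hs.div_u t ht _
  · rw [divergence_neg, divergence_reflField h (hdB t ht), hs.div_B t ht, neg_zero]

end

/-! ### Fields with reflection symmetry -/

/-- Vector fields invariant under the reflections in all planes through the axis. -/
def ReflEven (v : E3 → E3) : Prop :=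
  ∀ p q : ℝ, p ^ 2 + q ^ 2 = 1 → ∀ x, v (reflL p q x) = reflL p q (v x)

/-- Vector fields which change sign under the reflections in all planes through the axis. -/
def ReflOdd (v : E3 → E3) : Prop :=
  ∀ p q : ℝ, p ^ 2 + q ^ 2 = 1 → ∀ x, v (reflL p q x) = - reflL p q (v x)

theorem rad_reflL {p q : ℝ} (h : p ^ 2 + q ^ 2 = 1) (x : E3) : rad (reflL p q x) = rad x := by
  rw [rad, rad, reflL_zero, reflL_one]
  congr 1
  linear_combination (x 0 ^ 2 + x 1 ^ 2) * h

theorem IsAxisymmetricNoSwirl.reflEven {v : E3 → E3} (hv : IsAxisymmetricNoSwirl v) :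
    ReflEven v := by
  obtain ⟨vr, vz, hv⟩ := hv
  intro p q h x
  rw [hv, hv x, rad_reflL h, reflL_two, map_add, map_smul, map_smul]
  congr 2
  · ext j
    fin_cases j <;> simp [eR, rad_reflL h, reflL_zero, reflL_one, reflL_two] <;> ring
  · ext j
    fin_cases j <;> simp [eZ, reflL_zero, reflL_one, reflL_two]

theorem IsAxisymmetricSwirl.reflOdd {v : E3 → E3} (hv : IsAxisymmetricSwirl v) :
    ReflOdd v := by
  obtain ⟨w, hv⟩ := hv
  intro p q h x
  rw [hv, hv x, rad_reflL h, reflL_two, map_smul, ← smul_neg]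
  congr 1
  ext j
  fin_cases j <;> simp [eTheta, rad_reflL h, reflL_zero, reflL_one, reflL_two] <;> ring

theorem ReflEven.curl {v : E3 → E3} (hv : ReflEven v) (hd : Differentiable ℝ v) :
    ReflOdd (curl v) := by
  intro p q h x
  have e : reflField h v = v := funext fun y => by
    change reflL p q (v (reflL p q y)) = v y
    rw [hv p q h, reflL_reflL h]
  have := curl_reflField h hd (refl h x)
  rw [e, refl_refl] at this
  exact this

theorem ReflOdd.curl {v : E3 → E3} (hv : ReflOdd v) (hd : Differentiable ℝ v) :
    ReflEven (curl v) := by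
  intro p q h x
  have e : reflField h v = fun y => - v y := funext fun y => by
    change reflL p q (v (reflL p q y)) = - v y
    rw [hv p q h, map_neg, reflL_reflL h]
  have := curl_reflField h hd (refl h x)
  rw [e, refl_refl, curl_neg, neg_inj] at this
  exact this

/-- For initial data of the form `u = u_r e_r + u_z e_z`, `B = b_θ e_θ`, the solution has the same
symmetry, since the reflected solution has the same initial data. -/
theorem RegSol.symm {T : ℝ} {u B ut Bt : ℝ → E3 → E3} (hs : RegSol T u B ut Bt)
    (hu : ReflEven (u 0)) (hB : ReflOdd (B 0)) {t : ℝ} (ht : t ∈ Icc 0 T) :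
    ReflEven (u t) ∧ ReflOdd (B t) := by
  have key : ∀ p q : ℝ, ∀ h : p ^ 2 + q ^ 2 = 1, u t = reflField h (u t) ∧
      B t = fun x => - reflField h (B t) x := by
    intro p q h
    refine hs.unique (hs.reflect h) ?_ ?_ ht
    · funext x
      change u 0 x = reflL p q (u 0 (reflL p q x))
      rw [hu p q h, reflL_reflL h]
    · funext x
      change B 0 x = - reflL p q (B 0 (reflL p q x))
      rw [hB p q h, map_neg, reflL_reflL h, neg_neg]
  refine ⟨fun p q h x => ?_, fun p q h x => ?_⟩
  · have := congrFun (key p q h).1 (reflL p q x)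
    rw [this]
    change reflL p q (u t (reflL p q (reflL p q x))) = _
    rw [reflL_reflL h]
  · have := congrFun (key p q h).2 (reflL p q x)
    rw [this]
    change - reflL p q (B t (reflL p q (reflL p q x))) = _
    rw [reflL_reflL h]

theorem rad_sq (x : E3) : rad x ^ 2 = x 0 ^ 2 + x 1 ^ 2 := Real.sq_sqrt (by positivity)

theorem rad_eq_zero {x : E3} : rad x = 0 ↔ x 0 = 0 ∧ x 1 = 0 := by
  rw [rad, Real.sqrt_eq_zero (by positivity)]
  constructor
  · intro h
    exact ⟨by nlinarith [sq_nonneg (x 0), sq_nonneg (x 1)],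
      by nlinarith [sq_nonneg (x 0), sq_nonneg (x 1)]⟩
  · rintro ⟨h1, h2⟩; simp [h1, h2]

/-- Every point is fixed by a reflection; `p = cos 2θ`, `q = sin 2θ`. -/
theorem exists_reflL_fixed (x : E3) (hx : x 0 ^ 2 + x 1 ^ 2 ≠ 0) :
    ((x 0 ^ 2 - x 1 ^ 2) / (x 0 ^ 2 + x 1 ^ 2)) ^ 2 +
      (2 * x 0 * x 1 / (x 0 ^ 2 + x 1 ^ 2)) ^ 2 = 1 ∧
    reflL ((x 0 ^ 2 - x 1 ^ 2) / (x 0 ^ 2 + x 1 ^ 2)) (2 * x 0 * x 1 / (x 0 ^ 2 + x 1 ^ 2)) x = x := by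
  constructor
  · field_simp; ring
  · ext j
    fin_cases j
    · simp only [Fin.zero_eta, reflL_zero]; field_simp; ring
    · simp only [Fin.mk_one, reflL_one]; field_simp; ring
    · rfl

theorem reflL_of_axis {p q : ℝ} {x : E3} (h0 : x 0 = 0) (h1 : x 1 = 0) : reflL p q x = x := by
  ext j
  fin_cases j
  · simp [reflL_zero, h0, h1]
  · simp [reflL_one, h0, h1]
  · rfl

theorem ReflEven.axis_zero {v : E3 → E3} (hv : ReflEven v) {x : E3} (h0 : x 0 = 0) (h1 : x 1 = 0) :
    v x 0 = 0 ∧ v x 1 = 0 := by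
  have a := hv 1 0 (by norm_num) x
  have b := hv (-1) 0 (by norm_num) x
  rw [reflL_of_axis h0 h1] at a b
  have a1 := congrArg (fun y : E3 => y 1) a
  have b0 := congrArg (fun y : E3 => y 0) b
  simp only [reflL_one, reflL_zero] at a1 b0
  constructor <;> linarith

/-- At every point `v` is tangent to the meridian plane, which is fixed by a reflection. -/
theorem ReflEven.swirl_eq_zero {v : E3 → E3} (hv : ReflEven v) (x : E3) :
    x 0 * v x 1 - x 1 * v x 0 = 0 := by
  by_cases hx : x 0 ^ 2 + x 1 ^ 2 = 0
  · have h0 : x 0 = 0 := by nlinarith [sq_nonneg (x 0), sq_nonneg (x 1)]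
    have h1 : x 1 = 0 := by nlinarith [sq_nonneg (x 0), sq_nonneg (x 1)]
    simp [h0, h1]
  · obtain ⟨h1, h2⟩ := exists_reflL_fixed x hx
    have h3 := hv _ _ h1 x
    rw [h2] at h3
    have e0 := congrArg (fun y : E3 => y 0) h3
    have e1 := congrArg (fun y : E3 => y 1) h3
    simp only [reflL_zero, reflL_one] at e0 e1
    field_simp at e0 e1
    have : (x 0 ^ 2 + x 1 ^ 2) * (x 0 * v x 1 - x 1 * v x 0) = 0 := by
      linear_combination (x 0 * e1 - x 1 * e0) / 2
    exact (mul_eq_zero.1 this).resolve_left hx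

/-- At every point `v` is normal to the meridian plane, which is fixed by a reflection; the same
argument gives `v₂ = 0`. -/
theorem ReflOdd.radial_eq_zero {v : E3 → E3} (hv : ReflOdd v) (x : E3) :
    x 0 * v x 0 + x 1 * v x 1 = 0 := by
  by_cases hx : x 0 ^ 2 + x 1 ^ 2 = 0
  · have h0 : x 0 = 0 := by nlinarith [sq_nonneg (x 0), sq_nonneg (x 1)]
    have h1 : x 1 = 0 := by nlinarith [sq_nonneg (x 0), sq_nonneg (x 1)]
    simp [h0, h1]
  · obtain ⟨h1, h2⟩ := exists_reflL_fixed x hx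
    have h3 := hv _ _ h1 x
    rw [h2] at h3
    have e0 := congrArg (fun y : E3 => y 0) h3
    have e1 := congrArg (fun y : E3 => y 1) h3
    simp only [reflL_zero, reflL_one, PiLp.neg_apply] at e0 e1
    field_simp at e0 e1
    have : (x 0 ^ 2 + x 1 ^ 2) * (x 0 * v x 0 + x 1 * v x 1) = 0 := by
      linear_combination (x 0 * e0 + x 1 * e1) / 2
    exact (mul_eq_zero.1 this).resolve_left hx

theorem ReflOdd.axis_zero {v : E3 → E3} (hv : ReflOdd v) {x : E3} (h0 : x 0 = 0) (h1 : x 1 = 0) :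
    v x 0 = 0 ∧ v x 1 = 0 := by
  have a := hv 1 0 (by norm_num) x
  have b := hv (-1) 0 (by norm_num) x
  rw [reflL_of_axis h0 h1] at a b
  have a0 := congrArg (fun y : E3 => y 0) a
  have b1 := congrArg (fun y : E3 => y 1) b
  simp only [reflL_one, reflL_zero, PiLp.neg_apply] at a0 b1
  constructor <;> linarith

theorem ReflOdd.vertical_eq_zero {v : E3 → E3} (hv : ReflOdd v) (x : E3) : v x 2 = 0 := by
  by_cases hx : x 0 ^ 2 + x 1 ^ 2 = 0
  · have h0 : x 0 = 0 := by nlinarith [sq_nonneg (x 0), sq_nonneg (x 1)]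
    have h1 : x 1 = 0 := by nlinarith [sq_nonneg (x 0), sq_nonneg (x 1)]
    have a := hv 1 0 (by norm_num) x
    rw [reflL_of_axis h0 h1] at a
    have a2 := congrArg (fun y : E3 => y 2) a
    simp only [reflL_two, PiLp.neg_apply] at a2
    linarith
  · obtain ⟨h1, h2⟩ := exists_reflL_fixed x hx
    have h3 := hv _ _ h1 x
    rw [h2] at h3
    have a2 := congrArg (fun y : E3 => y 2) h3
    simp only [reflL_two, PiLp.neg_apply] at a2
    linarith

/-- A reflection maps every point to the half-plane `θ = 0`. -/
theorem exists_reflL_meridian (x : E3) (hx : rad x ≠ 0) :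
    (x 0 / rad x) ^ 2 + (x 1 / rad x) ^ 2 = 1 ∧
      reflL (x 0 / rad x) (x 1 / rad x) (meridian (rad x) (x 2)) = x := by
  constructor
  · have := rad_sq x
    field_simp; exact this.symm
  · ext j
    fin_cases j
    · simp [reflL_zero, meridian]; field_simp
    · simp [reflL_one, meridian]; field_simp
    · rfl

theorem meridian_of_rad_eq_zero {x : E3} (hx : rad x = 0) : meridian (rad x) (x 2) = x := by
  obtain ⟨h0, h1⟩ := rad_eq_zero.1 hx
  ext j
  fin_cases j <;> simp [meridian, h0, h1, hx]

theorem ReflEven.isAxisymmetricNoSwirl {v : E3 → E3} (hv : ReflEven v) :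
    IsAxisymmetricNoSwirl v := by
  refine ⟨compR v, compZ v, fun x => ?_⟩
  by_cases hx : rad x = 0
  · obtain ⟨h0, h1⟩ := rad_eq_zero.1 hx
    obtain ⟨k0, k1⟩ := hv.axis_zero h0 h1
    rw [compZ, compR, meridian_of_rad_eq_zero hx]
    ext j
    fin_cases j <;> simp [eR, eZ, hx, k0, k1]
  · obtain ⟨h1, h2⟩ := exists_reflL_meridian x hx
    have h3 := hv _ _ h1 (meridian (rad x) (x 2))
    have h4 := hv.swirl_eq_zero (meridian (rad x) (x 2))
    have h5 : v (meridian (rad x) (x 2)) 1 = 0 := by simpa [meridian, hx] using h4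
    rw [h2] at h3
    rw [h3]
    ext j
    fin_cases j
    · simp [reflL_zero, eR, eZ, compR, h5]; ring
    · simp [reflL_one, eR, eZ, compR, h5]; ring
    · simp [reflL_two, eR, eZ, compZ]

theorem ReflOdd.isAxisymmetricSwirl {v : E3 → E3} (hv : ReflOdd v) :
    IsAxisymmetricSwirl v := by
  refine ⟨compTheta v, fun x => ?_⟩
  by_cases hx : rad x = 0
  · obtain ⟨h0, h1⟩ := rad_eq_zero.1 hx
    obtain ⟨k0, k1⟩ := hv.axis_zero h0 h1
    have k2 := hv.vertical_eq_zero x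
    ext j
    fin_cases j <;> simp [eTheta, hx, k0, k1, k2]
  · obtain ⟨h1, h2⟩ := exists_reflL_meridian x hx
    have h3 := hv _ _ h1 (meridian (rad x) (x 2))
    have h4 := hv.radial_eq_zero (meridian (rad x) (x 2))
    have h5 : v (meridian (rad x) (x 2)) 0 = 0 := by simpa [meridian, hx] using h4
    have h6 := hv.vertical_eq_zero (meridian (rad x) (x 2))
    rw [h2] at h3
    rw [h3]
    ext j
    fin_cases j
    · simp [reflL_zero, eTheta, compTheta, h5]; ring
    · simp [reflL_one, eTheta, compTheta, h5]; ring
    · simp [reflL_two, eTheta, h6]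

/-- The generator `(-x₁, x₀, 0)` of the rotations around the axis. -/
def rotGen (x : E3) : E3 := !₂[-(x 1), x 0, 0]

/-- Fields commuting with rotations commute with their generator. -/
theorem fderiv_rotGen_of_rot {v : E3 → E3} (hd : Differentiable ℝ v)
    (hv : ∀ c s : ℝ, c ^ 2 + s ^ 2 = 1 → ∀ x,
      v (reflL c s (reflL 1 0 x)) = reflL c s (reflL 1 0 (v x))) (x : E3) :
    fderiv ℝ v x (rotGen x) = rotGen (v x) := by
  -- rotations are products of two reflections
  have hγ : ∀ y : E3, HasDerivAt (fun θ : ℝ => reflL (Real.cos θ) (Real.sin θ) (reflL 1 0 y))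
      (rotGen y) 0 := by
    intro y
    have e : (fun θ : ℝ => reflL (Real.cos θ) (Real.sin θ) (reflL 1 0 y)) = fun θ : ℝ =>
        Real.cos θ • (!₂[y 0, y 1, 0] : E3) + Real.sin θ • rotGen y + (!₂[0, 0, y 2] : E3) := by
      funext θ
      ext j
      fin_cases j
      · simp [reflL_zero, reflL_one, rotGen]
      · simp [reflL_zero, reflL_one, rotGen]; ring
      · simp [reflL_two, rotGen]
    rw [e]
    have := ((((Real.hasDerivAt_cos 0).smul_const (!₂[y 0, y 1, 0] : E3)).add
      ((Real.hasDerivAt_sin 0).smul_const (rotGen y))).add_const (!₂[0, 0, y 2] : E3))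
    simpa using! this
  have h0 : reflL (Real.cos 0) (Real.sin 0) (reflL 1 0 x) = x := by
    rw [Real.cos_zero, Real.sin_zero]; exact reflL_reflL (by norm_num) x
  have h1 : HasDerivAt (fun θ : ℝ => v (reflL (Real.cos θ) (Real.sin θ) (reflL 1 0 x)))
      (fderiv ℝ v x (rotGen x)) 0 := by
    have := (hd (reflL (Real.cos 0) (Real.sin 0) (reflL 1 0 x))).hasFDerivAt.comp_hasDerivAt 0 (hγ x)
    rw [h0] at this
    exact this
  have h2 := hγ (v x)
  have e : (fun θ : ℝ => v (reflL (Real.cos θ) (Real.sin θ) (reflL 1 0 x))) =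
      fun θ : ℝ => reflL (Real.cos θ) (Real.sin θ) (reflL 1 0 (v x)) :=
    funext fun θ => hv _ _ (Real.cos_sq_add_sin_sq θ) x
  rw [e] at h1
  exact h1.unique h2

theorem ReflEven.fderiv_rotGen {v : E3 → E3} (hv : ReflEven v) (hd : Differentiable ℝ v) (x : E3) :
    fderiv ℝ v x (rotGen x) = rotGen (v x) :=
  fderiv_rotGen_of_rot hd (fun c s h x => by rw [hv c s h, hv 1 0 (by norm_num)]) x

theorem ReflOdd.fderiv_rotGen {v : E3 → E3} (hv : ReflOdd v) (hd : Differentiable ℝ v) (x : E3) :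
    fderiv ℝ v x (rotGen x) = rotGen (v x) :=
  fderiv_rotGen_of_rot hd (fun c s h x => by
    rw [hv c s h, hv 1 0 (by norm_num), map_neg, neg_neg]) x

/-! ### Vector identities for axisymmetric fields -/

/-- `∇ × (V × W) = (W·∇)V - (V·∇)W` for divergence free fields. -/
theorem curl_cross {V W : E3 → E3} {x : E3} (hV : DifferentiableAt ℝ V x)
    (hW : DifferentiableAt ℝ W x) (hdV : divergence V x = 0) (hdW : divergence W x = 0) :
    curl (fun y => cross (V y) (W y)) x = fderiv ℝ V x (W x) - fderiv ℝ W x (V x) := by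
  simp only [divergence, pd_eq_pdv, Fin.sum_univ_three] at hdV hdW
  rw [fderiv_eq_sum_pdv, fderiv_eq_sum_pdv]
  ext j
  fin_cases j <;>
  simp only [Fin.zero_eta, Fin.mk_one, Fin.reduceFinMk, curl_zero_apply, curl_one_apply,
    curl_two_apply, pd_eq_pdv, pdv_cross hV hW, PiLp.add_apply, cross_zero_apply, cross_one_apply,
    cross_two_apply, Fin.sum_univ_three, PiLp.sub_apply, PiLp.smul_apply, smul_eq_mul]
  · linear_combination (V x 0) * hdW - W x 0 * hdV
  · linear_combination (V x 1) * hdW - W x 1 * hdV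
  · linear_combination (V x 2) * hdW - W x 2 * hdV

/-- `x₀W₁ - x₁W₀`, that is, `r` times the azimuthal component of `W`. -/
def swirl (W : E3 → E3) (x : E3) : ℝ := x 0 * W x 1 - x 1 * W x 0

/-- `r` times the radial component. -/
def radial (V : E3 → E3) (x : E3) : ℝ := x 0 * V x 0 + x 1 * V x 1

theorem differentiable_swirl {W : E3 → E3} (hW : Differentiable ℝ W) :
    Differentiable ℝ (swirl W) := by
  unfold swirl; fun_prop

theorem sd_swirl {W : E3 → E3} {x : E3} (hW : DifferentiableAt ℝ W x) (i : Fin 3) :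
    sd i (swirl W) x = (if i = 0 then W x 1 else 0) + x 0 * pdv i W x 1
      - (if i = 1 then W x 0 else 0) - x 1 * pdv i W x 0 := by
  unfold swirl
  have h0 : DifferentiableAt ℝ (fun y => W y 0) x := differentiableAt_coord hW 0
  have h1 : DifferentiableAt ℝ (fun y => W y 1) x := differentiableAt_coord hW 1
  simp (disch := fun_prop) only [sd_sub, sd_mul, sd_coord, pdv_apply hW]
  split_ifs <;> ring

theorem ReflOdd.sq_mul_apply {W : E3 → E3} (hW : ReflOdd W) (x : E3) :
    (x 0 ^ 2 + x 1 ^ 2) * W x 0 = - x 1 * swirl W x ∧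
    (x 0 ^ 2 + x 1 ^ 2) * W x 1 = x 0 * swirl W x := by
  have h := hW.radial_eq_zero x
  unfold swirl
  constructor
  · linear_combination x 0 * h
  · linear_combination x 1 * h

/-- The azimuthal component of `∇ × (V × W)` for `V` without swirl and `W` purely azimuthal. -/
theorem swirl_curl_cross {V W : E3 → E3} (hV : ReflEven V) (hW : ReflOdd W)
    (dV : Differentiable ℝ V) (dW : Differentiable ℝ W) {x : E3} (hdV : divergence V x = 0)
    (hdW : divergence W x = 0) :
    (x 0 ^ 2 + x 1 ^ 2) * swirl (curl (fun y => cross (V y) (W y))) x =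
      2 * swirl W x * radial V x
        - (x 0 ^ 2 + x 1 ^ 2) * ∑ i, V x i * sd i (swirl W) x := by
  obtain ⟨w0, w1⟩ := hW.sq_mul_apply x
  have w2 := hW.vertical_eq_zero x
  have hg := hV.fderiv_rotGen dV x
  rw [fderiv_eq_sum_pdv] at hg
  have g0 := congrArg (fun y : E3 => y 0) hg
  have g1 := congrArg (fun y : E3 => y 1) hg
  simp only [Fin.sum_univ_three, PiLp.add_apply, PiLp.smul_apply, smul_eq_mul, rotGen] at g0 g1
  simp at g0 g1
  rw [swirl, curl_cross (dV x) (dW x) hdV hdW, fderiv_eq_sum_pdv, fderiv_eq_sum_pdv]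
  simp only [Fin.sum_univ_three, PiLp.add_apply, PiLp.smul_apply, PiLp.sub_apply, smul_eq_mul,
    sd_swirl (dW x), w2]
  simp
  unfold radial
  linear_combination (x 0 * pdv 0 V x 1 - x 1 * pdv 0 V x 0 - V x 1) * w0 +
    (x 0 * pdv 1 V x 1 - x 1 * pdv 1 V x 0 + V x 0) * w1 +
    swirl W x * (x 0 * g1 - x 1 * g0)

theorem radial_curl {B : E3 → E3} (hB : ReflOdd B) (dB : Differentiable ℝ B) (x : E3) :
    radial (curl B) x = - sd 2 (swirl B) x := by
  have h2 : (fun y => B y 2) = fun _ => 0 := funext hB.vertical_eq_zero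
  have e : ∀ i, pdv i B x 2 = 0 := fun i => by rw [pdv_apply (dB x), h2, sd_const]
  simp [radial, sd_swirl (dB x), curl_zero_apply, curl_one_apply, pd_eq_pdv, e]
  ring

/-- The level sets of `r b_θ` contain the lines of the current `∇ × B`. -/
theorem current_sd_swirl {B : E3 → E3} (hB : ReflOdd B) (dB : Differentiable ℝ B) (x : E3) :
    ∑ i, curl B x i * sd i (swirl B) x = 0 := by
  have h2 : (fun y => B y 2) = fun _ => 0 := funext hB.vertical_eq_zero
  have e : ∀ i, pdv i B x 2 = 0 := fun i => by rw [pdv_apply (dB x), h2, sd_const]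
  have hr : (fun y => y 0 * B y 0 + y 1 * B y 1) = fun _ => 0 := funext hB.radial_eq_zero
  have c0 : DifferentiableAt ℝ (fun y => B y 0) x := differentiableAt_coord (dB x) 0
  have c1 : DifferentiableAt ℝ (fun y => B y 1) x := differentiableAt_coord (dB x) 1
  have hri : ∀ i, sd i (fun y => y 0 * B y 0 + y 1 * B y 1) x = 0 := fun i => by rw [hr, sd_const]
  simp (disch := fun_prop) only [sd_add, sd_mul, sd_coord] at hri
  simp only [← pdv_apply (dB x)] at hri
  have r0 := hri 0
  have r1 := hri 1
  have r2 := hri 2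
  simp at r0 r1 r2
  have hg := hB.fderiv_rotGen dB x
  rw [fderiv_eq_sum_pdv] at hg
  have g0 := congrArg (fun y : E3 => y 0) hg
  have g1 := congrArg (fun y : E3 => y 1) hg
  simp only [Fin.sum_univ_three, PiLp.add_apply, PiLp.smul_apply, smul_eq_mul, rotGen] at g0 g1
  simp at g0 g1
  simp only [Fin.sum_univ_three, curl_zero_apply, curl_one_apply, curl_two_apply, pd_eq_pdv, e,
    sd_swirl (dB x)]
  simp
  by_cases hx : x 0 ^ 2 + x 1 ^ 2 = 0
  · have h0 : x 0 = 0 := by nlinarith [sq_nonneg (x 0), sq_nonneg (x 1)]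
    have h1 : x 1 = 0 := by nlinarith [sq_nonneg (x 0), sq_nonneg (x 1)]
    obtain ⟨k0, k1⟩ := hB.axis_zero h0 h1
    simp [h0, h1, k0, k1]
  · refine (mul_eq_zero.1 (?_ : (x 0 ^ 2 + x 1 ^ 2) * _ = 0)).resolve_left hx
    linear_combination (x 0 * pdv 2 B x 1 - x 1 * pdv 2 B x 0) * (x 1 * r0 - x 0 * r1) +
      (-x 1 * (B x 1 + x 0 * pdv 0 B x 1 - x 1 * pdv 0 B x 0) +
        x 0 * (x 0 * pdv 1 B x 1 - B x 0 - x 1 * pdv 1 B x 0)) * r2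

/-- The azimuthal component of the curl of the Lorentz force. -/
theorem swirl_curl_lorentz {B : E3 → E3} (hB : ReflOdd B) (cB : ContDiff ℝ 2 B)
    {x : E3} (hdB : divergence B x = 0) :
    (x 0 ^ 2 + x 1 ^ 2) * swirl (curl (fun y => cross (curl B y) (B y))) x =
      - (2 * swirl B x * sd 2 (swirl B) x) := by
  have dB : Differentiable ℝ B := cB.differentiable (by norm_num)
  rw [swirl_curl_cross (hB.curl dB) hB (differentiable_curl cB) dB (divergence_curl cB x) hdB,
    radial_curl hB dB, current_sd_swirl hB dB]
  ring

/-! ### The vorticity equation -/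

theorem fderiv_eq_sum_smulRight (v : E3 → E3) (x : E3) :
    fderiv ℝ v x = ∑ i, (EuclideanSpace.proj i : E3 →L[ℝ] ℝ).smulRight (pdv i v x) := by
  ext w : 1
  rw [fderiv_eq_sum_pdv, sum_apply]
  rfl

theorem BddW1.continuousOn_fderiv {T : ℝ} {F : ℝ → E3 → E3} (hF : BddW1 T F) (x : E3) :
    ContinuousOn (fun τ => fderiv ℝ (F τ) x) (Icc 0 T) := by
  simp_rw [fderiv_eq_sum_smulRight]
  refine continuousOn_finsetSum _ fun i _ => ?_
  have : ContinuousOn (fun τ => pdv i (F τ) x) (Icc 0 T) :=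
    (hF.one i).cont.comp (f := fun τ : ℝ => (τ, x)) (by fun_prop) (fun τ hτ => ⟨hτ, mem_univ _⟩)
  exact ((ContinuousLinearMap.smulRightL ℝ E3 E3 (EuclideanSpace.proj i)).continuous).comp_continuousOn
    this

theorem BddW1.fderiv_bound {T : ℝ} {F : ℝ → E3 → E3} (hF : BddW1 T F) :
    ∃ M : ℝ, 0 ≤ M ∧ ∀ t ∈ Icc 0 T, ∀ x, ‖fderiv ℝ (F t) x‖ ≤ M := by
  obtain ⟨M, hM, h⟩ := hF.pdv_bound
  exact ⟨3 * M, by positivity, fun t ht x => ContinuousLinearMap.opNorm_le_bound _ (by positivity)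
    fun w => norm_fderiv_apply_le (h t ht x) w⟩

/-- Differentiation under the integral in time. -/
theorem BddW1.hasFDerivAt_intervalIntegral {T s t : ℝ} {F : ℝ → E3 → E3} (hF : BddW1 T F)
    (hs : 0 ≤ s) (hst : s ≤ t) (ht : t ≤ T) (x : E3) :
    HasFDerivAt (fun x => ∫ τ in s..t, F τ x) (∫ τ in s..t, fderiv ℝ (F τ) x) x := by
  have hsub : Icc s t ⊆ Icc 0 T := Icc_subset_Icc hs ht
  have hIoc : Set.uIoc s t = Ioc s t := uIoc_of_le hst
  obtain ⟨M, -, hM⟩ := hF.fderiv_bound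
  have hFc : ∀ x, ContinuousOn (fun τ => F τ x) (Icc s t) := fun x =>
    (hF.zero.cont.mono (prod_mono_left hsub)).comp (f := fun τ : ℝ => (τ, x)) (by fun_prop)
      (fun τ hτ => ⟨hτ, mem_univ _⟩)
  refine (intervalIntegral.hasFDerivAt_integral_of_dominated_of_fderiv_le (𝕜 := ℝ)
    (μ := volume) (a := s) (b := t) (F := fun x τ => F τ x)
    (F' := fun x τ => fderiv ℝ (F τ) x) (x₀ := x) (s := univ) (bound := fun _ => M)
    univ_mem (Eventually.of_forall fun y => ?_)
    (ContinuousOn.intervalIntegrable (by rw [uIcc_of_le hst]; exact hFc x)) ?_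
    (ae_of_all _ fun τ hτ y hy => ?_) (by simp) (ae_of_all _ fun τ hτ y hy => ?_))
  · rw [hIoc]
    exact ((hFc y).mono Ioc_subset_Icc_self).aestronglyMeasurable measurableSet_Ioc
  · rw [hIoc]
    exact ((hF.continuousOn_fderiv x).mono
      (Ioc_subset_Icc_self.trans hsub)).aestronglyMeasurable measurableSet_Ioc
  · exact hM τ (hsub (Ioc_subset_Icc_self (hIoc ▸ hτ))) y
  · exact (hF.diff τ (hsub (Ioc_subset_Icc_self (hIoc ▸ hτ))) y).hasFDerivAt

/-- If `∂ₜv = F - ∇p`, then `∂ₜ(∇ × v) = ∇ × F`, integrated in time. No derivative of `∂ₜv` or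
second derivative of `p` is needed: after integration in time the gradient has a derivative, which
is symmetric. -/
theorem curl_sub_eq_intervalIntegral {T : ℝ} {v vt F : ℝ → E3 → E3} (hF : BddW1 T F)
    (hv : ∀ t ∈ Icc 0 T, Differentiable ℝ (v t))
    (hvt : ContinuousOn (fun q : ℝ × E3 => vt q.1 q.2) (Icc 0 T ×ˢ univ))
    (dv : ∀ t ∈ Icc 0 T, ∀ x, HasDerivWithinAt (fun s => v s x) (vt t x) (Icc 0 T) t)
    (hp : ∀ t ∈ Icc 0 T, ∃ p : E3 → ℝ, ContDiff ℝ 1 p ∧ ∀ x, gradient p x = F t x - vt t x)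
    {s t : ℝ} (hs : 0 ≤ s) (hst : s ≤ t) (ht : t ≤ T) (x : E3) :
    curl (v t) x - curl (v s) x = ∫ τ in s..t, curl (F τ) x := by
  have hsub : Icc s t ⊆ Icc 0 T := Icc_subset_Icc hs ht
  obtain ⟨Q, hQ⟩ := exists_potential_intervalIntegral (h := fun τ x => F τ x - vt τ x) hst
    ((hF.zero.cont.sub hvt).mono (prod_mono_left hsub)) (fun τ hτ => hp τ (hsub hτ))
  have hc1 : ∀ x, IntervalIntegrable (fun τ => F τ x) volume s t := fun x =>
    ContinuousOn.intervalIntegrable (by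
      rw [uIcc_of_le hst]
      exact (hF.zero.cont.mono (prod_mono_left hsub)).comp (f := fun τ : ℝ => (τ, x)) (by fun_prop)
        (fun τ hτ => ⟨hτ, mem_univ _⟩))
  have hc2 : ∀ x, IntervalIntegrable (fun τ => vt τ x) volume s t := fun x =>
    ContinuousOn.intervalIntegrable (by
      rw [uIcc_of_le hst]
      exact (hvt.mono (prod_mono_left hsub)).comp (f := fun τ : ℝ => (τ, x)) (by fun_prop)
        (fun τ hτ => ⟨hτ, mem_univ _⟩))
  have hH : ∀ x, ∫ τ in s..t, (F τ x - vt τ x) = (∫ τ in s..t, F τ x) - (v t x - v s x) := by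
    intro x
    rw [intervalIntegral.integral_sub (hc1 x) (hc2 x)]
    congr 1
    exact intervalIntegral_eq_sub_of_bddL2 hvt dv hs hst ht x
  simp_rw [hH] at hQ
  have hH' : HasFDerivAt (fun x => (∫ τ in s..t, F τ x) - (v t x - v s x))
      ((∫ τ in s..t, fderiv ℝ (F τ) x) - (fderiv ℝ (v t) x - fderiv ℝ (v s) x)) x :=
    (hF.hasFDerivAt_intervalIntegral hs hst ht x).sub
      ((hv t ⟨hs.trans hst, ht⟩ x).hasFDerivAt.sub (hv s ⟨hs, hst.trans ht⟩ x).hasFDerivAt)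
  have hsym := second_derivative_symmetric hQ ((innerSL ℝ (E := E3)).hasFDerivAt.comp x hH')
  set A := ∫ τ in s..t, fderiv ℝ (F τ) x with hA
  have hfi : IntervalIntegrable (fun τ => fderiv ℝ (F τ) x) volume s t :=
    ContinuousOn.intervalIntegrable (by
      rw [uIcc_of_le hst]; exact (hF.continuousOn_fderiv x).mono hsub)
  have hAe : ∀ i j : Fin 3, A (EuclideanSpace.single i 1) j = ∫ τ in s..t, pd i j (F τ) x := by
    intro i j
    have := ((EuclideanSpace.proj j : E3 →L[ℝ] ℝ).comp
      (ContinuousLinearMap.apply ℝ E3 (EuclideanSpace.single i (1 : ℝ)))).intervalIntegral_comp_comm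
        hfi
    exact this.symm
  have hij : ∀ i j : Fin 3, A (EuclideanSpace.single i 1) j - (pd i j (v t) x - pd i j (v s) x) =
      A (EuclideanSpace.single j 1) i - (pd j i (v t) x - pd j i (v s) x) := by
    intro i j
    have : inner ℝ (A (EuclideanSpace.single i 1) - (fderiv ℝ (v t) x (EuclideanSpace.single i 1)
          - fderiv ℝ (v s) x (EuclideanSpace.single i 1))) (EuclideanSpace.single j (1 : ℝ)) =
        inner ℝ (A (EuclideanSpace.single j 1) - (fderiv ℝ (v t) x (EuclideanSpace.single j 1)
          - fderiv ℝ (v s) x (EuclideanSpace.single j 1))) (EuclideanSpace.single i (1 : ℝ)) :=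
      hsym (EuclideanSpace.single i 1) (EuclideanSpace.single j 1)
    simpa [inner_eq_sum, pd] using this
  have hii : ∀ i j : Fin 3, IntervalIntegrable (fun τ => pd i j (F τ) x) volume s t := by
    intro i j
    refine ContinuousOn.intervalIntegrable ?_
    rw [uIcc_of_le hst]
    have := ((hF.continuousOn_fderiv x).mono hsub).clm_apply
      (continuousOn_const (c := (EuclideanSpace.single i 1 : E3)))
    exact (EuclideanSpace.proj j : E3 →L[ℝ] ℝ).continuous.comp_continuousOn this
  have hcc : ContinuousOn (fun τ => curl (F τ) x) (Icc s t) :=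
    (hF.curl.cont.mono (prod_mono_left hsub)).comp (f := fun τ : ℝ => (τ, x)) (by fun_prop)
      (fun τ hτ => ⟨hτ, mem_univ _⟩)
  have hcj : ∀ j : Fin 3, (∫ τ in s..t, curl (F τ) x) j = ∫ τ in s..t, curl (F τ) x j := by
    intro j
    exact ((EuclideanSpace.proj j : E3 →L[ℝ] ℝ).intervalIntegral_comp_comm
      (ContinuousOn.intervalIntegrable (by rw [uIcc_of_le hst]; exact hcc))).symm
  ext j
  rw [hcj]
  fin_cases j <;>
  simp only [Fin.zero_eta, Fin.mk_one, Fin.reduceFinMk, PiLp.sub_apply, curl_zero_apply,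
    curl_one_apply, curl_two_apply] <;>
  rw [intervalIntegral.integral_sub (hii _ _) (hii _ _), ← hAe, ← hAe]
  · linarith [hij 1 2]
  · linarith [hij 2 0]
  · linarith [hij 0 1]

/-- `u·∇u = ∇(|u|²/2) - u × (∇ × u)`. -/
theorem gradient_half_norm_sq {u : E3 → E3} (hu : Differentiable ℝ u) (x : E3) :
    gradient (fun y => ‖u y‖ ^ 2 / 2) x = fderiv ℝ u x (u x) + cross (u x) (curl u x) := by
  refine HasGradientAt.gradient ?_
  rw [hasGradientAt_iff_hasFDerivAt]
  have h1 := ((hu x).hasFDerivAt.norm_sq).mul_const (2 : ℝ)⁻¹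
  refine h1.congr_fderiv ?_
  ext w
  change (2 : ℝ)⁻¹ * ((2 : ℕ) • inner ℝ (u x) (fderiv ℝ u x w)) =
    inner ℝ (fderiv ℝ u x (u x) + cross (u x) (curl u x)) w
  rw [fderiv_eq_sum_pdv, fderiv_eq_sum_pdv]
  simp only [inner_eq_sum, Fin.sum_univ_three, PiLp.add_apply, PiLp.smul_apply, smul_eq_mul,
    nsmul_eq_mul, cross_zero_apply, cross_one_apply, cross_two_apply, curl_zero_apply,
    curl_one_apply, curl_two_apply, pd_eq_pdv]
  push_cast
  ring

/-- The vorticity equation `∂ₜω = ∇ × (u × ω) + ∇ × ((∇ × B) × B)`, integrated in time. -/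
theorem RegSol.vorticity {T : ℝ} {u B ut Bt : ℝ → E3 → E3} (hs : RegSol T u B ut Bt)
    {s t : ℝ} (h0 : 0 ≤ s) (hst : s ≤ t) (ht : t ≤ T) (x : E3) :
    curl (u t) x - curl (u s) x = ∫ τ in s..t,
      (curl (fun y => cross (u τ y) (curl (u τ) y)) x +
        curl (fun y => cross (curl (B τ) y) (B τ y)) x) := by
  have c1 := hs.u2.bddW1.cross hs.u2.bddW1_curl
  have c2 := hs.B2.bddW1_curl.cross hs.B2.bddW1
  rw [curl_sub_eq_intervalIntegral (c1.add c2) hs.u2.bddW1.diff hs.ut_cont hs.du (fun t ht => ?_)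
    h0 hst ht x]
  · refine intervalIntegral.integral_congr fun τ hτ => ?_
    rw [uIcc_of_le hst] at hτ
    have hτ' := Icc_subset_Icc h0 ht hτ
    exact curl_add (c1.diff τ hτ' x) (c2.diff τ hτ' x)
  · obtain ⟨p, hp, hp'⟩ := hs.momentum t ht
    have hu := hs.u2.bddW1.diff t ht
    have hq : ContDiff ℝ 1 (fun y => ‖u t y‖ ^ 2 / 2) :=
      ((((hs.u2.c2 t ht).of_le (by norm_num)).norm_sq ℝ).div_const 2)
    refine ⟨fun y => p y + ‖u t y‖ ^ 2 / 2, hp.add hq, fun x => ?_⟩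
    have hpd := (hp.differentiable (by norm_num) x).hasGradientAt
    have hqd := (hq.differentiable (by norm_num) x).hasGradientAt
    have : HasGradientAt (fun y => p y + ‖u t y‖ ^ 2 / 2)
        (gradient p x + gradient (fun y => ‖u t y‖ ^ 2 / 2) x) x := by
      rw [hasGradientAt_iff_hasFDerivAt, map_add]
      exact hpd.hasFDerivAt.add hqd.hasFDerivAt
    rw [this.gradient, hp', gradient_half_norm_sq hu, force]
    abel

/-- For `W = ω + B` the Hall terms cancel: `∂ₜW = ∇ × (u × W)`. -/
theorem RegSol.total_vorticity {T : ℝ} {u B ut Bt : ℝ → E3 → E3} (hs : RegSol T u B ut Bt)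
    {s t : ℝ} (h0 : 0 ≤ s) (hst : s ≤ t) (ht : t ≤ T) (x : E3) :
    (curl (u t) x + B t x) - (curl (u s) x + B s x) = ∫ τ in s..t,
      curl (fun y => cross (u τ y) (curl (u τ) y + B τ y)) x := by
  have c1 := hs.u2.bddW1.cross hs.u2.bddW1_curl
  have c2 := hs.B2.bddW1_curl.cross hs.B2.bddW1
  have c3 := hs.u2.bddW1.cross hs.B2.bddW1
  have e1 := hs.vorticity h0 hst ht x
  have e2 := intervalIntegral_eq_sub_of_bddL2 hs.Bt_bddL2.cont hs.dB h0 hst ht x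
  have hsub : Icc s t ⊆ Icc 0 T := Icc_subset_Icc h0 ht
  have hii : ∀ {F : ℝ → E3 → E3}, BddL2 T F → IntervalIntegrable (fun τ => F τ x) volume s t :=
    fun {F} hF => ContinuousOn.intervalIntegrable (by
      rw [uIcc_of_le hst]
      exact (hF.cont.mono (prod_mono_left hsub)).comp (f := fun τ : ℝ => (τ, x)) (by fun_prop)
        (fun τ hτ => ⟨hτ, mem_univ _⟩))
  have : (curl (u t) x + B t x) - (curl (u s) x + B s x) =
      (curl (u t) x - curl (u s) x) + (B t x - B s x) := by abel
  rw [this, e1, ← e2, ← intervalIntegral.integral_add (hii (c1.curl.add c2.curl))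
    (hii hs.Bt_bddL2)]
  refine intervalIntegral.integral_congr fun τ hτ => ?_
  rw [uIcc_of_le hst] at hτ
  have hτ' := hsub hτ
  change _ + Bt τ x = _
  rw [hs.induction τ hτ' x]
  have e3 : curl (emf (u τ) (B τ)) x = _ := curl_sub (c3.diff τ hτ' x) (c2.diff τ hτ' x)
  have e4 : (fun y => cross (u τ y) (curl (u τ) y + B τ y)) =
      fun y => cross (u τ y) (curl (u τ) y) + cross (u τ y) (B τ y) := by
    funext y
    have := cross_sub_right (u τ y) (curl (u τ) y) (-B τ y)
    rw [sub_neg_eq_add, cross_neg_right, sub_neg_eq_add] at this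
    exact this
  rw [e3, e4, curl_add (c1.diff τ hτ' x) (c3.diff τ hτ' x)]
  abel

/-! ### The transport equations for the azimuthal components -/

theorem primitive_hasDerivWithinAt {F : Type*} [NormedAddCommGroup F] [NormedSpace ℝ F]
    [CompleteSpace F] {T : ℝ} {g : ℝ → F} (hg : ContinuousOn g (Icc 0 T)) {t : ℝ}
    (ht : t ∈ Icc 0 T) :
    HasDerivWithinAt (fun s => ∫ τ in 0..s, g τ) (g t) (Icc 0 T) t := by
  have hT : 0 ≤ T := ht.1.trans ht.2
  have hc : Continuous (IccExtend hT (Icc 0 T |>.domRestrict g)) :=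
    (continuousOn_iff_continuous_domRestrict.1 hg).Icc_extend'
  have he : ∀ τ ∈ Icc 0 T, IccExtend hT (Icc 0 T |>.domRestrict g) τ = g τ := fun τ hτ =>
    IccExtend_of_mem hT _ hτ
  have h1 := (intervalIntegral.integral_hasDerivAt_right (hc.intervalIntegrable 0 t)
    (hc.stronglyMeasurableAtFilter _ _) hc.continuousAt).hasDerivWithinAt (s := Icc 0 T)
  rw [he t ht] at h1
  have h2 : ∀ s ∈ Icc 0 T, (∫ τ in 0..s, g τ) =
      ∫ τ in 0..s, IccExtend hT (Icc 0 T |>.domRestrict g) τ := fun s hs => by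
    refine intervalIntegral.integral_congr fun τ hτ => ?_
    rw [uIcc_of_le hs.1] at hτ
    exact (he τ ⟨hτ.1, hτ.2.trans hs.2⟩).symm
  exact h1.congr h2 (h2 t ht)

/-- The equation `∂ₜb + u·∇b = (u_r/r) b + 2κ b ∂_zb/r` for the azimuthal component `b` of a purely
azimuthal field `W`, multiplied by `r³`. -/
structure SwirlTransport (T κ : ℝ) (u W Wt : ℝ → E3 → E3) : Prop where
  hu : BddW1 T u
  hW : BddW1 T W
  hWt : BddL2 T Wt
  dW : ∀ t ∈ Icc 0 T, ∀ x, HasDerivWithinAt (fun s => W s x) (Wt t x) (Icc 0 T) t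
  u_even : ∀ t ∈ Icc 0 T, ReflEven (u t)
  W_odd : ∀ t ∈ Icc 0 T, ReflOdd (W t)
  div_u : ∀ t ∈ Icc 0 T, ∀ x, divergence (u t) x = 0
  eq : ∀ t ∈ Icc 0 T, ∀ x, (x 0 ^ 2 + x 1 ^ 2) * swirl (Wt t) x =
    2 * swirl (W t) x * (radial (u t) x + κ * sd 2 (swirl (W t)) x)
      - (x 0 ^ 2 + x 1 ^ 2) * ∑ i, u t x i * sd i (swirl (W t)) x

theorem ReflOdd.add {V W : E3 → E3} (hV : ReflOdd V) (hW : ReflOdd W) :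
    ReflOdd (fun x => V x + W x) := fun p q h x => by
  simp only [hV p q h, hW p q h, map_add]; abel

theorem divergence_add {V W : E3 → E3} {x : E3} (hV : DifferentiableAt ℝ V x)
    (hW : DifferentiableAt ℝ W x) :
    divergence (fun y => V y + W y) x = divergence V x + divergence W x := by
  simp only [divergence, pd_eq_pdv, pdv_add _ hV hW, PiLp.add_apply, Finset.sum_add_distrib]

/-- The induction equation for the azimuthal magnetic field. The term with `κ = 1` is the Hall term. -/
theorem RegSol.swirlTransport_B {T : ℝ} {u B ut Bt : ℝ → E3 → E3} (hs : RegSol T u B ut Bt)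
    (hu : ReflEven (u 0)) (hB : ReflOdd (B 0)) : SwirlTransport T 1 u B Bt where
  hu := hs.u2.bddW1
  hW := hs.B2.bddW1
  hWt := hs.Bt_bddL2
  dW := hs.dB
  u_even t ht := (hs.symm hu hB ht).1
  W_odd t ht := (hs.symm hu hB ht).2
  div_u := hs.div_u
  eq t ht x := by
    obtain ⟨he, ho⟩ := hs.symm hu hB ht
    have d1 := (hs.u2.bddW1.cross hs.B2.bddW1).diff t ht x
    have d2 := (hs.B2.bddW1_curl.cross hs.B2.bddW1).diff t ht x
    have e : Bt t x = curl (fun y => cross (u t y) (B t y)) x -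
        curl (fun y => cross (curl (B t) y) (B t y)) x := by
      rw [hs.induction t ht]; exact curl_sub d1 d2
    have h1 := swirl_curl_cross he ho (hs.u2.bddW1.diff t ht) (hs.B2.bddW1.diff t ht)
      (hs.div_u t ht x) (hs.div_B t ht x)
    have h2 := swirl_curl_lorentz ho (hs.B2.c2 t ht) (hs.div_B t ht x)
    have h3 : swirl (Bt t) x = swirl (curl (fun y => cross (u t y) (B t y))) x -
        swirl (curl (fun y => cross (curl (B t) y) (B t y))) x := by
      simp only [swirl, e, PiLp.sub_apply]; ring
    rw [h3, mul_sub, h1, h2]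
    ring

/-- The sum `ω + B` of the vorticity and the magnetic field. -/
def totalVorticity (u B : E3 → E3) (x : E3) : E3 := curl u x + B x

/-- The azimuthal part of `ω + B` obeys the transport equation without Hall term. -/
theorem RegSol.swirlTransport_total {T : ℝ} {u B ut Bt : ℝ → E3 → E3} (hs : RegSol T u B ut Bt)
    (hu : ReflEven (u 0)) (hB : ReflOdd (B 0)) :
    SwirlTransport T 0 u (fun t => totalVorticity (u t) (B t))
      (fun t => curl (fun y => cross (u t y) (totalVorticity (u t) (B t) y))) where
  hu := hs.u2.bddW1
  hW := hs.u2.bddW1_curl.add hs.B2.bddW1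
  hWt := (hs.u2.bddW1.cross (hs.u2.bddW1_curl.add hs.B2.bddW1)).curl
  dW t ht x := by
    have hc := (hs.u2.bddW1.cross (hs.u2.bddW1_curl.add hs.B2.bddW1)).curl
    have h1 := primitive_hasDerivWithinAt (T := T) (g := fun τ =>
      curl (fun y => cross (u τ y) (curl (u τ) y + B τ y)) x)
      (hc.cont.comp (f := fun τ : ℝ => (τ, x)) (by fun_prop) (fun τ hτ => ⟨hτ, mem_univ _⟩)) ht
    have h2 : ∀ s ∈ Icc 0 T, totalVorticity (u s) (B s) x = (∫ τ in 0..s,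
        curl (fun y => cross (u τ y) (curl (u τ) y + B τ y)) x) + totalVorticity (u 0) (B 0) x :=
      fun s hs' => by
        rw [← hs.total_vorticity le_rfl hs'.1 hs'.2 x, totalVorticity, totalVorticity]; abel
    exact (h1.add_const (totalVorticity (u 0) (B 0) x)).congr h2 (h2 t ht)
  u_even t ht := (hs.symm hu hB ht).1
  W_odd t ht := ((hs.symm hu hB ht).1.curl (hs.u2.bddW1.diff t ht)).add (hs.symm hu hB ht).2
  div_u := hs.div_u
  eq t ht x := by
    obtain ⟨he, ho⟩ := hs.symm hu hB ht
    have dc := differentiable_curl (hs.u2.c2 t ht)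
    have dB := hs.B2.bddW1.diff t ht
    rw [zero_mul, add_zero]
    refine swirl_curl_cross he ((he.curl (hs.u2.bddW1.diff t ht)).add ho)
      (hs.u2.bddW1.diff t ht) (dc.add dB) (hs.div_u t ht x) ?_
    have := divergence_add (dc x) (dB x)
    rw [divergence_curl (hs.u2.c2 t ht), hs.div_B t ht, add_zero] at this
    exact this

/-! ### Regularized quotients -/

theorem sd_inv {f : E3 → ℝ} {x : E3} (i : Fin 3) (hf : DifferentiableAt ℝ f x) (h0 : f x ≠ 0) :
    sd i (fun y => (f y)⁻¹) x = - sd i f x / f x ^ 2 := by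
  have h1 := (hasDerivAt_inv h0).comp_hasFDerivAt x hf.hasFDerivAt
  have h2 : fderiv ℝ (fun y => (f y)⁻¹) x = _ := h1.fderiv
  rw [sd, h2]
  simp [sd]; ring

theorem BddL2.mul_bdd {T : ℝ} {f : E3 → ℝ} {g : ℝ → E3 → ℝ} (hf : Continuous f)
    (hfb : ∃ M : ℝ, ∀ x, ‖f x‖ ≤ M) (hg : BddL2 T g) : BddL2 T (fun t x => f x * g t x) := by
  obtain ⟨M, hM⟩ := hfb
  obtain ⟨N, hN⟩ := hg.bdd
  obtain ⟨K, hK, hK'⟩ := hg.l2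
  refine ⟨(hf.comp continuous_snd).continuousOn.mul hg.cont, ⟨M * N, fun t ht x => ?_⟩,
    ENNReal.ofReal M * K, ENNReal.mul_ne_top ENNReal.ofReal_ne_top hK, fun t ht => ?_⟩
  · rw [norm_mul]
    exact mul_le_mul (hM x) (hN t ht x) (norm_nonneg _) ((norm_nonneg _).trans (hM x))
  · refine (eLpNorm_le_mul_eLpNorm_of_ae_le_mul (g := g t) (c := M) (ae_of_all _ fun x => ?_) 2).trans
      (by gcongr; exact hK' t ht)
    rw [norm_mul]; exact mul_le_mul_of_nonneg_right (hM x) (norm_nonneg _)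

theorem BddL2.pow_succ {T : ℝ} {g : ℝ → E3 → ℝ} (hg : BddL2 T g) (n : ℕ) :
    BddL2 T (fun t x => g t x ^ (n + 1)) := by
  induction n with
  | zero => simpa using! hg
  | succ n ih => exact (ih.mul hg).congr fun t _ x => _root_.pow_succ _ _

/-- Bounded continuous functions. -/
def BC (f : E3 → ℝ) : Prop := Continuous f ∧ ∃ M : ℝ, ∀ x, ‖f x‖ ≤ M

theorem BC.mul {f g : E3 → ℝ} (hf : BC f) (hg : BC g) : BC (fun x => f x * g x) := by
  obtain ⟨hf, M, hM⟩ := hf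
  obtain ⟨hg, N, hN⟩ := hg
  refine ⟨hf.mul hg, M * N, fun x => ?_⟩
  rw [norm_mul]
  exact mul_le_mul (hM x) (hN x) (norm_nonneg _) ((norm_nonneg _).trans (hM x))

theorem BC.sub {f g : E3 → ℝ} (hf : BC f) (hg : BC g) : BC (fun x => f x - g x) := by
  obtain ⟨hf, M, hM⟩ := hf
  obtain ⟨hg, N, hN⟩ := hg
  exact ⟨hf.sub hg, M + N, fun x => (norm_sub_le _ _).trans (add_le_add (hM x) (hN x))⟩

theorem BC.const (c : ℝ) : BC (fun _ => c) := ⟨continuous_const, ‖c‖, fun _ => le_rfl⟩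

theorem BC.congr {f g : E3 → ℝ} (hf : BC f) (h : ∀ x, g x = f x) : BC g := by
  rwa [show g = f from funext h]

theorem BL2.mul_bc {f g : E3 → ℝ} (hf : BC f) (hg : BL2 g) : BL2 (fun x => f x * g x) :=
  BL2.mul_bdd hf.1 hf.2 hg

section Regularized
variable (ε : ℝ)

/-- `r² + ε²`. -/
def denom (x : E3) : ℝ := x 0 ^ 2 + x 1 ^ 2 + ε ^ 2

/-- The regularization `r W_θ / (r² + ε²)` of `W_θ / r`. -/
def regQuot (W : E3 → E3) (x : E3) : ℝ := swirl W x / denom ε x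

/-- `r² / (r² + ε²)`. -/
def regWeight (x : E3) : ℝ := (x 0 ^ 2 + x 1 ^ 2) / denom ε x

variable {ε}

theorem denom_pos (hε : 0 < ε) (x : E3) : 0 < denom ε x := by unfold denom; positivity

theorem differentiable_denom : Differentiable ℝ (denom ε) := by unfold denom; fun_prop

theorem sd_denom (i : Fin 3) (x : E3) :
    sd i (denom ε) x = (if i = 0 then 2 * x 0 else 0) + if i = 1 then 2 * x 1 else 0 := by
  unfold denom
  have h : ∀ j : Fin 3, DifferentiableAt ℝ (fun y : E3 => y j ^ 2) x := fun j => by fun_prop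
  simp (disch := fun_prop) only [sd_add, sd_const, sd_pow, sd_coord]
  fin_cases i <;> simp

theorem bc_inv_denom (hε : 0 < ε) : BC (fun x => (denom ε x)⁻¹) := by
  refine ⟨differentiable_denom.continuous.inv₀ fun x => (denom_pos hε x).ne', (ε ^ 2)⁻¹, fun x => ?_⟩
  rw [Real.norm_of_nonneg (inv_nonneg.2 (denom_pos hε x).le)]
  refine inv_anti₀ (by positivity) ?_
  unfold denom; nlinarith [sq_nonneg (x 0), sq_nonneg (x 1)]

theorem bc_coord_div_denom (hε : 0 < ε) {j : Fin 3} (hj : j = 0 ∨ j = 1) :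
    BC (fun x => x j * (denom ε x)⁻¹) := by
  refine ⟨(by fun_prop : Continuous fun x : E3 => x j).mul (bc_inv_denom hε).1, ε⁻¹, fun x => ?_⟩
  have hd := denom_pos hε x
  rw [norm_mul, Real.norm_of_nonneg (inv_nonneg.2 hd.le), ← div_eq_mul_inv, div_le_iff₀ hd,
    Real.norm_eq_abs, inv_mul_eq_div, le_div_iff₀ hε]
  have h1 : |x j| ^ 2 ≤ x 0 ^ 2 + x 1 ^ 2 := by
    rw [sq_abs]
    rcases hj with rfl | rfl <;> nlinarith [sq_nonneg (x 0), sq_nonneg (x 1)]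
  unfold denom
  nlinarith [sq_nonneg (|x j| - ε)]

theorem bc_regWeight (hε : 0 < ε) : BC (regWeight ε) := by
  refine ((BC.const 1).sub ((BC.const (ε ^ 2)).mul (bc_inv_denom hε))).congr fun x => ?_
  have hd := (denom_pos hε x).ne'
  rw [regWeight]; field_simp; unfold denom; ring

theorem regQuot_eq (W : E3 → E3) (x : E3) : regQuot ε W x =
    (x 0 * (denom ε x)⁻¹) * W x 1 - (x 1 * (denom ε x)⁻¹) * W x 0 := by
  rw [regQuot, swirl]; ring

theorem BddL2.regQuot {T : ℝ} {W : ℝ → E3 → E3} (hW : BddL2 T W) (hε : 0 < ε) :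
    BddL2 T (fun t => regQuot ε (W t)) := by
  have c0 := bc_coord_div_denom hε (Or.inl rfl : (0 : Fin 3) = 0 ∨ _)
  have c1 := bc_coord_div_denom hε (Or.inr rfl : (1 : Fin 3) = 0 ∨ _)
  exact ((BddL2.mul_bdd c0.1 c0.2 (hW.coord 1)).sub (BddL2.mul_bdd c1.1 c1.2 (hW.coord 0))).congr
    fun t _ x => regQuot_eq (W t) x

theorem differentiable_regQuot {W : E3 → E3} (hW : Differentiable ℝ W) (hε : 0 < ε) :
    Differentiable ℝ (regQuot ε W) := by
  have e : regQuot ε W = fun y => swirl W y * (denom ε y)⁻¹ := funext fun y => div_eq_mul_inv _ _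
  rw [e]
  exact (differentiable_swirl hW).mul (differentiable_denom.inv fun x => (denom_pos hε x).ne')

theorem differentiable_regWeight (hε : 0 < ε) : Differentiable ℝ (regWeight ε) := by
  unfold regWeight
  simp_rw [div_eq_mul_inv]
  exact (by fun_prop : Differentiable ℝ fun x : E3 => x 0 ^ 2 + x 1 ^ 2).mul
    (differentiable_denom.inv fun x => (denom_pos hε x).ne')

theorem sd_regQuot {W : E3 → E3} (hW : Differentiable ℝ W) (hε : 0 < ε) (i : Fin 3) (x : E3) :
    sd i (regQuot ε W) x =
      (sd i (swirl W) x - regQuot ε W x * sd i (denom ε) x) * (denom ε x)⁻¹ := by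
  have hd := (denom_pos hε x).ne'
  have hs := differentiable_swirl hW x
  have hdi : DifferentiableAt ℝ (fun y => (denom ε y)⁻¹) x := (differentiable_denom x).inv hd
  have e : regQuot ε W = fun y => swirl W y * (denom ε y)⁻¹ := funext fun y => div_eq_mul_inv _ _
  rw [e, sd_mul hs hdi, sd_inv i (differentiable_denom x) hd]
  field_simp
  ring

theorem sd_regWeight (hε : 0 < ε) (i : Fin 3) (x : E3) :
    sd i (regWeight ε) x = ε ^ 2 * sd i (denom ε) x * ((denom ε x)⁻¹ * (denom ε x)⁻¹) := by
  have hd := (denom_pos hε x).ne'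
  have hdi : DifferentiableAt ℝ (fun y => (denom ε y)⁻¹) x := (differentiable_denom x).inv hd
  have e : regWeight ε = fun y => 1 - ε ^ 2 * (denom ε y)⁻¹ := funext fun y => by
    have hd := (denom_pos hε y).ne'
    rw [regWeight]; field_simp; unfold denom; ring
  rw [e, sd_sub (by fun_prop) (hdi.const_mul _), sd_const, sd_mul (by fun_prop) hdi, sd_const,
    sd_inv i (differentiable_denom x) hd]
  field_simp
  ring

theorem BL2.sd_regQuot {W : E3 → E3} (hW : W1 W) (hε : 0 < ε) (i : Fin 3) :
    BL2 (sd i (HallMHD.regQuot ε W)) := by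
  have c0 := bc_coord_div_denom hε (Or.inl rfl : (0 : Fin 3) = 0 ∨ _)
  have c1 := bc_coord_div_denom hε (Or.inr rfl : (1 : Fin 3) = 0 ∨ _)
  have ci := bc_inv_denom hε
  have hq : BL2 (HallMHD.regQuot ε W) := by
    refine ((BL2.mul_bc c0 (hW.zero.coord 1)).sub (BL2.mul_bc c1 (hW.zero.coord 0))).congr
      fun x => regQuot_eq W x
  have hD : BC (fun x => sd i (denom ε) x * (denom ε x)⁻¹) := by
    simp_rw [sd_denom]
    fin_cases i
    · exact ((BC.const 2).mul c0).congr fun x => by simp; ring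
    · exact ((BC.const 2).mul c1).congr fun x => by simp; ring
    · exact (BC.const 0).congr fun x => by simp
  have hS : BL2 (fun x => (denom ε x)⁻¹ * sd i (swirl W) x) := by
    have k0 := BL2.mul_bc c0 ((hW.one i).coord 1)
    have k1 := BL2.mul_bc c1 ((hW.one i).coord 0)
    have k2 := BL2.mul_bc ((BC.const (if i = 0 then 1 else 0)).mul ci) (hW.zero.coord 1)
    have k3 := BL2.mul_bc ((BC.const (if i = 1 then 1 else 0)).mul ci) (hW.zero.coord 0)
    refine (((k2.add k0).sub k3).sub k1).congr fun x => ?_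
    rw [sd_swirl (hW.diff x)]
    split_ifs <;> ring
  refine (hS.sub (BL2.mul_bc hD hq)).congr fun x => ?_
  rw [HallMHD.sd_regQuot hW.diff hε]; ring

end Regularized

/-! ### Conservation of the `Lⁿ` norms of the quotients -/

/-- The radial velocity vanishes on the axis, so `|r u_r| ≤ M r²`. -/
theorem abs_radial_le {T : ℝ} {u : ℝ → E3 → E3} (hu : BddW1 T u)
    (he : ∀ t ∈ Icc 0 T, ReflEven (u t)) :
    ∃ M : ℝ, 0 ≤ M ∧ ∀ t ∈ Icc 0 T, ∀ x, |radial (u t) x| ≤ M * (x 0 ^ 2 + x 1 ^ 2) := by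
  obtain ⟨M, hM, hb⟩ := hu.fderiv_bound
  refine ⟨2 * M, by positivity, fun t ht x => ?_⟩
  set y : E3 := !₂[0, 0, x 2] with hy
  obtain ⟨k0, k1⟩ := (he t ht).axis_zero (x := y) rfl rfl
  have h1 : ‖u t x - u t y‖ ≤ M * ‖x - y‖ :=
    Convex.norm_image_sub_le_of_norm_fderiv_le (fun z _ => hu.diff t ht z) (fun z _ => hb t ht z)
      convex_univ (mem_univ y) (mem_univ x)
  have h2 : ‖x - y‖ = rad x := by
    rw [EuclideanSpace.norm_eq, rad]
    simp [Fin.sum_univ_three, hy]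
  rw [h2] at h1
  have c0 := (PiLp.norm_apply_le (u t x - u t y) 0).trans h1
  have c1 := (PiLp.norm_apply_le (u t x - u t y) 1).trans h1
  rw [PiLp.sub_apply, k0, sub_zero, Real.norm_eq_abs] at c0
  rw [PiLp.sub_apply, k1, sub_zero, Real.norm_eq_abs] at c1
  have hr := rad_sq x
  have hr0 : 0 ≤ rad x := Real.sqrt_nonneg _
  have a0 : |x 0| ≤ rad x := by
    rw [← abs_of_nonneg hr0, ← sq_le_sq, hr]; nlinarith [sq_nonneg (x 1)]
  have a1 : |x 1| ≤ rad x := by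
    rw [← abs_of_nonneg hr0, ← sq_le_sq, hr]; nlinarith [sq_nonneg (x 0)]
  rw [← hr, radial]
  refine (abs_add_le _ _).trans ?_
  rw [abs_mul, abs_mul]
  have b0 := mul_le_mul a0 c0 (abs_nonneg _) hr0
  have b1 := mul_le_mul a1 c1 (abs_nonneg _) hr0
  nlinarith

section Energy
variable {T κ : ℝ} {u W Wt : ℝ → E3 → E3} {ε : ℝ}

/-- The balance law for `r² P^n / (r² + ε²)^(n+1)`, `P = r W_θ`, in divergence form. The only
term which is not a divergence is small for `ε → 0`. -/
theorem SwirlTransport.balance (h : SwirlTransport T κ u W Wt) (hε : 0 < ε) (m : ℕ) {t : ℝ}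
    (ht : t ∈ Icc 0 T) (x : E3) :
    regWeight ε x * ((m + 1 : ℕ) * regQuot ε (W t) x ^ m * regQuot ε (Wt t) x) =
      - (∑ i, sd i (fun y => regWeight ε y * regQuot ε (W t) y ^ (m + 1) * u t y i) x)
      + 2 * κ * (m + 1 : ℕ) / (m + 2 : ℕ) * sd 2 (fun y => regQuot ε (W t) y ^ (m + 2)) x
      + 2 * (m + 2 : ℕ) * (ε ^ 2 * (denom ε x)⁻¹ ^ 2 * radial (u t) x *
          regQuot ε (W t) x ^ (m + 1)) := by
  have hdW := h.hW.diff t ht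
  have hdu := h.hu.diff t ht
  have hq := differentiable_regQuot hdW hε x
  have hw := differentiable_regWeight hε x
  have hui : ∀ i, DifferentiableAt ℝ (fun y => u t y i) x := differentiableAt_coord (hdu x)
  have hd := (denom_pos hε x).ne'
  have hP : swirl (W t) x = regQuot ε (W t) x * denom ε x := by rw [regQuot]; field_simp
  have hPt : swirl (Wt t) x = regQuot ε (Wt t) x * denom ε x := by rw [regQuot]; field_simp
  have hr : x 0 ^ 2 + x 1 ^ 2 = denom ε x - ε ^ 2 := by unfold denom; ring
  have hdiv := h.div_u t ht x
  simp only [divergence, pd_eq_pdv, pdv_apply (hdu x), Fin.sum_univ_three] at hdiv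
  have hsP : ∀ i, sd i (swirl (W t)) x = sd i (regQuot ε (W t)) x * denom ε x +
      regQuot ε (W t) x * sd i (denom ε) x := fun i => by
    rw [sd_regQuot hdW hε]; field_simp; ring
  have hm2 : ((m + 2 : ℕ) : ℝ) ≠ 0 := by positivity
  have heq := h.eq t ht x
  rw [hP, hPt, hr] at heq
  simp only [hsP, Fin.sum_univ_three, sd_denom] at heq
  simp at heq
  have e1 : ∀ i, sd i (fun y => regWeight ε y * regQuot ε (W t) y ^ (m + 1) * u t y i) x =
      (sd i (regWeight ε) x * regQuot ε (W t) x ^ (m + 1) + regWeight ε x *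
        ((m + 1 : ℕ) * regQuot ε (W t) x ^ m * sd i (regQuot ε (W t)) x)) * u t x i +
      regWeight ε x * regQuot ε (W t) x ^ (m + 1) * sd i (fun y => u t y i) x := by
    intro i
    have k1 : DifferentiableAt ℝ (fun y => regQuot ε (W t) y ^ (m + 1)) x := hq.pow _
    have k2 : DifferentiableAt ℝ (fun y => regWeight ε y * regQuot ε (W t) y ^ (m + 1)) x :=
      hw.mul k1
    rw [sd_mul k2 (hui i), sd_mul hw k1, sd_pow _ hq]
    simp only [Nat.add_sub_cancel]
    ring
  have e2 : sd 2 (fun y => regQuot ε (W t) y ^ (m + 2)) x =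
      (m + 2 : ℕ) * regQuot ε (W t) x ^ (m + 1) * sd 2 (regQuot ε (W t)) x := sd_pow _ hq
  have e3 : regWeight ε x = (denom ε x - ε ^ 2) * (denom ε x)⁻¹ := by
    rw [regWeight, hr, div_eq_mul_inv]
  simp only [e1, e2, Fin.sum_univ_three, sd_regWeight hε, sd_denom, e3]
  simp only [radial] at heq ⊢
  simp
  push_cast at hm2
  generalize regQuot ε (W t) x = q at *
  generalize regQuot ε (Wt t) x = qt at *
  generalize denom ε x = d at *
  field_simp
  linear_combination (m + 1) * q ^ m * heq + (d - ε ^ 2) * d * q ^ (m + 1) * hdiv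

/-- `∫ r² P^n / (r² + ε²)^(n+1)`, a regularization of `∫ (W_θ/r)^n`. -/
def regEnergy (ε : ℝ) (n : ℕ) (W : E3 → E3) : ℝ := ∫ x, regWeight ε x * regQuot ε W x ^ n

/-- The error made by the regularization. -/
def regDefect (ε : ℝ) (n : ℕ) (u W : E3 → E3) : ℝ :=
  ∫ x, ε ^ 2 * (denom ε x)⁻¹ ^ 2 * radial u x * regQuot ε W x ^ n

theorem bc_radial_div (hε : 0 < ε) {v : E3 → E3} (hv : BL2 v) :
    BL2 (fun x => ε ^ 2 * (denom ε x)⁻¹ ^ 2 * radial v x) := by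
  have c0 := bc_coord_div_denom hε (Or.inl rfl : (0 : Fin 3) = 0 ∨ _)
  have c1 := bc_coord_div_denom hε (Or.inr rfl : (1 : Fin 3) = 0 ∨ _)
  have ci := (BC.const (ε ^ 2)).mul (bc_inv_denom hε)
  refine ((BL2.mul_bc (ci.mul c0) (hv.coord 0)).add (BL2.mul_bc (ci.mul c1) (hv.coord 1))).congr
    fun x => ?_
  rw [radial]; ring

/-- The energy balance: after integration over `ℝ³` only the error term of the local balance law
remains. -/
theorem SwirlTransport.regEnergy_sub (h : SwirlTransport T κ u W Wt) (hε : 0 < ε) (k : ℕ) {t : ℝ}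
    (ht : t ∈ Icc 0 T) :
    IntervalIntegrable (fun τ => regDefect ε (k + 2) (u τ) (W τ)) volume 0 t ∧
    regEnergy ε (k + 2) (W t) - regEnergy ε (k + 2) (W 0) =
      2 * (k + 3 : ℕ) * ∫ τ in 0..t, regDefect ε (k + 2) (u τ) (W τ) := by
  have h0 : (0 : ℝ) ∈ Icc 0 T := ⟨le_rfl, ht.1.trans ht.2⟩
  have hq := h.hW.zero.regQuot hε
  have hqt := h.hWt.regQuot hε
  have hw := bc_regWeight hε
  have hsub : Icc 0 t ⊆ Icc 0 T := Icc_subset_Icc_right ht.2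
  -- the time derivative of the density
  set f' : ℝ → E3 → ℝ := fun τ x =>
    regWeight ε x * ((k + 1 + 1 : ℕ) * regQuot ε (W τ) x ^ (k + 1) * regQuot ε (Wt τ) x) with hf'
  have hA : BddL2 T (fun τ x => (regWeight ε x * (k + 1 + 1 : ℕ)) * regQuot ε (W τ) x ^ (k + 1)) :=
    BddL2.mul_bdd (hw.mul (BC.const _)).1 (hw.mul (BC.const _)).2 (hq.pow_succ k)
  have hf'e : ∀ τ x, f' τ x = (regWeight ε x * (k + 1 + 1 : ℕ)) * regQuot ε (W τ) x ^ (k + 1) *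
      regQuot ε (Wt τ) x := fun τ x => by simp only [hf']; ring
  have hcont : ContinuousOn (fun q : ℝ × E3 => f' q.1 q.2) (Icc 0 T ×ˢ univ) :=
    (hA.cont.mul hqt.cont).congr fun q _ => hf'e q.1 q.2
  obtain ⟨C, hC, hb⟩ := hA.lintegral_mul hqt
  obtain ⟨-, hi, hswap⟩ := integral_intervalIntegral_swap ht.1 (f := f')
    (hcont.mono (prod_mono_left hsub)) hC (fun τ hτ => by simp_rw [hf'e]; exact hb τ (hsub hτ))
  have hftc : ∀ x, ∫ τ in 0..t, f' τ x = regWeight ε x * regQuot ε (W t) x ^ (k + 2) -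
      regWeight ε x * regQuot ε (W 0) x ^ (k + 2) := by
    intro x
    refine intervalIntegral_deriv_eq_sub
      (f := fun τ => regWeight ε x * regQuot ε (W τ) x ^ (k + 2)) (fun τ hτ => ?_)
      (hcont.comp (f := fun τ : ℝ => (τ, x)) (by fun_prop) (fun τ hτ => ⟨hτ, mem_univ _⟩))
      le_rfl ht.1 ht.2
    have hd := h.dW τ hτ x
    have hdj : ∀ j : Fin 3, HasDerivWithinAt (fun s => W s x j) (Wt τ x j) (Icc 0 T) τ := fun j =>
      (EuclideanSpace.proj j : E3 →L[ℝ] ℝ).hasFDerivAt.comp_hasDerivWithinAt τ hd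
    have hqd : HasDerivWithinAt (fun s => regQuot ε (W s) x) (regQuot ε (Wt τ) x) (Icc 0 T) τ := by
      have := (((hdj 1).const_mul (x 0)).sub ((hdj 0).const_mul (x 1))).div_const (denom ε x)
      exact this
    exact ((hqd.fun_pow (k + 2)).const_mul (regWeight ε x))
  have hint : ∀ τ ∈ Icc 0 T, Integrable (fun x => regWeight ε x * regQuot ε (W τ) x ^ (k + 2)) := by
    intro τ hτ
    have := (BL2.mul_bc hw ((hq.pow_succ k).at_time hτ)).integrable_mul (hq.at_time hτ)
    refine this.congr (ae_of_all _ fun x => ?_)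
    ring
  have hfix : ∀ τ ∈ Icc 0 T, ∫ x, f' τ x = 2 * (k + 3 : ℕ) * regDefect ε (k + 2) (u τ) (W τ) := by
    intro τ hτ
    have hdW := h.hW.diff τ hτ
    have hdu := h.hu.diff τ hτ
    have dq := differentiable_regQuot hdW hε
    have dw := differentiable_regWeight hε
    have hqτ := hq.at_time hτ
    have hsq := fun i => BL2.sd_regQuot (h.hW.at_time hτ) hε i
    have hq1 := (hq.pow_succ k).at_time hτ
    have hu0 := fun i => (h.hu.at_time hτ).zero.coord i
    have hu1 := fun i => ((h.hu.at_time hτ).one i).coord i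
    have dui : ∀ i, Differentiable ℝ (fun y => u τ y i) := fun i x => differentiableAt_coord (hdu x) i
    have c0 := bc_coord_div_denom hε (Or.inl rfl : (0 : Fin 3) = 0 ∨ _)
    have c1 := bc_coord_div_denom hε (Or.inr rfl : (1 : Fin 3) = 0 ∨ _)
    have hsw : ∀ i, BC (sd i (regWeight ε)) := by
      intro i
      have hD : BC (fun x => sd i (denom ε) x * (denom ε x)⁻¹) := by
        simp_rw [sd_denom]
        fin_cases i
        · exact ((BC.const 2).mul c0).congr fun x => by simp; ring
        · exact ((BC.const 2).mul c1).congr fun x => by simp; ring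
        · exact (BC.const 0).congr fun x => by simp
      refine (((BC.const (ε ^ 2)).mul hD).mul (bc_inv_denom hε)).congr fun x => ?_
      rw [sd_regWeight hε]; ring
    -- the divergence terms integrate to zero
    have i1 : ∀ i, Integrable (fun y => regWeight ε y * regQuot ε (W τ) y ^ (k + 1 + 1) * u τ y i) := by
      intro i
      refine ((BL2.mul_bc hw hq1).integrable_mul (hqτ.mul (hu0 i))).congr (ae_of_all _ fun x => ?_)
      ring
    have d1 : ∀ i, Differentiable ℝ
        (fun y => regWeight ε y * regQuot ε (W τ) y ^ (k + 1 + 1) * u τ y i) := fun i =>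
      (dw.mul (dq.pow _)).mul (dui i)
    have i2 : ∀ i, Integrable
        (sd i (fun y => regWeight ε y * regQuot ε (W τ) y ^ (k + 1 + 1) * u τ y i)) := by
      intro i
      have a1 := (BL2.mul_bc (hsw i) hq1).integrable_mul (hqτ.mul (hu0 i))
      have a2 := (BL2.mul_bc ((BC.const (k + 1 + 1 : ℕ)).mul hw) hq1).integrable_mul
        ((hsq i).mul (hu0 i))
      have a3 := (BL2.mul_bc hw hq1).integrable_mul (hqτ.mul (hu1 i))
      refine ((a1.add a2).add a3).congr (ae_of_all _ fun x => ?_)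
      have k1 : DifferentiableAt ℝ (fun y => regQuot ε (W τ) y ^ (k + 1 + 1)) x := (dq x).pow _
      have k2 : DifferentiableAt ℝ (fun y => regWeight ε y * regQuot ε (W τ) y ^ (k + 1 + 1)) x :=
        (dw x).mul k1
      rw [sd_mul k2 (dui i x), sd_mul (dw x) k1, sd_pow _ (dq x), ← pdv_apply (hdu x)]
      simp only [Nat.add_sub_cancel, Pi.add_apply]
      ring
    have i3 : Integrable (fun y => regQuot ε (W τ) y ^ (k + 1 + 2)) := by
      refine (hq1.integrable_mul (hqτ.mul hqτ)).congr (ae_of_all _ fun x => ?_)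
      ring
    have i4 : Integrable (sd 2 (fun y => regQuot ε (W τ) y ^ (k + 1 + 2))) := by
      refine (((hq1.integrable_mul (hqτ.mul (hsq 2)))).const_mul ((k + 1 + 2 : ℕ) : ℝ)).congr
        (ae_of_all _ fun x => ?_)
      rw [sd_pow _ (dq x)]
      simp only [show k + 1 + 2 - 1 = k + 1 + 1 from rfl]
      ring
    have i5 : Integrable (fun x => ε ^ 2 * (denom ε x)⁻¹ ^ 2 * radial (u τ) x *
        regQuot ε (W τ) x ^ (k + 1 + 1)) := by
      refine ((bc_radial_div hε (h.hu.at_time hτ).zero).mul hq1 |>.integrable_mul hqτ).congr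
        (ae_of_all _ fun x => ?_)
      ring
    have z1 := integral_sum_sd_eq_zero d1 i1 i2
    have z2 := integral_sd_eq_zero 2 (dq.fun_pow _) i3 i4
    have hsumI : Integrable (fun x => - ∑ i, sd i
        (fun y => regWeight ε y * regQuot ε (W τ) y ^ (k + 1 + 1) * u τ y i) x) :=
      (integrable_finsetSum _ fun i _ => i2 i).neg
    simp only [hf']
    simp_rw [h.balance hε (k + 1) hτ]
    have hsI2 : Integrable (fun x => - (∑ i, sd i
        (fun y => regWeight ε y * regQuot ε (W τ) y ^ (k + 1 + 1) * u τ y i) x) +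
        2 * κ * (k + 1 + 1 : ℕ) / (k + 1 + 2 : ℕ) *
          sd 2 (fun y => regQuot ε (W τ) y ^ (k + 1 + 2)) x) := hsumI.add (i4.const_mul _)
    rw [integral_add hsI2 (i5.const_mul _), integral_add hsumI (i4.const_mul _), integral_neg, z1,
      integral_const_mul, z2, integral_const_mul, regDefect]
    simp only [neg_zero, mul_zero, zero_add]
  have hk : (2 * ((k + 3 : ℕ) : ℝ)) ≠ 0 := by positivity
  have hfix' : ∀ τ ∈ Icc 0 T, regDefect ε (k + 2) (u τ) (W τ) =
      (2 * ((k + 3 : ℕ) : ℝ))⁻¹ * ∫ x, f' τ x := fun τ hτ => by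
    rw [hfix τ hτ]; field_simp
  constructor
  · refine (hi.const_mul (2 * ((k + 3 : ℕ) : ℝ))⁻¹).congr fun τ hτ => ?_
    rw [uIoc_of_le ht.1] at hτ
    exact (hfix' τ (hsub (Ioc_subset_Icc_self hτ))).symm
  · rw [regEnergy, regEnergy, ← integral_sub (hint t ht) (hint 0 h0), ← intervalIntegral.integral_const_mul]
    simp_rw [← hftc]
    rw [hswap]
    refine intervalIntegral.integral_congr fun τ hτ => ?_
    rw [uIcc_of_le ht.1] at hτ
    exact hfix τ (hsub hτ)

/-- Gronwall's inequality in integral form. -/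
theorem le_mul_exp_of_le_integral {A C : ℝ} {E : ℝ → ℝ} (hE : ContinuousOn E (Icc 0 T))
    (hC : 0 ≤ C) (h : ∀ t ∈ Icc 0 T, E t ≤ A + C * ∫ τ in 0..t, E τ) {t : ℝ} (ht : t ∈ Icc 0 T) :
    E t ≤ A * Real.exp (C * t) := by
  set z : ℝ → ℝ := fun t => (A + C * ∫ τ in 0..t, E τ) * Real.exp (-(C * t)) with hz
  have hd : ∀ s ∈ Icc 0 T, HasDerivWithinAt z ((C * E s) * Real.exp (-(C * s)) +
      (A + C * ∫ τ in 0..s, E τ) * (Real.exp (-(C * s)) * -(C * 1))) (Icc 0 T) s := by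
    intro s hs
    have h1 := ((primitive_hasDerivWithinAt hE hs).const_mul C).const_add A
    have h2 := (((hasDerivAt_id s).const_mul C).neg.exp).hasDerivWithinAt (s := Icc 0 T)
    exact h1.mul h2
  have hanti : AntitoneOn z (Icc 0 T) := by
    refine antitoneOn_of_hasDerivWithinAt_nonpos (convex_Icc 0 T)
      (fun s hs => (hd s hs).continuousWithinAt)
      (fun s hs => (hd s (interior_subset hs)).mono interior_subset) fun s hs => ?_
    have h1 := h s (interior_subset hs)
    have h2 := Real.exp_pos (-(C * s))
    have h3 := mul_nonneg (mul_nonneg hC (sub_nonneg.2 h1)) h2.le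
    linarith
  have h0 := hanti ⟨le_rfl, ht.1.trans ht.2⟩ ht ht.1
  simp only [hz, intervalIntegral.integral_same, mul_zero, neg_zero, Real.exp_zero, add_zero,
    mul_one] at h0
  have h1 := h t ht
  rw [Real.exp_neg, ← div_eq_mul_inv, div_le_iff₀ (Real.exp_pos _)] at h0
  exact h1.trans h0

/-- The quotient `(W_θ/r)^n`; division by zero makes it vanish on the axis, a null set, if `n ≠ 0`. -/
def quotPow (n : ℕ) (W : E3 → E3) (x : E3) : ℝ := (swirl W x / (x 0 ^ 2 + x 1 ^ 2)) ^ n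

theorem swirl_eq_zero_of_axis {W : E3 → E3} {x : E3} (h : x 0 ^ 2 + x 1 ^ 2 = 0) :
    swirl W x = 0 ∧ radial W x = 0 := by
  have h0 : x 0 = 0 := by nlinarith [sq_nonneg (x 0), sq_nonneg (x 1)]
  have h1 : x 1 = 0 := by nlinarith [sq_nonneg (x 0), sq_nonneg (x 1)]
  simp [swirl, radial, h0, h1]

theorem regDensity_nonneg (hε : 0 < ε) {n : ℕ} (hn : Even n) (W : E3 → E3) (x : E3) :
    0 ≤ regWeight ε x * regQuot ε W x ^ n :=
  mul_nonneg (div_nonneg (by positivity) (denom_pos hε x).le) (hn.pow_nonneg _)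

theorem regDensity_le (hε : 0 < ε) {n : ℕ} (hn : Even n) (W : E3 → E3) (x : E3) :
    regWeight ε x * regQuot ε W x ^ n ≤ quotPow n W x := by
  have hd := denom_pos hε x
  have h1 : 0 ≤ quotPow n W x := hn.pow_nonneg _
  by_cases hr : x 0 ^ 2 + x 1 ^ 2 = 0
  · rw [regWeight, hr]; simpa using h1
  · have hr0 : 0 < x 0 ^ 2 + x 1 ^ 2 := lt_of_le_of_ne (by positivity) (Ne.symm hr)
    have hle : x 0 ^ 2 + x 1 ^ 2 ≤ denom ε x := by unfold denom; nlinarith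
    have hw : regWeight ε x ≤ 1 := (div_le_one hd).2 hle
    have hw0 : 0 ≤ regWeight ε x := div_nonneg hr0.le hd.le
    have e : regQuot ε W x ^ n = regWeight ε x ^ n * quotPow n W x := by
      rw [regQuot, regWeight, quotPow, ← mul_pow]; congr 1; field_simp
    rw [e, ← mul_assoc]
    exact mul_le_of_le_one_left h1 (mul_le_one₀ hw (pow_nonneg hw0 _) (pow_le_one₀ hw0 hw))

theorem tendsto_regDensity {n : ℕ} (hn : n ≠ 0) (W : E3 → E3) (x : E3) {e : ℕ → ℝ}
    (he : Tendsto e atTop (𝓝 0)) :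
    Tendsto (fun j => regWeight (e j) x * regQuot (e j) W x ^ n) atTop (𝓝 (quotPow n W x)) := by
  by_cases hr : x 0 ^ 2 + x 1 ^ 2 = 0
  · simp [regWeight, quotPow, hr, hn]
  · have hc : ContinuousAt (fun ε : ℝ => regWeight ε x * regQuot ε W x ^ n) 0 := by
      unfold regWeight regQuot denom
      fun_prop (disch := simpa using hr)
    have h0 : regWeight 0 x * regQuot 0 W x ^ n = quotPow n W x := by
      simp [regWeight, regQuot, quotPow, denom, hr]
    rw [← h0]
    exact hc.tendsto.comp he

theorem tendsto_regDefect_density {n : ℕ} (u W : E3 → E3) (x : E3) {e : ℕ → ℝ}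
    (he : Tendsto e atTop (𝓝 0)) :
    Tendsto (fun j => (e j) ^ 2 * (denom (e j) x)⁻¹ ^ 2 * radial u x * regQuot (e j) W x ^ n) atTop
      (𝓝 0) := by
  by_cases hr : x 0 ^ 2 + x 1 ^ 2 = 0
  · simp [(swirl_eq_zero_of_axis (W := u) hr).2]
  · have hc : ContinuousAt (fun ε : ℝ =>
        ε ^ 2 * (denom ε x)⁻¹ ^ 2 * radial u x * regQuot ε W x ^ n) 0 := by
      unfold regQuot denom
      fun_prop (disch := simpa using hr)
    have := hc.tendsto.comp he
    simpa using! this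

/-- The norms of `W_θ/r` in `Lⁿ`, `n` even, are at most the initial ones. No integrability of the
quotient at positive times is presupposed. -/
theorem SwirlTransport.lintegral_quotPow_le (h : SwirlTransport T κ u W Wt) {k : ℕ} (hk : Even k)
    {t : ℝ} (ht : t ∈ Icc 0 T) :
    ∫⁻ x, ENNReal.ofReal (quotPow (k + 2) (W t) x) ≤
      ∫⁻ x, ENNReal.ofReal (quotPow (k + 2) (W 0) x) := by
  have hn : Even (k + 2) := hk.add even_two
  by_cases hfin : ∫⁻ x, ENNReal.ofReal (quotPow (k + 2) (W 0) x) = ⊤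
  · rw [hfin]; exact le_top
  have h0T : (0 : ℝ) ∈ Icc 0 T := ⟨le_rfl, ht.1.trans ht.2⟩
  set L : ℝ → ℝ≥0∞ := fun τ => ∫⁻ x, ENNReal.ofReal (quotPow (k + 2) (W τ) x) with hL
  set A := (L 0).toReal with hA
  obtain ⟨M, hM, hrad⟩ := abs_radial_le h.hu h.u_even
  have hmeas : ∀ τ ∈ Icc 0 T, Measurable (quotPow (k + 2) (W τ)) := by
    intro τ hτ
    have h1 : Continuous (swirl (W τ)) := (differentiable_swirl (h.hW.diff τ hτ)).continuous
    have h2 : Continuous fun x : E3 => x 0 ^ 2 + x 1 ^ 2 := by fun_prop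
    exact (h1.measurable.div h2.measurable).pow_const _
  have hcont : ∀ ε > 0, ∀ τ ∈ Icc 0 T,
      Continuous (fun x => regWeight ε x * regQuot ε (W τ) x ^ (k + 2)) := fun ε hε τ hτ =>
    (bc_regWeight hε).1.mul (((h.hW.zero.regQuot hε).at_time hτ).cont.pow _)
  have hint : ∀ ε > 0, ∀ τ ∈ Icc 0 T,
      Integrable (fun x => regWeight ε x * regQuot ε (W τ) x ^ (k + 2)) := by
    intro ε hε τ hτ
    have hq := h.hW.zero.regQuot hε
    have := (BL2.mul_bc (bc_regWeight hε) ((hq.pow_succ k).at_time hτ)).integrable_mul (hq.at_time hτ)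
    refine this.congr (ae_of_all _ fun x => ?_)
    ring
  have hEL : ∀ ε > 0, ∀ τ ∈ Icc 0 T, ENNReal.ofReal (regEnergy ε (k + 2) (W τ)) =
      ∫⁻ x, ENNReal.ofReal (regWeight ε x * regQuot ε (W τ) x ^ (k + 2)) := fun ε hε τ hτ =>
    ofReal_integral_eq_lintegral_ofReal (hint ε hε τ hτ)
      (ae_of_all _ fun x => regDensity_nonneg hε hn _ x)
  have hE0 : ∀ ε > 0, ∀ τ, 0 ≤ regEnergy ε (k + 2) (W τ) := fun ε hε τ =>
    integral_nonneg fun x => regDensity_nonneg hε hn _ x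
  have hEA : ∀ ε > 0, regEnergy ε (k + 2) (W 0) ≤ A := by
    intro ε hε
    rw [hA, ← ENNReal.ofReal_le_iff_le_toReal hfin, hEL ε hε 0 h0T]
    exact lintegral_mono fun x => ENNReal.ofReal_le_ofReal (regDensity_le hε hn _ x)
  -- Fatou's lemma
  set e : ℕ → ℝ := fun j => 1 / ((j : ℝ) + 1) with he
  have hepos : ∀ j, 0 < e j := fun j => by positivity
  have hetend : Tendsto e atTop (𝓝 0) := tendsto_one_div_add_atTop_nhds_zero_nat
  have hfatou : ∀ τ ∈ Icc 0 T, ∀ (c : ℕ → ℝ) (c' : ℝ), Tendsto c atTop (𝓝 c') →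
      (∀ j, regEnergy (e j) (k + 2) (W τ) ≤ c j) → L τ ≤ ENNReal.ofReal c' := by
    intro τ hτ c c' hc hle
    have h1 : ∀ x, liminf (fun j => ENNReal.ofReal
        (regWeight (e j) x * regQuot (e j) (W τ) x ^ (k + 2))) atTop =
        ENNReal.ofReal (quotPow (k + 2) (W τ) x) := fun x =>
      (ENNReal.tendsto_ofReal (tendsto_regDensity (by omega) (W τ) x hetend)).liminf_eq
    calc L τ = ∫⁻ x, liminf (fun j => ENNReal.ofReal
            (regWeight (e j) x * regQuot (e j) (W τ) x ^ (k + 2))) atTop := by simp_rw [h1, hL]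
      _ ≤ liminf (fun j => ∫⁻ x, ENNReal.ofReal
            (regWeight (e j) x * regQuot (e j) (W τ) x ^ (k + 2))) atTop :=
          lintegral_liminf_le fun j => (hcont (e j) (hepos j) τ hτ).measurable.ennreal_ofReal
      _ ≤ liminf (fun j => ENNReal.ofReal (c j)) atTop := by
          refine liminf_le_liminf (Eventually.of_forall fun j => ?_)
          rw [← hEL _ (hepos j) τ hτ]
          exact ENNReal.ofReal_le_ofReal (hle j)
      _ = ENNReal.ofReal c' := (ENNReal.tendsto_ofReal hc).liminf_eq
  -- the defect is controlled by the energy, since `ε² |r u_r| / (r² + ε²)² ≤ M r² / (r² + ε²)`;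
  -- by Gronwall the energies, and with them the norms of the quotient, are bounded
  have hpt : ∀ ε > 0, ∀ τ ∈ Icc 0 T, ∀ x,
      ‖ε ^ 2 * (denom ε x)⁻¹ ^ 2 * radial (u τ) x * regQuot ε (W τ) x ^ (k + 2)‖ ≤
        M * (regWeight ε x * regQuot ε (W τ) x ^ (k + 2)) := by
    intro ε hε τ hτ x
    have hd := denom_pos hε x
    have h1 := hrad τ hτ x
    have h2 : ε ^ 2 * (denom ε x)⁻¹ ≤ 1 := by
      rw [← div_eq_mul_inv, div_le_one hd]; unfold denom; nlinarith [sq_nonneg (x 0), sq_nonneg (x 1)]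
    have h3 : 0 ≤ regQuot ε (W τ) x ^ (k + 2) := hn.pow_nonneg _
    rw [norm_mul, norm_mul, Real.norm_of_nonneg h3, Real.norm_of_nonneg (by positivity),
      Real.norm_eq_abs, ← mul_assoc]
    refine mul_le_mul_of_nonneg_right ?_ h3
    calc ε ^ 2 * (denom ε x)⁻¹ ^ 2 * |radial (u τ) x|
        = (ε ^ 2 * (denom ε x)⁻¹) * ((denom ε x)⁻¹ * |radial (u τ) x|) := by ring
      _ ≤ 1 * ((denom ε x)⁻¹ * (M * (x 0 ^ 2 + x 1 ^ 2))) := by gcongr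
      _ = M * regWeight ε x := by rw [regWeight]; ring
  have hdef : ∀ ε > 0, ∀ τ ∈ Icc 0 T,
      |regDefect ε (k + 2) (u τ) (W τ)| ≤ M * regEnergy ε (k + 2) (W τ) := by
    intro ε hε τ hτ
    rw [regDefect, regEnergy, ← integral_const_mul]
    exact norm_integral_le_of_norm_le ((hint ε hε τ hτ).const_mul M)
      (ae_of_all _ fun x => hpt ε hε τ hτ x)
  set C : ℝ := 2 * (k + 3 : ℕ) * M with hC
  set K := A * Real.exp (C * T) with hK
  have hA0 : 0 ≤ A := ENNReal.toReal_nonneg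
  have hC0 : 0 ≤ C := by positivity
  have hEK : ∀ ε > 0, ∀ τ ∈ Icc 0 T, regEnergy ε (k + 2) (W τ) ≤ K := by
    intro ε hε τ hτ
    have hcE : ContinuousOn (fun τ => regEnergy ε (k + 2) (W τ)) (Icc 0 T) := by
      have h1 := (h.regEnergy_sub hε k ⟨h0T.2, le_rfl⟩).1
      rw [intervalIntegrable_iff_integrableOn_Icc_of_le h0T.2] at h1
      have h2 := ((intervalIntegral.continuousOn_primitive_interval
        (by rwa [uIcc_of_le h0T.2])).const_smul (2 * ((k + 3 : ℕ) : ℝ))).add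
          (continuousOn_const (c := regEnergy ε (k + 2) (W 0)))
      rw [uIcc_of_le h0T.2] at h2
      refine h2.congr fun s hs => ?_
      have := (h.regEnergy_sub hε k hs).2
      simp only [Pi.smul_apply, smul_eq_mul, Pi.add_apply]
      linarith
    refine (le_mul_exp_of_le_integral (A := A) hcE hC0 (fun s hs => ?_) hτ).trans ?_
    · obtain ⟨hi, h1⟩ := h.regEnergy_sub hε k hs
      have h2 : ∫ σ in 0..s, regDefect ε (k + 2) (u σ) (W σ) ≤
          ∫ σ in 0..s, M * regEnergy ε (k + 2) (W σ) := by
        refine intervalIntegral.integral_mono_on hs.1 hi ?_ fun σ hσ =>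
          (le_abs_self _).trans (hdef ε hε σ ⟨hσ.1, hσ.2.trans hs.2⟩)
        refine ContinuousOn.intervalIntegrable ?_
        rw [uIcc_of_le hs.1]
        exact (hcE.mono (Icc_subset_Icc_right hs.2)).const_smul M
      rw [intervalIntegral.integral_const_mul] at h2
      have h3 := hEA ε hε
      have h4 := mul_le_mul_of_nonneg_left h2 (by positivity : (0 : ℝ) ≤ 2 * (k + 3 : ℕ))
      rw [hC]; linarith
    · rw [hK]; gcongr; exact hτ.2
  have hLK : ∀ τ ∈ Icc 0 T, L τ < ⊤ := fun τ hτ =>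
    (hfatou τ hτ (fun _ => K) K tendsto_const_nhds fun j => hEK _ (hepos j) τ hτ).trans_lt
      ENNReal.ofReal_lt_top
  -- with this bound as a majorant, the defect vanishes in the limit, and no growth is left
  have hD0 : ∀ τ ∈ Icc 0 T,
      Tendsto (fun j => regDefect (e j) (k + 2) (u τ) (W τ)) atTop (𝓝 0) := by
    intro τ hτ
    have hgi : Integrable (quotPow (k + 2) (W τ)) :=
      ⟨(hmeas τ hτ).aestronglyMeasurable, by
        have hq0 : 0 ≤ᵐ[volume] quotPow (k + 2) (W τ) := ae_of_all _ fun x => hn.pow_nonneg _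
        rw [hasFiniteIntegral_iff_ofReal hq0]
        exact hLK τ hτ⟩
    have := tendsto_integral_of_dominated_convergence (F := fun j x =>
      (e j) ^ 2 * (denom (e j) x)⁻¹ ^ 2 * radial (u τ) x * regQuot (e j) (W τ) x ^ (k + 2))
      (f := fun _ => (0 : ℝ)) (bound := fun x => M * quotPow (k + 2) (W τ) x) (fun j => ?_)
      (hgi.const_mul M) (fun j => ae_of_all _ fun x => ?_)
      (ae_of_all _ fun x => tendsto_regDefect_density _ _ x hetend)
    · rw [integral_zero] at this; exact this
    · have h1 := (bc_radial_div (hepos j) (h.hu.at_time hτ).zero).cont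
      exact (h1.mul (((h.hW.zero.regQuot (hepos j)).at_time hτ).cont.pow _)).aestronglyMeasurable
    · exact (hpt _ (hepos j) τ hτ x).trans
        (mul_le_mul_of_nonneg_left (regDensity_le (hepos j) hn _ x) hM)
  have hI0 : Tendsto (fun j => ∫ τ in 0..t, regDefect (e j) (k + 2) (u τ) (W τ)) atTop (𝓝 0) := by
    have hIoc : ∀ τ ∈ Set.uIoc 0 t, τ ∈ Icc 0 T := fun τ hτ => by
      rw [uIoc_of_le ht.1] at hτ; exact ⟨hτ.1.le, hτ.2.trans ht.2⟩
    have := intervalIntegral.tendsto_integral_filter_of_dominated_convergence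
      (l := atTop) (μ := volume) (a := 0) (b := t)
      (F := fun j τ => regDefect (e j) (k + 2) (u τ) (W τ)) (f := fun _ => (0 : ℝ))
      (fun _ => M * K)
      (Eventually.of_forall fun j => by
        have := (h.regEnergy_sub (hepos j) k ht).1
        rw [uIoc_of_le ht.1]; exact this.1.aestronglyMeasurable)
      (Eventually.of_forall fun j => ae_of_all _ fun τ hτ =>
        (hdef _ (hepos j) τ (hIoc τ hτ)).trans
          (mul_le_mul_of_nonneg_left (hEK _ (hepos j) τ (hIoc τ hτ)) hM))
      (by simp) (ae_of_all _ fun τ hτ => hD0 τ (hIoc τ hτ))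
    simpa using! this
  have hlim : Tendsto (fun j => A + 2 * (k + 3 : ℕ) *
      ∫ τ in 0..t, regDefect (e j) (k + 2) (u τ) (W τ)) atTop (𝓝 A) := by
    simpa using! (hI0.const_mul (2 * ((k + 3 : ℕ) : ℝ))).const_add A
  refine (hfatou t ht _ A hlim fun j => ?_).trans_eq (ENNReal.ofReal_toReal hfin)
  have h1 := (h.regEnergy_sub (hepos j) k ht).2
  have h2 := hEA _ (hepos j)
  linarith

end Energy

/-! ### The axial velocity gradient on the axis -/

/-- Differentiable functions, bounded with their partial derivatives. -/
structure BCD (p : E3 → ℝ) : Prop where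
  diff : Differentiable ℝ p
  bc : BC p
  one : ∀ i, BC (sd i p)

/-- Differentiable functions, bounded and square integrable with their partial derivatives. -/
structure ScalarW1 (w : E3 → ℝ) : Prop where
  diff : Differentiable ℝ w
  zero : BL2 w
  one : ∀ i, BL2 (sd i w)

/-- Differentiable functions, integrable with their partial derivatives. -/
structure ScalarW11 (f : E3 → ℝ) : Prop where
  diff : Differentiable ℝ f
  zero : Integrable f
  one : ∀ i, Integrable (sd i f)

theorem BC.add {f g : E3 → ℝ} (hf : BC f) (hg : BC g) : BC (fun x => f x + g x) :=
  (hf.sub ((BC.const (-1)).mul hg)).congr fun x => by ring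

theorem BCD.mul {p q : E3 → ℝ} (hp : BCD p) (hq : BCD q) : BCD (fun x => p x * q x) :=
  ⟨hp.diff.mul hq.diff, hp.bc.mul hq.bc, fun i =>
    ((hp.bc.mul (hq.one i)).add ((hp.one i).mul hq.bc)).congr fun x => sd_mul (hp.diff x) (hq.diff x)⟩

theorem BCD.sub {p q : E3 → ℝ} (hp : BCD p) (hq : BCD q) : BCD (fun x => p x - q x) :=
  ⟨hp.diff.sub hq.diff, hp.bc.sub hq.bc, fun i =>
    ((hp.one i).sub (hq.one i)).congr fun x => sd_sub (hp.diff x) (hq.diff x)⟩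

theorem BCD.const (c : ℝ) : BCD (fun _ => c) :=
  ⟨differentiable_const c, BC.const c, fun _ => (BC.const 0).congr fun _ => sd_const c⟩

theorem ScalarW1.bcd_mul {p w : E3 → ℝ} (hp : BCD p) (hw : ScalarW1 w) :
    ScalarW1 (fun x => p x * w x) :=
  ⟨hp.diff.mul hw.diff, BL2.mul_bc hp.bc hw.zero, fun i =>
    ((BL2.mul_bc hp.bc (hw.one i)).add (BL2.mul_bc (hp.one i) hw.zero)).congr fun x =>
      sd_mul (hp.diff x) (hw.diff x)⟩

theorem ScalarW1.mul {w g : E3 → ℝ} (hw : ScalarW1 w) (hg : ScalarW1 g) :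
    ScalarW11 (fun x => w x * g x) :=
  ⟨hw.diff.mul hg.diff, hw.zero.integrable_mul hg.zero, fun i =>
    ((hw.zero.integrable_mul (hg.one i)).add ((hw.one i).integrable_mul hg.zero)).congr
      (ae_of_all _ fun x => (sd_mul (hw.diff x) (hg.diff x)).symm)⟩

theorem ScalarW11.add {f g : E3 → ℝ} (hf : ScalarW11 f) (hg : ScalarW11 g) :
    ScalarW11 (fun x => f x + g x) :=
  ⟨hf.diff.add hg.diff, hf.zero.add hg.zero, fun i => ((hf.one i).add (hg.one i)).congr
    (ae_of_all _ fun x => (sd_add (hf.diff x) (hg.diff x)).symm)⟩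

theorem ScalarW11.neg {f : E3 → ℝ} (hf : ScalarW11 f) : ScalarW11 (fun x => - f x) :=
  ⟨hf.diff.neg, hf.zero.neg, fun i => (hf.one i).neg.congr (ae_of_all _ fun _ => sd_neg.symm)⟩

theorem ScalarW11.sub {f g : E3 → ℝ} (hf : ScalarW11 f) (hg : ScalarW11 g) :
    ScalarW11 (fun x => f x - g x) :=
  ⟨hf.diff.sub hg.diff, hf.zero.sub hg.zero, fun i => ((hf.one i).sub (hg.one i)).congr
    (ae_of_all _ fun x => (sd_sub (hf.diff x) (hg.diff x)).symm)⟩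

theorem W1.scalar {u : E3 → E3} (hu : W1 u) (j : Fin 3) : ScalarW1 (fun x => u x j) :=
  ⟨fun x => differentiableAt_coord (hu.diff x) j, hu.zero.coord j, fun i =>
    ((hu.one i).coord j).congr fun x => (pdv_apply (hu.diff x) i j).symm⟩

/-- The regularized inverse distance `(|x - y|² + ε²)^(-1/2)`. -/
def invDist (ε : ℝ) (y x : E3) : ℝ :=
  (√((x 0 - y 0) ^ 2 + (x 1 - y 1) ^ 2 + (x 2 - y 2) ^ 2 + ε ^ 2))⁻¹

theorem norm_sub_sq_eq (x y : E3) :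
    ‖x - y‖ ^ 2 = (x 0 - y 0) ^ 2 + (x 1 - y 1) ^ 2 + (x 2 - y 2) ^ 2 := by
  rw [EuclideanSpace.norm_sq_eq]
  simp [Fin.sum_univ_three]

section Kernel
variable {ε : ℝ} (hε : 0 < ε) (y : E3)
include hε

theorem invDist_pos (x : E3) : 0 < invDist ε y x := by
  unfold invDist; positivity

theorem invDist_sq (x : E3) : invDist ε y x ^ 2 *
    ((x 0 - y 0) ^ 2 + (x 1 - y 1) ^ 2 + (x 2 - y 2) ^ 2 + ε ^ 2) = 1 := by
  rw [invDist, inv_pow, Real.sq_sqrt (by positivity)]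
  exact inv_mul_cancel₀ (by positivity)

theorem differentiable_invDist : Differentiable ℝ (invDist ε y) := by
  intro x
  unfold invDist
  have h : (x 0 - y 0) ^ 2 + (x 1 - y 1) ^ 2 + (x 2 - y 2) ^ 2 + ε ^ 2 ≠ 0 := by positivity
  have h2 : √((x 0 - y 0) ^ 2 + (x 1 - y 1) ^ 2 + (x 2 - y 2) ^ 2 + ε ^ 2) ≠ 0 := by positivity
  exact DifferentiableAt.inv (DifferentiableAt.sqrt (by fun_prop) h) h2

theorem sd_invDist (i : Fin 3) (x : E3) :
    sd i (invDist ε y) x = - (x i - y i) * invDist ε y x ^ 3 := by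
  set N : E3 → ℝ := fun x => (x 0 - y 0) ^ 2 + (x 1 - y 1) ^ 2 + (x 2 - y 2) ^ 2 + ε ^ 2 with hN
  have hN0 : N x ≠ 0 := by simp only [hN]; positivity
  have hs0 : √(N x) ≠ 0 := by simp only [hN]; positivity
  have hNd : DifferentiableAt ℝ N x := by simp only [hN]; fun_prop
  have h1 : sd i N x = 2 * (x i - y i) := by
    simp only [hN]
    simp (disch := fun_prop) only [sd_add, sd_sub, sd_pow, sd_coord, sd_const]
    fin_cases i <;> simp
  have h2 : sd i (fun x => √(N x)) x = (x i - y i) * (√(N x))⁻¹ := by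
    have h3 : fderiv ℝ (fun x => √(N x)) x = _ := (hNd.hasFDerivAt.sqrt hN0).fderiv
    rw [sd, h3]
    change (1 / (2 * √(N x))) * sd i N x = _
    rw [h1]; field_simp
  have h4 : sd i (fun x => (√(N x))⁻¹) x = _ := sd_inv i (hNd.sqrt hN0) hs0
  change sd i (fun x => (√(N x))⁻¹) x = - (x i - y i) * (√(N x))⁻¹ ^ 3
  rw [h4, h2]
  field_simp

theorem abs_coord_mul_invDist_le (j : Fin 3) (x : E3) : |(x j - y j) * invDist ε y x| ≤ 1 := by
  rw [← sq_le_one_iff_abs_le_one, mul_pow, mul_comm]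
  refine le_trans ?_ (invDist_sq hε y x).le
  gcongr
  fin_cases j <;> simp <;> nlinarith [sq_nonneg (x 0 - y 0), sq_nonneg (x 1 - y 1),
    sq_nonneg (x 2 - y 2), sq_nonneg ε]

theorem invDist_le (x : E3) : invDist ε y x ≤ ε⁻¹ := by
  unfold invDist
  refine inv_anti₀ hε (Real.le_sqrt_of_sq_le ?_)
  nlinarith [sq_nonneg (x 0 - y 0), sq_nonneg (x 1 - y 1), sq_nonneg (x 2 - y 2)]

theorem bc_invDist : BC (invDist ε y) :=
  ⟨(differentiable_invDist hε y).continuous, ε⁻¹, fun x => by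
    rw [Real.norm_of_nonneg (invDist_pos hε y x).le]; exact invDist_le hε y x⟩

theorem bc_coord_mul_invDist (j : Fin 3) : BC (fun x => (x j - y j) * invDist ε y x) :=
  ⟨(by fun_prop : Continuous fun x : E3 => x j - y j).mul (differentiable_invDist hε y).continuous,
    1, fun x => abs_coord_mul_invDist_le hε y j x⟩

theorem bcd_invDist : BCD (invDist ε y) :=
  ⟨differentiable_invDist hε y, bc_invDist hε y, fun i =>
    ((BC.const (-1)).mul ((bc_coord_mul_invDist hε y i).mul
      ((bc_invDist hε y).mul (bc_invDist hε y)))).congr fun x => by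
        rw [sd_invDist hε]; ring⟩

theorem bcd_coord_mul_invDist (j : Fin 3) : BCD (fun x => (x j - y j) * invDist ε y x) := by
  refine ⟨(by fun_prop : Differentiable ℝ fun x : E3 => x j - y j).mul (differentiable_invDist hε y),
    bc_coord_mul_invDist hε y j, fun i => ?_⟩
  refine (((BC.const (if i = j then 1 else 0)).mul (bc_invDist hε y)).sub
    ((bc_coord_mul_invDist hε y j).mul ((bc_coord_mul_invDist hε y i).mul
      (bc_invDist hε y)))).congr fun x => ?_
  rw [sd_mul (by fun_prop) (differentiable_invDist hε y x), sd_invDist hε,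
    sd_sub (by fun_prop) (by fun_prop), sd_coord, sd_const]
  ring

theorem bl2_invDist_pow : BL2 (fun x => invDist ε y x ^ 3) := by
  have hc := (differentiable_invDist hε y).continuous
  refine ⟨hc.pow 3, ⟨ε⁻¹ ^ 3, fun x => ?_⟩, ?_⟩
  · rw [norm_pow, Real.norm_of_nonneg (invDist_pos hε y x).le]
    exact pow_le_pow_left₀ (invDist_pos hε y x).le (invDist_le hε y x) 3
  · refine (memLp_two_iff_integrable_sq (f := fun x => invDist ε y x ^ 3)
      (hc.pow 3).aestronglyMeasurable).2 ?_
    have h1 : Integrable (fun x : E3 => ((1 : ℝ) + ‖x‖ ^ 2) ^ (-(6 : ℝ) / 2)) :=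
      integrable_rpow_neg_one_add_norm_sq (by simp; norm_num)
    refine ((h1.comp_sub_right y).const_mul ((1 + (ε ^ 2)⁻¹) ^ 3)).mono'
      ((hc.pow 3).pow 2).aestronglyMeasurable (ae_of_all _ fun x => ?_)
    have hs := norm_sub_sq_eq x y
    have hN := invDist_sq hε y x
    rw [← hs] at hN
    set s := ‖x - y‖ ^ 2 with hsdef
    have hs0 : 0 ≤ s := by positivity
    have e : ((1 : ℝ) + s) ^ (-(6 : ℝ) / 2) = ((1 + s)⁻¹) ^ 3 := by
      rw [show (-(6 : ℝ) / 2) = -((3 : ℕ) : ℝ) by norm_num, Real.rpow_neg (by positivity),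
        Real.rpow_natCast, inv_pow]
    rw [e, ← mul_pow, Real.norm_of_nonneg (by have := invDist_pos hε y x; positivity), ← pow_mul,
      mul_comm 3 2, pow_mul]
    refine pow_le_pow_left₀ (by positivity) ?_ 3
    rw [← div_eq_mul_inv, le_div_iff₀ (by positivity)]
    have h2 : 1 + s ≤ (1 + (ε ^ 2)⁻¹) * (s + ε ^ 2) := by
      have : (1 + (ε ^ 2)⁻¹) * (s + ε ^ 2) = 1 + s + (ε ^ 2 + s * (ε ^ 2)⁻¹) := by
        field_simp; ring
      rw [this]
      have : 0 ≤ ε ^ 2 + s * (ε ^ 2)⁻¹ := by positivity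
      linarith
    calc invDist ε y x ^ 2 * (1 + s) ≤ invDist ε y x ^ 2 * ((1 + (ε ^ 2)⁻¹) * (s + ε ^ 2)) := by
          gcongr
      _ = (1 + (ε ^ 2)⁻¹) * (invDist ε y x ^ 2 * (s + ε ^ 2)) := by ring
      _ = _ := by rw [hN, mul_one]

theorem scalarW1_invDist_pow : ScalarW1 (fun x => invDist ε y x ^ 3) := by
  refine ⟨(differentiable_invDist hε y).fun_pow 3, bl2_invDist_pow hε y, fun i => ?_⟩
  refine (BL2.mul_bc ((BC.const (-3)).mul ((bc_coord_mul_invDist hε y i).mul (bc_invDist hε y)))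
    (bl2_invDist_pow hε y)).congr fun x => ?_
  rw [sd_pow 3 (differentiable_invDist hε y x), sd_invDist hε]
  push_cast
  ring

/-- The Biot–Savart formula for `∂_z u_z` at a point `y` of the axis, regularized at the scale `ε`.
With `ρ = (|x - y|² + ε²)^(-1/2)`, the curl of the vector potential `(x₂ - y₂) ρ⁵ (-x₁, x₀, 0)` is
a gradient, which is orthogonal to `u`, plus `-∂_z(ε² ρ⁵) e_z`. -/
theorem biotSavart_axis_identity {u : E3 → E3} (hu : W1 u) (hdiv : ∀ x, divergence u x = 0)
    (hy0 : y 0 = 0) (hy1 : y 1 = 0) :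
    Integrable (fun x => (x 2 - y 2) * invDist ε y x ^ 5 * swirl (curl u) x) ∧
    ∫ x, ε ^ 2 * invDist ε y x ^ 5 * pdv 2 u x 2 =
      ∫ x, (x 2 - y 2) * invDist ε y x ^ 5 * swirl (curl u) x := by
  have hρ := bcd_invDist hε y
  have hX := bcd_coord_mul_invDist hε y
  have hw3 := scalarW1_invDist_pow hε y
  -- the components of the vector potential, the potential of the gradient, and the factor `ε² ρ⁵`
  have hw := fun j => ScalarW1.bcd_mul ((hX 2).mul (hX j)) hw3
  have hφ := ScalarW1.bcd_mul (((hX 2).mul (hX 2)).sub (BCD.const (1 / 3))) hw3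
  have he := ScalarW1.bcd_mul ((BCD.const (ε ^ 2)).mul (hρ.mul hρ)) hw3
  have hU := hu.scalar
  have g0 := (((hw 0).mul (hU 2)).neg).sub (hφ.mul (hU 0))
  have g1 := (((hw 1).mul (hU 2)).neg).sub (hφ.mul (hU 1))
  have g2 := ((((hw 0).mul (hU 0)).add ((hw 1).mul (hU 1))).sub (hφ.mul (hU 2))).sub (he.mul (hU 2))
  have z0 := integral_sd_eq_zero 0 g0.diff g0.zero (g0.one 0)
  have z1 := integral_sd_eq_zero 1 g1.diff g1.zero (g1.one 1)
  have z2 := integral_sd_eq_zero 2 g2.diff g2.zero (g2.one 2)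
  have hzero := integral_add (f := fun x => _ + _) ((g0.one 0).add (g1.one 1)) (g2.one 2)
  rw [integral_add (g0.one 0) (g1.one 1), z0, z1, z2] at hzero
  have hcl : ∀ x, ∀ i j : Fin 3, pdv i u x j = sd i (fun y => u y j) x := fun x i j =>
    pdv_apply (hu.diff x) i j
  have hI1 : Integrable (fun x => (x 2 - y 2) * invDist ε y x ^ 5 * swirl (curl u) x) := by
    have a := fun i j => (hu.one i).coord j
    refine (((hw 0).zero.integrable_mul ((a 2 0).sub (a 0 2))).sub
      ((hw 1).zero.integrable_mul ((a 1 2).sub (a 2 1)))).congr (ae_of_all _ fun x => ?_)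
    simp only [Pi.sub_apply, swirl, curl_zero_apply, curl_one_apply, pd_eq_pdv, hy0, hy1]
    ring
  have hI2 : Integrable (fun x => ε ^ 2 * invDist ε y x ^ 5 * pdv 2 u x 2) := by
    refine (he.zero.integrable_mul ((hu.one 2).coord 2)).congr (ae_of_all _ fun x => ?_)
    simp only
    ring
  refine ⟨hI1, ?_⟩
  rw [← sub_eq_zero, ← integral_sub hI2 hI1, ← neg_eq_zero, ← integral_neg]
  refine Eq.trans (integral_congr_ae (ae_of_all _ fun x => ?_)) (hzero.trans (by norm_num))
  have hN := invDist_sq hε y x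
  have hd := hdiv x
  simp only [divergence, pd_eq_pdv, Fin.sum_univ_three, hcl] at hd
  have dρ := (differentiable_invDist hε y) x
  have du : ∀ j, DifferentiableAt ℝ (fun z => u z j) x := fun j => (hU j).diff x
  have d3 : DifferentiableAt ℝ (fun z => invDist ε y z ^ 3) x := dρ.fun_pow 3
  have dx : ∀ j : Fin 3, DifferentiableAt ℝ (fun z => (z j - y j) * invDist ε y z) x := fun j =>
    (hX j).diff x
  have dφ : DifferentiableAt ℝ (fun z => ((z 2 - y 2) * invDist ε y z *
      ((z 2 - y 2) * invDist ε y z) - 1 / 3) * invDist ε y z ^ 3) x := hφ.diff x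
  have dw : ∀ j : Fin 3, DifferentiableAt ℝ (fun z => (z 2 - y 2) * invDist ε y z *
      ((z j - y j) * invDist ε y z) * invDist ε y z ^ 3) x := fun j => (hw j).diff x
  have de : DifferentiableAt ℝ (fun z => ε ^ 2 * (invDist ε y z * invDist ε y z) *
      invDist ε y z ^ 3) x := he.diff x
  simp only [swirl, curl_zero_apply, curl_one_apply, pd_eq_pdv, hcl]
  simp (disch := fun_prop) only [sd_sub, sd_add, sd_neg, sd_mul, sd_pow, sd_coord, sd_const,
    sd_invDist hε]
  simp [hy0, hy1]
  simp only [hy0, hy1, sub_zero] at hN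
  generalize invDist ε y x = ρ at *
  linear_combination (-5 * (x 2 - y 2) * ρ ^ 5 * u x 2) * hN +
    ((x 2 - y 2) ^ 2 * ρ ^ 5 - ρ ^ 3 / 3) * hd

/-- Pointwise bound of the Biot–Savart integrand. The kernel acting on `ω_θ/r` is at most `|x - y|⁻²`,
which is in `L^(4/3)` near `y` and in `L²` at infinity; Young's inequality pairs it with the fourth
and the second power of `ω_θ/r`. -/
theorem abs_kernel_le (hy0 : y 0 = 0) (hy1 : y 1 = 0) (W : E3 → E3) (x : E3) :
    |(x 2 - y 2) * invDist ε y x ^ 5 * swirl W x| ≤ quotPow 2 W x + quotPow 4 W x +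
      ((Metric.ball 0 1).indicator (fun z : E3 => ‖z‖ ^ (-(8 / 3) : ℝ)) (x - y) +
        16 * (1 + ‖x - y‖) ^ (-4 : ℝ)) := by
  have hn2 : 0 ≤ quotPow 2 W x := by unfold quotPow; positivity
  have hn4 : 0 ≤ quotPow 4 W x := by unfold quotPow; positivity
  have hi : 0 ≤ (Metric.ball 0 1).indicator (fun z : E3 => ‖z‖ ^ (-(8 / 3) : ℝ)) (x - y) :=
    indicator_nonneg (fun z _ => by positivity) _
  have hj : 0 ≤ 16 * (1 + ‖x - y‖) ^ (-4 : ℝ) := by positivity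
  by_cases hr : x 0 ^ 2 + x 1 ^ 2 = 0
  · rw [(swirl_eq_zero_of_axis hr).1, mul_zero, abs_zero]; positivity
  have hr0 : 0 < x 0 ^ 2 + x 1 ^ 2 := lt_of_le_of_ne (by positivity) (Ne.symm hr)
  have hs := norm_sub_sq_eq x y
  have hN := invDist_sq hε y x
  have hρ := invDist_pos hε y x
  set a := |swirl W x / (x 0 ^ 2 + x 1 ^ 2)| with ha
  have ha0 : 0 ≤ a := abs_nonneg _
  have q2 : quotPow 2 W x = a ^ 2 := (sq_abs _).symm
  have q4 : quotPow 4 W x = a ^ 4 := by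
    rw [ha, show (4 : ℕ) = 2 * 2 from rfl, pow_mul, sq_abs, ← pow_mul]; rfl
  have hs0 : 0 < ‖x - y‖ := by
    rw [norm_pos_iff]; intro h
    have h0 := congrArg (fun z : E3 => z 0) h
    have h1 := congrArg (fun z : E3 => z 1) h
    simp [hy0, hy1] at h0 h1
    simp [h0, h1] at hr
  have hk : |(x 2 - y 2) * invDist ε y x ^ 5 * swirl W x| ≤ (‖x - y‖ ^ 2)⁻¹ * a := by
    have e : (x 2 - y 2) * invDist ε y x ^ 5 * swirl W x = invDist ε y x ^ 2 *
        (((x 2 - y 2) * invDist ε y x) * (invDist ε y x ^ 2 * (x 0 ^ 2 + x 1 ^ 2)) *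
          (swirl W x / (x 0 ^ 2 + x 1 ^ 2))) := by field_simp
    have h1 := abs_coord_mul_invDist_le hε y 2 x
    have h2 : |invDist ε y x ^ 2 * (x 0 ^ 2 + x 1 ^ 2)| ≤ 1 := by
      rw [abs_of_nonneg (by positivity)]
      refine le_trans ?_ hN.le
      rw [hy0, hy1, sub_zero, sub_zero]
      exact mul_le_mul_of_nonneg_left (by linarith [sq_nonneg (x 2 - y 2), sq_nonneg ε])
        (by positivity)
    have h3 : invDist ε y x ^ 2 ≤ (‖x - y‖ ^ 2)⁻¹ := by
      rw [le_inv_comm₀ (by positivity) (by positivity), hs]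
      rw [← mul_comm, ← eq_div_iff (by positivity)] at hN
      rw [← one_div, ← hN]
      linarith [sq_nonneg ε]
    rw [e, abs_mul, abs_of_nonneg (by positivity : 0 ≤ invDist ε y x ^ 2)]
    refine mul_le_mul h3 ?_ (abs_nonneg _) (by positivity)
    rw [abs_mul, abs_mul]
    exact mul_le_of_le_one_left ha0 (mul_le_one₀ h1 (abs_nonneg _) h2)
  refine hk.trans ?_
  rw [q2, q4]
  by_cases hlt : ‖x - y‖ < 1
  · rw [indicator_of_mem (by simpa using hlt)]
    -- Young's inequality with exponents `4` and `4/3`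
    set c := ‖x - y‖ ^ (-(2 / 3) : ℝ) with hc
    have hc0 : 0 < c := by positivity
    have c3 : (‖x - y‖ ^ 2)⁻¹ = c ^ 3 := by
      rw [hc, ← Real.rpow_natCast, ← Real.rpow_natCast, ← Real.rpow_mul hs0.le,
        ← Real.rpow_neg hs0.le]
      norm_num
    have c4 : ‖x - y‖ ^ (-(8 / 3) : ℝ) = c ^ 4 := by
      rw [hc, ← Real.rpow_natCast, ← Real.rpow_mul hs0.le]; norm_num
    rw [c3, c4]
    have : c ^ 3 * a ≤ a ^ 4 + c ^ 4 := by
      rcases le_total a c with h | h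
      · have := mul_le_mul_of_nonneg_left h (by positivity : 0 ≤ c ^ 3)
        nlinarith [pow_nonneg ha0 4]
      · have := mul_le_mul_of_nonneg_right (pow_le_pow_left₀ hc0.le h 3) ha0
        nlinarith [pow_pos hc0 4]
    nlinarith [sq_nonneg a]
  · rw [not_lt] at hlt
    have h4 : ((‖x - y‖ ^ 2)⁻¹) ^ 2 ≤ 16 * (1 + ‖x - y‖) ^ (-4 : ℝ) := by
      rw [show (-4 : ℝ) = -((4 : ℕ) : ℝ) by norm_num, Real.rpow_neg (by positivity),
        Real.rpow_natCast, ← inv_pow, ← pow_mul, ← div_eq_mul_inv, le_div_iff₀ (by positivity),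
        inv_pow, inv_mul_le_iff₀ (by positivity)]
      have : (1 + ‖x - y‖) ^ 4 ≤ (2 * ‖x - y‖) ^ 4 :=
        pow_le_pow_left₀ (by positivity) (by linarith) 4
      rw [mul_pow] at this
      norm_num at this ⊢
      linarith
    generalize (‖x - y‖ ^ 2)⁻¹ = k at h4 ⊢
    have h5 : k * a ≤ a ^ 2 + k ^ 2 := by
      nlinarith [sq_nonneg (k - a), sq_nonneg k, sq_nonneg a]
    have h6 := pow_nonneg ha0 4
    linarith

end Kernel

/-- `8/3 < 3` makes the singularity integrable, `4 > 3` the tail. -/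
theorem integrable_kernel_majorant : Integrable (fun z : E3 =>
    (Metric.ball 0 1).indicator (fun z : E3 => ‖z‖ ^ (-(8 / 3) : ℝ)) z +
      16 * (1 + ‖z‖) ^ (-4 : ℝ)) := by
  have h3 : Module.finrank ℝ E3 = 3 := by simp
  refine Integrable.add ?_ ((integrable_one_add_norm (by rw [h3]; norm_num)).const_mul 16)
  rw [integrable_indicator_iff Metric.isOpen_ball.measurableSet]
  have hm : Measurable fun z : E3 => ‖z‖ ^ (-(8 / 3) : ℝ) := by fun_prop
  refine integrableOn_ball_of_norm_le_rpow (by rw [h3]; norm_num) (C := 1) (α := 8 / 3)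
    (by rw [h3]; norm_num) (ae_of_all _ fun z => ?_) hm.aestronglyMeasurable
  rw [one_mul, Real.norm_of_nonneg (by positivity)]

theorem integrable_invDist_pow_five : Integrable fun v : E3 => invDist 1 0 v ^ 5 := by
  have h1 : Integrable (fun v : E3 => ((1 : ℝ) + ‖v‖ ^ 2) ^ (-(5 : ℝ) / 2)) :=
    integrable_rpow_neg_one_add_norm_sq (by simp; norm_num)
  refine h1.congr (ae_of_all _ fun v => ?_)
  have hs := norm_sub_sq_eq v 0
  rw [sub_zero] at hs
  have e1 : invDist 1 0 v = ((1 : ℝ) + ‖v‖ ^ 2) ^ (-(1 / 2) : ℝ) := by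
    rw [invDist, ← hs, one_pow, add_comm, Real.sqrt_eq_rpow, Real.rpow_neg (by positivity)]
  change _ = invDist 1 0 v ^ 5
  rw [e1, ← Real.rpow_natCast, ← Real.rpow_mul (by positivity)]
  norm_num

/-- Regularized kernels `ε² (|x - y|² + ε²)^(-5/2)` are an approximate identity, up to a factor. -/
theorem tendsto_integral_kernel {g : E3 → ℝ} (hg : BC g) (y : E3) {e : ℕ → ℝ} (he0 : ∀ j, 0 < e j)
    (he : Tendsto e atTop (𝓝 0)) :
    Tendsto (fun j => ∫ x, (e j) ^ 2 * invDist (e j) y x ^ 5 * g x) atTop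
      (𝓝 ((∫ v : E3, invDist 1 0 v ^ 5) * g y)) := by
  obtain ⟨hgc, M, hM⟩ := hg
  have hpos := invDist_pos one_pos (0 : E3)
  have hΦc : Continuous fun v : E3 => invDist 1 0 v ^ 5 :=
    (differentiable_invDist one_pos 0).continuous.pow 5
  have hΦ := integrable_invDist_pow_five
  have hscale : ∀ j, ∫ x, (e j) ^ 2 * invDist (e j) y x ^ 5 * g x =
      ∫ v, invDist 1 0 v ^ 5 * g (e j • v + y) := by
    intro j
    have hj := he0 j
    rw [← integral_add_right_eq_self _ y]
    have h1 := Measure.integral_comp_smul_of_nonneg (volume : Measure E3)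
      (fun x => (e j) ^ 2 * invDist (e j) y (x + y) ^ 5 * g (x + y)) (e j) (hR := hj.le)
    have h3 : Module.finrank ℝ E3 = 3 := by simp
    rw [h3, smul_eq_mul, eq_comm, inv_mul_eq_iff_eq_mul₀ (by positivity), ← integral_const_mul] at h1
    rw [h1]
    refine integral_congr_ae (ae_of_all _ fun v => ?_)
    have e1 : invDist (e j) y (e j • v + y) = (e j)⁻¹ * invDist 1 0 v := by
      simp only [invDist, PiLp.add_apply, PiLp.smul_apply, smul_eq_mul, add_sub_cancel_right,
        PiLp.zero_apply, sub_zero]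
      rw [show (e j * v 0) ^ 2 + (e j * v 1) ^ 2 + (e j * v 2) ^ 2 + e j ^ 2 =
        (e j) ^ 2 * (v 0 ^ 2 + v 1 ^ 2 + v 2 ^ 2 + 1 ^ 2) by ring, Real.sqrt_mul (by positivity),
        Real.sqrt_sq hj.le, mul_inv]
    simp only [e1]
    field_simp
  simp_rw [hscale]
  rw [← integral_mul_const]
  refine tendsto_integral_of_dominated_convergence (fun v => invDist 1 0 v ^ 5 * M) (fun j => ?_)
    (hΦ.mul_const M) (fun j => ae_of_all _ fun v => ?_) (ae_of_all _ fun v => ?_)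
  · exact (hΦc.mul (hgc.comp (by fun_prop))).aestronglyMeasurable
  · rw [norm_mul, Real.norm_of_nonneg (by have := hpos v; positivity)]
    exact mul_le_mul_of_nonneg_left (hM _) (by have := hpos v; positivity)
  · refine Tendsto.const_mul _ ?_
    have h1 : Tendsto (fun j => e j • v + y) atTop (𝓝 ((0 : ℝ) • v + y)) :=
      (he.smul_const v).add_const y
    rw [zero_smul, zero_add] at h1
    exact (hgc.tendsto y).comp h1

/-- On the axis the axial derivative of the axial velocity is controlled by `L²` and `L⁴` norms of
`ω_θ/r`. -/
theorem exists_abs_pdv_axis_le : ∃ C₀ C₁ : ℝ, 0 ≤ C₀ ∧ 0 ≤ C₁ ∧ ∀ u : E3 → E3, W1 u →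
    BL2 (curl u) → (∀ x, divergence u x = 0) → ∀ a b : ℝ, 0 ≤ a → 0 ≤ b →
    ∫⁻ x, ENNReal.ofReal (quotPow 2 (curl u) x) ≤ ENNReal.ofReal a →
    ∫⁻ x, ENNReal.ofReal (quotPow 4 (curl u) x) ≤ ENNReal.ofReal b →
    ∀ y : E3, y 0 = 0 → y 1 = 0 → |pdv 2 u y 2| ≤ C₀ + C₁ * (a + b) := by
  set H : E3 → ℝ := fun z => (Metric.ball 0 1).indicator (fun z : E3 => ‖z‖ ^ (-(8 / 3) : ℝ)) z +
      16 * (1 + ‖z‖) ^ (-4 : ℝ) with hH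
  have hH0 : ∀ z, 0 ≤ H z := fun z => add_nonneg (indicator_nonneg (fun z _ => by positivity) _)
    (by positivity)
  set c := ∫ v : E3, invDist 1 0 v ^ 5 with hc
  have hΦc : Continuous fun v : E3 => invDist 1 0 v ^ 5 :=
    (differentiable_invDist one_pos 0).continuous.pow 5
  have hc0 : 0 < c := by
    refine (integral_pos_iff_support_of_nonneg (fun v => ?_) integrable_invDist_pow_five).2 ?_
    · have := invDist_pos one_pos (0 : E3) v
      positivity
    · have : Function.support (fun v : E3 => invDist 1 0 v ^ 5) = univ := by
        ext v
        simpa using (invDist_pos one_pos (0 : E3) v).ne'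
      rw [this]
      simp
  have hHi : Integrable H := integrable_kernel_majorant
  refine ⟨(∫ z, H z) / c, 1 / c, div_nonneg (integral_nonneg hH0) hc0.le, by positivity, ?_⟩
  intro u hu hω hdiv a b ha hb h2 h4 y hy0 hy1
  have hm : ∀ n, AEStronglyMeasurable (quotPow n (curl u)) := by
    intro n
    have : Measurable (quotPow n (curl u)) := by
      have : Continuous (swirl (curl u)) := by
        have h0 := (hω.coord 0).cont
        have h1 := (hω.coord 1).cont
        exact ((by fun_prop : Continuous fun x : E3 => x 0).mul h1).sub
          ((by fun_prop : Continuous fun x : E3 => x 1).mul h0)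
      exact ((this.measurable).div (by fun_prop)).pow_const n
    exact this.aestronglyMeasurable
  have hint : ∀ n c, Even n → ∫⁻ x, ENNReal.ofReal (quotPow n (curl u) x) ≤ ENNReal.ofReal c →
      Integrable (quotPow n (curl u)) ∧ (0 ≤ c → ∫ x, quotPow n (curl u) x ≤ c) := by
    intro n c hn h
    have h0 : ∀ x, 0 ≤ quotPow n (curl u) x := fun x => hn.pow_nonneg _
    refine ⟨⟨hm n, ?_⟩, fun hc => ?_⟩
    · rw [hasFiniteIntegral_iff_ofReal (ae_of_all _ h0)]
      exact h.trans_lt ENNReal.ofReal_lt_top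
    · rw [integral_eq_lintegral_of_nonneg_ae (ae_of_all _ h0) (hm n)]
      exact ENNReal.toReal_le_of_le_ofReal hc h
  obtain ⟨i2, b2⟩ := hint 2 a (by decide) h2
  obtain ⟨i4, b4⟩ := hint 4 b (by decide) h4
  have hb : ∀ j : ℕ, |∫ x, (1 / ((j : ℝ) + 1)) ^ 2 * invDist (1 / ((j : ℝ) + 1)) y x ^ 5 *
      pdv 2 u x 2| ≤ (∫ z, H z) + (a + b) := by
    intro j
    have hε : 0 < 1 / ((j : ℝ) + 1) := by positivity
    rw [(biotSavart_axis_identity hε y hu hdiv hy0 hy1).2, ← Real.norm_eq_abs]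
    refine (norm_integral_le_of_norm_le ((i2.add i4).add (hHi.comp_sub_right y))
      (ae_of_all _ fun x => abs_kernel_le hε y hy0 hy1 _ x)).trans ?_
    have e := integral_add (i2.add i4) (hHi.comp_sub_right y)
    have e' := integral_add i2 i4
    have e'' := integral_sub_right_eq_self (μ := (volume : Measure E3)) H y
    simp only [Pi.add_apply] at e e' ⊢
    rw [e, e', e'']
    linarith [b2 ha, b4 ‹_›]
  have hlim := tendsto_integral_kernel (g := fun x => pdv 2 u x 2) ⟨((hu.one 2).coord 2).cont, ((hu.one 2).coord 2).bdd⟩ y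
    (e := fun j : ℕ => 1 / ((j : ℝ) + 1)) (fun j => by positivity)
    tendsto_one_div_add_atTop_nhds_zero_nat
  have := le_of_tendsto hlim.abs (Eventually.of_forall hb)
  rw [abs_mul, abs_of_pos hc0, mul_comm, ← le_div_iff₀ hc0] at this
  refine this.trans (le_of_eq ?_)
  ring

/-! ### The transport equation on the axis -/

/-- Functions `w` and `g` on `[0,T] × ℝ` with `∂ₜg + (w - 2g) ∂_zg = 0`, bounded together with their
`z`-derivatives `wz` and `gz`. -/
structure AxisFlow (T : ℝ) (w wz g gz : ℝ → ℝ → ℝ) : Prop where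
  hasDeriv_time : ∀ t ∈ Icc 0 T, ∀ z,
    HasDerivWithinAt (fun s => g s z) ((2 * g t z - w t z) * gz t z) (Icc 0 T) t
  hasDeriv_g : ∀ t ∈ Icc 0 T, ∀ z, HasDerivAt (g t) (gz t z) z
  hasDeriv_w : ∀ t ∈ Icc 0 T, ∀ z, HasDerivAt (w t) (wz t z) z
  cont_g : ContinuousOn (fun q : ℝ × ℝ => g q.1 q.2) (Icc 0 T ×ˢ univ)
  cont_gz : ContinuousOn (fun q : ℝ × ℝ => gz q.1 q.2) (Icc 0 T ×ˢ univ)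
  cont_w : ContinuousOn (fun q : ℝ × ℝ => w q.1 q.2) (Icc 0 T ×ˢ univ)
  bdd : ∃ M : ℝ, ∀ t ∈ Icc 0 T, ∀ z, |w t z| ≤ M ∧ |wz t z| ≤ M ∧ |g t z| ≤ M ∧ |gz t z| ≤ M

namespace AxisFlow
variable {T : ℝ} {w wz g gz : ℝ → ℝ → ℝ}

/-- Characteristics exist on the whole time interval, as the speed is bounded and Lipschitz. -/
theorem exists_characteristic (h : AxisFlow T w wz g gz) (hT : 0 ≤ T) (a : ℝ) :
    ∃ Z : ℝ → ℝ, Z 0 = a ∧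
      ∀ t ∈ Icc 0 T, HasDerivWithinAt Z (w t (Z t) - 2 * g t (Z t)) (Icc 0 T) t := by
  obtain ⟨M, hM⟩ := h.bdd
  have hM0 : 0 ≤ M := (abs_nonneg _).trans (hM 0 ⟨le_rfl, hT⟩ 0).1
  have hpl : IsPicardLindelof (fun t z => w t z - 2 * g t z) (tmin := 0) (tmax := T)
      ⟨0, le_rfl, hT⟩ a (3 * M * T).toNNReal 0 (3 * M).toNNReal (3 * M).toNNReal := by
    refine ⟨fun t ht => ?_, fun z _ => ?_, fun t ht z _ => ?_, ?_⟩
    · refine LipschitzOnWith.of_dist_le_mul fun x _ y _ => ?_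
      rw [Real.coe_toNNReal _ (by positivity), dist_eq_norm, dist_eq_norm]
      refine convex_univ.norm_image_sub_le_of_norm_hasDerivWithin_le
        (fun z _ => ((h.hasDeriv_w t ht z).sub
          ((h.hasDeriv_g t ht z).const_mul 2)).hasDerivWithinAt)
        (fun z _ => ?_) (mem_univ _) (mem_univ _)
      obtain ⟨-, h1, -, h2⟩ := hM t ht z
      rw [Real.norm_eq_abs, abs_le]
      rw [abs_le] at h1 h2
      constructor <;> linarith
    · have e : ContinuousOn (fun t : ℝ => (t, z)) (Icc 0 T) := by fun_prop
      exact (h.cont_w.comp e fun t ht => ⟨ht, mem_univ _⟩).sub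
        ((h.cont_g.comp e fun t ht => ⟨ht, mem_univ _⟩).const_mul 2)
    · obtain ⟨h1, -, h2, -⟩ := hM t ht z
      rw [Real.coe_toNNReal _ (by positivity), Real.norm_eq_abs, abs_le]
      rw [abs_le] at h1 h2
      constructor <;> linarith
    · rw [Real.coe_toNNReal _ (by positivity), Real.coe_toNNReal _ (by positivity)]
      simp [hT]
  obtain ⟨Z, h0, hZ⟩ := hpl.exists_eq_forall_mem_Icc_hasDerivWithinAt₀
  exact ⟨Z, h0, hZ⟩

theorem const_of_characteristic (h : AxisFlow T w wz g gz) {Z : ℝ → ℝ}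
    (hZ : ∀ t ∈ Icc 0 T, HasDerivWithinAt Z (w t (Z t) - 2 * g t (Z t)) (Icc 0 T) t)
    {t : ℝ} (ht : t ∈ Icc 0 T) : g t (Z t) = g 0 (Z 0) := by
  rcases ht.1.eq_or_lt with rfl | ht0
  · rfl
  have hsub : Icc 0 t ⊆ Icc 0 T := Icc_subset_Icc_right ht.2
  have hZc : ContinuousOn Z (Icc 0 T) := fun s hs => (hZ s hs).continuousWithinAt
  have hc : ContinuousOn (fun s => g s (Z s)) (Icc 0 t) :=
    (h.cont_g.comp (f := fun s => (s, Z s)) (continuousOn_id.prodMk hZc)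
      (fun s hs => ⟨hs, mem_univ _⟩)).mono hsub
  have hd : ∀ s ∈ Ioo 0 t, HasDerivAt (fun s => g s (Z s)) 0 s := by
    intro s hs
    have hsT : s ∈ Ioo 0 T := ⟨hs.1, hs.2.trans_le ht.2⟩
    have hn : Icc 0 T ∈ 𝓝 s := Icc_mem_nhds hsT.1 hsT.2
    have hn2 : Icc 0 T ×ˢ (univ : Set ℝ) ∈ 𝓝 (s, Z s) := prod_mem_nhds hn univ_mem
    have hn3 : Ioo 0 T ×ˢ (univ : Set ℝ) ∈ 𝓝 (s, Z s) :=
      prod_mem_nhds (Ioo_mem_nhds hsT.1 hsT.2) univ_mem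
    have cg := h.cont_g.continuousAt hn2
    have cw := h.cont_w.continuousAt hn2
    have cgz := h.cont_gz.continuousAt hn2
    have hs' := hasStrictFDerivAt_uncurry_coprod (𝕜 := ℝ) (u := (s, Z s)) (f := g)
      (f₁ := fun t z => ContinuousLinearMap.toSpanSingleton ℝ ((2 * g t z - w t z) * gz t z))
      (f₂ := fun t z => ContinuousLinearMap.toSpanSingleton ℝ (gz t z))
      (by
        filter_upwards [hn3] with v hv
        exact ((h.hasDeriv_time v.1 (Ioo_subset_Icc_self hv.1) v.2).hasDerivAt
          (Icc_mem_nhds hv.1.1 hv.1.2)).hasFDerivAt)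
      (by
        filter_upwards [hn2] with v hv
        exact (h.hasDeriv_g v.1 hv.1 v.2).hasFDerivAt)
      (by
        have := (((cg.const_mul 2).sub cw).mul cgz)
        exact (ContinuousLinearMap.toSpanSingletonCLE (𝕜 := ℝ) (E := ℝ)).continuous.continuousAt.comp
          this)
      (by
        exact (ContinuousLinearMap.toSpanSingletonCLE (𝕜 := ℝ) (E := ℝ)).continuous.continuousAt.comp
          cgz)
    have hz := (hZ s (Ioo_subset_Icc_self hsT)).hasDerivAt hn
    have h1 := hs'.hasFDerivAt.comp_hasDerivAt s ((hasDerivAt_id s).prodMk hz)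
    refine (h1.congr_deriv ?_ : HasDerivAt (fun s => g s (Z s)) 0 s)
    simp [Function.HasUncurry.uncurry]
    ring
  obtain ⟨c, hc1, hc2⟩ := exists_hasDerivAt_eq_slope (fun s => g s (Z s)) (fun _ => 0) ht0 hc hd
  rw [eq_comm, div_eq_zero_iff] at hc2
  rcases hc2 with h2 | h2 <;> linarith

/-- Compression of characteristics: if `∂_zw` is small compared with `y₀ = ∂_zg(0,0) > 0`, then `g`
steepens along the characteristic through the origin, before the time `2/y₀`. -/
theorem steepening (h : AxisFlow T w wz g gz) {y₀ : ℝ} (hy : 0 < y₀)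
    (hw : ∀ t ∈ Icc 0 T, ∀ z, |wz t z| ≤ y₀ / 2) (h0 : gz 0 0 = y₀) {t : ℝ} (ht : t ∈ Icc 0 T) :
    t * y₀ < 2 ∧ ∃ ζ, g t ζ = g 0 0 ∧ y₀ / (2 - t * y₀) ≤ gz t ζ := by
  have hT : 0 ≤ T := ht.1.trans ht.2
  choose Z hZ0 hZ using h.exists_characteristic hT
  have hslope : ∀ᶠ b in 𝓝[>] (0 : ℝ), y₀ * b / 2 < g 0 b - g 0 0 := by
    have h1 := (h0 ▸ h.hasDeriv_g 0 ⟨le_rfl, hT⟩ 0).hasDerivWithinAt (s := Ioi 0)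
    rw [hasDerivWithinAt_iff_tendsto_slope' self_notMem_Ioi] at h1
    filter_upwards [h1.eventually (lt_mem_nhds (half_lt_self hy)), self_mem_nhdsWithin] with b hb hb0
    have hb0 : 0 < b := hb0
    rw [slope_def_field, sub_zero, lt_div_iff₀ hb0] at hb
    linarith
  have key : ∀ b, 0 < b → y₀ * b / 2 < g 0 b - g 0 0 → ∀ s ∈ Icc 0 T,
      0 < Z b s - Z 0 s ∧ Z b s - Z 0 s ≤ b * (1 - s * y₀ / 2) ∧
        g s (Z b s) - g s (Z 0 s) = g 0 b - g 0 0 := by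
    intro b hb hΔ
    have hconst : ∀ s ∈ Icc 0 T, g s (Z b s) - g s (Z 0 s) = g 0 b - g 0 0 := fun s hs => by
      rw [h.const_of_characteristic (hZ b) hs, h.const_of_characteristic (hZ 0) hs, hZ0, hZ0]
    have hyb : 0 < y₀ * b := by positivity
    have hder : ∀ s ∈ Icc 0 T, HasDerivWithinAt (fun s => Z b s - Z 0 s)
        (w s (Z b s) - w s (Z 0 s) - 2 * (g 0 b - g 0 0)) (Icc 0 T) s := fun s hs => by
      refine ((hZ b s hs).sub (hZ 0 s hs)).congr_deriv ?_
      rw [← hconst s hs]; ring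
    have hcont : ContinuousOn (fun s => Z b s - Z 0 s) (Icc 0 T) := fun s hs =>
      (hder s hs).continuousWithinAt
    -- characteristics carrying different values of `g` do not meet
    have hpos : ∀ s ∈ Icc 0 T, 0 < Z b s - Z 0 s := by
      intro s hs
      by_contra hneg
      obtain ⟨c, hc, hc0⟩ := intermediate_value_Icc' hs.1
        (hcont.mono (Icc_subset_Icc_right hs.2)) (show (0 : ℝ) ∈ Icc _ _ from
          ⟨not_lt.1 hneg, by rw [hZ0, hZ0]; linarith⟩)
      have := hconst c ⟨hc.1, hc.2.trans hs.2⟩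
      rw [sub_eq_zero.1 hc0] at this
      linarith
    -- at a time where the distance equals `b (1 - s y₀/2)`, the difference of the velocities `w` is at
    -- most `y₀ b/2`, and that of `2g` is more than `y₀ b`
    have hle : ∀ ⦃s⦄, s ∈ Icc 0 T → Z b s - Z 0 s ≤ b * (1 - s * y₀ / 2) := by
      refine image_le_of_deriv_right_lt_deriv_boundary' hcont
        (fun s hs => (hder s (Ico_subset_Icc_self hs)).mono_of_mem_nhdsWithin
          (Icc_mem_nhdsGE_of_mem hs)) (B' := fun _ => b * (-(y₀ / 2))) ?_ (by fun_prop)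
        (fun s _ => ?_) fun s hs he => ?_
      · simp [hZ0]
      · have := (((hasDerivAt_id s).mul_const y₀).div_const 2).const_sub 1 |>.const_mul b
        exact (this.congr_deriv (by ring)).hasDerivWithinAt
      · have hs' := Ico_subset_Icc_self hs
        have h1 : ‖w s (Z b s) - w s (Z 0 s)‖ ≤ y₀ / 2 * ‖Z b s - Z 0 s‖ :=
          convex_univ.norm_image_sub_le_of_norm_hasDerivWithin_le
            (fun z _ => (h.hasDeriv_w s hs' z).hasDerivWithinAt) (fun z _ => hw s hs' z)
            (mem_univ _) (mem_univ _)
        rw [Real.norm_of_nonneg (hpos s hs').le, he] at h1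
        have h2 := (le_abs_self _).trans h1
        have h3 : 0 ≤ s * y₀ := mul_nonneg hs.1 hy.le
        have h4 : y₀ / 2 * (b * (1 - s * y₀ / 2)) ≤ y₀ / 2 * b := by
          have := mul_nonneg hyb.le h3
          linarith
        linarith
    exact fun s hs => ⟨hpos s hs, hle hs, hconst s hs⟩
  have hev : ∀ᶠ b in 𝓝[>] (0 : ℝ), 0 < b ∧ y₀ * b / 2 < g 0 b - g 0 0 := by
    filter_upwards [hslope, self_mem_nhdsWithin] with b hb hb0 using ⟨hb0, hb⟩
  have hlt : t * y₀ < 2 := by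
    obtain ⟨b, hb0, hb⟩ := hev.exists
    obtain ⟨h1, h2, -⟩ := key b hb0 hb t ht
    have := pos_of_mul_pos_right (h1.trans_le h2) hb0.le
    linarith
  refine ⟨hlt, Z 0 t, ?_, ?_⟩
  · rw [h.const_of_characteristic (hZ 0) ht, hZ0]
  -- the difference quotients of `g` at time `t` between the two characteristics
  · have hne : Tendsto (fun b => Z b t) (𝓝[>] 0) (𝓝[≠] (Z 0 t)) := by
      refine tendsto_nhdsWithin_iff.2 ⟨?_, ?_⟩
      · have hup : Tendsto (fun b : ℝ => Z 0 t + b * (1 - t * y₀ / 2)) (𝓝[>] 0)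
            (𝓝 (Z 0 t + 0 * (1 - t * y₀ / 2))) :=
          ((tendsto_id.mul_const _).const_add _).mono_left nhdsWithin_le_nhds
        rw [zero_mul, add_zero] at hup
        refine tendsto_of_tendsto_of_tendsto_of_le_of_le' tendsto_const_nhds hup ?_ ?_
        · filter_upwards [hev] with b hb
          linarith [(key b hb.1 hb.2 t ht).1]
        · filter_upwards [hev] with b hb
          linarith [(key b hb.1 hb.2 t ht).2.1]
      · filter_upwards [hev] with b hb
        have := (key b hb.1 hb.2 t ht).1
        exact fun he => by rw [he] at this; simp at this
    have hlim := (hasDerivAt_iff_tendsto_slope.1 (h.hasDeriv_g t ht (Z 0 t))).comp hne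
    refine ge_of_tendsto hlim ?_
    filter_upwards [hev] with b hb
    obtain ⟨h1, h2, h3⟩ := key b hb.1 hb.2 t ht
    rw [Function.comp, slope_def_field, h3, div_le_div_iff₀ (by linarith) h1]
    have h4 := mul_le_mul_of_nonneg_left h2 hy.le
    have h5 := mul_lt_mul_of_pos_right hb.2 (by linarith : 0 < 2 - t * y₀)
    linarith

end AxisFlow

/-! ### Transport of the azimuthal components on the axis -/

theorem meridian_zero_apply (r z : ℝ) : meridian r z 0 = r := rfl
theorem meridian_one_apply (r z : ℝ) : meridian r z 1 = 0 := rfl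
theorem meridian_two_apply (r z : ℝ) : meridian r z 2 = z := rfl

theorem hasDerivAt_meridian_radial (r z : ℝ) :
    HasDerivAt (fun ρ => meridian ρ z) (EuclideanSpace.single 0 1) r := by
  have h : ∀ ρ, meridian ρ z = meridian 0 z + ρ • EuclideanSpace.single 0 1 := fun ρ => by
    ext i; fin_cases i <;> simp [meridian]
  rw [show (fun ρ => meridian ρ z) = _ from funext h]
  simpa using! ((hasDerivAt_id r).smul_const (EuclideanSpace.single (0 : Fin 3) (1 : ℝ))).const_add
    (meridian 0 z)

theorem hasDerivAt_meridian_axial (r z : ℝ) :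
    HasDerivAt (fun ζ => meridian r ζ) (EuclideanSpace.single 2 1) z := by
  have h : ∀ ζ, meridian r ζ = meridian r 0 + ζ • EuclideanSpace.single 2 1 := fun ζ => by
    ext i; fin_cases i <;> simp [meridian]
  rw [show (fun ζ => meridian r ζ) = _ from funext h]
  simpa using! ((hasDerivAt_id z).smul_const (EuclideanSpace.single (2 : Fin 3) (1 : ℝ))).const_add
    (meridian r 0)

theorem continuous_meridian : Continuous fun q : ℝ × ℝ => meridian q.1 q.2 := by
  unfold meridian
  refine (PiLp.continuous_toLp 2 _).comp (continuous_pi fun i => ?_)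
  fin_cases i <;> simp <;> fun_prop

theorem hasDerivAt_comp_meridian_radial {v : E3 → E3} (hv : Differentiable ℝ v) (j : Fin 3)
    (r z : ℝ) : HasDerivAt (fun ρ => v (meridian ρ z) j) (pdv 0 v (meridian r z) j) r := by
  have h := (hv (meridian r z)).hasFDerivAt.comp_hasDerivAt r (hasDerivAt_meridian_radial r z)
  exact (EuclideanSpace.proj j : E3 →L[ℝ] ℝ).hasFDerivAt.comp_hasDerivAt r h

theorem hasDerivAt_comp_meridian_axial {v : E3 → E3} (hv : Differentiable ℝ v) (j : Fin 3)
    (r z : ℝ) : HasDerivAt (fun ζ => v (meridian r ζ) j) (pdv 2 v (meridian r z) j) z := by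
  have h := (hv (meridian r z)).hasFDerivAt.comp_hasDerivAt z (hasDerivAt_meridian_axial r z)
  exact (EuclideanSpace.proj j : E3 →L[ℝ] ℝ).hasFDerivAt.comp_hasDerivAt z h

theorem pdv_comm {v : E3 → E3} (hv : ContDiff ℝ 2 v) (i k : Fin 3) (x : E3) :
    pdv i (pdv k v) x = pdv k (pdv i v) x := by
  have hc : ∀ j : Fin 3, ContDiff ℝ 2 (fun y => v y j) := fun j =>
    (EuclideanSpace.proj j : E3 →L[ℝ] ℝ).contDiff.comp hv
  have hd : ∀ k, Differentiable ℝ (pdv k v) := fun k =>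
    (contDiff_pdv (n := 1) (m := 2) hv (by norm_num) k).differentiable (by norm_num)
  ext j
  have e : ∀ k, (fun y => pdv k v y j) = sd k (fun y => v y j) := fun k =>
    funext fun y => pdv_apply (hv.differentiable (by norm_num) y) k j
  rw [pdv_apply (hd k x), pdv_apply (hd i x), e, e, sd_comm (hc j)]

theorem tendsto_div_of_hasDerivAt {φ : ℝ → ℝ} {φ' : ℝ} (h : HasDerivAt φ φ' 0) (h0 : φ 0 = 0) :
    Tendsto (fun r => φ r / r) (𝓝[>] 0) (𝓝 φ') := by
  have h1 := (h.hasDerivWithinAt (s := Ioi 0))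
  rw [hasDerivWithinAt_iff_tendsto_slope' self_notMem_Ioi] at h1
  refine h1.congr fun r => ?_
  rw [slope_def_field, h0, sub_zero, sub_zero]

theorem abs_div_le_of_hasDerivAt {φ φ' : ℝ → ℝ} {M r : ℝ} (hr : 0 < r)
    (h : ∀ ρ ∈ Icc 0 r, HasDerivAt φ (φ' ρ) ρ) (hM : ∀ ρ ∈ Icc 0 r, |φ' ρ| ≤ M) (h0 : φ 0 = 0) :
    |φ r / r| ≤ M := by
  have := (convex_Icc 0 r).norm_image_sub_le_of_norm_hasDerivWithin_le
    (fun ρ hρ => (h ρ hρ).hasDerivWithinAt) hM ⟨le_rfl, hr.le⟩ ⟨hr.le, le_rfl⟩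
  rw [h0, sub_zero, sub_zero, Real.norm_eq_abs, Real.norm_of_nonneg hr.le] at this
  rwa [abs_div, abs_of_pos hr, div_le_iff₀ hr]

/-- The transport equation on the half-plane `θ = 0`, written for `W_θ/r`. -/
theorem SwirlTransport.meridian_eq {T κ : ℝ} {u W Wt : ℝ → E3 → E3}
    (h : SwirlTransport T κ u W Wt) {t : ℝ} (ht : t ∈ Icc 0 T) {r : ℝ} (hr : r ≠ 0) (z : ℝ) :
    Wt t (meridian r z) 1 / r = W t (meridian r z) 1 / r * (u t (meridian r z) 0 / r)
      + 2 * κ * (W t (meridian r z) 1 / r * (pdv 2 (W t) (meridian r z) 1 / r))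
      - u t (meridian r z) 0 / r * pdv 0 (W t) (meridian r z) 1
      - u t (meridian r z) 2 * (pdv 2 (W t) (meridian r z) 1 / r) := by
  have he := h.eq t ht (meridian r z)
  have hu := (h.u_even t ht).swirl_eq_zero (meridian r z)
  have hW := (h.W_odd t ht).radial_eq_zero (meridian r z)
  have hd := h.hW.diff t ht (meridian r z)
  simp only [Fin.sum_univ_three, sd_swirl hd, swirl, radial, meridian_zero_apply,
    meridian_one_apply, zero_mul, sub_zero, add_zero, mul_eq_zero, hr, false_or] at he hu hW
  simp [hu] at he
  have h3 : r ^ 3 ≠ 0 := pow_ne_zero 3 hr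
  field_simp
  have h4 : r ^ 2 * (Wt t (meridian r z) 1 * r) = r ^ 2 * (W t (meridian r z) 1 *
      (u t (meridian r z) 0 + 2 * κ * pdv 2 (W t) (meridian r z) 1) -
      r * (u t (meridian r z) 0 * pdv 0 (W t) (meridian r z) 1 +
        u t (meridian r z) 2 * pdv 2 (W t) (meridian r z) 1)) := by
    linear_combination he
  have := mul_left_cancel₀ (pow_ne_zero 2 hr) h4
  linear_combination this

/-- On the axis, `Π = ∂_r b` obeys `∂ₜΠ + w ∂_zΠ = 2κ Π ∂_zΠ`, where `w` is the axial velocity. -/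
theorem SwirlTransport.hasDerivWithinAt_axis {T κ : ℝ} {u W Wt : ℝ → E3 → E3}
    (h : SwirlTransport T κ u W Wt) (h2 : ∀ t ∈ Icc 0 T, ContDiff ℝ 2 (W t))
    (hc : ContinuousOn (fun q : ℝ × E3 => pdv 0 (pdv 2 (W q.1)) q.2) (Icc 0 T ×ˢ univ)) (z : ℝ)
    {t : ℝ} (ht : t ∈ Icc 0 T) :
    HasDerivWithinAt (fun s => pdv 0 (W s) (meridian 0 z) 1)
      ((2 * κ * pdv 0 (W t) (meridian 0 z) 1 - u t (meridian 0 z) 2) *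
        pdv 0 (pdv 2 (W t)) (meridian 0 z) 1) (Icc 0 T) t := by
  have hdW := fun τ hτ => h.hW.diff τ hτ
  have hdu := fun τ hτ => h.hu.diff τ hτ
  have hd2 : ∀ τ ∈ Icc 0 T, Differentiable ℝ (pdv 2 (W τ)) := fun τ hτ =>
    (contDiff_pdv (n := 1) (m := 2) (h2 τ hτ) (by norm_num) 2).differentiable (by norm_num)
  have u0 : ∀ τ ∈ Icc 0 T, u τ (meridian 0 z) 0 = 0 := fun τ hτ =>
    ((h.u_even τ hτ).axis_zero rfl rfl).1
  have W0 : ∀ τ ∈ Icc 0 T, ∀ ζ, W τ (meridian 0 ζ) 1 = 0 := fun τ hτ ζ =>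
    ((h.W_odd τ hτ).axis_zero rfl rfl).2
  have Wz0 : ∀ τ ∈ Icc 0 T, pdv 2 (W τ) (meridian 0 z) 1 = 0 := fun τ hτ => by
    have := hasDerivAt_comp_meridian_axial (hdW τ hτ) 1 0 z
    rw [show (fun ζ => W τ (meridian 0 ζ) 1) = fun _ => 0 from funext (W0 τ hτ)] at this
    exact this.unique (hasDerivAt_const z 0)
  have slice : ∀ {F : ℝ → E3 → E3}, ContinuousOn (fun q : ℝ × E3 => F q.1 q.2) (Icc 0 T ×ˢ univ) →
      ∀ x j, ContinuousOn (fun τ => F τ x j) (Icc 0 T) := fun {F} hF x j =>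
    (EuclideanSpace.proj j : E3 →L[ℝ] ℝ).continuous.comp_continuousOn
      (hF.comp (f := fun τ : ℝ => (τ, x)) (by fun_prop) fun τ hτ => ⟨hτ, mem_univ _⟩)
  -- uniform bounds on the segment `0 ≤ r ≤ 1`
  obtain ⟨M1, hM1⟩ := (h.hW.one 0).bdd
  obtain ⟨M2, hM2⟩ := (h.hu.one 0).bdd
  obtain ⟨M3, hM3⟩ := h.hu.zero.bdd
  obtain ⟨M4, hM4⟩ : ∃ M : ℝ, ∀ τ ∈ Icc 0 T, ∀ ρ ∈ Icc (0 : ℝ) 1,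
      ‖pdv 0 (pdv 2 (W τ)) (meridian ρ z)‖ ≤ M := by
    have hk : IsCompact (Icc 0 T ×ˢ Icc (0 : ℝ) 1) := isCompact_Icc.prod isCompact_Icc
    have hf : ContinuousOn (fun q : ℝ × ℝ => pdv 0 (pdv 2 (W q.1)) (meridian q.2 z))
        (Icc 0 T ×ˢ Icc (0 : ℝ) 1) :=
      hc.comp (f := fun q : ℝ × ℝ => (q.1, meridian q.2 z))
        ((continuous_fst.prodMk (continuous_meridian.comp
          (continuous_snd.prodMk continuous_const))).continuousOn) fun q hq => ⟨hq.1, mem_univ _⟩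
    obtain ⟨M, hM⟩ := hk.exists_bound_of_continuousOn hf
    exact ⟨M, fun τ hτ ρ hρ => hM (τ, ρ) ⟨hτ, hρ⟩⟩
  set M := max (max M1 M2) (max M3 M4) with hMdef
  have coordle : ∀ (x : E3) j, |x j| ≤ ‖x‖ := fun x j => by
    simpa using! PiLp.norm_apply_le x j
  have b1 : ∀ τ ∈ Icc 0 T, ∀ x, |pdv 0 (W τ) x 1| ≤ M := fun τ hτ x =>
    (coordle _ _).trans ((hM1 τ hτ x).trans (by simp [hMdef]))
  have b2 : ∀ τ ∈ Icc 0 T, ∀ x, |pdv 0 (u τ) x 0| ≤ M := fun τ hτ x =>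
    (coordle _ _).trans ((hM2 τ hτ x).trans (by simp [hMdef]))
  have b3 : ∀ τ ∈ Icc 0 T, ∀ x, |u τ x 2| ≤ M := fun τ hτ x =>
    (coordle _ _).trans ((hM3 τ hτ x).trans (by simp [hMdef]))
  have b4 : ∀ τ ∈ Icc 0 T, ∀ ρ ∈ Icc (0 : ℝ) 1, |pdv 0 (pdv 2 (W τ)) (meridian ρ z) 1| ≤ M :=
    fun τ hτ ρ hρ => (coordle _ _).trans ((hM4 τ hτ ρ hρ).trans (by simp [hMdef]))
  have hM0 : 0 ≤ M := (abs_nonneg _).trans (b3 t ht 0)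
  set F : ℝ → ℝ := fun τ => (2 * κ * pdv 0 (W τ) (meridian 0 z) 1 - u τ (meridian 0 z) 2) *
    pdv 0 (pdv 2 (W τ)) (meridian 0 z) 1 with hF
  have hFc : ContinuousOn F (Icc 0 T) :=
    (((slice (h.hW.one 0).cont _ 1).const_mul (2 * κ)).sub (slice h.hu.zero.cont _ 2)).mul
      (slice hc _ 1)
  -- the integrated equation for `W_θ/r` in the limit `r → 0`; this avoids mixed derivatives in `t`
  -- and `r`
  have hint : ∀ s ∈ Icc 0 T, pdv 0 (W s) (meridian 0 z) 1 =
      (∫ τ in 0..s, F τ) + pdv 0 (W 0) (meridian 0 z) 1 := by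
    intro s hs
    have hT0 : (0 : ℝ) ∈ Icc 0 T := ⟨le_rfl, hs.1.trans hs.2⟩
    have hIoc : ∀ τ ∈ Set.uIoc 0 s, τ ∈ Icc 0 T := fun τ hτ => by
      rw [uIoc_of_le hs.1] at hτ; exact ⟨hτ.1.le, hτ.2.trans hs.2⟩
    have hq : ∀ r, W s (meridian r z) 1 / r - W 0 (meridian r z) 1 / r =
        ∫ τ in 0..s, Wt τ (meridian r z) 1 / r := by
      intro r
      have e := intervalIntegral_eq_sub_of_bddL2 h.hWt.cont h.dW le_rfl hs.1 hs.2 (meridian r z)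
      have e2 := (EuclideanSpace.proj (1 : Fin 3) : E3 →L[ℝ] ℝ).intervalIntegral_comp_comm
        (a := 0) (b := s) (μ := volume) (f := fun τ => Wt τ (meridian r z))
        (ContinuousOn.intervalIntegrable (by
          rw [uIcc_of_le hs.1]
          exact (h.hWt.cont.comp (f := fun τ : ℝ => (τ, meridian r z)) (by fun_prop)
            fun τ hτ => ⟨hτ, mem_univ _⟩).mono (Icc_subset_Icc_right hs.2)))
      rw [e] at e2
      rw [intervalIntegral.integral_div, ← sub_div]
      congr 1
      exact e2.symm
    have hl1 : Tendsto (fun r => W s (meridian r z) 1 / r - W 0 (meridian r z) 1 / r) (𝓝[>] 0)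
        (𝓝 (pdv 0 (W s) (meridian 0 z) 1 - pdv 0 (W 0) (meridian 0 z) 1)) :=
      (tendsto_div_of_hasDerivAt (hasDerivAt_comp_meridian_radial (hdW s hs) 1 0 z)
        (W0 s hs z)).sub
      (tendsto_div_of_hasDerivAt (hasDerivAt_comp_meridian_radial (hdW 0 hT0) 1 0 z) (W0 0 hT0 z))
    have hl2 : Tendsto (fun r => ∫ τ in 0..s, Wt τ (meridian r z) 1 / r) (𝓝[>] 0)
        (𝓝 (∫ τ in 0..s, F τ)) := by
      have hr1 : ∀ᶠ r in 𝓝[>] (0 : ℝ), 0 < r ∧ r ≤ 1 := by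
        filter_upwards [Ioc_mem_nhdsGT (zero_lt_one' ℝ)] with r hr using hr
      refine intervalIntegral.tendsto_integral_filter_of_dominated_convergence
        (fun _ => M * M + 2 * |κ| * (M * M) + M * M + M * M) ?_ ?_ (by simp) ?_
      · refine Eventually.of_forall fun r => ?_
        rw [uIoc_of_le hs.1]
        exact (((slice h.hWt.cont (meridian r z) 1).mono (Icc_subset_Icc_right hs.2)).mono
          Ioc_subset_Icc_self).div_const r |>.aestronglyMeasurable measurableSet_Ioc
      · filter_upwards [hr1] with r hr
        refine ae_of_all _ fun τ hτ => ?_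
        have hτ' := hIoc τ hτ
        have c1 : |W τ (meridian r z) 1 / r| ≤ M := abs_div_le_of_hasDerivAt hr.1
          (fun ρ _ => hasDerivAt_comp_meridian_radial (hdW τ hτ') 1 ρ z) (fun ρ _ => b1 τ hτ' _)
          (W0 τ hτ' z)
        have c2 : |u τ (meridian r z) 0 / r| ≤ M := abs_div_le_of_hasDerivAt hr.1
          (fun ρ _ => hasDerivAt_comp_meridian_radial (hdu τ hτ') 0 ρ z) (fun ρ _ => b2 τ hτ' _)
          (u0 τ hτ')
        have c3 : |pdv 2 (W τ) (meridian r z) 1 / r| ≤ M := abs_div_le_of_hasDerivAt hr.1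
          (fun ρ _ => hasDerivAt_comp_meridian_radial (hd2 τ hτ') 1 ρ z)
          (fun ρ hρ => b4 τ hτ' ρ ⟨hρ.1, hρ.2.trans hr.2⟩) (Wz0 τ hτ')
        rw [h.meridian_eq hτ' hr.1.ne' z]
        refine (norm_sub_le _ _).trans (add_le_add ((norm_sub_le _ _).trans (add_le_add
          ((norm_add_le _ _).trans (add_le_add ?_ ?_)) ?_)) ?_)
        · rw [norm_mul]; exact mul_le_mul c1 c2 (abs_nonneg _) hM0
        · rw [norm_mul, norm_mul, norm_mul, Real.norm_ofNat, Real.norm_eq_abs κ]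
          exact mul_le_mul_of_nonneg_left (mul_le_mul c1 c3 (abs_nonneg _) hM0) (by positivity)
        · rw [norm_mul]; exact mul_le_mul c2 (b1 τ hτ' _) (abs_nonneg _) hM0
        · rw [norm_mul]; exact mul_le_mul (b3 τ hτ' _) c3 (abs_nonneg _) hM0
      · refine ae_of_all _ fun τ hτ => ?_
        have hτ' := hIoc τ hτ
        have l1 := tendsto_div_of_hasDerivAt
          (hasDerivAt_comp_meridian_radial (hdW τ hτ') 1 0 z) (W0 τ hτ' z)
        have l2 := tendsto_div_of_hasDerivAt
          (hasDerivAt_comp_meridian_radial (hdu τ hτ') 0 0 z) (u0 τ hτ')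
        have l3 := tendsto_div_of_hasDerivAt
          (hasDerivAt_comp_meridian_radial (hd2 τ hτ') 1 0 z) (Wz0 τ hτ')
        have cm : Continuous fun r : ℝ => meridian r z :=
          continuous_meridian.comp (continuous_id.prodMk continuous_const)
        have l4 : Tendsto (fun r => pdv 0 (W τ) (meridian r z) 1) (𝓝[>] 0)
            (𝓝 (pdv 0 (W τ) (meridian 0 z) 1)) :=
          ((((h.hW.at_time hτ').one 0).coord 1).cont.comp cm).continuousAt.mono_left
            nhdsWithin_le_nhds
        have l5 : Tendsto (fun r => u τ (meridian r z) 2) (𝓝[>] 0)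
            (𝓝 (u τ (meridian 0 z) 2)) :=
          ((((h.hu.at_time hτ').zero).coord 2).cont.comp cm).continuousAt.mono_left
            nhdsWithin_le_nhds
        have := (((l1.mul l2).add ((l1.mul l3).const_mul (2 * κ))).sub (l2.mul l4)).sub (l5.mul l3)
        have e : F τ = pdv 0 (W τ) (meridian 0 z) 1 * pdv 0 (u τ) (meridian 0 z) 0 +
            2 * κ * (pdv 0 (W τ) (meridian 0 z) 1 * pdv 0 (pdv 2 (W τ)) (meridian 0 z) 1) -
            pdv 0 (u τ) (meridian 0 z) 0 * pdv 0 (W τ) (meridian 0 z) 1 -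
            u τ (meridian 0 z) 2 * pdv 0 (pdv 2 (W τ)) (meridian 0 z) 1 := by
          simp only [hF]; ring
        rw [e]
        refine this.congr' ?_
        filter_upwards [hr1] with r hr
        exact (h.meridian_eq hτ' hr.1.ne' z).symm
    simp_rw [hq] at hl1
    have := tendsto_nhds_unique hl1 hl2
    linarith
  exact ((primitive_hasDerivWithinAt hFc ht).add_const _).congr hint (hint t ht)

/-- The functions `w = u_z` and `g = Π` on the axis. -/
theorem RegSol.axisFlow {T : ℝ} {u B ut Bt : ℝ → E3 → E3} (hs : RegSol T u B ut Bt)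
    (hu : ReflEven (u 0)) (hB : ReflOdd (B 0)) :
    AxisFlow T (fun t z => u t (meridian 0 z) 2) (fun t z => pdv 2 (u t) (meridian 0 z) 2)
      (fun t z => pdv 0 (B t) (meridian 0 z) 1)
      (fun t z => pdv 2 (pdv 0 (B t)) (meridian 0 z) 1) := by
  have hd0 : ∀ τ ∈ Icc 0 T, Differentiable ℝ (pdv 0 (B τ)) := fun τ hτ =>
    (contDiff_pdv (n := 1) (m := 2) (hs.B2.c2 τ hτ) (by norm_num) 0).differentiable (by norm_num)
  have cont : ∀ {F : ℝ → E3 → E3}, ContinuousOn (fun q : ℝ × E3 => F q.1 q.2) (Icc 0 T ×ˢ univ) →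
      ∀ j, ContinuousOn (fun q : ℝ × ℝ => F q.1 (meridian 0 q.2) j) (Icc 0 T ×ˢ univ) :=
    fun {F} hF j => (EuclideanSpace.proj j : E3 →L[ℝ] ℝ).continuous.comp_continuousOn
      (hF.comp (f := fun q : ℝ × ℝ => (q.1, meridian 0 q.2))
        (continuous_fst.prodMk (continuous_meridian.comp
          (continuous_const.prodMk continuous_snd))).continuousOn fun q hq => ⟨hq.1, mem_univ _⟩)
  refine ⟨fun t ht z => ?_, fun t ht z => hasDerivAt_comp_meridian_axial (hd0 t ht) 1 0 z,
    fun t ht z => hasDerivAt_comp_meridian_axial (hs.u2.bddW1.diff t ht) 2 0 z,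
    cont (F := fun t => pdv 0 (B t)) (hs.B2.one 0).cont 1,
    cont (F := fun t => pdv 2 (pdv 0 (B t))) (hs.B2.two 2 0).cont 1,
    cont (F := u) hs.u2.zero.cont 2, ?_⟩
  · refine ((hs.swirlTransport_B hu hB).hasDerivWithinAt_axis hs.B2.c2 (hs.B2.two 0 2).cont z
      ht).congr_deriv ?_
    rw [pdv_comm (hs.B2.c2 t ht) 0 2, mul_one]
  · obtain ⟨M1, hM1⟩ := hs.u2.zero.bdd
    obtain ⟨M2, hM2⟩ := (hs.u2.one 2).bdd
    obtain ⟨M3, hM3⟩ := (hs.B2.one 0).bdd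
    obtain ⟨M4, hM4⟩ := (hs.B2.two 2 0).bdd
    have coordle : ∀ (x : E3) j, |x j| ≤ ‖x‖ := fun x j => by
      simpa using! PiLp.norm_apply_le x j
    refine ⟨max (max M1 M2) (max M3 M4), fun t ht z => ⟨?_, ?_, ?_, ?_⟩⟩
    · exact (coordle _ _).trans ((hM1 t ht _).trans (by simp))
    · exact (coordle _ _).trans ((hM2 t ht _).trans (by simp))
    · exact (coordle _ _).trans ((hM3 t ht _).trans (by simp))
    · exact (coordle _ _).trans ((hM4 t ht _).trans (by simp))

/-! ### Bounds by the data -/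

theorem ReflOdd.swirl_eq {v : E3 → E3} (hv : ReflOdd v) (x : E3) :
    swirl v x = rad x * compTheta v (rad x) (x 2) := by
  by_cases hx : rad x = 0
  · obtain ⟨h0, h1⟩ := rad_eq_zero.1 hx
    simp [swirl, hx, h0, h1]
  · obtain ⟨h1, h2⟩ := exists_reflL_meridian x hx
    have h3 := hv _ _ h1 (meridian (rad x) (x 2))
    have h4 := hv.radial_eq_zero (meridian (rad x) (x 2))
    have h5 : v (meridian (rad x) (x 2)) 0 = 0 := by simpa [meridian, hx] using h4
    rw [h2] at h3
    have hr := rad_sq x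
    rw [swirl, h3]
    simp only [PiLp.neg_apply, reflL_zero, reflL_one, h5, compTheta]
    field_simp
    rw [hr]; ring

/-- Off the axis this is an equality; on the axis the left side is zero. -/
theorem ReflOdd.quotPow_le {v : E3 → E3} (hv : ReflOdd v) {n : ℕ} (hn : n ≠ 0) (x : E3) :
    quotPow n v x ≤ |lift (angularQuotient v) x| ^ n := by
  have hr := rad_sq x
  by_cases hx : rad x = 0
  · rw [hx] at hr
    rw [quotPow, ← hr]
    simp [hn]
  · rw [quotPow, ← abs_pow]
    refine le_trans (le_of_eq ?_) (le_abs_self _)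
    rw [lift, angularQuotient, if_neg hx, hv.swirl_eq, ← hr]
    congr 1
    field_simp

/-- Interpolation between `L¹` and `L^∞`. -/
theorem lintegral_pow_le_normL1Linfty {g : ℝ → ℝ → ℝ} (hg : MemL1Linfty g) {n : ℕ} (hn : n ≠ 0) :
    ∫⁻ x : E3, ENNReal.ofReal (|lift g x| ^ n) ≤ ENNReal.ofReal (normL1Linfty g ^ n) := by
  obtain ⟨h1, h2⟩ := hg
  obtain ⟨k, rfl⟩ := Nat.exists_eq_succ_of_ne_zero hn
  set a := eLpNorm (lift g) 1 volume with ha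
  set b := eLpNorm (lift g) ⊤ volume with hb
  have hle : a + b = ENNReal.ofReal (normL1Linfty g) := by
    rw [normL1Linfty, ENNReal.ofReal_add (by positivity) (by positivity),
      ENNReal.ofReal_toReal h1.eLpNorm_ne_top, ENNReal.ofReal_toReal h2.eLpNorm_ne_top]
  have hN : 0 ≤ normL1Linfty g := by unfold normL1Linfty; positivity
  calc ∫⁻ x : E3, ENNReal.ofReal (|lift g x| ^ (k + 1))
      ≤ ∫⁻ x : E3, b ^ k * ‖lift g x‖ₑ := by
        refine lintegral_mono_ae ?_
        filter_upwards [enorm_ae_le_eLpNormEssSup (lift g) volume] with x hx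
        rw [ENNReal.ofReal_pow (abs_nonneg _), ← Real.enorm_eq_ofReal_abs, pow_succ, hb,
          eLpNorm_exponent_top]
        gcongr
    _ = b ^ k * a := by
        rw [lintegral_const_mul' _ _ (ENNReal.pow_ne_top h2.eLpNorm_ne_top), ha,
          eLpNorm_one_eq_lintegral_enorm]
    _ ≤ (a + b) ^ k * (a + b) := by gcongr <;> simp
    _ = _ := by rw [← pow_succ, hle, ENNReal.ofReal_pow hN]

theorem measurable_quotPow {W : E3 → E3} (hW : Continuous W) (n : ℕ) :
    Measurable (quotPow n W) := by
  have : Continuous (swirl W) := by unfold swirl; fun_prop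
  exact ((this.measurable).div (by fun_prop)).pow_const n

theorem lintegral_quotPow_add_le {V W B : E3 → E3} {n : ℕ} (hn : Even n) (hW : Continuous W)
    (h : ∀ x, |swirl V x| ≤ |swirl W x| + |swirl B x|) {a b : ℝ} (ha : 0 ≤ a) (hb : 0 ≤ b)
    (h1 : ∫⁻ x, ENNReal.ofReal (quotPow n W x) ≤ ENNReal.ofReal a)
    (h2 : ∫⁻ x, ENNReal.ofReal (quotPow n B x) ≤ ENNReal.ofReal b) :
    ∫⁻ x, ENNReal.ofReal (quotPow n V x) ≤ ENNReal.ofReal (2 ^ n * (a + b)) := by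
  have hpt : ∀ x, quotPow n V x ≤ 2 ^ n * (quotPow n W x + quotPow n B x) := by
    intro x
    simp only [quotPow, div_pow, ← add_div, ← mul_div_assoc]
    refine div_le_div_of_nonneg_right ?_ (by positivity)
    rw [← hn.pow_abs, ← hn.pow_abs (swirl W x), ← hn.pow_abs (swirl B x)]
    refine (pow_le_pow_left₀ (abs_nonneg _) (h x) n).trans ((add_pow_le (abs_nonneg _)
      (abs_nonneg _) n).trans ?_)
    gcongr
    · norm_num
    · omega
  have hW0 : ∀ x, 0 ≤ quotPow n W x := fun x => hn.pow_nonneg _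
  have hB0 : ∀ x, 0 ≤ quotPow n B x := fun x => hn.pow_nonneg _
  calc ∫⁻ x, ENNReal.ofReal (quotPow n V x)
      ≤ ∫⁻ x, ENNReal.ofReal (2 ^ n) *
          (ENNReal.ofReal (quotPow n W x) + ENNReal.ofReal (quotPow n B x)) := by
        refine lintegral_mono fun x => ?_
        rw [← ENNReal.ofReal_add (hW0 x) (hB0 x), ← ENNReal.ofReal_mul (by positivity)]
        exact ENNReal.ofReal_le_ofReal (hpt x)
    _ ≤ _ := by
        rw [lintegral_const_mul' _ _ ENNReal.ofReal_ne_top,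
          lintegral_add_left (measurable_quotPow hW n).ennreal_ofReal,
          ENNReal.ofReal_mul (by positivity), ENNReal.ofReal_add ha hb]
        gcongr

/-- The axial strain on the axis is bounded by the norm of the data, as long as the solution
exists. -/
theorem exists_axial_strain_bound : ∃ K : ℝ → ℝ, (∀ s s', 0 ≤ s → s ≤ s' → K s ≤ K s') ∧
    ∀ (T : ℝ) (u B ut Bt : ℝ → E3 → E3), RegSol T u B ut Bt → IsAxisymmetricDatum (u 0) (B 0) →
      ∀ t ∈ Icc 0 T, ∀ z, |pdv 2 (u t) (meridian 0 z) 2| ≤ K (dataNorm (u 0) (B 0)) := by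
  obtain ⟨C₀, C₁, hC₀, hC₁, hC⟩ := exists_abs_pdv_axis_le
  -- the bound for the `n`-th power of the `Lⁿ` norm of `Ω` which results from `Ω = (Ω + Π) - Π`
  let bd : ℕ → ℝ → ℝ := fun n s => 2 ^ n * (2 ^ n * (s ^ n + s ^ n) + s ^ n)
  have hbd : ∀ n s s', 0 ≤ s → s ≤ s' → bd n s ≤ bd n s' := fun n s s' h0 h => by
    simp only [bd]; gcongr
  refine ⟨fun s => C₀ + C₁ * (bd 2 s + bd 4 s), fun s s' h0 h =>
    add_le_add_right (mul_le_mul_of_nonneg_left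
      (add_le_add (hbd 2 s s' h0 h) (hbd 4 s s' h0 h)) hC₁) _, ?_⟩
  intro T u B ut Bt hs hdat t ht z
  have hu := hdat.form_u.reflEven
  have hB := hdat.form_B.reflOdd
  have hN1 : 0 ≤ normL1Linfty (OmegaOf (u 0)) := by unfold normL1Linfty; positivity
  have hN2 : 0 ≤ normL1Linfty (PiOf (B 0)) := by unfold normL1Linfty; positivity
  set s := dataNorm (u 0) (B 0) with hsd
  have hs0 : 0 ≤ s := add_nonneg hN1 hN2
  have h0T : (0 : ℝ) ∈ Icc 0 T := ⟨le_rfl, ht.1.trans ht.2⟩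
  have hω := hu.curl (hdat.smooth_u.differentiable (by simp))
  have cω : ∀ τ ∈ Icc 0 T, Continuous (curl (u τ)) := fun τ hτ =>
    (hs.u2.bddW1_curl.diff τ hτ).continuous
  have cB : ∀ τ ∈ Icc 0 T, Continuous (B τ) := fun τ hτ => (hs.B2.bddW1.diff τ hτ).continuous
  have main : ∀ k, Even k → ∫⁻ x, ENNReal.ofReal (quotPow (k + 2) (curl (u t)) x) ≤
      ENNReal.ofReal (bd (k + 2) s) := by
    intro k hk
    have hn : Even (k + 2) := hk.add even_two
    have i1 : ∫⁻ x, ENNReal.ofReal (quotPow (k + 2) (curl (u 0)) x) ≤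
        ENNReal.ofReal (s ^ (k + 2)) :=
      (lintegral_mono fun x => ENNReal.ofReal_le_ofReal (hω.quotPow_le (by omega) x)).trans
        ((lintegral_pow_le_normL1Linfty hdat.omega (by omega)).trans
          (ENNReal.ofReal_le_ofReal (pow_le_pow_left₀ hN1 (by rw [hsd, dataNorm]; linarith) _)))
    have i2 : ∫⁻ x, ENNReal.ofReal (quotPow (k + 2) (B 0) x) ≤ ENNReal.ofReal (s ^ (k + 2)) :=
      (lintegral_mono fun x => ENNReal.ofReal_le_ofReal (hB.quotPow_le (by omega) x)).trans
        ((lintegral_pow_le_normL1Linfty hdat.pi (by omega)).trans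
          (ENNReal.ofReal_le_ofReal (pow_le_pow_left₀ hN2 (by rw [hsd, dataNorm]; linarith) _)))
    have i3 := lintegral_quotPow_add_le (V := totalVorticity (u 0) (B 0)) hn (cω 0 h0T)
      (fun x => by
        refine le_trans (le_of_eq ?_) (abs_add_le _ _)
        simp only [swirl, totalVorticity, PiLp.add_apply]; ring_nf)
      (by positivity) (by positivity) i1 i2
    have i4 := ((hs.swirlTransport_total hu hB).lintegral_quotPow_le hk ht).trans i3
    have i5 := ((hs.swirlTransport_B hu hB).lintegral_quotPow_le hk ht).trans i2
    exact lintegral_quotPow_add_le (V := curl (u t)) hn ((cω t ht).add (cB t ht))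
      (fun x => by
        refine le_trans (le_of_eq ?_) (abs_sub _ _)
        simp only [swirl, Pi.add_apply, PiLp.add_apply]; ring_nf)
      (by positivity) (by positivity) i4 i5
  exact hC (u t) (hs.u2.bddW1.at_time ht) (hs.u2.bddW1_curl.zero.at_time ht) (hs.div_u t ht) _ _
    (by positivity) (by positivity) (main 0 (by decide)) (main 2 (by decide)) _ rfl rfl

/-! ### Smooth solutions on the axis -/

theorem ContDiffOn.pdv_joint {T : ℝ} {v : ℝ → E3 → E3}
    (hv : ContDiffOn ℝ ∞ (fun q : ℝ × E3 => v q.1 q.2) (Ico 0 T ×ˢ univ)) (i : Fin 3) :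
    ContDiffOn ℝ ∞ (fun q : ℝ × E3 => pdv i (v q.1) q.2) (Ico 0 T ×ˢ univ) := by
  have hU : UniqueDiffOn ℝ (Ico 0 T ×ˢ (univ : Set E3)) :=
    (uniqueDiffOn_Ico 0 T).prod uniqueDiffOn_univ
  have h1 := hv.fderivWithin hU (m := ∞) (by norm_cast)
  refine (h1.clm_apply (contDiffOn_const (c := ((0 : ℝ), (EuclideanSpace.single i 1 : E3))))).congr
    fun q hq => ?_
  obtain ⟨t, x⟩ := q
  have h2 := (hv.differentiableOn (by simp) (t, x) hq).hasFDerivWithinAt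
  have h3 : HasFDerivWithinAt (fun y : E3 => (t, y)) (ContinuousLinearMap.inr ℝ ℝ E3) univ x :=
    (hasFDerivAt_prodMk_right t x).hasFDerivWithinAt
  have h4 := (h2.comp x h3 (fun y _ => ⟨hq.1, mem_univ _⟩)).hasFDerivAt univ_mem
  have h5 : fderiv ℝ (v t) x = _ := h4.fderiv
  rw [pdv, h5]
  simp

theorem ContDiffOn.curl_joint {T : ℝ} {v : ℝ → E3 → E3}
    (hv : ContDiffOn ℝ ∞ (fun q : ℝ × E3 => v q.1 q.2) (Ico 0 T ×ˢ univ)) :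
    ContDiffOn ℝ ∞ (fun q : ℝ × E3 => curl (v q.1) q.2) (Ico 0 T ×ˢ univ) := by
  have h : ∀ i j : Fin 3, ContDiffOn ℝ ∞ (fun q : ℝ × E3 => pdv i (v q.1) q.2 j)
      (Ico 0 T ×ˢ univ) := fun i j =>
    (EuclideanSpace.proj j : E3 →L[ℝ] ℝ).contDiff.comp_contDiffOn (ContDiffOn.pdv_joint hv i)
  refine contDiffOn_euclidean.2 fun j => ?_
  fin_cases j
  · exact (h 1 2).sub (h 2 1)
  · exact (h 2 0).sub (h 0 2)
  · exact (h 0 1).sub (h 1 0)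

theorem angularQuotient_axis {v : E3 → E3} (hv : Differentiable ℝ v) (z : ℝ) :
    angularQuotient v 0 z = pdv 0 v (meridian 0 z) 1 := by
  rw [angularQuotient, if_pos rfl]
  exact (hasDerivAt_comp_meridian_radial hv 1 0 z).deriv

theorem dzPiAxis_eq {B : E3 → E3} (hB : ContDiff ℝ 2 B) (z : ℝ) :
    dzPiAxis B z = pdv 2 (pdv 0 B) (meridian 0 z) 1 := by
  have hd0 : Differentiable ℝ (pdv 0 B) :=
    (contDiff_pdv (n := 1) (m := 2) hB (by norm_num) 0).differentiable (by norm_num)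
  rw [dzPiAxis, show (fun ζ => PiOf B 0 ζ) = fun ζ => pdv 0 B (meridian 0 ζ) 1 from
    funext fun ζ => angularQuotient_axis (hB.differentiable (by norm_num)) ζ]
  exact (hasDerivAt_comp_meridian_axial hd0 1 0 z).deriv

/-- On the axis, `Ω` is forced by `-∂_z(Π²)`: the difference of the equations for `Ω + Π`, which is
transported, and for `Π`. -/
theorem IsSmoothSolution.materialOmega_eq {m T₀ : ℝ} (hm : 7 / 2 < m) {u₀ B₀ : E3 → E3}
    {u B : ℝ → E3 → E3} (h : IsSmoothSolution m T₀ u₀ B₀ u B) (hd : IsAxisymmetricDatum u₀ B₀)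
    {t : ℝ} (ht : t ∈ Ico 0 T₀) (z : ℝ) :
    materialOmega u t 0 z = -2 * (PiOf (B t) 0 z * dzPiAxis (B t) z) := by
  obtain ⟨T, htT, hT⟩ := exists_between ht.2
  have hs := h.solution.regSol hm hT hd.div_B
  have htI : t ∈ Icc 0 T := ⟨ht.1, htT.le⟩
  have hsub : Icc 0 T ⊆ Ico 0 T₀ := fun τ hτ => ⟨hτ.1, hτ.2.trans_lt hT⟩
  have hu : ReflEven (u 0) := by rw [h.solution.init_u]; exact hd.form_u.reflEven
  have hB : ReflOdd (B 0) := by rw [h.solution.init_B]; exact hd.form_B.reflOdd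
  have slice : ∀ {v : ℝ → E3 → E3},
      ContDiffOn ℝ ∞ (fun q : ℝ × E3 => v q.1 q.2) (Ico 0 T₀ ×ˢ univ) →
      ∀ τ ∈ Ico 0 T₀, ContDiff ℝ ∞ (v τ) := fun {v} hv τ hτ => by
    have := hv.comp (f := fun y : E3 => (τ, y)) (s := univ)
      (contDiff_const.prodMk contDiff_id).contDiffOn (fun y _ => ⟨hτ, mem_univ _⟩)
    exact contDiffOn_univ.1 this
  have hW : ContDiffOn ℝ ∞ (fun q : ℝ × E3 => totalVorticity (u q.1) (B q.1) q.2)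
      (Ico 0 T₀ ×ˢ univ) := (ContDiffOn.curl_joint h.smooth_u).add h.smooth_B
  have hW2 : ∀ τ ∈ Ico 0 T₀, ContDiff ℝ 2 (totalVorticity (u τ) (B τ)) := fun τ hτ =>
    (slice (v := fun τ => totalVorticity (u τ) (B τ)) hW τ hτ).of_le (by norm_cast)
  have hC2 : ∀ τ ∈ Ico 0 T₀, ContDiff ℝ 2 (curl (u τ)) := fun τ hτ =>
    (slice (v := fun τ => curl (u τ)) (ContDiffOn.curl_joint h.smooth_u) τ hτ).of_le
      (by norm_cast)
  have hB2 : ∀ τ ∈ Ico 0 T₀, ContDiff ℝ 2 (B τ) := h.solution.c2_B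
  have hWzz := (ContDiffOn.pdv_joint (v := fun τ => pdv 2 (totalVorticity (u τ) (B τ)))
    (ContDiffOn.pdv_joint (v := fun τ => totalVorticity (u τ) (B τ)) hW 2) 0).continuousOn.mono
    (prod_mono_left hsub)
  have e1 := (hs.swirlTransport_total hu hB).hasDerivWithinAt_axis
    (fun τ hτ => hW2 τ (hsub hτ)) hWzz z htI
  have e2 := (hs.swirlTransport_B hu hB).hasDerivWithinAt_axis hs.B2.c2 (hs.B2.two 0 2).cont z htI
  have pd0 : ∀ τ ∈ Ico 0 T₀, ∀ x, pdv 0 (totalVorticity (u τ) (B τ)) x =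
      pdv 0 (curl (u τ)) x + pdv 0 (B τ) x := fun τ hτ x =>
    pdv_add 0 ((hC2 τ hτ).differentiable (by norm_num) x) ((hB2 τ hτ).differentiable (by norm_num) x)
  have hΩ : ∀ τ ∈ Ico 0 T₀, ∀ ζ, OmegaOf (u τ) 0 ζ = pdv 0 (curl (u τ)) (meridian 0 ζ) 1 :=
    fun τ hτ ζ => angularQuotient_axis ((hC2 τ hτ).differentiable (by norm_num)) ζ
  have e3 : HasDerivWithinAt (fun s => OmegaOf (u s) 0 z) _ (Icc 0 T) t :=
    (e1.sub e2).congr (fun s hs' => by rw [hΩ s (hsub hs')]; simp [pd0 s (hsub hs')])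
      (by rw [hΩ t ht]; simp [pd0 t ht])
  have hn : Icc 0 T ∈ 𝓝[Ici 0] t :=
    mem_nhdsWithin.2 ⟨Iio T, isOpen_Iio, htT, fun τ hτ => ⟨hτ.2, hτ.1.le⟩⟩
  have e4 := (e3.mono_of_mem_nhdsWithin hn).derivWithin (uniqueDiffOn_Ici 0 t ht.1)
  have hd1 : ∀ {v : E3 → E3}, ContDiff ℝ 2 v → Differentiable ℝ (pdv 0 v) := fun hv =>
    (contDiff_pdv (n := 1) (m := 2) hv (by norm_num) 0).differentiable (by norm_num)
  have e5 : deriv (fun ζ => OmegaOf (u t) 0 ζ) z =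
      pdv 2 (pdv 0 (curl (u t))) (meridian 0 z) 1 := by
    rw [show (fun ζ => OmegaOf (u t) 0 ζ) = _ from funext (hΩ t ht)]
    exact (hasDerivAt_comp_meridian_axial (hd1 (hC2 t ht)) 1 0 z).deriv
  have e6 : pdv 0 (pdv 2 (totalVorticity (u t) (B t))) (meridian 0 z) =
      pdv 2 (pdv 0 (curl (u t))) (meridian 0 z) + pdv 2 (pdv 0 (B t)) (meridian 0 z) := by
    rw [pdv_comm (hW2 t ht), show pdv 0 (totalVorticity (u t) (B t)) =
      fun x => pdv 0 (curl (u t)) x + pdv 0 (B t) x from funext (pd0 t ht)]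
    exact pdv_add 2 (hd1 (hC2 t ht) _) (hd1 (hB2 t ht) _)
  have e7 : compR (u t) 0 z = 0 :=
    (((hs.symm hu hB htI).1).axis_zero (x := meridian 0 z) rfl rfl).1
  rw [materialOmega, e4, e5, e7, dzPiAxis_eq (hB2 t ht), PiOf,
    angularQuotient_axis ((hB2 t ht).differentiable (by norm_num)), e6,
    pdv_comm (hB2 t ht) 0 2, compZ, PiLp.add_apply]
  ring

/-! ### Data with a large gradient of `Π` and bounded `Π` -/

/-- Smooth compactly supported fields belong to all Sobolev spaces: their Fourier transform is a
Schwartz function. -/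
theorem sobolevNorm_lt_top_of_hasCompactSupport {v : E3 → E3} (hv : ContDiff ℝ ∞ v)
    (hc : HasCompactSupport v) (s : ℝ) : sobolevNorm s v < ⊤ := by
  have h1 : ContDiff ℝ ∞ (complexify v) := by
    rw [complexify_eq]; exact complexL.contDiff.comp hv
  have h2 : HasCompactSupport (complexify v) := by
    rw [complexify_eq]; exact hc.comp_left (map_zero complexL)
  set f := h2.toSchwartzMap h1 with hf
  have hm : MemLp (complexify v) 2 volume := f.memLp 2 volume
  rw [sobolevNorm_eq hm]
  have e1 : hm.toLp (complexify v) = f.toLp 2 := rfl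
  rw [e1, SchwartzMap.toLp_fourier_eq]
  have hw := Function.hasTemperateGrowth_one_add_norm_sq_rpow E3 (s / 2)
  have h3 := (SchwartzMap.smulLeftCLM (EuclideanSpace ℂ (Fin 3))
    (fun ξ : E3 => ((1 + ‖ξ‖ ^ 2) ^ (s / 2) : ℝ)) (𝓕 f)).memLp 2 volume
  refine (h3.ae_eq ?_).2
  filter_upwards [(𝓕 f).coeFn_toLp 2 volume] with ξ hξ
  rw [hξ, SchwartzMap.smulLeftCLM_apply_apply hw]

/-- A cut-off function, equal to `1` on the unit ball. -/
def cutoff (x : E3) : ℝ := Real.smoothTransition (2 - ‖x‖ ^ 2)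

theorem contDiff_cutoff : ContDiff ℝ ∞ cutoff :=
  Real.smoothTransition.contDiff.comp (contDiff_const.sub (contDiff_norm_sq ℝ))

theorem hasCompactSupport_cutoff : HasCompactSupport cutoff := by
  refine HasCompactSupport.of_support_subset_isCompact (isCompact_closedBall (0 : E3) 2)
    fun x hx => ?_
  by_contra h
  rw [mem_closedBall_zero_iff, not_le] at h
  exact hx (Real.smoothTransition.zero_of_nonpos (by nlinarith))

/-- The quotient `Π` of the data: bounded uniformly in `N`, with `z`-derivative `N` at the origin. -/
def amplitude (N : ℝ) (x : E3) : ℝ := cutoff x * (2 + Real.sin (N * x 2))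

theorem contDiff_amplitude (N : ℝ) : ContDiff ℝ ∞ (amplitude N) := by
  have h : ContDiff ℝ ∞ fun x : E3 => 2 + Real.sin (N * x 2) := by fun_prop
  exact contDiff_cutoff.mul h

theorem abs_amplitude_le (N : ℝ) (x : E3) : |amplitude N x| ≤ 3 * cutoff x := by
  have h0 : 0 ≤ cutoff x := Real.smoothTransition.nonneg _
  have h1 : |2 + Real.sin (N * x 2)| ≤ 3 := by
    rw [abs_le]
    constructor <;> linarith [Real.neg_one_le_sin (N * x 2), Real.sin_le_one (N * x 2)]
  rw [amplitude, abs_mul, abs_of_nonneg h0, mul_comm]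
  exact mul_le_mul_of_nonneg_right h1 h0

theorem norm_meridian_sq (r z : ℝ) : ‖meridian r z‖ ^ 2 = r ^ 2 + z ^ 2 := by
  rw [EuclideanSpace.norm_sq_eq]
  simp [Fin.sum_univ_three, meridian]

theorem amplitude_meridian (N : ℝ) (x : E3) :
    amplitude N (meridian (rad x) (x 2)) = amplitude N x := by
  have h : ‖meridian (rad x) (x 2)‖ ^ 2 = ‖x‖ ^ 2 := by
    rw [norm_meridian_sq, rad_sq, EuclideanSpace.norm_sq_eq]
    simp [Fin.sum_univ_three]
  rw [amplitude, amplitude, cutoff, cutoff, h, meridian_two_apply]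

/-- The azimuthal field `r Π e_θ` with `Π` given by `amplitude`. -/
def swirlDatum (N : ℝ) (x : E3) : E3 := amplitude N x • rotGen x

theorem contDiff_swirlDatum (N : ℝ) : ContDiff ℝ ∞ (swirlDatum N) := by
  have h : ContDiff ℝ ∞ rotGen := by
    refine contDiff_euclidean.2 fun j => ?_
    fin_cases j <;> simp [rotGen] <;> fun_prop
  exact (contDiff_amplitude N).smul h

theorem angularQuotient_swirlDatum (N r z : ℝ) :
    PiOf (swirlDatum N) r z = amplitude N (meridian r z) := by
  have h : ∀ ρ, compTheta (swirlDatum N) ρ z = amplitude N (meridian ρ z) * ρ := fun ρ => by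
    simp [compTheta, swirlDatum, rotGen, meridian]
  by_cases hr : r = 0
  · subst hr
    rw [PiOf, angularQuotient, if_pos rfl, funext h]
    have h0 : DifferentiableAt ℝ (amplitude N) (meridian 0 z) :=
      (contDiff_amplitude N).differentiable (by simp) _
    have h1 := h0.hasFDerivAt.comp_hasDerivAt 0 (hasDerivAt_meridian_radial 0 z)
    have h2 := (h1.mul (hasDerivAt_id 0)).deriv
    simp only [id, mul_zero, zero_add, mul_one] at h2
    exact h2
  · rw [PiOf, angularQuotient, if_neg hr, h, mul_div_cancel_right₀ _ hr]

theorem lift_swirlDatum (N : ℝ) : lift (PiOf (swirlDatum N)) = amplitude N :=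
  funext fun x => by rw [lift, angularQuotient_swirlDatum, amplitude_meridian]

theorem divergence_swirlDatum (N : ℝ) (x : E3) : divergence (swirlDatum N) x = 0 := by
  have hd : DifferentiableAt ℝ (swirlDatum N) x :=
    (contDiff_swirlDatum N).differentiable (by simp) x
  have ha : DifferentiableAt ℝ (amplitude N) x := (contDiff_amplitude N).differentiable (by simp) x
  have hc : DifferentiableAt ℝ cutoff x := contDiff_cutoff.differentiable (by simp) x
  -- the derivatives across the axis are radial
  have hcut : ∀ i, sd i cutoff x = deriv Real.smoothTransition (2 - ‖x‖ ^ 2) * (-(2 * x i)) := by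
    intro i
    have h1 : HasFDerivAt (fun y : E3 => 2 - ‖y‖ ^ 2) (-(2 • innerSL ℝ x)) x :=
      ((hasStrictFDerivAt_norm_sq x).hasFDerivAt).const_sub 2
    have h2 : HasDerivAt Real.smoothTransition _ (2 - ‖x‖ ^ 2) :=
      ((Real.smoothTransition.contDiff (n := 1)).differentiable (by simp) _).hasDerivAt
    have h3 : fderiv ℝ cutoff x = _ := (h2.comp_hasFDerivAt x h1).fderiv
    rw [sd, h3]
    simp [EuclideanSpace.inner_single_right]
  have hsin : ∀ i : Fin 3, i ≠ 2 → sd i (fun y : E3 => 2 + Real.sin (N * y 2)) x = 0 := by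
    intro i hi
    have h1 : HasFDerivAt (fun y : E3 => y 2) (EuclideanSpace.proj 2 : E3 →L[ℝ] ℝ) x :=
      (EuclideanSpace.proj 2 : E3 →L[ℝ] ℝ).hasFDerivAt
    have h3 : fderiv ℝ (fun y : E3 => 2 + Real.sin (N * y 2)) x = _ :=
      ((h1.const_mul N).sin.const_add 2).fderiv
    rw [sd, h3]
    simp [hi.symm]
  have hamp : ∀ i : Fin 3, i ≠ 2 → sd i (amplitude N) x = deriv Real.smoothTransition (2 - ‖x‖ ^ 2) *
      (-(2 * x i)) * (2 + Real.sin (N * x 2)) := by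
    intro i hi
    have := sd_mul (i := i) hc (by fun_prop : DifferentiableAt ℝ (fun y : E3 =>
      2 + Real.sin (N * y 2)) x)
    rw [hcut, hsin i hi] at this
    refine Eq.trans this ?_
    ring
  have e0 : (fun y => swirlDatum N y 0) = fun y => -(amplitude N y * y 1) := by
    funext y; simp [swirlDatum, rotGen]
  have e1 : (fun y => swirlDatum N y 1) = fun y => amplitude N y * y 0 := by
    funext y; simp [swirlDatum, rotGen]
  have e2 : (fun y => swirlDatum N y 2) = fun _ => 0 := by
    funext y; simp [swirlDatum, rotGen]
  simp only [divergence, Fin.sum_univ_three, pd_eq_sd hd, e0, e1, e2]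
  simp (disch := fun_prop) only [sd_neg, sd_mul, sd_coord, sd_const]
  rw [hamp 0 (by decide), hamp 1 (by decide)]
  simp
  ring

theorem isAxisymmetricSwirl_swirlDatum (N : ℝ) : IsAxisymmetricSwirl (swirlDatum N) := by
  refine ⟨fun r z => amplitude N (meridian r z) * r, fun x => ?_⟩
  change _ = (amplitude N (meridian (rad x) (x 2)) * rad x) • eTheta x
  rw [amplitude_meridian]
  by_cases hx : rad x = 0
  · obtain ⟨h0, h1⟩ := rad_eq_zero.1 hx
    ext j
    fin_cases j <;> simp [swirlDatum, rotGen, hx, h0, h1]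
  · ext j
    fin_cases j <;> simp [swirlDatum, rotGen, eTheta] <;> field_simp

theorem curl_zero (x : E3) : curl (0 : E3 → E3) x = 0 := by
  ext j
  fin_cases j <;> simp [curl, pd]

theorem lift_OmegaOf_zero : lift (OmegaOf (0 : E3 → E3)) = 0 := by
  funext x
  have h : curl (0 : E3 → E3) = 0 := funext curl_zero
  simp [lift, OmegaOf, angularQuotient, h, compTheta]

theorem hasCompactSupport_amplitude (N : ℝ) : HasCompactSupport (amplitude N) :=
  hasCompactSupport_cutoff.mul_right

theorem isAxisymmetricDatum_swirlDatum (N : ℝ) :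
    IsAxisymmetricDatum (0 : E3 → E3) (swirlDatum N) where
  smooth_u := contDiff_const
  smooth_B := contDiff_swirlDatum N
  compact_u := HasCompactSupport.zero
  compact_B := (hasCompactSupport_amplitude N).smul_right
  div_u x := by simp [divergence, pd]
  div_B := divergence_swirlDatum N
  form_u := ⟨0, 0, fun x => by simp⟩
  form_B := isAxisymmetricSwirl_swirlDatum N
  omega := by
    rw [MemL1Linfty, lift_OmegaOf_zero]
    exact ⟨MemLp.zero, MemLp.zero⟩
  pi := by
    rw [MemL1Linfty, lift_swirlDatum]
    have h := (contDiff_amplitude N).continuous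
    exact ⟨h.memLp_of_hasCompactSupport (hasCompactSupport_amplitude N),
      h.memLp_of_hasCompactSupport (hasCompactSupport_amplitude N)⟩

theorem exists_dataNorm_swirlDatum_le :
    ∃ S, ∀ N, 0 ≤ dataNorm (0 : E3 → E3) (swirlDatum N) ∧
      dataNorm (0 : E3 → E3) (swirlDatum N) ≤ S := by
  have hc : Continuous fun x => 3 * cutoff x := contDiff_cutoff.continuous.const_mul 3
  have hs : HasCompactSupport fun x => 3 * cutoff x := hasCompactSupport_cutoff.mul_left
  have hm : ∀ p, MemLp (fun x => 3 * cutoff x) p volume := fun p =>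
    hc.memLp_of_hasCompactSupport hs
  refine ⟨(eLpNorm (fun x => 3 * cutoff x) 1 volume).toReal +
    (eLpNorm (fun x => 3 * cutoff x) ⊤ volume).toReal, fun N => ?_⟩
  have e : dataNorm (0 : E3 → E3) (swirlDatum N) = (eLpNorm (amplitude N) 1 volume).toReal +
      (eLpNorm (amplitude N) ⊤ volume).toReal := by
    rw [dataNorm, normL1Linfty, normL1Linfty, lift_OmegaOf_zero, lift_swirlDatum]
    simp
  have hle : ∀ p, (eLpNorm (amplitude N) p volume).toReal ≤
      (eLpNorm (fun x => 3 * cutoff x) p volume).toReal := fun p =>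
    ENNReal.toReal_mono (hm p).eLpNorm_ne_top (eLpNorm_mono_real (abs_amplitude_le N))
  rw [e]
  exact ⟨by positivity, add_le_add (hle 1) (hle ⊤)⟩

theorem PiOf_swirlDatum_origin (N : ℝ) : PiOf (swirlDatum N) 0 0 = 2 := by
  rw [angularQuotient_swirlDatum, amplitude, cutoff, norm_meridian_sq, meridian_two_apply]
  rw [Real.smoothTransition.one_of_one_le (by norm_num)]
  simp

theorem dzPiAxis_swirlDatum (N : ℝ) : dzPiAxis (swirlDatum N) 0 = N := by
  have h : (fun ζ => PiOf (swirlDatum N) 0 ζ) =ᶠ[𝓝 0] fun ζ => 2 + Real.sin (N * ζ) := by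
    filter_upwards [Metric.ball_mem_nhds (0 : ℝ) one_pos] with ζ hζ
    rw [mem_ball_zero_iff, Real.norm_eq_abs] at hζ
    rw [angularQuotient_swirlDatum, amplitude, cutoff, norm_meridian_sq, meridian_two_apply,
      Real.smoothTransition.one_of_one_le, one_mul]
    have := (sq_lt_one_iff_abs_lt_one ζ).2 hζ
    linarith
  rw [dzPiAxis, h.deriv_eq]
  have h1 : HasDerivAt (fun ζ : ℝ => 2 + Real.sin (N * ζ)) (Real.cos (N * 0) * (N * 1)) 0 :=
    (((hasDerivAt_id (0 : ℝ)).const_mul N).sin).const_add 2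
  rw [h1.deriv]
  simp

/-! ### Restriction and gluing in time -/

section Local
variable {m : ℝ} {I : Set ℝ} {u₀ B₀ : E3 → E3} {u B u' B' : ℝ → E3 → E3}

theorem ContinuousInSobolev.inter_Iio {v : ℝ → E3 → E3} (h : ContinuousInSobolev m I v) (c : ℝ) :
    ContinuousInSobolev m (I ∩ Iio c) v :=
  ⟨fun t ht => h.1 t ht.1, fun t ht => (h.2 t ht.1).mono_left (nhdsWithin_mono _ inter_subset_left)⟩

theorem IsSolution.inter_Iio (h : IsSolution m I u₀ B₀ u B) (c : ℝ) :
    IsSolution m (I ∩ Iio c) u₀ B₀ u B where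
  sobolev_u := h.sobolev_u.inter_Iio c
  sobolev_B := h.sobolev_B.inter_Iio c
  c1_u := h.c1_u.mono (prod_mono_left inter_subset_left)
  c1_B := h.c1_B.mono (prod_mono_left inter_subset_left)
  c2_u t ht := h.c2_u t ht.1
  c2_B t ht := h.c2_B t ht.1
  momentum t ht := by
    simp_rw [derivWithin_inter (Iio_mem_nhds (mem_Iio.1 ht.2))]
    exact h.momentum t ht.1
  div_u t ht := h.div_u t ht.1
  induction t ht x := by
    rw [derivWithin_inter (Iio_mem_nhds (mem_Iio.1 ht.2))]
    exact h.induction t ht.1 x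
  init_u := h.init_u
  init_B := h.init_B

theorem ContDiffOn.of_inter_Iio {n : WithTop ℕ∞} {T : ℝ} {v : ℝ × E3 → E3} (hI : I ⊆ Iio T)
    (h : ∀ c < T, ContDiffOn ℝ n v ((I ∩ Iio c) ×ˢ univ)) : ContDiffOn ℝ n v (I ×ˢ univ) := by
  rintro ⟨t, x⟩ ⟨ht, -⟩
  obtain ⟨c, htc, hc⟩ := exists_between (mem_Iio.1 (hI ht))
  refine (h c hc (t, x) ⟨⟨ht, htc⟩, mem_univ _⟩).mono_of_mem_nhdsWithin ?_
  have : I ×ˢ (univ : Set E3) ∩ (Iio c ×ˢ univ) ∈ 𝓝[I ×ˢ univ] (t, x) :=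
    inter_mem_nhdsWithin _ (prod_mem_nhds (Iio_mem_nhds htc) univ_mem)
  rwa [prod_inter_prod, univ_inter] at this

theorem ContinuousInSobolev.of_inter_Iio {T : ℝ} {v : ℝ → E3 → E3} (hI : I ⊆ Iio T)
    (h : ∀ c < T, ContinuousInSobolev m (I ∩ Iio c) v) : ContinuousInSobolev m I v := by
  constructor
  · intro t ht
    obtain ⟨c, htc, hc⟩ := exists_between (mem_Iio.1 (hI ht))
    exact (h c hc).1 t ⟨ht, htc⟩
  · intro t ht
    obtain ⟨c, htc, hc⟩ := exists_between (mem_Iio.1 (hI ht))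
    rw [nhdsWithin_restrict' I (Iio_mem_nhds htc)]
    exact (h c hc).2 t ⟨ht, htc⟩

theorem IsSolution.of_inter_Iio {T : ℝ} (hI : I ⊆ Iio T)
    (h : ∀ c < T, IsSolution m (I ∩ Iio c) u₀ B₀ u B) : IsSolution m I u₀ B₀ u B where
  sobolev_u := ContinuousInSobolev.of_inter_Iio hI fun c hc => (h c hc).sobolev_u
  sobolev_B := ContinuousInSobolev.of_inter_Iio hI fun c hc => (h c hc).sobolev_B
  c1_u := ContDiffOn.of_inter_Iio hI fun c hc => (h c hc).c1_u
  c1_B := ContDiffOn.of_inter_Iio hI fun c hc => (h c hc).c1_B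
  c2_u t ht := by
    obtain ⟨c, htc, hc⟩ := exists_between (mem_Iio.1 (hI ht))
    exact (h c hc).c2_u t ⟨ht, htc⟩
  c2_B t ht := by
    obtain ⟨c, htc, hc⟩ := exists_between (mem_Iio.1 (hI ht))
    exact (h c hc).c2_B t ⟨ht, htc⟩
  momentum t ht := by
    obtain ⟨c, htc, hc⟩ := exists_between (mem_Iio.1 (hI ht))
    have := (h c hc).momentum t ⟨ht, htc⟩
    simp_rw [derivWithin_inter (Iio_mem_nhds htc)] at this
    exact this
  div_u t ht := by
    obtain ⟨c, htc, hc⟩ := exists_between (mem_Iio.1 (hI ht))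
    exact (h c hc).div_u t ⟨ht, htc⟩
  induction t ht x := by
    obtain ⟨c, htc, hc⟩ := exists_between (mem_Iio.1 (hI ht))
    have := (h c hc).induction t ⟨ht, htc⟩ x
    rwa [derivWithin_inter (Iio_mem_nhds htc)] at this
  init_u := (h (T - 1) (by linarith)).init_u
  init_B := (h (T - 1) (by linarith)).init_B

theorem ContinuousInSobolev.congr {v v' : ℝ → E3 → E3} (h : ContinuousInSobolev m I v)
    (e : ∀ t ∈ I, v' t = v t) : ContinuousInSobolev m I v' := by
  refine ⟨fun t ht => by rw [e t ht]; exact h.1 t ht, fun t ht => (h.2 t ht).congr' ?_⟩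
  filter_upwards [self_mem_nhdsWithin] with s hs
  rw [e s hs, e t ht]

theorem IsSolution.congr (h : IsSolution m I u₀ B₀ u B) (h0 : 0 ∈ I) (eu : ∀ t ∈ I, u' t = u t)
    (eB : ∀ t ∈ I, B' t = B t) : IsSolution m I u₀ B₀ u' B' where
  sobolev_u := h.sobolev_u.congr eu
  sobolev_B := h.sobolev_B.congr eB
  c1_u := h.c1_u.congr fun q hq => by rw [eu q.1 hq.1]
  c1_B := h.c1_B.congr fun q hq => by rw [eB q.1 hq.1]
  c2_u t ht := by rw [eu t ht]; exact h.c2_u t ht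
  c2_B t ht := by rw [eB t ht]; exact h.c2_B t ht
  momentum t ht := by
    have e : ∀ x, derivWithin (fun s => u' s x) I t = derivWithin (fun s => u s x) I t := fun x =>
      derivWithin_congr (fun s hs => by rw [eu s hs]) (by rw [eu t ht])
    simp_rw [e]
    rw [eu t ht, eB t ht]
    exact h.momentum t ht
  div_u t ht := by rw [eu t ht]; exact h.div_u t ht
  induction t ht x := by
    have e : derivWithin (fun s => B' s x) I t = derivWithin (fun s => B s x) I t :=
      derivWithin_congr (fun s hs => by rw [eB s hs]) (by rw [eB t ht])
    rw [e, eu t ht, eB t ht]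
    exact h.induction t ht x
  init_u := by rw [eu 0 h0, h.init_u]
  init_B := by rw [eB 0 h0, h.init_B]

end Local

variable {m T T' : ℝ} {u₀ B₀ : E3 → E3} {u B u' B' : ℝ → E3 → E3}

theorem Ico_inter_Iio_of_le {c : ℝ} (h : c ≤ T) : Ico 0 T ∩ Iio c = Ico 0 c := by
  rw [Ico_inter_Iio, min_eq_right h]

theorem IsSmoothSolution.mono (h : IsSmoothSolution m T u₀ B₀ u B) (hT : T' ≤ T) :
    IsSmoothSolution m T' u₀ B₀ u B := by
  have h1 := h.solution.inter_Iio T'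
  rw [Ico_inter_Iio_of_le hT] at h1
  exact ⟨h1, h.smooth_u.mono (prod_mono_left (Ico_subset_Ico_right hT)),
    h.smooth_B.mono (prod_mono_left (Ico_subset_Ico_right hT))⟩

theorem IsSmoothSolution.congr (h : IsSmoothSolution m T u₀ B₀ u B) (hT : 0 < T)
    (eu : ∀ t ∈ Ico 0 T, u' t = u t) (eB : ∀ t ∈ Ico 0 T, B' t = B t) :
    IsSmoothSolution m T u₀ B₀ u' B' :=
  ⟨h.solution.congr ⟨le_rfl, hT⟩ eu eB, h.smooth_u.congr fun q hq => by rw [eu q.1 hq.1],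
    h.smooth_B.congr fun q hq => by rw [eB q.1 hq.1]⟩

theorem IsSmoothSolution.of_lt (hT : 0 < T)
    (h : ∀ c, 0 < c → c < T → IsSmoothSolution m c u₀ B₀ u B) :
    IsSmoothSolution m T u₀ B₀ u B := by
  have key : ∀ c < T, ∃ d, c ≤ d ∧ d ≤ T ∧ IsSmoothSolution m d u₀ B₀ u B := fun c hc =>
    ⟨max c (T / 2), le_max_left _ _, max_le hc.le (by linarith),
      h _ (lt_max_of_lt_right (by linarith)) (max_lt hc (by linarith))⟩
  have hI : Ico 0 T ⊆ Iio T := fun t ht => ht.2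
  have sub : ∀ {c d : ℝ}, c ≤ d → Ico 0 T ∩ Iio c ⊆ Ico 0 d := fun hcd t ht =>
    ⟨ht.1.1, lt_of_lt_of_le ht.2 hcd⟩
  refine ⟨IsSolution.of_inter_Iio hI fun c hc => ?_, ContDiffOn.of_inter_Iio hI fun c hc => ?_,
    ContDiffOn.of_inter_Iio hI fun c hc => ?_⟩
  · obtain ⟨d, hcd, hdT, hd⟩ := key c hc
    have := hd.solution.inter_Iio c
    rwa [Ico_inter_Iio_of_le hcd, ← Ico_inter_Iio_of_le (hcd.trans hdT)] at this
  · obtain ⟨d, hcd, -, hd⟩ := key c hc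
    exact hd.smooth_u.mono (prod_mono_left (sub hcd))
  · obtain ⟨d, hcd, -, hd⟩ := key c hc
    exact hd.smooth_B.mono (prod_mono_left (sub hcd))

theorem IsSmoothSolution.unique (hm : 7 / 2 < m) (hdiv : ∀ x, divergence B₀ x = 0)
    (h : IsSmoothSolution m T u₀ B₀ u B) (h' : IsSmoothSolution m T' u₀ B₀ u' B') {t : ℝ}
    (ht0 : 0 ≤ t) (ht : t < T) (ht' : t < T') : u t = u' t ∧ B t = B' t :=
  (h.solution.regSol hm ht hdiv).unique (h'.solution.regSol hm ht' hdiv)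
    (by rw [h.solution.init_u, h'.solution.init_u])
    (by rw [h.solution.init_B, h'.solution.init_B]) ⟨ht0, le_rfl⟩

/-- If smooth solutions have bounded existence times, then there is one with the largest existence
time. -/
theorem exists_maximal_smoothSolution (hm : 7 / 2 < m) (hdiv : ∀ x, divergence B₀ x = 0) {b : ℝ}
    (hex : ∃ T > 0, ∃ u B, IsSmoothSolution m T u₀ B₀ u B)
    (hb : ∀ T > 0, ∀ u B, IsSmoothSolution m T u₀ B₀ u B → T ≤ b) :
    ∃ tb ∈ Ioc 0 b, ∃ u B, IsSmoothSolution m tb u₀ B₀ u B ∧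
      ∀ T > tb, ∀ u' B', ¬ IsSmoothSolution m T u₀ B₀ u' B' := by
  classical
  set S : Set ℝ := {T | 0 < T ∧ ∃ u B, IsSmoothSolution m T u₀ B₀ u B} with hS
  have hSne : S.Nonempty := by
    obtain ⟨T, hT, h⟩ := hex; exact ⟨T, hT, h⟩
  have hSb : BddAbove S := ⟨b, fun T hT => by
    obtain ⟨u, B, h⟩ := hT.2; exact hb T hT.1 u B h⟩
  have hsol : ∀ T : S, ∃ uB : (ℝ → E3 → E3) × (ℝ → E3 → E3),
      IsSmoothSolution m T u₀ B₀ uB.1 uB.2 := fun T => by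
    obtain ⟨u, B, h⟩ := T.2.2; exact ⟨(u, B), h⟩
  choose F hF using hsol
  set tb := sSup S with htb
  have hpos : 0 < tb := by
    obtain ⟨T, hT⟩ := hSne
    exact hT.1.trans_le (le_csSup hSb hT)
  have hlt : ∀ t < tb, ∃ T : S, t < T := fun t ht => by
    obtain ⟨T, hT, h⟩ := exists_lt_of_lt_csSup hSne ht; exact ⟨⟨T, hT⟩, h⟩
  -- by uniqueness the choice of the solution does not matter
  set u : ℝ → E3 → E3 := fun t => if h : ∃ T : S, t < T then (F h.choose).1 t else 0 with hu
  set B : ℝ → E3 → E3 := fun t => if h : ∃ T : S, t < T then (F h.choose).2 t else 0 with hB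
  have hglue : ∀ T : S, ∀ t ∈ Ico 0 (T : ℝ), u t = (F T).1 t ∧ B t = (F T).2 t := by
    intro T t ht
    have h : ∃ T : S, t < T := ⟨T, ht.2⟩
    have := (hF h.choose).unique hm hdiv (hF T) ht.1 h.choose_spec ht.2
    simp only [hu, hB, dif_pos h]
    exact this
  refine ⟨tb, ⟨hpos, csSup_le hSne fun T hT => by
    obtain ⟨u, B, h⟩ := hT.2; exact hb T hT.1 u B h⟩, u, B,
    IsSmoothSolution.of_lt hpos fun c hc0 hc => ?_, fun T hT u' B' h => ?_⟩
  · obtain ⟨T, hcT⟩ := hlt c hc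
    exact ((hF T).congr T.2.1 (fun t ht => (hglue T t ht).1) (fun t ht => (hglue T t ht).2)).mono
      hcT.le
  · exact hT.not_ge (le_csSup hSb ⟨hpos.trans hT, u', B', h⟩)

/-- A solution with the largest existence time cannot be continued, so `Q` is unbounded on it. -/
theorem ContinuesWhileBounded.exists_blowup {Q : (ℝ → E3 → E3) → (ℝ → E3 → E3) → ℝ → ℝ≥0∞}
    (hQ : ContinuesWhileBounded m u₀ B₀ Q) (hm : 7 / 2 < m) (hdiv : ∀ x, divergence B₀ x = 0)
    {b : ℝ} (hex : ∃ T > 0, ∃ u B, IsSmoothSolution m T u₀ B₀ u B)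
    (hb : ∀ T > 0, ∀ u B, IsSmoothSolution m T u₀ B₀ u B → T ≤ b) :
    ∃ tb ∈ Ioc 0 b, ∃ u B, IsSmoothSolution m tb u₀ B₀ u B ∧
      limsup (Q u B) (𝓝[<] tb) = ⊤ := by
  obtain ⟨tb, htb, u, B, h, hmax⟩ := exists_maximal_smoothSolution hm hdiv hex hb
  refine ⟨tb, htb, u, B, h, ?_⟩
  by_contra hne
  obtain ⟨T', hT', u', B', h'⟩ := hQ tb htb.1 u B h (lt_top_iff_ne_top.2 hne)
  exact hmax T' hT' u' B' h'

/-! ### Breakdown -/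

/-- Solutions with a large gradient `y₀` of `Π` at the origin steepen before the time `2/y₀`. -/
theorem exists_steepening : ∃ K : ℝ → ℝ, (∀ s s', 0 ≤ s → s ≤ s' → K s ≤ K s') ∧
    ∀ (m T : ℝ) (u₀ B₀ : E3 → E3) (u B : ℝ → E3 → E3), 7 / 2 < m → IsAxisymmetricDatum u₀ B₀ →
      IsSolution m (Ico 0 T) u₀ B₀ u B → 0 < dzPiAxis B₀ 0 →
      2 * K (dataNorm u₀ B₀) ≤ dzPiAxis B₀ 0 → ∀ t ∈ Ico 0 T,
        IsAxisymmetricNoSwirl (u t) ∧ IsAxisymmetricSwirl (B t) ∧ t * dzPiAxis B₀ 0 < 2 ∧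
        ∃ ζ, PiOf (B t) 0 ζ = PiOf B₀ 0 0 ∧
          dzPiAxis B₀ 0 / (2 - t * dzPiAxis B₀ 0) ≤ dzPiAxis (B t) ζ := by
  obtain ⟨K, hmono, hK⟩ := exists_axial_strain_bound
  refine ⟨K, hmono, ?_⟩
  rintro m T u₀ B₀ u B hm hd h hy hKy t ht
  have hs := h.regSol hm ht.2 hd.div_B
  have htI : t ∈ Icc 0 t := ⟨ht.1, le_rfl⟩
  have h0T : (0 : ℝ) ∈ Ico 0 T := ⟨le_rfl, ht.1.trans_lt ht.2⟩
  have hu0 := h.init_u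
  have hB0 := h.init_B
  have hu : ReflEven (u 0) := by rw [hu0]; exact hd.form_u.reflEven
  have hB : ReflOdd (B 0) := by rw [hB0]; exact hd.form_B.reflOdd
  have hPi : ∀ τ ∈ Ico 0 T, ∀ ζ, PiOf (B τ) 0 ζ = pdv 0 (B τ) (meridian 0 ζ) 1 := fun τ hτ ζ =>
    angularQuotient_axis ((h.c2_B τ hτ).differentiable (by norm_num)) ζ
  have hw : ∀ τ ∈ Icc 0 t, ∀ z, |pdv 2 (u τ) (meridian 0 z) 2| ≤ dzPiAxis B₀ 0 / 2 := by
    intro τ hτ z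
    have := hK t u B _ _ hs (by rw [hu0, hB0]; exact hd) τ hτ z
    rw [hu0, hB0] at this
    linarith
  obtain ⟨h1, ζ, h2, h3⟩ := (hs.axisFlow hu hB).steepening hy hw
    (by rw [← dzPiAxis_eq (h.c2_B 0 h0T), hB0]) htI
  refine ⟨(hs.symm hu hB htI).1.isAxisymmetricNoSwirl, (hs.symm hu hB htI).2.isAxisymmetricSwirl,
    h1, ζ, ?_, ?_⟩
  · rw [hPi t ht, h2, ← hPi 0 h0T, hB0]
  · rwa [dzPiAxis_eq (h.c2_B t ht)]

theorem IsSolution.restrict_Ici (h : IsSolution m (Ici 0) u₀ B₀ u B) (T : ℝ) :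
    IsSolution m (Ico 0 T) u₀ B₀ u B := by
  have := h.inter_Iio T
  rwa [Ici_inter_Iio] at this

end HallMHD

end

open HallMHD in
theorem theorem1p2 :
    -- not globally well-posed
    (∀ m : ℝ, 7 / 2 < m → ¬ GloballyWellPosed m) ∧
    ∃ Ctil : ℝ → ℝ, (∀ s, 0 < Ctil s) ∧
      -- such data exist
      (∃ u₀ B₀ : E3 → E3, IsAxisymmetricDatum u₀ B₀ ∧
        4 * (Ctil (dataNorm u₀ B₀)) ^ (1 / 2 : ℝ) ≤ dzPiAxis B₀ 0 ∧ 0 < PiOf B₀ 0 0) ∧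
      -- and all of them lead to blow-up
      ∀ (u₀ B₀ : E3 → E3) (y₀ J₀ : ℝ), IsAxisymmetricDatum u₀ B₀ →
        y₀ = dzPiAxis B₀ 0 → J₀ = PiOf B₀ 0 0 →
        4 * (Ctil (dataNorm u₀ B₀)) ^ (1 / 2 : ℝ) ≤ y₀ → 0 < J₀ →
        ∀ m : ℝ, 7 / 2 < m →
          (∀ T > 0, ∀ u B, IsSmoothSolution m T u₀ B₀ u B →
            T ≤ 2 / y₀ ∧
            (∀ t ∈ Set.Ico 0 T,
              IsAxisymmetricNoSwirl (u t) ∧ IsAxisymmetricSwirl (B t) ∧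
              ENNReal.ofReal (y₀ / (2 - t * y₀)) ≤ supDzPi B t ∧
              ENNReal.ofReal (2 * J₀ * (y₀ / (2 - t * y₀))) ≤ supMaterialOmega u t)) ∧
          ((∃ T > 0, ∃ u B, IsSmoothSolution m T u₀ B₀ u B) →
            (ContinuesWhileBounded m u₀ B₀ (fun _ B => supDzPi B) →
              ∃ tb ∈ Set.Ioc 0 (2 / y₀), ∃ u B, IsSmoothSolution m tb u₀ B₀ u B ∧
                Filter.limsup (supDzPi B) (nhdsWithin tb (Set.Iio tb)) = ⊤) ∧
            (ContinuesWhileBounded m u₀ B₀ (fun u _ => supMaterialOmega u) →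
              ∃ tb ∈ Set.Ioc 0 (2 / y₀), ∃ u B, IsSmoothSolution m tb u₀ B₀ u B ∧
                Filter.limsup (supMaterialOmega u) (nhdsWithin tb (Set.Iio tb)) = ⊤)) := by
  obtain ⟨K, hmono, hK⟩ := exists_steepening
  -- existence times are bounded by `2/y₀`
  have hbound : ∀ (m T : ℝ) (u₀ B₀ : E3 → E3) (u B : ℝ → E3 → E3), 7 / 2 < m → 0 < T →
      IsAxisymmetricDatum u₀ B₀ → IsSolution m (Set.Ico 0 T) u₀ B₀ u B → 0 < dzPiAxis B₀ 0 →
      2 * K (dataNorm u₀ B₀) ≤ dzPiAxis B₀ 0 → T ≤ 2 / dzPiAxis B₀ 0 := by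
    intro m T u₀ B₀ u B hm hT hd h hy hKy
    refine le_of_forall_lt fun t ht => ?_
    rw [lt_div_iff₀ hy]
    rcases lt_or_ge t 0 with h0 | h0
    · nlinarith
    · exact (hK m T u₀ B₀ u B hm hd h hy hKy t ⟨h0, ht⟩).2.2.1
  have hroot : ∀ s, (Real.exp (K s)) ^ (1 / 2 : ℝ) = Real.exp (K s / 2) := fun s => by
    rw [← Real.exp_mul]; ring_nf
  -- `4 exp (K/2) ≥ 2K + 4`
  have hKy : ∀ s y, 4 * (Real.exp (K s)) ^ (1 / 2 : ℝ) ≤ y → 0 < y ∧ 2 * K s ≤ y := by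
    intro s y hy
    rw [hroot] at hy
    have h1 := Real.add_one_le_exp (K s / 2)
    have h2 := Real.exp_pos (K s / 2)
    exact ⟨by linarith, by linarith⟩
  obtain ⟨S, hS⟩ := exists_dataNorm_swirlDatum_le
  -- a frequency large enough for all data of this size
  set N := 4 * Real.exp (K S / 2) with hN
  have hdatum : 4 * (Real.exp (K (dataNorm 0 (swirlDatum N)))) ^ (1 / 2 : ℝ) ≤
      dzPiAxis (swirlDatum N) 0 := by
    rw [hroot, dzPiAxis_swirlDatum]
    nth_rw 2 [hN]
    have := hmono _ _ (hS N).1 (hS N).2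
    gcongr
  have hdat := isAxisymmetricDatum_swirlDatum N
  refine ⟨fun m hm hwp => ?_, fun s => Real.exp (K s), fun s => Real.exp_pos _,
    ⟨0, swirlDatum N, hdat, hdatum, by rw [PiOf_swirlDatum_origin]; norm_num⟩, ?_⟩
  · have hsob : ∀ v : E3 → E3, ContDiff ℝ ∞ v → HasCompactSupport v →
        (∀ x, divergence v x = 0) → IsSobolevDatum m v := fun v h1 h2 h3 =>
      ⟨h1.of_le (by norm_cast), sobolevNorm_lt_top_of_hasCompactSupport h1 h2 m, h3⟩
    obtain ⟨⟨u, B, h⟩, -⟩ := hwp 0 (swirlDatum N) (hsob _ hdat.smooth_u hdat.compact_u hdat.div_u)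
      (hsob _ hdat.smooth_B hdat.compact_B hdat.div_B)
    obtain ⟨hy, hK2⟩ := hKy _ _ hdatum
    have h2 : 0 < 2 / dzPiAxis (swirlDatum N) 0 := by positivity
    have := hbound m (2 / dzPiAxis (swirlDatum N) 0 + 1) 0 (swirlDatum N) u B hm (by linarith) hdat
      (h.restrict_Ici _) hy hK2
    linarith
  · rintro u₀ B₀ y₀ J₀ hd hy₀ hJ₀ hlarge hJ m hm
    subst hy₀ hJ₀
    obtain ⟨hy, hK2⟩ := hKy _ _ hlarge
    have hT : ∀ T > 0, ∀ u B, IsSmoothSolution m T u₀ B₀ u B → T ≤ 2 / dzPiAxis B₀ 0 :=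
      fun T hT u B h => hbound m T u₀ B₀ u B hm hT hd h.solution hy hK2
    refine ⟨fun T hT0 u B h => ⟨hT T hT0 u B h, fun t ht => ?_⟩, fun hex =>
      ⟨fun hQ => hQ.exists_blowup hm hd.div_B hex hT, fun hQ => hQ.exists_blowup hm hd.div_B hex hT⟩⟩
    obtain ⟨h1, h2, h3, ζ, h4, h5⟩ := hK m T u₀ B₀ u B hm hd h.solution hy hK2 t ht
    have hq : 0 ≤ dzPiAxis B₀ 0 / (2 - t * dzPiAxis B₀ 0) := div_nonneg hy.le (by linarith)
    refine ⟨h1, h2, ?_, ?_⟩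
    · refine le_trans ?_ (le_iSup (fun z : ℝ => ‖dzPiAxis (B t) z‖ₑ) ζ)
      rw [Real.enorm_eq_ofReal_abs]
      exact ENNReal.ofReal_le_ofReal (h5.trans (le_abs_self _))
    · refine le_trans ?_ (le_iSup (fun z : ℝ => ‖materialOmega u t 0 z‖ₑ) ζ)
      rw [Real.enorm_eq_ofReal_abs, h.materialOmega_eq hm hd ht, h4]
      refine ENNReal.ofReal_le_ofReal (le_trans ?_ (neg_le_abs _))
      have := mul_le_mul_of_nonneg_left h5 (by linarith : 0 ≤ 2 * PiOf B₀ 0 0)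
      linarith
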